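/- Let $(\mathsf A,\mathsf P,\Pi,\Pi^\vee,(\cdot,\cdot))$ be a Cartan datum with index set $I$: $\mathsf P$ is a free abelian group, $\Pi=\{\alpha_i\}_{i\in I}\subset\mathsf P$ is linearly independent, $\Pi^\vee=\{h_i\}_{i\in I}\subset\mathsf P^\vee=\mathrm{Hom}(\mathsf P,\mathbb Z)$, $(\cdot,\cdot)$ is a $\mathbb Q$-valued symmetric bilinear form on $\mathsf P$ with $(\alpha_i,\alpha_i)\in 2\mathbb Z_{>0}$ and $\langle h_i,\lambda\rangle=2(\alpha_i,\lambda)/(\alpha_i,\alpha_i)$, the matrix $\mathsf A=(a_{ij})=(\langle h_i,\alpha_j\rangle)_{i,j}$ is a generalized Cartan matrix, and for each $i$ there is $\Lambda_i\in\mathsf P$ with $\langle h_j,\Lambda_i\rangle=\delta_{ij}$. Let $\mathsf Q_+=\sum_i\mathbb Z_{\ge0}\alpha_i$, let $\Delta_+$ and $\Delta_-=-\Delta_+$ be the sets of positive and negative roots of the associated Kac–Moody algebra, and let $\mathsf W\subset\mathrm{Aut}(\mathsf P)$ be the Weyl group. Let $k$ be a field and let $\mathcal Q_{i,j}(u,v)\in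 k[u,v]$ ($i,j\in I$) satisfy $\mathcal Q_{i,j}(u,v)=\mathcal Q_{j,i}(v,u)$, $\mathcal Q_{i,i}=0$ and, for $i\ne j$, $\mathcal Q_{i,j}=\sum t_{i,j;p,q}u^pv^q$, summed over $p(\alpha_i,\alpha_i)+q(\alpha_j,\alpha_j)=-2(\alpha_i,\alpha_j)$, with $t_{i,j;-a_{ij},0}\ne0$. For $\beta\in\mathsf Q_+$ of height $n$ let $I^\beta=\{\nu\in I^n:\sum_k\alpha_{\nu_k}=\beta\}$, and let $R(\beta)$ be the corresponding quiver Hecke algebra, the $k$-algebra generated by $e(\nu)$ $(\nu\in I^\beta)$, $x_1,\dots,x_n$, $\tau_1,\dots,\tau_{n-1}$ with the usual relations, $\mathbb Z$-graded by $\deg e(\nu)=0$, $\deg x_ke(\nu)=(\alpha_{\nu_k},\alpha_{\nu_k})$, $\deg\tau_le(\nu)=-(\alpha_{\nu_l},\alpha_{\nu_{l+1}})$. Let $R\text{-gmod}=\bigoplus_{\beta\in\mathsf Q_+}R(\beta)\text{-gmod}$ be the category of finite-dimensional graded modules with degree-preserving homomorphisms; let $(qM)_d=M_{d-1}$ be the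 grading shift; let $e(\gamma,\gamma')=\sum_{\mu\in I^\gamma,\,\mu'\in I^{\gamma'}}e(\mu*\mu')\in R(\gamma+\gamma')$, where $\mu*\mu'$ is the concatenation; and let $$M\circ N=R(\gamma+\gamma')\,e(\gamma,\gamma')\otimes_{R(\gamma)\otimes R(\gamma')}(M\otimes N)$$ be the convolution product of an $R(\gamma)$-module $M$ and an $R(\gamma')$-module $N$ (extended additively to $R\text{-gmod}$). For an $R(\beta)$-module $M$ put $$W(M)=\{\gamma\in\mathsf Q_+\cap(\beta-\mathsf Q_+): e(\gamma,\beta-\gamma)M\ne0\},\qquad W^*(M)=\{\gamma\in\mathsf Q_+\cap(\beta-\mathsf Q_+): e(\beta-\gamma,\gamma)M\ne0\},$$ and for $M=\bigoplus_\beta M_\beta$ put $W(M)=\bigcup_\beta W(M_\beta)$, $W^*(M)=\bigcup_\beta W^*(M_\beta)$. Let $\mathrm{Sp}(X)\subset\mathbb R\otimes_{\mathbb Z}\mathsf P$ denote the set of linear combinations of elements of $X$ with non-negative real coefficients. For $w,v\in\mathsf W$ let $\mathcal C_w$, $\mathcal C_{*,v}$ and $\mathcal C_{w,v}$ be the full subcategories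 of $R\text{-gmod}$ consisting of the $M$ with, respectively, $W(M)\subset\mathrm{Sp}(\Delta_+\cap w\Delta_-)$; $W^*(M)\subset\mathrm{Sp}(\Delta_+\cap v\Delta_+)$; both conditions. Then, for all $w,v\in\mathsf W$, each of the categories $\mathcal C_w$, $\mathcal C_{*,v}$ and $\mathcal C_{w,v}$ is stable under taking subquotients, extensions, convolution products and grading shifts. In particular, the Grothendieck group of each of them is a $\mathbb Z[q,q^{-1}]$-algebra, with multiplication $[M][N]=[M\circ N]$, with unit the class of the trivial one-dimensional $R(0)$-module in degree $0$, and with $q[M]=[qM]$. -/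

import Mathlib

noncomputable section

namespace QHecke

open scoped Classical TensorProduct DirectSum

universe u w p

/-! ### Cartan data, Weyl group, roots -/

/-- A Cartan datum `(A, P, Π, Π^∨, (·,·))` with index set `I` and weight lattice `P`. -/
structure CartanDatum (I : Type w) (P : Type p) [AddCommGroup P] where
  /-- the weight lattice is a free abelian group -/
  free : Module.Free ℤ P
  /-- the simple roots `α_i` -/
  root : I → P
  /-- the simple coroots `h_i ∈ P^∨ = Hom(P, ℤ)` -/
  coroot : I → Module.Dual ℤ P
  /-- the symmetric bilinear form on `P` with values in `ℚ` -/
  form : P →+ P →+ ℚ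
  form_symm : ∀ x y, form x y = form y x
  form_root : ∀ i, ∃ d : ℕ, 0 < d ∧ form (root i) (root i) = 2 * d
  coroot_apply : ∀ i x, (coroot i x : ℚ) = 2 * form (root i) x / form (root i) (root i)
  coroot_root_self : ∀ i, coroot i (root i) = 2
  coroot_root_nonpos : ∀ i j, i ≠ j → coroot i (root j) ≤ 0
  linearIndependent : LinearIndependent ℤ root
  fundamental : ∀ i, ∃ x, ∀ j, coroot j x = if j = i then 1 else 0

namespace CartanDatum

variable {I : Type w} {P : Type p} [AddCommGroup P] (D : CartanDatum I P)

/-- The integer `(α_i, α_j)`; see `rootForm_cast`. -/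
def rootForm (i j : I) : ℤ := (D.form (D.root i) (D.root j)).num

theorem rootForm_cast (i j : I) :
    (D.rootForm i j : ℚ) = D.form (D.root i) (D.root j) := by
  obtain ⟨d, hd, h⟩ := D.form_root i
  have h2 := D.coroot_apply i (D.root j)
  have hd' : (d : ℚ) ≠ 0 := by exact_mod_cast hd.ne'
  have h3 : D.form (D.root i) (D.root j) = ((D.coroot i (D.root j) * d : ℤ) : ℚ) := by
    rw [h] at h2
    push_cast
    rw [h2]
    field_simp
  rw [rootForm, h3]
  norm_cast

theorem rootForm_comm (i j : I) : D.rootForm i j = D.rootForm j i := by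
  rw [rootForm, D.form_symm, rootForm]

/-- The element `∑ nᵢ αᵢ` of `P` attached to `(nᵢ)`.  By linear independence of the simple roots
this identifies `I →₀ ℕ` with `Q₊ ⊆ P`, and elements of `Q₊` are represented so throughout. -/
def wt (β : I →₀ ℕ) : P := β.sum fun i n => n • D.root i

/-- The simple reflection `s_i(x) = x - ⟨h_i, x⟩ α_i`. -/
def simpleReflection (i : I) : P ≃ₗ[ℤ] P := Module.reflection (D.coroot_root_self i)

/-- The Weyl group, as a subgroup of `Aut(P)`. -/
def weylGroup : Subgroup (P ≃ₗ[ℤ] P) := Subgroup.closure (Set.range D.simpleReflection)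

/-- Generators of the Kac-Moody algebra: `e_i`, `f_i` and `h ∈ P^∨`. -/
inductive LieGen (I : Type w) (P : Type p) [AddCommGroup P]
  | e : I → LieGen I P
  | f : I → LieGen I P
  | h : Module.Dual ℤ P → LieGen I P

variable (I P) in
/-- The free Lie algebra over `ℂ` on these generators. -/
abbrev FreeLie : Type (max w p) := FreeLieAlgebra ℂ (LieGen I P)

/-- The generator `e_i` in the free Lie algebra. -/
def freeE (i : I) : FreeLie I P := FreeLieAlgebra.of ℂ (LieGen.e i)
/-- The generator `f_i` in the free Lie algebra. -/
def freeF (i : I) : FreeLie I P := FreeLieAlgebra.of ℂ (LieGen.f i)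
/-- The generator `h ∈ P^∨` in the free Lie algebra. -/
def freeH (h : Module.Dual ℤ P) : FreeLie I P := FreeLieAlgebra.of ℂ (LieGen.h h)

/-- The defining relators of the Kac-Moody algebra. -/
inductive LieRelator : FreeLie I P → Prop
  | h_add (h h' : Module.Dual ℤ P) : LieRelator (freeH (h + h') - freeH h - freeH h')
  | h_h (h h' : Module.Dual ℤ P) : LieRelator ⁅(freeH h : FreeLie I P), (freeH h' : FreeLie I P)⁆
  | h_e (h : Module.Dual ℤ P) (i : I) :
      LieRelator (⁅(freeH h : FreeLie I P), freeE i⁆ - h (D.root i) • freeE i)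
  | h_f (h : Module.Dual ℤ P) (i : I) :
      LieRelator (⁅(freeH h : FreeLie I P), freeF i⁆ + h (D.root i) • freeF i)
  | e_f (i j : I) :
      LieRelator (⁅(freeE i : FreeLie I P), freeF j⁆ - if i = j then freeH (D.coroot i) else 0)
  | serre_e (i j : I) (hij : i ≠ j) :
      LieRelator ((LieAlgebra.ad ℂ (FreeLie I P) (freeE i) ^
        (1 - D.coroot i (D.root j)).toNat) (freeE j))
  | serre_f (i j : I) (hij : i ≠ j) :
      LieRelator ((LieAlgebra.ad ℂ (FreeLie I P) (freeF i) ^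
        (1 - D.coroot i (D.root j)).toNat) (freeF j))

/-- The ideal generated by the relators. -/
def lieIdeal : LieIdeal ℂ (FreeLie I P) :=
  LieSubmodule.lieSpan ℂ _ {x | D.LieRelator x}

/-- The Kac-Moody algebra `𝔤` attached to the Cartan datum. -/
abbrev KacMoody : Type (max w p) := FreeLie I P ⧸ D.lieIdeal

/-- The image of `h ∈ P^∨` in the Kac-Moody algebra. -/
def kmH (h : Module.Dual ℤ P) : D.KacMoody := LieSubmodule.Quotient.mk (freeH h)

/-- `β` is a root: `β ≠ 0` and the root space `𝔤_β` is nonzero. -/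
def IsRoot (β : P) : Prop :=
  β ≠ 0 ∧ ∃ x : D.KacMoody, x ≠ 0 ∧ ∀ h : Module.Dual ℤ P, ⁅D.kmH h, x⁆ = h β • x

/-- The set `Δ₊` of positive roots. -/
def posRoots : Set P := {β | D.IsRoot β ∧ ∃ γ : I →₀ ℕ, β = D.wt γ}

/-- The set `Δ₋` of negative roots. -/
def negRoots : Set P := {β | D.IsRoot β ∧ ∃ γ : I →₀ ℕ, β = - D.wt γ}

end CartanDatum

/-- The set of linear combinations of elements of `S ⊆ P`, in the real vector space `ℝ ⊗ P`,
with nonnegative real coefficients. -/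
def Sp {P : Type p} [AddCommGroup P] (S : Set P) : Set (ℝ ⊗[ℤ] P) :=
  {x | ∃ c : P →₀ ℝ, (∀ y, 0 ≤ c y) ∧ (∀ y, c y ≠ 0 → y ∈ S) ∧
    x = c.sum fun y r => r ⊗ₜ[ℤ] y}

/-! ### The quiver Hecke algebras -/

variable {I : Type w} {P : Type p} [AddCommGroup P]

/-- The family of polynomials `Q_{ij}(u, v)`, where `u = X 0` and `v = X 1`. -/
structure QPoly (D : CartanDatum I P) (k : Type u) [Field k] where
  poly : I → I → MvPolynomial (Fin 2) k
  symm : ∀ i j, poly i j = MvPolynomial.rename ![1, 0] (poly j i)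
  diag : ∀ i, poly i i = 0
  homogeneous : ∀ i j, i ≠ j → ∀ m ∈ (poly i j).support,
    (m 0 : ℤ) * D.rootForm i i + (m 1 : ℤ) * D.rootForm j j = -2 * D.rootForm i j
  leading : ∀ i j, i ≠ j →
    (poly i j).coeff (Finsupp.single 0 (-D.coroot i (D.root j)).toNat) ≠ 0

/-- The polynomial `(q(u,v) - q(w,v)) / (u - w)` in `u = X 0`, `v = X 1`, `w = X 2`;
see `divDiff_mul`. -/
def divDiff {k : Type u} [Field k] (q : MvPolynomial (Fin 2) k) : MvPolynomial (Fin 3) k :=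
  ∑ m ∈ q.support, ∑ a ∈ Finset.range (m 0),
    MvPolynomial.monomial (Finsupp.single 0 a + Finsupp.single 1 (m 1) +
      Finsupp.single 2 (m 0 - 1 - a)) (q.coeff m)

theorem divDiff_mul {k : Type u} [Field k] (q : MvPolynomial (Fin 2) k) :
    divDiff q * (MvPolynomial.X 0 - MvPolynomial.X 2) =
      MvPolynomial.rename ![0, 1] q - MvPolynomial.rename ![2, 1] q := by
  conv_rhs => rw [q.as_sum]
  rw [divDiff, map_sum, map_sum, ← Finset.sum_sub_distrib, Finset.sum_mul]
  refine Finset.sum_congr rfl fun m _ => ?_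
  have h1 : ∀ f : Fin 2 → Fin 3, MvPolynomial.rename f (MvPolynomial.monomial m (q.coeff m)) =
      MvPolynomial.C (q.coeff m) * (MvPolynomial.X (f 0) ^ m 0 * MvPolynomial.X (f 1) ^ m 1) := by
    intro f
    rw [MvPolynomial.monomial_eq, map_mul, MvPolynomial.rename_C, Finsupp.prod_fintype _ _ (by simp)]
    simp [Fin.prod_univ_two]
  have h2 : ∀ a, MvPolynomial.monomial (Finsupp.single 0 a + Finsupp.single 1 (m 1) +
      Finsupp.single 2 (m 0 - 1 - a)) (q.coeff m) = MvPolynomial.C (q.coeff m) *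
      MvPolynomial.X (1 : Fin 3) ^ m 1 *
      (MvPolynomial.X (0 : Fin 3) ^ a * MvPolynomial.X (2 : Fin 3) ^ (m 0 - 1 - a)) := by
    intro a
    rw [MvPolynomial.monomial_eq, Finsupp.prod_fintype _ _ (by simp)]
    simp [Fin.prod_univ_three]
    ring
  rw [h1, h1, Finset.sum_congr rfl fun a _ => h2 a, ← Finset.mul_sum, mul_assoc,
    Commute.geom_sum₂_mul (Commute.all _ _)]
  simp
  ring

/-- Evaluation of a polynomial at a tuple of elements of an algebra (used for tuples which
commute modulo the relations; each monomial is a product in increasing order of the variables). -/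
def evalOrd {k : Type u} [Field k] {A : Type*} [Ring A] [Algebra k A] {n : ℕ}
    (q : MvPolynomial (Fin n) k) (a : Fin n → A) : A :=
  ∑ m ∈ q.support, q.coeff m • (List.ofFn fun i => a i ^ m i).prod

/-- The height `∑ nᵢ`. -/
abbrev ht (β : I →₀ ℕ) : ℕ := Finsupp.degree β

/-- The set `I^β` of sequences `(ν_1, …, ν_n)` with `∑ α_{ν_k} = β`, where `n = ht β`.
Positions are counted from `0`. -/
@[ext]
structure Seq (β : I →₀ ℕ) where
  toFun : Fin (ht β) → I
  sum_eq : ∑ j, Finsupp.single (toFun j) 1 = β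

namespace Seq

instance (β : I →₀ ℕ) : CoeFun (Seq β) (fun _ => Fin (ht β) → I) := ⟨Seq.toFun⟩

instance (β : I →₀ ℕ) : Finite (Seq β) := by
  have hmem : ∀ (ν : Seq β) (k : Fin (ht β)), ν k ∈ β.support := by
    intro ν k
    rw [Finsupp.mem_support_iff]
    intro h0
    have h := DFunLike.congr_fun ν.sum_eq (ν k)
    rw [h0, Finsupp.finsetSum_apply, Finset.sum_eq_zero_iff] at h
    have := h k (Finset.mem_univ _)
    simp at this
  refine Finite.of_injective
    (fun ν : Seq β => fun k : Fin (ht β) => (⟨ν k, hmem ν k⟩ : β.support)) ?_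
  intro ν ν' h
  apply Seq.ext
  funext k
  have := congrFun h k
  simpa using this

instance (β : I →₀ ℕ) : Fintype (Seq β) := Fintype.ofFinite _

/-- The action of the transposition `s_l` exchanging positions `l` and `l+1`. -/
def swap {β : I →₀ ℕ} (l : ℕ) (hl : l + 1 < ht β) (ν : Seq β) : Seq β where
  toFun := fun j => ν (Equiv.swap ⟨l, Nat.lt_of_succ_lt hl⟩ ⟨l + 1, hl⟩ j)
  sum_eq := by
    have h := Equiv.sum_comp (Equiv.swap (⟨l, Nat.lt_of_succ_lt hl⟩ : Fin (ht β)) ⟨l + 1, hl⟩)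
      fun j => (Finsupp.single (ν j) 1 : I →₀ ℕ)
    rw [ν.sum_eq] at h
    exact h

/-- `ν` is the concatenation `μ ∗ μ'`. -/
def IsConcat {β γ γ' : I →₀ ℕ} (ν : Seq β) (μ : Seq γ) (μ' : Seq γ') : Prop :=
  List.ofFn ν.toFun = List.ofFn μ.toFun ++ List.ofFn μ'.toFun

end Seq

variable {k : Type u} [Field k]

/-- The defining relations of the quiver Hecke algebra `R(β)`, for elements
`e(ν)`, `x_k`, `τ_l` of an arbitrary `k`-algebra `A`. -/
inductive Rel (D : CartanDatum I P) (Q : QPoly D k) (β : I →₀ ℕ) {A : Type*} [Ring A] [Algebra k A]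
    (e : Seq β → A) (x : Fin (ht β) → A) (τ : (l : ℕ) → l + 1 < ht β → A) : A → A → Prop
  | e_e (ν ν' : Seq β) : Rel D Q β e x τ (e ν * e ν') (if ν = ν' then e ν else 0)
  | e_sum : Rel D Q β e x τ (∑ ν, e ν) 1
  | x_e (j : Fin (ht β)) (ν : Seq β) : Rel D Q β e x τ (x j * e ν) (e ν * x j)
  | x_x (j l : Fin (ht β)) : Rel D Q β e x τ (x j * x l) (x l * x j)
  | τ_e (l : ℕ) (hl : l + 1 < ht β) (ν : Seq β) :
      Rel D Q β e x τ (τ l hl * e ν) (e (ν.swap l hl) * τ l hl)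
  | τ_τ (j l : ℕ) (hj : j + 1 < ht β) (hl : l + 1 < ht β) (hjl : j + 1 < l ∨ l + 1 < j) :
      Rel D Q β e x τ (τ j hj * τ l hl) (τ l hl * τ j hj)
  | τ_sq (l : ℕ) (hl : l + 1 < ht β) (ν : Seq β) :
      Rel D Q β e x τ (τ l hl * τ l hl * e ν)
        (evalOrd (Q.poly (ν ⟨l, by omega⟩) (ν ⟨l + 1, hl⟩)) ![x ⟨l, by omega⟩, x ⟨l + 1, hl⟩] * e ν)
  | τ_x (l : ℕ) (hl : l + 1 < ht β) (j : Fin (ht β)) (ν : Seq β) :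
      Rel D Q β e x τ
        ((τ l hl * x j - x (Equiv.swap ⟨l, by omega⟩ ⟨l + 1, hl⟩ j) * τ l hl) * e ν)
        (if ν ⟨l, by omega⟩ = ν ⟨l + 1, hl⟩ then
          (if j.1 = l then - e ν else if j.1 = l + 1 then e ν else 0) else 0)
  | braid (l : ℕ) (hl : l + 2 < ht β) (ν : Seq β) :
      Rel D Q β e x τ
        ((τ (l + 1) hl * τ l (by omega) * τ (l + 1) hl -
          τ l (by omega) * τ (l + 1) hl * τ l (by omega)) * e ν)
        (if ν ⟨l, by omega⟩ = ν ⟨l + 2, hl⟩ then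
          evalOrd (divDiff (Q.poly (ν ⟨l, by omega⟩) (ν ⟨l + 1, by omega⟩)))
            ![x ⟨l, by omega⟩, x ⟨l + 1, by omega⟩, x ⟨l + 2, hl⟩] * e ν
        else 0)

/-- The generators of `R(β)`. -/
inductive Gen (β : I →₀ ℕ) : Type w
  | e : Seq β → Gen β
  | x : Fin (ht β) → Gen β
  | τ : (l : ℕ) → l + 1 < ht β → Gen β

/-- The relations of `R(β)` in the free algebra on its generators. -/
def freeRel (D : CartanDatum I P) (Q : QPoly D k) (β : I →₀ ℕ) :
    FreeAlgebra k (Gen β) → FreeAlgebra k (Gen β) → Prop :=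
  Rel D Q β (fun ν => FreeAlgebra.ι k (Gen.e ν)) (fun j => FreeAlgebra.ι k (Gen.x j))
    (fun l hl => FreeAlgebra.ι k (Gen.τ l hl))

/-- The quiver Hecke algebra `R(β)`: the `k`-algebra with generators `e(ν)`, `x_j`, `τ_l` and the
relations above. -/
def R (D : CartanDatum I P) (Q : QPoly D k) (β : I →₀ ℕ) : Type (max u w) :=
  RingQuot (freeRel D Q β)

variable (D : CartanDatum I P) (Q : QPoly D k) (β : I →₀ ℕ)

instance : Ring (R D Q β) := inferInstanceAs (Ring (RingQuot (freeRel D Q β)))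
instance : Algebra k (R D Q β) := inferInstanceAs (Algebra k (RingQuot (freeRel D Q β)))

namespace R

/-- The quotient map from the free algebra. -/
def proj : FreeAlgebra k (Gen β) →ₐ[k] R D Q β := RingQuot.mkAlgHom k (freeRel D Q β)

variable {β}

/-- The idempotent `e(ν)`. -/
def e (ν : Seq β) : R D Q β := proj D Q β (FreeAlgebra.ι k (Gen.e ν))
/-- The element `x_j`. -/
def x (j : Fin (ht β)) : R D Q β := proj D Q β (FreeAlgebra.ι k (Gen.x j))
/-- The element `τ_l`. -/
def τ (l : ℕ) (hl : l + 1 < ht β) : R D Q β := proj D Q β (FreeAlgebra.ι k (Gen.τ l hl))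

variable {D Q}

theorem map_evalOrd {A B : Type*} [Ring A] [Algebra k A] [Ring B] [Algebra k B] (f : A →ₐ[k] B)
    {n : ℕ} (q : MvPolynomial (Fin n) k) (a : Fin n → A) :
    f (evalOrd q a) = evalOrd q (f ∘ a) := by
  simp [evalOrd, map_list_prod, List.map_ofFn, Function.comp_def]

theorem comp_two {A B : Type*} (f : A → B) (a b : A) : f ∘ ![a, b] = ![f a, f b] := by
  funext i; fin_cases i <;> rfl

theorem comp_three {A B : Type*} (f : A → B) (a b c : A) :
    f ∘ ![a, b, c] = ![f a, f b, f c] := by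
  funext i; fin_cases i <;> rfl

theorem map_rel {A B : Type*} [Ring A] [Algebra k A] [Ring B] [Algebra k B] (f : A →ₐ[k] B)
    {e : Seq β → A} {x : Fin (ht β) → A} {τ : (l : ℕ) → l + 1 < ht β → A} {a b : A}
    (h : Rel D Q β e x τ a b) :
    Rel D Q β (fun ν => f (e ν)) (fun j => f (x j)) (fun l hl => f (τ l hl)) (f a) (f b) := by
  cases h with
  | e_e ν ν' => rw [map_mul, apply_ite f, map_zero]; exact .e_e ν ν'
  | e_sum => rw [map_sum, map_one]; exact .e_sum
  | x_e j ν => rw [map_mul, map_mul]; exact .x_e j ν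
  | x_x j l => rw [map_mul, map_mul]; exact .x_x j l
  | τ_e l hl ν => rw [map_mul, map_mul]; exact .τ_e l hl ν
  | τ_τ j l hj hl hjl => rw [map_mul, map_mul]; exact .τ_τ j l hj hl hjl
  | τ_sq l hl ν =>
    have := Rel.τ_sq (D := D) (Q := Q) (e := fun ν => f (e ν)) (x := fun j => f (x j))
      (τ := fun l hl => f (τ l hl)) l hl ν
    simpa [map_evalOrd, comp_two, comp_three] using this
  | τ_x l hl j ν =>
    have := Rel.τ_x (D := D) (Q := Q) (e := fun ν => f (e ν)) (x := fun j => f (x j))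
      (τ := fun l hl => f (τ l hl)) l hl j ν
    simpa [apply_ite f] using this
  | braid l hl ν =>
    have := Rel.braid (D := D) (Q := Q) (e := fun ν => f (e ν)) (x := fun j => f (x j))
      (τ := fun l hl => f (τ l hl)) l hl ν
    simpa [apply_ite f, map_evalOrd, comp_two, comp_three] using this

theorem rel {a b : R D Q β} (h : Rel D Q β (e D Q) (x D Q) (τ D Q) a b) : a = b := by
  have key : ∃ a' b', freeRel D Q β a' b' ∧ proj D Q β a' = a ∧ proj D Q β b' = b := by
    cases h with
    | e_e ν ν' => exact ⟨_, _, .e_e ν ν', by simp [e], by simp [e, apply_ite (proj D Q β)]⟩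
    | e_sum => exact ⟨_, _, .e_sum, by simp [e], by simp⟩
    | x_e j ν => exact ⟨_, _, .x_e j ν, by simp [e, x], by simp [e, x]⟩
    | x_x j l => exact ⟨_, _, .x_x j l, by simp [x], by simp [x]⟩
    | τ_e l hl ν => exact ⟨_, _, .τ_e l hl ν, by simp [e, τ], by simp [e, τ]⟩
    | τ_τ j l hj hl hjl => exact ⟨_, _, .τ_τ j l hj hl hjl, by simp [τ], by simp [τ]⟩
    | τ_sq l hl ν =>
      exact ⟨_, _, .τ_sq l hl ν, by simp [e, τ], by simp [e, x, map_evalOrd, comp_two]⟩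
    | τ_x l hl j ν =>
      exact ⟨_, _, .τ_x l hl j ν, by simp [e, τ, x], by simp [e, apply_ite (proj D Q β)]⟩
    | braid l hl ν =>
      exact ⟨_, _, .braid l hl ν, by simp [e, τ],
        by simp [e, x, map_evalOrd, comp_three, apply_ite (proj D Q β)]⟩
  obtain ⟨a', b', hab, rfl, rfl⟩ := key
  exact RingQuot.mkAlgHom_rel k hab

/-- The universal property of `R(β)`. -/
theorem exists_lift {A : Type*} [Ring A] [Algebra k A] (e' : Seq β → A) (x' : Fin (ht β) → A)
    (τ' : (l : ℕ) → l + 1 < ht β → A) (h : ∀ a b, Rel D Q β e' x' τ' a b → a = b) :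
    ∃ f : R D Q β →ₐ[k] A, (∀ ν, f (e D Q ν) = e' ν) ∧ (∀ j, f (x D Q j) = x' j) ∧
      ∀ l hl, f (τ D Q l hl) = τ' l hl := by
  let g : FreeAlgebra k (Gen β) →ₐ[k] A := FreeAlgebra.lift k fun g => match g with
    | .e ν => e' ν | .x j => x' j | .τ l hl => τ' l hl
  have hg : ∀ a b, freeRel D Q β a b → g a = g b := by
    intro a b hab
    refine h _ _ ?_
    simpa [g] using map_rel g hab
  refine ⟨RingQuot.liftAlgHom k ⟨g, fun a b hab => hg a b hab⟩, ?_, ?_, ?_⟩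
  · intro ν
    exact (RingQuot.liftAlgHom_mkAlgHom_apply _ _ _ _).trans (by simp [g])
  · intro j
    exact (RingQuot.liftAlgHom_mkAlgHom_apply _ _ _ _).trans (by simp [g])
  · intro l hl
    exact (RingQuot.liftAlgHom_mkAlgHom_apply _ _ _ _).trans (by simp [g])

theorem induction {C : R D Q β → Prop} (he : ∀ ν, C (e D Q ν)) (hx : ∀ j, C (x D Q j))
    (hτ : ∀ l hl, C (τ D Q l hl)) (halg : ∀ c : k, C (algebraMap k _ c))
    (hmul : ∀ a b, C a → C b → C (a * b)) (hadd : ∀ a b, C a → C b → C (a + b)) (a : R D Q β) :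
    C a := by
  obtain ⟨a, rfl⟩ := RingQuot.mkAlgHom_surjective k (freeRel D Q β) a
  change C (proj D Q β a)
  induction a using FreeAlgebra.induction with
  | grade0 c => rw [AlgHom.commutes]; exact halg c
  | grade1 g => cases g with
    | e ν => exact he ν
    | x j => exact hx j
    | τ l hl => exact hτ l hl
  | mul a b ha hb => rw [map_mul]; exact hmul _ _ ha hb
  | add a b ha hb => rw [map_add]; exact hadd _ _ ha hb

/-! ### The grading of `R(β)` -/

variable (D) in
/-- The degree of `x_j e(ν)`. -/
def degX (j : Fin (ht β)) (ν : Seq β) : ℤ := D.rootForm (ν j) (ν j)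

variable (D) in
/-- The degree of `τ_l e(ν)`. -/
def degT (l : ℕ) (hl : l + 1 < ht β) (ν : Seq β) : ℤ :=
  - D.rootForm (ν ⟨l, Nat.lt_of_succ_lt hl⟩) (ν ⟨l + 1, hl⟩)

variable (D Q) in
/-- `a` is a monomial in the elements `e(ν)`, `x_j e(ν)`, `τ_l e(ν)` of total degree `d`. -/
inductive IsMonomial : R D Q β → ℤ → Prop
  | e (ν : Seq β) : IsMonomial (e D Q ν) 0
  | x (j : Fin (ht β)) (ν : Seq β) : IsMonomial (x D Q j * e D Q ν) (degX D j ν)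
  | τ (l : ℕ) (hl : l + 1 < ht β) (ν : Seq β) :
      IsMonomial (τ D Q l hl * e D Q ν) (degT D l hl ν)
  | mul (a b : R D Q β) (c d : ℤ) (ha : IsMonomial a c) (hb : IsMonomial b d) :
      IsMonomial (a * b) (c + d)

variable (D Q β) in
/-- The homogeneous part `R(β)_d` of degree `d`. -/
def grading (d : ℤ) : Submodule k (R D Q β) := Submodule.span k {a | IsMonomial D Q a d}

theorem e_mul_e (ν ν' : Seq β) : e D Q ν * e D Q ν' = if ν = ν' then e D Q ν else 0 :=
  rel (.e_e ν ν')

theorem sum_e : ∑ ν, e D Q ν = (1 : R D Q β) := rel .e_sum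

theorem one_mem_grading : (1 : R D Q β) ∈ grading D Q β 0 := by
  rw [← sum_e]
  exact Submodule.sum_mem _ fun ν _ => Submodule.subset_span (.e ν)

theorem mul_mem_grading {c d : ℤ} {a b : R D Q β} (ha : a ∈ grading D Q β c)
    (hb : b ∈ grading D Q β d) : a * b ∈ grading D Q β (c + d) := by
  have h := Submodule.mul_mem_mul ha hb
  rw [grading, grading, Submodule.span_mul_span] at h
  refine Submodule.span_mono ?_ h
  rintro _ ⟨a, ha, b, hb, rfl⟩
  exact .mul a b c d ha hb

theorem iSup_grading : ⨆ d, grading D Q β d = ⊤ := by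
  have hle : ∀ d, grading D Q β d ≤ ⨆ d, grading D Q β d := le_iSup _
  rw [eq_top_iff]
  rintro a -
  have hsum : ∀ b : R D Q β, (∀ ν, b * e D Q ν ∈ ⨆ d, grading D Q β d) →
      b ∈ ⨆ d, grading D Q β d := by
    intro b hb
    rw [← mul_one b, ← sum_e, Finset.mul_sum]
    exact Submodule.sum_mem _ fun ν _ => hb ν
  induction a using R.induction with
  | he ν => exact hle 0 (Submodule.subset_span (.e ν))
  | hx j => exact hsum _ fun ν => hle _ (Submodule.subset_span (.x j ν))
  | hτ l hl => exact hsum _ fun ν => hle _ (Submodule.subset_span (.τ l hl ν))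
  | halg c =>
    rw [Algebra.algebraMap_eq_smul_one]
    exact Submodule.smul_mem _ _ (hle 0 one_mem_grading)
  | hmul a b ha hb =>
    have h := Submodule.mul_mem_mul ha hb
    rw [Submodule.iSup_mul] at h
    refine SetLike.le_def.1 (iSup_le fun c => ?_) h
    rw [Submodule.mul_iSup]
    refine iSup_le fun d => ?_
    rw [Submodule.mul_le]
    exact fun a ha b hb => hle _ (mul_mem_grading ha hb)
  | hadd a b ha hb => exact Submodule.add_mem _ ha hb

section coaction

open AddMonoidAlgebra (single)

variable (D Q β)

/-- The element `∑ x_j e(ν) t^{deg}`. -/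
def gx (j : Fin (ht β)) : AddMonoidAlgebra (R D Q β) ℤ :=
  ∑ ν, single (degX D j ν) (x D Q j * e D Q ν)

/-- The element `∑ τ_l e(ν) t^{deg}`. -/
def gτ (l : ℕ) (hl : l + 1 < ht β) : AddMonoidAlgebra (R D Q β) ℤ :=
  ∑ ν, single (degT D l hl ν) (τ D Q l hl * e D Q ν)

variable {D Q β}

theorem gx_mul {ν : Seq β} {a : R D Q β} (ha : e D Q ν * a = a) (j : Fin (ht β)) (d : ℤ) :
    gx D Q β j * single d a = single (degX D j ν + d) (x D Q j * a) := by
  rw [gx, Finset.sum_mul, Finset.sum_eq_single ν]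
  · rw [AddMonoidAlgebra.single_mul_single, mul_assoc, ha]
  · intro ν' _ h
    rw [AddMonoidAlgebra.single_mul_single, ← ha, mul_assoc, ← mul_assoc (e D Q ν'), e_mul_e,
      if_neg h]
    simp
  · simp

theorem gτ_mul {ν : Seq β} {a : R D Q β} (ha : e D Q ν * a = a) (l : ℕ)
    (hl : l + 1 < ht β) (d : ℤ) :
    gτ D Q β l hl * single d a = single (degT D l hl ν + d) (τ D Q l hl * a) := by
  rw [gτ, Finset.sum_mul, Finset.sum_eq_single ν]
  · rw [AddMonoidAlgebra.single_mul_single, mul_assoc, ha]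
  · intro ν' _ h
    rw [AddMonoidAlgebra.single_mul_single, ← ha, mul_assoc, ← mul_assoc (e D Q ν'), e_mul_e,
      if_neg h]
    simp
  · simp

theorem at_x {ν : Seq β} {a : R D Q β} (ha : e D Q ν * a = a) (j : Fin (ht β)) :
    e D Q ν * (x D Q j * a) = x D Q j * a := by
  rw [← mul_assoc, ← rel (.x_e j ν), mul_assoc, ha]

theorem at_τ {ν : Seq β} {a : R D Q β} (ha : e D Q ν * a = a) (l : ℕ)
    (hl : l + 1 < ht β) : e D Q (ν.swap l hl) * (τ D Q l hl * a) = τ D Q l hl * a := by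
  rw [← mul_assoc, ← rel (.τ_e l hl ν), mul_assoc, ha]

theorem at_e (ν : Seq β) : e D Q ν * e D Q ν = e D Q ν := by simp [e_mul_e]

theorem gx_pow_mul {ν : Seq β} {a : R D Q β} (ha : e D Q ν * a = a) (j : Fin (ht β))
    (n : ℕ) (d : ℤ) : e D Q ν * (x D Q j ^ n * a) = x D Q j ^ n * a ∧
    gx D Q β j ^ n * single d a = single (n * degX D j ν + d) (x D Q j ^ n * a) := by
  induction n with
  | zero => simp [ha]
  | succ n ih =>
    rw [pow_succ', pow_succ', mul_assoc, mul_assoc, ih.2, gx_mul ih.1]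
    refine ⟨at_x ih.1 j, ?_⟩
    congr 1
    push_cast
    ring

theorem prod_mul {ν : Seq β} {a : R D Q β} (ha : e D Q ν * a = a) {n : ℕ}
    (js : Fin n → Fin (ht β)) (m : Fin n → ℕ) :
    e D Q ν * ((List.ofFn fun i => x D Q (js i) ^ m i).prod * a) =
      (List.ofFn fun i => x D Q (js i) ^ m i).prod * a ∧ ∀ d : ℤ,
    (List.ofFn fun i => gx D Q β (js i) ^ m i).prod * single d a =
      single ((∑ i, m i * degX D (js i) ν) + d)
        ((List.ofFn fun i => x D Q (js i) ^ m i).prod * a) := by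
  induction n with
  | zero => simp [ha]
  | succ n ih =>
    obtain ⟨h1, h2⟩ := ih (fun i => js i.succ) (fun i => m i.succ)
    simp only [List.ofFn_succ, List.prod_cons, Fin.sum_univ_succ, mul_assoc]
    refine ⟨(gx_pow_mul h1 _ _ 0).1, fun d => ?_⟩
    rw [h2, (gx_pow_mul h1 _ _ _).2, add_assoc]

theorem evalOrd_mul {n : ℕ} (q : MvPolynomial (Fin n) k) (js : Fin n → Fin (ht β))
    (ν : Seq β) (d : ℤ) (hq : ∀ m ∈ q.support, ∑ i, (m i : ℤ) * degX D (js i) ν = d) :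
    evalOrd q (fun i => gx D Q β (js i)) * single 0 (e D Q ν) =
      single d (evalOrd q (fun i => x D Q (js i)) * e D Q ν) := by
  rw [evalOrd, evalOrd, Finset.sum_mul, Finset.sum_mul]
  have h : ∀ f : (Fin n →₀ ℕ) → R D Q β, single d (∑ m ∈ q.support, f m) =
      ∑ m ∈ q.support, single d (f m) := fun f =>
    map_sum (AddMonoidAlgebra.singleAddHom d) f q.support
  rw [h]
  refine Finset.sum_congr rfl fun m hm => ?_
  rw [smul_mul_assoc, smul_mul_assoc, (prod_mul (at_e ν) js m).2, hq m hm, add_zero,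
    AddMonoidAlgebra.smul_single]

theorem single_eq {c d : ℤ} (h : c = d) (a : R D Q β) : single c a = single d a := by
  rw [h]

theorem eq_of_mul_single {a b : AddMonoidAlgebra (R D Q β) ℤ}
    (h : ∀ ν, a * single 0 (e D Q ν) = b * single 0 (e D Q ν)) : a = b := by
  have h1 : ∑ ν, single (0 : ℤ) (e D Q ν) = (1 : AddMonoidAlgebra (R D Q β) ℤ) := by
    rw [AddMonoidAlgebra.one_def, ← sum_e]
    exact (map_sum (AddMonoidAlgebra.singleAddHom (0 : ℤ)) _ _).symm
  rw [← mul_one a, ← mul_one b, ← h1, Finset.mul_sum, Finset.mul_sum]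
  exact Finset.sum_congr rfl fun ν _ => h ν

theorem mem_support_divDiff {q : MvPolynomial (Fin 2) k} {m : Fin 3 →₀ ℕ}
    (h : m ∈ (divDiff q).support) : ∃ m' ∈ q.support, ∃ a < m' 0,
      m = Finsupp.single 0 a + Finsupp.single 1 (m' 1) + Finsupp.single 2 (m' 0 - 1 - a) := by
  obtain ⟨m', hm', h⟩ := Finset.mem_biUnion.1 (MvPolynomial.support_sum h)
  obtain ⟨a, ha, h⟩ := Finset.mem_biUnion.1 (MvPolynomial.support_sum h)
  exact ⟨m', hm', a, Finset.mem_range.1 ha,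
    Finset.mem_singleton.1 (MvPolynomial.support_monomial_subset h)⟩

theorem gx_e (j : Fin (ht β)) (ν : Seq β) : gx D Q β j * single 0 (e D Q ν) =
    single (degX D j ν) (x D Q j * e D Q ν) := by
  rw [gx_mul (at_e ν), add_zero]

theorem gτ_e (l : ℕ) (hl : l + 1 < ht β) (ν : Seq β) : gτ D Q β l hl * single 0 (e D Q ν) =
    single (degT D l hl ν) (τ D Q l hl * e D Q ν) := by
  rw [gτ_mul (at_e ν), add_zero]

theorem degT_congr {l l' : ℕ} {hl : l + 1 < ht β} {hl' : l' + 1 < ht β} {ν ν' : Seq β}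
    (h1 : ν ⟨l, Nat.lt_of_succ_lt hl⟩ = ν' ⟨l', Nat.lt_of_succ_lt hl'⟩)
    (h2 : ν ⟨l + 1, hl⟩ = ν' ⟨l' + 1, hl'⟩) : degT D l hl ν = degT D l' hl' ν' := by
  rw [degT, degT, h1, h2]

theorem graded_rel {a b : AddMonoidAlgebra (R D Q β) ℤ}
    (h : Rel D Q β (fun ν => single 0 (e D Q ν)) (gx D Q β) (gτ D Q β) a b) : a = b := by
  cases h with
  | e_e ν ν' =>
    rw [AddMonoidAlgebra.single_mul_single, e_mul_e]
    split_ifs <;> simp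
  | e_sum =>
    rw [AddMonoidAlgebra.one_def, ← sum_e]
    exact (map_sum (AddMonoidAlgebra.singleAddHom (0 : ℤ)) _ _).symm
  | x_e j ν =>
    rw [gx_e, gx, Finset.mul_sum, Finset.sum_eq_single ν]
    · rw [AddMonoidAlgebra.single_mul_single, zero_add, at_x (at_e ν)]
    · intro ν' _ h
      rw [AddMonoidAlgebra.single_mul_single, rel (.x_e j ν'), ← mul_assoc, e_mul_e,
        if_neg (Ne.symm h)]
      simp
    · simp
  | x_x j l =>
    refine eq_of_mul_single fun ν => ?_
    rw [mul_assoc, mul_assoc, gx_e, gx_e, gx_mul (at_x (at_e ν) _), gx_mul (at_x (at_e ν) _),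
      ← mul_assoc, ← mul_assoc, rel (.x_x j l), add_comm]
  | τ_e l hl ν =>
    rw [gτ_e, gτ, Finset.mul_sum, Finset.sum_eq_single ν]
    · rw [AddMonoidAlgebra.single_mul_single, zero_add, at_τ (at_e ν)]
    · intro ν' _ h
      have h' : ν.swap l hl ≠ ν'.swap l hl := by
        intro h'
        apply h
        ext j
        have := congrArg (fun μ : Seq β =>
          μ (Equiv.swap ⟨l, Nat.lt_of_succ_lt hl⟩ ⟨l + 1, hl⟩ j)) h'
        simpa [Seq.swap] using this.symm
      rw [AddMonoidAlgebra.single_mul_single, rel (.τ_e l hl ν'), ← mul_assoc, e_mul_e,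
        if_neg h']
      simp
    · simp
  | τ_τ j l hj hl hjl =>
    refine eq_of_mul_single fun ν => ?_
    have h1 : degT D j hj (ν.swap l hl) = degT D j hj ν := by
      apply degT_congr <;>
      · simp only [Seq.swap]
        rw [Equiv.swap_apply_of_ne_of_ne] <;> simp [Fin.ext_iff] <;> omega
    have h2 : degT D l hl (ν.swap j hj) = degT D l hl ν := by
      apply degT_congr <;>
      · simp only [Seq.swap]
        rw [Equiv.swap_apply_of_ne_of_ne] <;> simp [Fin.ext_iff] <;> omega
    rw [mul_assoc, mul_assoc, gτ_e, gτ_e, gτ_mul (at_τ (at_e ν) _ _), gτ_mul (at_τ (at_e ν) _ _),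
      ← mul_assoc, ← mul_assoc, rel (.τ_τ j l hj hl hjl), h1, h2, add_comm]
  | τ_sq l hl ν =>
    have hl' := Nat.lt_of_succ_lt hl
    have h1 : degT D l hl (ν.swap l hl) = degT D l hl ν := by
      simp [degT, Seq.swap, D.rootForm_comm]
    have key := evalOrd_mul (Q := Q) (Q.poly (ν ⟨l, hl'⟩) (ν ⟨l + 1, hl⟩)) ![⟨l, hl'⟩, ⟨l + 1, hl⟩] ν
      (degT D l hl ν + degT D l hl ν) (by
        intro m hm
        have hne : ν ⟨l, hl'⟩ ≠ ν ⟨l + 1, hl⟩ := by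
          intro h
          rw [h, Q.diag] at hm
          simp at hm
        have := Q.homogeneous _ _ hne m hm
        simp only [Fin.sum_univ_two, degX, degT]
        simp only [Matrix.cons_val_zero, Matrix.cons_val_one]
        linarith)
    have hx : ∀ {A : Type max u w} (f : Fin (ht β) → A), (fun i => f
        ((![⟨l, hl'⟩, ⟨l + 1, hl⟩] : Fin 2 → Fin (ht β)) i)) =
        ![f ⟨l, hl'⟩, f ⟨l + 1, hl⟩] := fun f => comp_two f _ _
    rw [hx, hx, ← rel (.τ_sq l hl ν)] at key
    rw [key, mul_assoc, gτ_e, gτ_mul (at_τ (at_e ν) _ _), h1, mul_assoc]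
  | τ_x l hl j ν =>
    have hl' := Nat.lt_of_succ_lt hl
    have hr := rel (.τ_x (D := D) (Q := Q) (e := e D Q) (x := x D Q) (τ := τ D Q) l hl j ν)
    have h1 : degX D (Equiv.swap ⟨l, hl'⟩ ⟨l + 1, hl⟩ j) (ν.swap l hl) = degX D j ν := by
      simp [degX, Seq.swap]
    rw [sub_mul, mul_assoc, mul_assoc, gx_e, gτ_e, gτ_mul (at_x (at_e ν) _),
      gx_mul (at_τ (at_e ν) _ _), h1, single_eq (add_comm (degX D j ν) (degT D l hl ν)),
      ← mul_assoc, ← mul_assoc, ← AddMonoidAlgebra.single_sub, ← sub_mul, hr]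
    split_ifs with h2 h3 h4
    · have : degT D l hl ν + degX D j ν = 0 := by
        have : j = ⟨l, hl'⟩ := Fin.ext h3
        subst this
        simp [degT, degX, h2]
      rw [this, AddMonoidAlgebra.single_neg]
    · have : degT D l hl ν + degX D j ν = 0 := by
        have : j = ⟨l + 1, hl⟩ := Fin.ext h4
        subst this
        simp [degT, degX, h2]
      rw [this]
    · simp
    · simp
  | braid l hl ν =>
    have hl1 : l + 1 < ht β := Nat.lt_of_succ_lt hl
    have hl0 : l < ht β := Nat.lt_of_succ_lt hl1
    have hr := rel (.braid (D := D) (Q := Q) (e := e D Q) (x := x D Q) (τ := τ D Q) l hl ν)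
    have sw : ∀ (ν : Seq β) (p : ℕ) (hp : p + 1 < ht β) (q : ℕ) (hq : q < ht β),
        (ν.swap p hp) ⟨q, hq⟩ = if q = p then ν ⟨p + 1, hp⟩ else
          if q = p + 1 then ν ⟨p, Nat.lt_of_succ_lt hp⟩ else ν ⟨q, hq⟩ := by
      intro ν p hp q hq
      simp only [Seq.swap, Equiv.swap_apply_def, Fin.mk.injEq]
      split_ifs <;> rfl
    have d1 : degT D l hl1 (ν.swap (l + 1) hl) =
        -D.rootForm (ν ⟨l, hl0⟩) (ν ⟨l + 2, hl⟩) := by simp [degT, sw, show ¬ (l = l + 1 + 1) by omega]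
    have d2 : degT D (l + 1) hl ((ν.swap (l + 1) hl).swap l hl1) =
        -D.rootForm (ν ⟨l, hl0⟩) (ν ⟨l + 1, hl1⟩) := by simp [degT, sw, show ¬ (l = l + 1 + 1) by omega, show ¬ (l + 1 + 1 = l) by omega]
    have d3 : degT D (l + 1) hl (ν.swap l hl1) =
        -D.rootForm (ν ⟨l, hl0⟩) (ν ⟨l + 2, hl⟩) := by simp [degT, sw, show ¬ (l + 1 + 1 = l) by omega]
    have d4 : degT D l hl1 ((ν.swap l hl1).swap (l + 1) hl) =
        -D.rootForm (ν ⟨l + 1, hl1⟩) (ν ⟨l + 2, hl⟩) := by simp [degT, sw, show ¬ (l = l + 1 + 1) by omega, show ¬ (l + 1 + 1 = l) by omega]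
    have d5 : degT D (l + 1) hl ν = -D.rootForm (ν ⟨l + 1, hl1⟩) (ν ⟨l + 2, hl⟩) := rfl
    have d6 : degT D l hl1 ν = -D.rootForm (ν ⟨l, hl0⟩) (ν ⟨l + 1, hl1⟩) := rfl
    rw [sub_mul, mul_assoc, mul_assoc, mul_assoc, mul_assoc, gτ_e, gτ_e,
      gτ_mul (at_τ (at_e ν) _ _), gτ_mul (at_τ (at_e ν) _ _),
      gτ_mul (at_τ (at_τ (at_e ν) _ _) _ _), gτ_mul (at_τ (at_τ (at_e ν) _ _) _ _),
      d1, d2, d3, d4, d5, d6]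
    rw [single_eq (show -D.rootForm (ν ⟨l + 1, hl1⟩) (ν ⟨l + 2, hl⟩) +
        (-D.rootForm (ν ⟨l, hl0⟩) (ν ⟨l + 2, hl⟩) + -D.rootForm (ν ⟨l, hl0⟩) (ν ⟨l + 1, hl1⟩)) =
      -D.rootForm (ν ⟨l, hl0⟩) (ν ⟨l + 1, hl1⟩) + (-D.rootForm (ν ⟨l, hl0⟩) (ν ⟨l + 2, hl⟩) +
        -D.rootForm (ν ⟨l + 1, hl1⟩) (ν ⟨l + 2, hl⟩)) by ring), ← AddMonoidAlgebra.single_sub]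
    rw [sub_mul, mul_assoc, mul_assoc, mul_assoc, mul_assoc] at hr
    rw [hr]
    split_ifs with hii
    · have key := evalOrd_mul (Q := Q) (divDiff (Q.poly (ν ⟨l, hl0⟩) (ν ⟨l + 1, hl1⟩)))
        ![⟨l, hl0⟩, ⟨l + 1, hl1⟩, ⟨l + 2, hl⟩] ν
        (-D.rootForm (ν ⟨l, hl0⟩) (ν ⟨l + 1, hl1⟩) + (-D.rootForm (ν ⟨l, hl0⟩) (ν ⟨l + 2, hl⟩) +
          -D.rootForm (ν ⟨l + 1, hl1⟩) (ν ⟨l + 2, hl⟩))) (by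
          intro m hm
          obtain ⟨m', hm', a, ha, rfl⟩ := mem_support_divDiff hm
          have hne : ν ⟨l, hl0⟩ ≠ ν ⟨l + 1, hl1⟩ := by
            intro h
            rw [h, Q.diag] at hm'
            simp at hm'
          have := Q.homogeneous _ _ hne m' hm'
          simp only [Fin.sum_univ_three, degX, Matrix.cons_val_zero, Matrix.cons_val_one,
            Matrix.cons_val, ← hii, D.rootForm_comm (ν ⟨l + 1, hl1⟩) (ν ⟨l, hl0⟩)]
          have hs : ((m' 0 - 1 - a : ℕ) : ℤ) = m' 0 - 1 - a := by omega
          simp [hs]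
          linear_combination this)
      have hx : ∀ {A : Type max u w} (f : Fin (ht β) → A), (fun i => f
          ((![⟨l, hl0⟩, ⟨l + 1, hl1⟩, ⟨l + 2, hl⟩] : Fin 3 → Fin (ht β)) i)) =
          ![f ⟨l, hl0⟩, f ⟨l + 1, hl1⟩, f ⟨l + 2, hl⟩] := fun f => comp_three f _ _ _
      rw [hx, hx] at key
      rw [key]
    · simp

variable (D Q β) in
theorem exists_coaction : ∃ δ : R D Q β →ₗ[k] (ℤ →₀ R D Q β),
    ∀ d, ∀ a ∈ grading D Q β d, δ a = Finsupp.single d a := by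
  obtain ⟨f, he, hx, hτ⟩ := exists_lift (D := D) (Q := Q) (β := β)
    (A := AddMonoidAlgebra (R D Q β) ℤ) _ _ _ (fun a b h => graded_rel h)
  have hf : ∀ a d, IsMonomial D Q a d → f a = single d a := by
    intro a d h
    induction h with
    | e ν => exact he ν
    | x j ν => rw [map_mul, hx, he, gx_e]
    | τ l hl ν => rw [map_mul, hτ, he, gτ_e]
    | mul a b c d _ _ ha hb => rw [map_mul, ha, hb, AddMonoidAlgebra.single_mul_single]
  refine ⟨(AddMonoidAlgebra.coeffLinearEquiv k).toLinearMap ∘ₗ f.toLinearMap, fun d a ha => ?_⟩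
  induction ha using Submodule.span_induction with
  | mem a h =>
    change AddMonoidAlgebra.coeff (f a) = _
    rw [hf a d h]
    rfl
  | zero => simp
  | add a b _ _ ha hb => rw [map_add, ha, hb, Finsupp.single_add]
  | smul c a _ ha => rw [map_smul, ha, Finsupp.smul_single]

end coaction

end R

/-! ### Internal gradings -/

section internal

variable {V : Type*} [AddCommGroup V] [Module k V]

theorem isInternal_of_coaction (A : ℤ → Submodule k V) (δ : V →ₗ[k] (ℤ →₀ V))
    (hδ : ∀ d, ∀ v ∈ A d, δ v = Finsupp.single d v) (hA : ⨆ d, A d = ⊤) :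
    DirectSum.IsInternal A := by
  refine DirectSum.isInternal_submodule_of_iSupIndep_of_iSup_eq_top ?_ hA
  intro d
  rw [Submodule.disjoint_def]
  intro v hv hv'
  have h1 : ⨆ j, ⨆ (_ : j ≠ d), A j ≤ LinearMap.ker (Finsupp.lapply d ∘ₗ δ) := by
    refine iSup₂_le fun j hj v hv => ?_
    simp [hδ j v hv, hj]
  have h2 := h1 hv'
  simpa [hδ d v hv] using h2

theorem exists_coaction_of_isInternal {A : ℤ → Submodule k V} (h : DirectSum.IsInternal A) :
    ∃ δ : V →ₗ[k] (ℤ →₀ V), ∀ d, ∀ v ∈ A d, δ v = Finsupp.single d v := by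
  let f : (⨁ d, A d) ≃ₗ[k] V := LinearEquiv.ofBijective (DirectSum.coeLinearMap A) h
  refine ⟨DirectSum.toModule k ℤ _ (fun d => Finsupp.lsingle d ∘ₗ (A d).subtype) ∘ₗ
    f.symm.toLinearMap, fun d v hv => ?_⟩
  have : f.symm v = DirectSum.lof k ℤ (fun d => A d) d ⟨v, hv⟩ := by
    rw [LinearEquiv.symm_apply_eq]
    exact (DirectSum.coeLinearMap_lof A d ⟨v, hv⟩).symm
  simp [this]

theorem exists_tensor_coaction {W : Type*} [AddCommGroup W] [Module k W] {A : ℤ → Submodule k V}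
    {B : ℤ → Submodule k W} {δ : V →ₗ[k] (ℤ →₀ V)} {ε : W →ₗ[k] (ℤ →₀ W)}
    (hδ : ∀ d, ∀ v ∈ A d, δ v = Finsupp.single d v)
    (hε : ∀ d, ∀ v ∈ B d, ε v = Finsupp.single d v) :
    ∃ η : V ⊗[k] W →ₗ[k] (ℤ →₀ V ⊗[k] W), ∀ c d, ∀ v ∈ A c, ∀ w ∈ B d,
      η (v ⊗ₜ w) = Finsupp.single (c + d) (v ⊗ₜ w) := by
  refine ⟨Finsupp.lmapDomain _ k (fun p : ℤ × ℤ => p.1 + p.2) ∘ₗ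
    (finsuppTensorFinsupp k k V W ℤ ℤ).toLinearMap ∘ₗ TensorProduct.map δ ε, ?_⟩
  intro c d v hv w hw
  simp [hδ c v hv, hε d w hw, finsuppTensorFinsupp_single]

/-- Induction on homogeneous components. -/
theorem induction_of_iSup_eq_top {A : ℤ → Submodule k V} (hA : ⨆ d, A d = ⊤) {C : V → Prop}
    (h : ∀ d, ∀ v ∈ A d, C v) (h0 : C 0) (hadd : ∀ v w, C v → C w → C (v + w)) (v : V) : C v :=
  Submodule.iSup_induction A (motive := C) (hA ▸ Submodule.mem_top : v ∈ ⨆ d, A d) h h0 hadd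

end internal

/-! ### Graded modules -/

/-- A graded left `R(β)`-module `M = ⨁_{d ∈ ℤ} M_d`. -/
structure GMod where
  carrier : Type (max u w)
  [addCommGroup : AddCommGroup carrier]
  [moduleBase : Module k carrier]
  [module : Module (R D Q β) carrier]
  [isScalarTower : IsScalarTower k (R D Q β) carrier]
  /-- the homogeneous part `M_d` -/
  part : ℤ → Submodule k carrier
  isInternal : DirectSum.IsInternal part
  smul_mem : ∀ {c d : ℤ} {a : R D Q β} {m : carrier},
    a ∈ R.grading D Q β c → m ∈ part d → a • m ∈ part (c + d)

attribute [instance] GMod.addCommGroup GMod.moduleBase GMod.module GMod.isScalarTower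

namespace GMod

variable {D Q β}

instance : CoeSort (GMod D Q β) (Type (max u w)) := ⟨GMod.carrier⟩

/-- Degree-preserving homomorphisms of graded modules. -/
@[ext]
structure Hom (M N : GMod D Q β) where
  toLin : M →ₗ[R D Q β] N
  map_part : ∀ d, ∀ m ∈ M.part d, toLin m ∈ N.part d

/-- The grading shift `q^n M`, with `(q^n M)_d = M_{d-n}`. -/
def shift (n : ℤ) (M : GMod D Q β) : GMod D Q β where
  carrier := M
  part := fun d => M.part (d - n)
  isInternal := by
    obtain ⟨δ, hδ⟩ := exists_coaction_of_isInternal M.isInternal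
    refine isInternal_of_coaction _
      (Finsupp.lmapDomain _ k (fun d => d + n) ∘ₗ δ) (fun d v hv => ?_) ?_
    · simp [hδ _ v hv]
    · rw [← M.isInternal.submodule_iSup_eq_top]
      exact (Equiv.subRight n).iSup_comp (g := M.part)
  smul_mem := by
    intro c d a m ha hm
    have := M.smul_mem ha hm
    rwa [show c + d - n = c + (d - n) by ring]

variable (D Q β) in
/-- The regular module `R(β)` with its grading. -/
def regular : GMod D Q β where
  carrier := R D Q β
  part := R.grading D Q β
  isInternal := by
    obtain ⟨δ, hδ⟩ := R.exists_coaction D Q β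
    exact isInternal_of_coaction _ δ hδ R.iSup_grading
  smul_mem := fun ha hm => R.mul_mem_grading ha hm

variable (D Q β) in
/-- The zero module. -/
def zero : GMod D Q β where
  carrier := PUnit
  part := fun _ => ⊤
  isInternal := isInternal_of_coaction _ 0 (fun _ _ _ => Subsingleton.elim _ _)
    (Subsingleton.elim _ _)
  smul_mem := fun _ _ => Submodule.mem_top

end GMod

/-! ### The convolution product -/

section convolution

variable {D Q β} {γ γ' : I →₀ ℕ}

variable (D Q β γ γ') in
/-- The algebra homomorphism `R(γ) ⊗ R(γ') → e(γ,γ') R(β) e(γ,γ')`, where `β = γ + γ'`, on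
algebra generators: `EmbGen a b c` means that the generator `a ⊗ b` of `R(γ) ⊗ R(γ')` is sent
to `c`. -/
inductive EmbGen : R D Q γ → R D Q γ' → R D Q β → Prop
  | e {ν : Seq β} {μ : Seq γ} {μ' : Seq γ'} (h : ν.IsConcat μ μ') :
      EmbGen (R.e D Q μ) (R.e D Q μ') (R.e D Q ν)
  | x_left {ν : Seq β} {μ : Seq γ} {μ' : Seq γ'} (h : ν.IsConcat μ μ')
      (j : Fin (ht γ)) (i : Fin (ht β)) (hij : i.1 = j.1) :
      EmbGen (R.x D Q j * R.e D Q μ) (R.e D Q μ') (R.x D Q i * R.e D Q ν)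
  | x_right {ν : Seq β} {μ : Seq γ} {μ' : Seq γ'} (h : ν.IsConcat μ μ')
      (j : Fin (ht γ')) (i : Fin (ht β)) (hij : i.1 = ht γ + j.1) :
      EmbGen (R.e D Q μ) (R.x D Q j * R.e D Q μ') (R.x D Q i * R.e D Q ν)
  | τ_left {ν : Seq β} {μ : Seq γ} {μ' : Seq γ'} (h : ν.IsConcat μ μ')
      (l : ℕ) (hl : l + 1 < ht γ) (hl' : l + 1 < ht β) :
      EmbGen (R.τ D Q l hl * R.e D Q μ) (R.e D Q μ') (R.τ D Q l hl' * R.e D Q ν)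
  | τ_right {ν : Seq β} {μ : Seq γ} {μ' : Seq γ'} (h : ν.IsConcat μ μ')
      (l : ℕ) (hl : l + 1 < ht γ') (hl' : ht γ + l + 1 < ht β) :
      EmbGen (R.e D Q μ) (R.τ D Q l hl * R.e D Q μ') (R.τ D Q (ht γ + l) hl' * R.e D Q ν)

theorem Seq.IsConcat.length {ν : Seq β} {μ : Seq γ} {μ' : Seq γ'} (h : ν.IsConcat μ μ') :
    ht β = ht γ + ht γ' := by
  have := congrArg List.length h
  simpa using this

theorem Seq.IsConcat.left {ν : Seq β} {μ : Seq γ} {μ' : Seq γ'} (h : ν.IsConcat μ μ')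
    (j : ℕ) (hj : j < ht γ) (hj' : j < ht β) : ν ⟨j, hj'⟩ = μ ⟨j, hj⟩ := by
  have h1 := congrArg (fun l : List I => l[j]?) h
  simpa [List.getElem?_append, hj, hj'] using h1

theorem Seq.IsConcat.right {ν : Seq β} {μ : Seq γ} {μ' : Seq γ'} (h : ν.IsConcat μ μ')
    (j : ℕ) (hj : j < ht γ') (hj' : ht γ + j < ht β) : ν ⟨ht γ + j, hj'⟩ = μ' ⟨j, hj⟩ := by
  have h1 := congrArg (fun l : List I => l[ht γ + j]?) h
  simpa [List.getElem?_append, hj, hj'] using h1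

theorem EmbGen.homogeneous {a : R D Q γ} {b : R D Q γ'} {c : R D Q β}
    (h : EmbGen D Q β γ γ' a b c) : ∃ r s : ℤ, a ∈ R.grading D Q γ r ∧
      b ∈ R.grading D Q γ' s ∧ c ∈ R.grading D Q β (r + s) := by
  cases h with
  | e h => exact ⟨0, 0, Submodule.subset_span (.e _), Submodule.subset_span (.e _),
      Submodule.subset_span (.e _)⟩
  | @x_left ν μ μ' h j i hij =>
    refine ⟨_, 0, Submodule.subset_span (.x j _), Submodule.subset_span (.e _), ?_⟩
    have hd : R.degX D j μ + 0 = R.degX D i ν := by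
      obtain ⟨i, hi⟩ := i
      obtain rfl : i = j.1 := hij
      rw [R.degX, R.degX, h.left j.1 j.2 hi, add_zero]
    rw [hd]
    exact Submodule.subset_span (.x i ν)
  | @x_right ν μ μ' h j i hij =>
    refine ⟨0, _, Submodule.subset_span (.e _), Submodule.subset_span (.x j _), ?_⟩
    have hd : 0 + R.degX D j μ' = R.degX D i ν := by
      obtain ⟨i, hi⟩ := i
      obtain rfl : i = ht γ + j.1 := hij
      rw [R.degX, R.degX, h.right j.1 j.2 hi, zero_add]
    rw [hd]
    exact Submodule.subset_span (.x i ν)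
  | @τ_left ν μ μ' h l hl hl' =>
    refine ⟨_, 0, Submodule.subset_span (.τ l hl _), Submodule.subset_span (.e _), ?_⟩
    have hd : R.degT D l hl μ + 0 = R.degT D l hl' ν := by
      rw [R.degT, R.degT, h.left l (Nat.lt_of_succ_lt hl) (Nat.lt_of_succ_lt hl'),
        h.left (l + 1) hl hl', add_zero]
    rw [hd]
    exact Submodule.subset_span (.τ l hl' ν)
  | @τ_right ν μ μ' h l hl hl' =>
    refine ⟨0, _, Submodule.subset_span (.e _), Submodule.subset_span (.τ l hl _), ?_⟩
    have hd : 0 + R.degT D l hl μ' = R.degT D (ht γ + l) hl' ν := by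
      rw [R.degT, R.degT, zero_add, h.right l (Nat.lt_of_succ_lt hl) (Nat.lt_of_succ_lt hl')]
      exact congrArg (fun i => - D.rootForm _ i) (h.right (l + 1) hl hl').symm
    rw [hd]
    exact Submodule.subset_span (.τ _ hl' ν)

variable (β)

/-- The relations `c ⊗ (m ⊗ n) = 1 ⊗ (a m ⊗ b n)`, for `a ⊗ b` a generator of `R(γ) ⊗ R(γ')`
with image `c` in `R(β)`. -/
def convRel (M : GMod D Q γ) (N : GMod D Q γ') : Set (R D Q β ⊗[k] (M ⊗[k] N)) :=
  {z | ∃ (a : R D Q γ) (b : R D Q γ') (c : R D Q β) (m : M) (n : N), EmbGen D Q β γ γ' a b c ∧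
    z = c ⊗ₜ[k] (m ⊗ₜ[k] n) - 1 ⊗ₜ[k] ((a • m) ⊗ₜ[k] (b • n))}

/-- For `β = γ + γ'`, the `R(β)`-module `M ∘ N = R(β) e(γ,γ') ⊗_{R(γ) ⊗ R(γ')} (M ⊗ N)`, as the
quotient of `R(β) ⊗_k (M ⊗_k N)` by the `R(β)`-submodule generated by the relations `convRel`.
(These relations give `r ⊗ z = r e(γ,γ') ⊗ z`, since `1 ∈ R(γ) ⊗ R(γ')` is mapped to
`e(γ,γ')`, and they express that the tensor product is balanced over `R(γ) ⊗ R(γ')`.) -/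
abbrev ConvCarrier (M : GMod D Q γ) (N : GMod D Q γ') : Type (max u w) :=
  (R D Q β ⊗[k] (M ⊗[k] N)) ⧸ Submodule.span (R D Q β) (convRel β M N)

/-- The class of `r ⊗ m ⊗ n` in `M ∘ N`. -/
def convMk (M : GMod D Q γ) (N : GMod D Q γ') (r : R D Q β) (m : M) (n : N) :
    ConvCarrier β M N :=
  Submodule.Quotient.mk (r ⊗ₜ[k] (m ⊗ₜ[k] n))

/-- The part of degree `d` of `M ∘ N`. -/
def convPart (M : GMod D Q γ) (N : GMod D Q γ') (d : ℤ) : Submodule k (ConvCarrier β M N) :=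
  Submodule.span k {z | ∃ (c₀ c₁ c₂ : ℤ) (r : R D Q β) (m : M) (n : N),
    r ∈ R.grading D Q β c₀ ∧ m ∈ M.part c₁ ∧ n ∈ N.part c₂ ∧ c₀ + c₁ + c₂ = d ∧
      z = convMk β M N r m n}

variable {β}

theorem convMk_rel (M : GMod D Q γ) (N : GMod D Q γ') {a : R D Q γ} {b : R D Q γ'} {c : R D Q β}
    (h : EmbGen D Q β γ γ' a b c) (r : R D Q β) (m : M) (n : N) :
    convMk β M N (r * c) m n = convMk β M N r (a • m) (b • n) := by
  refine (Submodule.Quotient.eq _).2 ?_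
  have := Submodule.smul_mem _ r (Submodule.subset_span (s := convRel β M N)
    ⟨a, b, c, m, n, h, rfl⟩)
  simpa [smul_sub, TensorProduct.smul_tmul'] using this

theorem smul_convMk (M : GMod D Q γ) (N : GMod D Q γ') (a r : R D Q β) (m : M) (n : N) :
    a • convMk β M N r m n = convMk β M N (a * r) m n := rfl

theorem iSup_convPart (M : GMod D Q γ) (N : GMod D Q γ') : ⨆ d, convPart β M N d = ⊤ := by
  rw [eq_top_iff]
  rintro z -
  obtain ⟨t, rfl⟩ := Submodule.Quotient.mk_surjective _ z
  have hmk : ∀ r m n, convMk β M N r m n ∈ ⨆ d, convPart β M N d := by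
    intro r m n
    induction r using induction_of_iSup_eq_top R.iSup_grading with
    | h0 =>
      rw [convMk, TensorProduct.zero_tmul, Submodule.Quotient.mk_zero]
      exact Submodule.zero_mem _
    | hadd r r' h h' =>
      rw [convMk, TensorProduct.add_tmul, Submodule.Quotient.mk_add]
      exact Submodule.add_mem _ h h'
    | h c₀ r hr =>
    induction m using induction_of_iSup_eq_top M.isInternal.submodule_iSup_eq_top with
    | h0 =>
      rw [convMk, TensorProduct.zero_tmul, TensorProduct.tmul_zero, Submodule.Quotient.mk_zero]
      exact Submodule.zero_mem _
    | hadd m m' h h' =>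
      rw [convMk, TensorProduct.add_tmul, TensorProduct.tmul_add, Submodule.Quotient.mk_add]
      exact Submodule.add_mem _ h h'
    | h c₁ m hm =>
    induction n using induction_of_iSup_eq_top N.isInternal.submodule_iSup_eq_top with
    | h0 =>
      rw [convMk, TensorProduct.tmul_zero, TensorProduct.tmul_zero, Submodule.Quotient.mk_zero]
      exact Submodule.zero_mem _
    | hadd n n' h h' =>
      rw [convMk, TensorProduct.tmul_add, TensorProduct.tmul_add, Submodule.Quotient.mk_add]
      exact Submodule.add_mem _ h h'
    | h c₂ n hn =>
    exact Submodule.mem_iSup_of_mem _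
      (Submodule.subset_span ⟨c₀, c₁, c₂, r, m, n, hr, hm, hn, rfl, rfl⟩)
  induction t with
  | zero => exact Submodule.zero_mem _
  | add t t' h h' => exact Submodule.add_mem _ h h'
  | tmul r t =>
    induction t with
    | zero => rw [TensorProduct.tmul_zero]; exact Submodule.zero_mem _
    | add t t' h h' => rw [TensorProduct.tmul_add]; exact Submodule.add_mem _ h h'
    | tmul m n => exact hmk r m n

theorem isInternal_convPart (M : GMod D Q γ) (N : GMod D Q γ') :
    DirectSum.IsInternal (convPart β M N) := by
  obtain ⟨δ₀, h₀⟩ := R.exists_coaction D Q β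
  obtain ⟨δ₁, h₁⟩ := exists_coaction_of_isInternal M.isInternal
  obtain ⟨δ₂, h₂⟩ := exists_coaction_of_isInternal N.isInternal
  obtain ⟨δ₁₂, h₁₂⟩ := exists_tensor_coaction h₁ h₂
  have h₁₂' : ∀ d, ∀ v ∈ Submodule.span k {z | ∃ (c₁ c₂ : ℤ) (m : M) (n : N),
      m ∈ M.part c₁ ∧ n ∈ N.part c₂ ∧ c₁ + c₂ = d ∧ z = m ⊗ₜ[k] n},
      δ₁₂ v = Finsupp.single d v := by
    intro d v hv
    induction hv using Submodule.span_induction with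
    | mem v h =>
      obtain ⟨c₁, c₂, m, n, hm, hn, rfl, rfl⟩ := h
      exact h₁₂ c₁ c₂ m hm n hn
    | zero => simp
    | add a b _ _ ha hb => rw [map_add, ha, hb, Finsupp.single_add]
    | smul c a _ ha => rw [map_smul, ha, Finsupp.smul_single]
  obtain ⟨δ₃, h₃⟩ := exists_tensor_coaction h₀ h₁₂'
  have h₃' : ∀ c₀ c₁ c₂ r m n, r ∈ R.grading D Q β c₀ → m ∈ M.part c₁ → n ∈ N.part c₂ →
      δ₃ (r ⊗ₜ (m ⊗ₜ n)) = Finsupp.single (c₀ + (c₁ + c₂)) (r ⊗ₜ (m ⊗ₜ n)) :=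
    fun c₀ c₁ c₂ r m n hr hm hn => h₃ c₀ _ r hr _
      (Submodule.subset_span ⟨c₁, c₂, m, n, hm, hn, rfl, rfl⟩)
  let W := Submodule.span (R D Q β) (convRel β M N)
  let π : R D Q β ⊗[k] (M ⊗[k] N) →ₗ[k] ConvCarrier β M N := W.mkQ.restrictScalars k
  let η : R D Q β ⊗[k] (M ⊗[k] N) →ₗ[k] (ℤ →₀ ConvCarrier β M N) :=
    Finsupp.mapRange.linearMap π ∘ₗ δ₃
  have hη : ∀ c₀ c₁ c₂ r m n, r ∈ R.grading D Q β c₀ → m ∈ M.part c₁ → n ∈ N.part c₂ →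
      η (r ⊗ₜ (m ⊗ₜ n)) = Finsupp.single (c₀ + (c₁ + c₂)) (convMk β M N r m n) := by
    intro c₀ c₁ c₂ r m n hr hm hn
    simp only [η, LinearMap.comp_apply, h₃' c₀ c₁ c₂ r m n hr hm hn]
    rw [Finsupp.mapRange.linearMap_apply, Finsupp.mapRange_single]
    rfl
  have hker : ∀ a b c, EmbGen D Q β γ γ' a b c → ∀ r m n,
      η ((r * c) ⊗ₜ (m ⊗ₜ n)) = η (r ⊗ₜ ((a • m) ⊗ₜ (b • n))) := by
    intro a b c h r m n
    obtain ⟨d, d', ha, hb, hc⟩ := h.homogeneous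
    induction r using induction_of_iSup_eq_top R.iSup_grading with
    | h0 => simp
    | hadd r r' h h' => rw [add_mul, TensorProduct.add_tmul, TensorProduct.add_tmul, map_add,
        map_add, h, h']
    | h c₀ r hr =>
    induction m using induction_of_iSup_eq_top M.isInternal.submodule_iSup_eq_top with
    | h0 => simp
    | hadd m m' h h' => rw [smul_add, TensorProduct.add_tmul, TensorProduct.add_tmul,
        TensorProduct.tmul_add, TensorProduct.tmul_add, map_add, map_add, h, h']
    | h c₁ m hm =>
    induction n using induction_of_iSup_eq_top N.isInternal.submodule_iSup_eq_top with
    | h0 => simp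
    | hadd n n' h h' => rw [smul_add, TensorProduct.tmul_add, TensorProduct.tmul_add,
        TensorProduct.tmul_add, TensorProduct.tmul_add, map_add, map_add, h, h']
    | h c₂ n hn =>
    rw [hη _ _ _ _ _ _ (R.mul_mem_grading hr hc) hm hn,
      hη _ _ _ _ _ _ hr (M.smul_mem ha hm) (N.smul_mem hb hn), convMk_rel M N h]
    congr 1
    ring
  have hW : ∀ w ∈ W, η w = 0 := by
    intro w hw
    have : ∀ r : R D Q β, η (r • w) = 0 := by
      induction hw using Submodule.span_induction with
      | mem w h =>
        obtain ⟨a, b, c, m, n, h, rfl⟩ := h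
        intro r
        rw [smul_sub, map_sub, TensorProduct.smul_tmul', TensorProduct.smul_tmul', smul_eq_mul,
          smul_eq_mul, mul_one, hker a b c h, sub_self]
      | zero => simp
      | add v w _ _ hv hw => intro r; rw [smul_add, map_add, hv, hw, add_zero]
      | smul a w _ hw => intro r; rw [smul_smul]; exact hw _
    simpa using this 1
  let η' : ConvCarrier β M N →ₗ[k] (ℤ →₀ ConvCarrier β M N) :=
    (W.restrictScalars k).liftQ η hW
  refine isInternal_of_coaction _ η' (fun d v hv => ?_) (iSup_convPart M N)
  induction hv using Submodule.span_induction with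
  | mem v h =>
    obtain ⟨c₀, c₁, c₂, r, m, n, hr, hm, hn, rfl, rfl⟩ := h
    rw [add_assoc]
    exact hη c₀ c₁ c₂ r m n hr hm hn
  | zero => simp
  | add a b _ _ ha hb => rw [map_add, ha, hb, Finsupp.single_add]
  | smul c a _ ha => rw [map_smul, ha, Finsupp.smul_single]

variable (β)

/-- The convolution product `M ∘ N` of graded modules, for `β = γ + γ'`. -/
def GMod.conv (M : GMod D Q γ) (N : GMod D Q γ') : GMod D Q β where
  carrier := ConvCarrier β M N
  part := convPart β M N
  isInternal := isInternal_convPart M N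
  smul_mem := by
    intro c d a z ha hz
    induction hz using Submodule.span_induction with
    | mem z h =>
      obtain ⟨c₀, c₁, c₂, r, m, n, hr, hm, hn, rfl, rfl⟩ := h
      rw [smul_convMk]
      exact Submodule.subset_span
        ⟨c + c₀, c₁, c₂, _, m, n, R.mul_mem_grading ha hr, hm, hn, by ring, rfl⟩
    | zero => rw [smul_zero]; exact Submodule.zero_mem _
    | add v w _ _ hv hw => rw [smul_add]; exact Submodule.add_mem _ hv hw
    | smul t v _ hv => rw [smul_algebra_smul_comm]; exact Submodule.smul_mem _ t hv

end convolution

/-- The direct sum of a family of graded modules. -/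
def GMod.directSum {D : CartanDatum I P} {Q : QPoly D k} {β : I →₀ ℕ} {ι : Type w}
    (F : ι → GMod D Q β) : GMod D Q β where
  carrier := ⨁ i, F i
  part := fun d =>
    { carrier := {z | ∀ i, z i ∈ (F i).part d}
      add_mem' := fun ha hb i => Submodule.add_mem _ (ha i) (hb i)
      zero_mem' := fun i => Submodule.zero_mem _
      smul_mem' := fun c _ ha i => Submodule.smul_mem _ c (ha i) }
  isInternal := by
    choose δ hδ using fun i => exists_coaction_of_isInternal (F i).isInternal
    refine isInternal_of_coaction _ (DirectSum.toModule k ι _ fun i =>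
      Finsupp.mapRange.linearMap (DirectSum.lof k ι (fun i => F i) i) ∘ₗ δ i) ?_ ?_
    · intro d z hz
      have hz' : ∀ i, z i ∈ (F i).part d := hz
      conv_lhs => rw [← DirectSum.sum_support_of z]
      conv_rhs => rw [← DirectSum.sum_support_of z]
      rw [map_sum]
      refine Eq.trans ?_ (map_sum (Finsupp.singleAddHom d) _ _).symm
      refine Finset.sum_congr rfl fun i _ => ?_
      rw [← DirectSum.lof_eq_of k, DirectSum.toModule_lof]
      simp [hδ i d _ (hz' i)]
    · rw [eq_top_iff]
      rintro z -
      rw [← DirectSum.sum_support_of z]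
      refine Submodule.sum_mem _ fun i _ => ?_
      generalize z i = m
      induction m using induction_of_iSup_eq_top (F i).isInternal.submodule_iSup_eq_top with
      | h0 => rw [map_zero]; exact Submodule.zero_mem _
      | hadd m m' h h' => rw [map_add]; exact Submodule.add_mem _ h h'
      | h d m hm =>
        refine Submodule.mem_iSup_of_mem d fun j => ?_
        by_cases hij : i = j
        · subst hij
          rw [DirectSum.of_eq_same]
          exact hm
        · rw [DirectSum.of_eq_of_ne _ _ _ (Ne.symm hij)]
          exact Submodule.zero_mem _
  smul_mem := fun ha hm i => (F i).smul_mem ha (hm i)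

/-! ### The category of `R`-modules -/

/-- A family `M = (M_β)` of graded `R(β)`-modules, for `β ∈ Q₊`. -/
structure RMod (D : CartanDatum I P) (Q : QPoly D k) where
  obj : (β : I →₀ ℕ) → GMod D Q β

namespace RMod

open CategoryTheory

variable {D Q}

/-- Morphisms are families of degree-preserving homomorphisms. -/
@[ext]
structure Hom (M N : RMod D Q) where
  app : (β : I →₀ ℕ) → GMod.Hom (M.obj β) (N.obj β)

instance : Category (RMod D Q) where
  Hom := Hom
  id M := ⟨fun β => ⟨LinearMap.id, fun _ _ h => h⟩⟩
  comp f g := ⟨fun β => ⟨(g.app β).toLin ∘ₗ (f.app β).toLin, fun d m h =>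
    (g.app β).map_part d _ ((f.app β).map_part d m h)⟩⟩

/-- The underlying linear map of the component at `β` of a morphism. -/
def lin {M N : RMod D Q} (f : M ⟶ N) (β : I →₀ ℕ) : M.obj β →ₗ[R D Q β] N.obj β :=
  (Hom.app f β).toLin

variable (D Q) in
/-- The objects of `R-gmod = ⨁_β R(β)-gmod`: all `M_β` are finite-dimensional over `k`, and
`M_β = 0` for all but finitely many `β`. -/
def gmod : ObjectProperty (RMod D Q) := fun M =>
  (∀ β, FiniteDimensional k (M.obj β)) ∧ {β | Nontrivial (M.obj β)}.Finite

/-- The sequence `0 → M' → M → M'' → 0` given by `f` and `g` is exact. -/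
def IsShortExact {M' M M'' : RMod D Q} (f : M' ⟶ M) (g : M ⟶ M'') : Prop :=
  ∀ β, Function.Injective (lin f β) ∧ Function.Exact (lin f β) (lin g β) ∧
    Function.Surjective (lin g β)

/-- `N` is isomorphic to a quotient of a submodule of `M`. -/
def IsSubquotient (N M : RMod D Q) : Prop :=
  ∃ (L : RMod D Q) (f : L ⟶ M) (g : L ⟶ N),
    ∀ β, Function.Injective (lin f β) ∧ Function.Surjective (lin g β)

/-- The grading shift `q^n M`. -/
def shift (n : ℤ) (M : RMod D Q) : RMod D Q := ⟨fun β => (M.obj β).shift n⟩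

/-- The convolution product: `(M ∘ N)_β = ⨁_{γ + γ' = β} M_γ ∘ N_γ'`. -/
def conv (M N : RMod D Q) : RMod D Q :=
  ⟨fun β => GMod.directSum fun p : {p : (I →₀ ℕ) × (I →₀ ℕ) // p.1 + p.2 = β} =>
    GMod.conv β (M.obj p.1.1) (N.obj p.1.2)⟩

variable (D Q) in
/-- The trivial module: the one-dimensional `R(0)`-module `R(0) = k` in degree `0`. -/
def unit : RMod D Q := ⟨fun β => if β = 0 then GMod.regular D Q β else GMod.zero D Q β⟩

end RMod

/-! ### The categories `C_w`, `C_{*,v}`, `C_{w,v}` -/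

section categories

open CategoryTheory

/-- The idempotent `e(γ, γ') = ∑ e(μ ∗ μ')` of `R(β)`, where `β = γ + γ'` and the sum is over
`μ ∈ I^γ`, `μ' ∈ I^γ'`. -/
def R.eSplit (γ γ' : I →₀ ℕ) : R D Q β :=
  ∑ ν : Seq β with ∃ (μ : Seq γ) (μ' : Seq γ'), ν.IsConcat μ μ', R.e D Q ν

variable {D Q}

/-- `W(M) = {γ ∈ Q₊ ∩ (β - Q₊) | e(γ, β - γ) M ≠ 0}` for an `R(β)`-module `M`. -/
def GMod.gW {β : I →₀ ℕ} (M : GMod D Q β) : Set (I →₀ ℕ) :=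
  {γ | γ ≤ β ∧ ∃ m : M, R.eSplit D Q β γ (β - γ) • m ≠ 0}

/-- `W^*(M) = {γ ∈ Q₊ ∩ (β - Q₊) | e(β - γ, γ) M ≠ 0}` for an `R(β)`-module `M`. -/
def GMod.gWstar {β : I →₀ ℕ} (M : GMod D Q β) : Set (I →₀ ℕ) :=
  {γ | γ ≤ β ∧ ∃ m : M, R.eSplit D Q β (β - γ) γ • m ≠ 0}

/-- `W(M)` for an arbitrary `R`-module `M = ⨁ M_β`. -/
def RMod.gW (M : RMod D Q) : Set (I →₀ ℕ) := ⋃ β, (M.obj β).gW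

/-- `W^*(M)` for an arbitrary `R`-module `M = ⨁ M_β`. -/
def RMod.gWstar (M : RMod D Q) : Set (I →₀ ℕ) := ⋃ β, (M.obj β).gWstar

variable (D Q)

/-- The full subcategory `C_w` of `R-gmod`: `W(M) ⊆ Sp(Δ₊ ∩ w Δ₋)`. -/
def catC (w : D.weylGroup) : ObjectProperty (RMod D Q) := fun M =>
  RMod.gmod D Q M ∧ ∀ γ ∈ M.gW, (1 : ℝ) ⊗ₜ[ℤ] D.wt γ ∈ Sp (D.posRoots ∩ w.1 '' D.negRoots)

/-- The full subcategory `C_{*,v}` of `R-gmod`: `W^*(M) ⊆ Sp(Δ₊ ∩ v Δ₊)`. -/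
def catCstar (v : D.weylGroup) : ObjectProperty (RMod D Q) := fun M =>
  RMod.gmod D Q M ∧ ∀ γ ∈ M.gWstar,
    (1 : ℝ) ⊗ₜ[ℤ] D.wt γ ∈ Sp (D.posRoots ∩ v.1 '' D.posRoots)

/-- The full subcategory `C_{w,v}`, whose objects are those of `C_w` that lie in `C_{*,v}`. -/
def catCC (w v : D.weylGroup) : ObjectProperty (RMod D Q) := fun M =>
  catC D Q w M ∧ catCstar D Q v M

variable {D Q}

/-- A full subcategory of `R`-modules is stable under subquotients, extensions, convolution
products and grading shifts. -/
structure IsStable (C : ObjectProperty (RMod D Q)) : Prop where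
  subquotient : ∀ M N : RMod D Q, C M → N.IsSubquotient M → C N
  extension : ∀ (M' M M'' : RMod D Q) (f : M' ⟶ M) (g : M ⟶ M''),
    RMod.IsShortExact f g → C M' → C M'' → C M
  conv : ∀ M N : RMod D Q, C M → C N → C (M.conv N)
  shift : ∀ (n : ℤ) (M : RMod D Q), C M → C (M.shift n)

/-! ### Grothendieck groups -/

/-- The elements `[M] - [M'] - [M'']` for exact sequences `0 → M' → M → M'' → 0` in `C`. -/
def K0Rel (C : ObjectProperty (RMod D Q)) : Set (FreeAbelianGroup {M : RMod D Q // C M}) :=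
  {z | ∃ (M' M M'' : {M : RMod D Q // C M}) (f : M'.1 ⟶ M.1) (g : M.1 ⟶ M''.1),
    RMod.IsShortExact f g ∧
      z = FreeAbelianGroup.of M - FreeAbelianGroup.of M' - FreeAbelianGroup.of M''}

/-- The Grothendieck group `K₀(C)`. -/
abbrev K0 (C : ObjectProperty (RMod D Q)) : Type (max u w + 1) :=
  FreeAbelianGroup {M : RMod D Q // C M} ⧸ AddSubgroup.closure (K0Rel C)

/-- The class `[M] ∈ K₀(C)`. -/
def K0.cls {C : ObjectProperty (RMod D Q)} (M : RMod D Q) (hM : C M) : K0 C :=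
  QuotientAddGroup.mk (FreeAbelianGroup.of (⟨M, hM⟩ : {M : RMod D Q // C M}))

/-- `K₀(C)` is a `ℤ[q, q⁻¹]`-algebra (associative, with unit) whose multiplication is induced by
the convolution product, whose unit is the class of the trivial module and on which
`q` acts by the grading shift.  The structure is transported along a group isomorphism `φ`. -/
def K0IsAlgebra (C : ObjectProperty (RMod D Q)) : Prop :=
  ∃ (A : Type (max u w + 1)) (_ : Ring A) (_ : Algebra (LaurentPolynomial ℤ) A) (φ : K0 C ≃+ A),
    (∀ (M N : RMod D Q) (hM : C M) (hN : C N), ∃ h : C (M.conv N),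
      φ (K0.cls M hM) * φ (K0.cls N hN) = φ (K0.cls (M.conv N) h)) ∧
    (∃ h : C (RMod.unit D Q), φ (K0.cls (RMod.unit D Q) h) = 1) ∧
    (∀ (n : ℤ) (M : RMod D Q) (hM : C M), ∃ h : C (M.shift n),
      (LaurentPolynomial.T n : LaurentPolynomial ℤ) • φ (K0.cls M hM) =
        φ (K0.cls (M.shift n) h))

end categories

end QHecke

end

noncomputable section

namespace QHecke

open scoped Classical TensorProduct DirectSum

universe u w p

section

/-! ### Spanning by shuffle words -/

section spanning

/-! The three defining conditions see a module `M` only through its support, the set of sequences ν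
with e(ν)M ≠ 0: W(M) consists of the weights of the prefixes of these sequences, and W*(M) of the
weights of their suffixes (`GMod.mem_gW`, `GMod.mem_gWstar`). The cones enter only through closure
under addition, so all three categories are instances of one category `catOf K K'` attached to two
submonoids of Q₊; roots and the Weyl group play no further role. A subquotient has a smaller
support, the support of an extension lies in the union of the supports of its ends, and a grading
shift leaves the support unchanged. For the convolution product, `M ∘ N` is spanned by elements τ_u
⊗ m ⊗ n with u a word for a shuffle, so every sequence in its support is a shuffle of a sequence
from `M` with one from `N`. A prefix of a shuffle is made of a prefix of each, whence W(M ∘ N) ⊆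
W(M) + W(N), and likewise for W* (`supp_conv`, `gW_conv`, `gWstar_conv`).

For the convolution to induce a product on Grothendieck groups it must be exact in each variable.
This follows from the freeness of R(β)e(γ,γ') as a right module over R(γ) ⊗ R(γ'), with basis the
τ_u (`R.exists_shuffleSum_eq`, `R.shuffleSum_injective`): `M ∘ N` is then naturally a power of the
vector space M ⊗ N. That the τ_u span is a rewriting argument, valid in every algebra where the
commutation, quadratic and braid relations hold up to lower terms (`BraidLike.lowAlg_mem_wordSpan`).
That they are independent is a count. Over the field of rational functions, R(β) has a
representation of dimension n!, n = ht β, generated by one vector fixed by e(ν). A family of n!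
elements spanning R(β)e(ν) over the polynomials is therefore carried to a basis
(`R.eq_zero_of_sum_eq_zero`), and the shuffle words combined with the words for the two factors give
exactly n! elements.

Associativity holds up to isomorphism because both threefold products are generated by a balanced
trilinear map and have the corresponding universal property (`RMod.exists_assoc_hom`). Convolution
with q^n times the trivial module is, on either side, the shift by n; hence its class is central in
K₀, which yields the action of ℤ[q, q⁻¹]. -/

/-- A subalgebra `O` together with elements `t l` that satisfy the commutation, quadratic and braid
relations of quiver Hecke algebras up to terms of lower order. -/
structure BraidLike {k A : Type*} [Field k] [Ring A] [Algebra k A] (O : Subalgebra k A)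
    (t : ℕ → A) : Prop where
  t_mul : ∀ l, ∀ f ∈ O, ∃ g ∈ O, ∃ h ∈ O, t l * f = g * t l + h
  mul_t : ∀ l, ∀ f ∈ O, ∃ g ∈ O, ∃ h ∈ O, f * t l = t l * g + h
  sq : ∀ l, t l * t l ∈ O
  comm : ∀ l j, l + 1 < j → Commute (t l) (t j)
  braid : ∀ l, ∃ o ∈ O, t (l + 1) * t l * t (l + 1) = t l * t (l + 1) * t l + o

/-- The product of the `t l`, for `l` in the word `u`. -/
def wordProd {A : Type*} [Monoid A] (t : ℕ → A) (u : List ℕ) : A := (u.map t).prod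

theorem wordProd_append {A : Type*} [Monoid A] (t : ℕ → A) (u v : List ℕ) :
    wordProd t (u ++ v) = wordProd t u * wordProd t v := by
  simp [wordProd]

theorem wordProd_singleton {A : Type*} [Monoid A] (t : ℕ → A) (l : ℕ) :
    wordProd t [l] = t l := by
  simp [wordProd]

theorem wordProd_nil {A : Type*} [Monoid A] (t : ℕ → A) : wordProd t [] = 1 := by
  simp [wordProd]

/-- The word `b - 1, b - 2, …, a`. -/
def descWord (a b : ℕ) : List ℕ := (List.range' a (b - a)).reverse

theorem descWord_self (a : ℕ) : descWord a a = [] := by simp [descWord]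

theorem descWord_append {a b c : ℕ} (h : a ≤ b) (h' : b ≤ c) :
    descWord a c = descWord b c ++ descWord a b := by
  rw [descWord, descWord, descWord, ← List.reverse_append]
  congr 1
  have := List.range'_append (s := a) (m := b - a) (n := c - b) (step := 1)
  rw [one_mul, show a + (b - a) = b by omega, show b - a + (c - b) = c - a by omega] at this
  exact this.symm

theorem descWord_succ (a : ℕ) : descWord a (a + 1) = [a] := by simp [descWord]

theorem mem_descWord {a b l : ℕ} : l ∈ descWord a b ↔ a ≤ l ∧ l < b := by
  simp [descWord]; omega

variable {k A : Type*} [Field k] [Ring A] [Algebra k A] (O : Subalgebra k A) (t : ℕ → A)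

/-- The subalgebra generated by `O` and the `t l` with `l < b`. -/
def lowAlg (b : ℕ) : Subalgebra k A := Algebra.adjoin k (O ∪ {a | ∃ l < b, a = t l})

/-- The subalgebra generated by `O` and the `t l` with `l < b` and `l + 1 ≠ p`. -/
def splitAlg (b p : ℕ) : Subalgebra k A :=
  Algebra.adjoin k (O ∪ {a | ∃ l < b, l + 1 ≠ p ∧ a = t l})

variable {O t}

theorem O_le_lowAlg {b : ℕ} {f : A} (hf : f ∈ O) : f ∈ lowAlg O t b :=
  Algebra.subset_adjoin (Or.inl hf)

theorem t_mem_lowAlg {b l : ℕ} (hl : l < b) : t l ∈ lowAlg O t b :=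
  Algebra.subset_adjoin (Or.inr ⟨l, hl, rfl⟩)

theorem O_le_splitAlg {b p : ℕ} {f : A} (hf : f ∈ O) : f ∈ splitAlg O t b p :=
  Algebra.subset_adjoin (Or.inl hf)

theorem t_mem_splitAlg {b p l : ℕ} (hl : l < b) (hp : l + 1 ≠ p) : t l ∈ splitAlg O t b p :=
  Algebra.subset_adjoin (Or.inr ⟨l, hl, hp, rfl⟩)

theorem splitAlg_le_lowAlg (b p : ℕ) : splitAlg O t b p ≤ lowAlg O t b :=
  Algebra.adjoin_mono (Set.union_subset_union_right _ fun _ ⟨l, h, _, h'⟩ => ⟨l, h, h'⟩)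

theorem lowAlg_le_splitAlg {b p : ℕ} (h : p = 0 ∨ b < p) : lowAlg O t b ≤ splitAlg O t b p :=
  Algebra.adjoin_mono (Set.union_subset_union_right _ fun _ ⟨l, hl, h'⟩ => ⟨l, hl, by omega, h'⟩)

theorem lowAlg_mono {b b' : ℕ} (h : b ≤ b') : lowAlg O t b ≤ lowAlg O t b' :=
  Algebra.adjoin_mono (Set.union_subset_union_right _ fun _ ⟨l, hl, h'⟩ => ⟨l, by omega, h'⟩)

theorem splitAlg_succ_self (b : ℕ) : splitAlg O t (b + 1) (b + 1) = lowAlg O t b := by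
  rw [splitAlg, lowAlg]
  congr 2
  ext a
  exact ⟨fun ⟨l, h, h', e⟩ => ⟨l, by omega, e⟩, fun ⟨l, h, e⟩ => ⟨l, by omega, by omega, e⟩⟩

theorem lowAlg_zero : lowAlg O t 0 = O := by
  simp [lowAlg, Algebra.adjoin_eq]

theorem wordProd_mem {B : Subalgebra k A} {u : List ℕ} (h : ∀ l ∈ u, t l ∈ B) :
    wordProd t u ∈ B :=
  Subalgebra.list_prod_mem _ fun x hx => by
    obtain ⟨l, hl, rfl⟩ := List.mem_map.1 hx
    exact h l hl

theorem BraidLike.commute_wordProd (H : BraidLike O t) {l : ℕ} {u : List ℕ}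
    (h : ∀ j ∈ u, l + 1 < j ∨ j + 1 < l) : Commute (t l) (wordProd t u) := by
  refine Commute.list_prod_right _ _ fun x hx => ?_
  obtain ⟨j, hj, rfl⟩ := List.mem_map.1 hx
  exact (h j hj).elim (H.comm l j) fun h' => (H.comm j l h').symm

variable (O t) in
/-- `∑_{i ≤ a ≤ b + 1} S_b t_b ⋯ t_a`. -/
def descSpan (b i : ℕ) : Submodule k A :=
  Submodule.span k {x | ∃ a, i ≤ a ∧ a ≤ b + 1 ∧ ∃ s ∈ lowAlg O t b,
    x = s * wordProd t (descWord a (b + 1))}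

theorem mul_mem_descSpan {b i : ℕ} {s x : A} (hs : s ∈ lowAlg O t b)
    (hx : x ∈ descSpan O t b i) : s * x ∈ descSpan O t b i := by
  induction hx using Submodule.span_induction with
  | mem x h =>
    obtain ⟨a, h1, h2, s', hs', rfl⟩ := h
    exact Submodule.subset_span ⟨a, h1, h2, s * s', mul_mem hs hs', by rw [mul_assoc]⟩
  | zero => simp
  | add x y _ _ hx hy => rw [mul_add]; exact add_mem hx hy
  | smul c x _ hx => rw [mul_smul_comm]; exact Submodule.smul_mem _ c hx

theorem descSpan_anti {b i j : ℕ} (h : i ≤ j) : descSpan O t b j ≤ descSpan O t b i :=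
  Submodule.span_mono fun _ ⟨a, h1, h2⟩ => ⟨a, h.trans h1, h2⟩

theorem wordProd_mem_descSpan {b i a : ℕ} (h : i ≤ a) (h' : a ≤ b + 1) :
    wordProd t (descWord a (b + 1)) ∈ descSpan O t b i :=
  Submodule.subset_span ⟨a, h, h', 1, one_mem _, by rw [one_mul]⟩

namespace BraidLike

variable (H : BraidLike O t)
include H

theorem descSpan_mul_t {b i l : ℕ} (h : l + 1 < i) {x : A} (hx : x ∈ descSpan O t b i) :
    x * t l ∈ descSpan O t b i := by
  induction hx using Submodule.span_induction with
  | mem x h =>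
    obtain ⟨a, h1, h2, s, hs, rfl⟩ := h
    refine Submodule.subset_span ⟨a, h1, h2, s * t l, mul_mem hs (t_mem_lowAlg (by omega)), ?_⟩
    rw [mul_assoc, mul_assoc, (H.commute_wordProd fun j hj => ?_).eq]
    rw [mem_descWord] at hj
    omega
  | zero => simp
  | add x y _ _ hx hy => rw [add_mul]; exact add_mem hx hy
  | smul c x _ hx => rw [smul_mul_assoc]; exact Submodule.smul_mem _ c hx

theorem descSpan_mul_word {b i : ℕ} {u : List ℕ} (h : ∀ l ∈ u, l + 1 < i) {x : A}
    (hx : x ∈ descSpan O t b i) : x * wordProd t u ∈ descSpan O t b i := by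
  induction u generalizing x with
  | nil => simpa [wordProd] using hx
  | cons l u ih =>
    have : x * wordProd t (l :: u) = x * t l * wordProd t u := by simp [wordProd, mul_assoc]
    rw [this]
    exact ih (fun j hj => h j (List.mem_cons_of_mem _ hj))
      (H.descSpan_mul_t (h l List.mem_cons_self) hx)

/-- A word ending in t_{a+1} is prolonged by t_a, while t_a commutes with any word that ends higher
and is absorbed by the coefficient on the left. The empty word at a = b falls under the first case.
-/
theorem descSpan_succ_mul_t {b a : ℕ} (ha : a ≤ b) {x : A} (hx : x ∈ descSpan O t b (a + 1)) :
    x * t a ∈ descSpan O t b a := by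
  induction hx using Submodule.span_induction with
  | mem x h =>
    obtain ⟨a', h1, h2, s, hs, rfl⟩ := h
    rcases h1.eq_or_lt with rfl | h1
    · refine Submodule.subset_span ⟨a, le_rfl, by omega, s, hs, ?_⟩
      rw [descWord_append (Nat.le_succ a) h2, wordProd_append, descWord_succ, wordProd_singleton,
        mul_assoc]
    · refine Submodule.subset_span ⟨a', by omega, h2, s * t a,
        mul_mem hs (t_mem_lowAlg (by omega)), ?_⟩
      rw [mul_assoc, mul_assoc, (H.commute_wordProd fun j hj => ?_).eq]
      rw [mem_descWord] at hj
      omega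
  | zero => simp
  | add x y _ _ hx hy => rw [add_mul]; exact add_mem hx hy
  | smul c x _ hx => rw [smul_mul_assoc]; exact Submodule.smul_mem _ c hx

/-- The element of `O` is pushed to the left through one letter at a time. Each crossing creates a
correction in which that letter is missing; the correction is still a longer-index word times an
element of `O`, so the same induction disposes of it. -/
theorem wordProd_mul_mem {b a : ℕ} (ha : a ≤ b + 1) {f : A} (hf : f ∈ O) :
    wordProd t (descWord a (b + 1)) * f ∈ descSpan O t b a := by
  induction ha using Nat.decreasingInduction generalizing f with
  | self =>
    refine Submodule.subset_span ⟨b + 1, le_rfl, le_rfl, f, O_le_lowAlg hf, ?_⟩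
    simp [descWord_self, wordProd_nil]
  | of_succ a ha ih =>
    obtain ⟨g, hg, h, hh, e⟩ := H.t_mul a f hf
    rw [descWord_append (Nat.le_succ a) ha, wordProd_append, descWord_succ, wordProd_singleton,
      mul_assoc, e, mul_add, ← mul_assoc]
    exact add_mem (H.descSpan_succ_mul_t (by omega) (ih hg)) (descSpan_anti (Nat.le_succ a) (ih hh))

theorem descSpan_mul_O {b i : ℕ} {x : A} (hx : x ∈ descSpan O t b i) {f : A} (hf : f ∈ O) :
    x * f ∈ descSpan O t b i := by
  induction hx using Submodule.span_induction with
  | mem x h =>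
    obtain ⟨a, h1, h2, s, hs, rfl⟩ := h
    rw [mul_assoc]
    exact mul_mem_descSpan hs (descSpan_anti h1 (H.wordProd_mul_mem h2 hf))
  | zero => simp
  | add x y _ _ hx hy => rw [add_mul]; exact add_mem hx hy
  | smul c x _ hx => rw [smul_mul_assoc]; exact Submodule.smul_mem _ c hx

/-- Four positions of l relative to the last letter t_a of the word: a far smaller letter commutes,
l = a - 1 prolongs the word, l = a is the quadratic relation, and l > a is the braid relation. -/
theorem wordProd_mul_t {b a l : ℕ} (ha : a ≤ b + 1) (hl : l ≤ b) :
    wordProd t (descWord a (b + 1)) * t l ∈ descSpan O t b 0 := by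
  have h0 : ∀ i, descSpan O t b i ≤ descSpan O t b 0 := fun i => descSpan_anti (Nat.zero_le i)
  rcases Nat.lt_trichotomy (l + 1) a with h | rfl | h
  · exact h0 _ (H.descSpan_mul_t h (wordProd_mem_descSpan le_rfl ha))
  · exact h0 _ (H.descSpan_succ_mul_t hl (wordProd_mem_descSpan le_rfl ha))
  rcases (show a ≤ l by omega).eq_or_lt with rfl | h
  · rw [descWord_append (Nat.le_succ a) (by omega), wordProd_append, descWord_succ,
      wordProd_singleton, mul_assoc]
    exact h0 _ (H.wordProd_mul_mem (by omega) (H.sq a))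
  -- With l + 1 in place of l, the incoming letter meets t_{l+1} t_l inside the word; the braid
  -- relation turns it into t_l, which then leaves on the left. The error has `o` in place of the
  -- three letters.
  · obtain ⟨l, rfl⟩ : ∃ l', l = l' + 1 := ⟨l - 1, by omega⟩
    obtain ⟨o, ho, e⟩ := H.braid l
    have h1 : wordProd t (descWord a (b + 1)) = wordProd t (descWord (l + 2) (b + 1)) *
        (t (l + 1) * t l) * wordProd t (descWord a l) := by
      rw [descWord_append (show a ≤ l by omega) (show l ≤ b + 1 by omega),
        descWord_append (show l ≤ l + 2 by omega) (show l + 2 ≤ b + 1 by omega),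
        descWord_append (show l ≤ l + 1 by omega) (show l + 1 ≤ l + 2 by omega)]
      simp only [wordProd_append, descWord_succ, wordProd_singleton, mul_assoc]
    have h2 : Commute (t (l + 1)) (wordProd t (descWord a l)) :=
      H.commute_wordProd fun j hj => by rw [mem_descWord] at hj; omega
    have h3 : Commute (t l) (wordProd t (descWord (l + 2) (b + 1))) :=
      H.commute_wordProd fun j hj => by rw [mem_descWord] at hj; omega
    have h4 : wordProd t (descWord a (b + 1)) * t (l + 1) =
        t l * wordProd t (descWord a (b + 1)) +
          wordProd t (descWord (l + 2) (b + 1)) * o * wordProd t (descWord a l) := by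
      have : wordProd t (descWord a (b + 1)) * t (l + 1) = wordProd t (descWord (l + 2) (b + 1)) *
          (t (l + 1) * t l * t (l + 1)) * wordProd t (descWord a l) := by
        rw [h1, mul_assoc, ← h2.eq]; simp only [mul_assoc]
      rw [this, e, h1, mul_add, add_mul, ← mul_assoc (t l), ← mul_assoc (t l), h3.eq]
      simp only [mul_assoc]
    rw [h4]
    refine add_mem (mul_mem_descSpan (t_mem_lowAlg (by omega))
      (wordProd_mem_descSpan (Nat.zero_le _) ha)) (h0 (l + 2) ?_)
    exact H.descSpan_mul_word (fun j hj => by rw [mem_descWord] at hj; omega)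
      (H.wordProd_mul_mem (by omega) ho)

/-- The analogue of the decomposition of a symmetric group into cosets of the next smaller one:
`descSpan` contains 1 and is stable under right multiplication by all generators. -/
theorem lowAlg_succ_le (b : ℕ) {x : A} (hx : x ∈ lowAlg O t (b + 1)) :
    x ∈ descSpan O t b 0 := by
  have key : ∀ y ∈ descSpan O t b 0, y * x ∈ descSpan O t b 0 := by
    induction hx using Algebra.adjoin_induction with
    | mem x h =>
      intro y hy
      rcases h with h | ⟨l, hl, rfl⟩
      · exact H.descSpan_mul_O hy h
      induction hy using Submodule.span_induction with
      | mem y h =>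
        obtain ⟨a, h1, h2, s, hs, rfl⟩ := h
        rw [mul_assoc]
        exact mul_mem_descSpan hs (H.wordProd_mul_t h2 (by omega))
      | zero => simp
      | add x y _ _ hx hy => rw [add_mul]; exact add_mem hx hy
      | smul c x _ hx => rw [smul_mul_assoc]; exact Submodule.smul_mem _ c hx
    | algebraMap c =>
      intro y hy
      rw [← Algebra.commutes, ← Algebra.smul_def]
      exact Submodule.smul_mem _ c hy
    | add x y _ _ hx hy => intro z hz; rw [mul_add]; exact add_mem (hx z hz) (hy z hz)
    | mul x y _ _ hx hy => intro z hz; rw [← mul_assoc]; exact hy _ (hx z hz)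
  have h1 := wordProd_mem_descSpan (O := O) (t := t) (Nat.zero_le (b + 1)) (le_refl (b + 1))
  rw [descWord_self, wordProd_nil] at h1
  simpa using key 1 h1

/-- The opposite direction to `wordProd_mul_mem`. What matters is the error: it involves only words
ending strictly above a, and this triangularity drives the induction in `lowAlg_mul_mem_wordSpan`.
-/
theorem O_mul_wordProd {b a : ℕ} (ha : a ≤ b + 1) {f : A} (hf : f ∈ O) :
    ∃ g ∈ O, ∃ v ∈ descSpan O t b (a + 1), f * wordProd t (descWord a (b + 1)) =
      wordProd t (descWord a (b + 1)) * g + v := by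
  induction ha using Nat.decreasingInduction generalizing f with
  | self => exact ⟨f, hf, 0, zero_mem _, by simp [descWord_self, wordProd_nil]⟩
  | of_succ a ha ih =>
    obtain ⟨g, hg, v, hv, e⟩ := ih hf
    obtain ⟨g', hg', h', hh', e'⟩ := H.mul_t a g hg
    refine ⟨g', hg', wordProd t (descWord (a + 1) (b + 1)) * h' + v * t a,
      add_mem (H.wordProd_mul_mem ha hh')
        (descSpan_anti (Nat.le_succ _) (H.descSpan_mul_t (by omega) hv)), ?_⟩
    rw [descWord_append (Nat.le_succ a) ha, wordProd_append, descWord_succ, wordProd_singleton,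
      ← mul_assoc, e, add_mul, mul_assoc, e', mul_add]
    simp only [mul_assoc, add_assoc]

/-- Conjugation by the descending word raises the index of an inner letter by one. The error of the
braid relation loses the letters l and l + 1, so what remains ends at l + 2 or higher, once the
lower letters are moved into the coefficient. -/
theorem t_mul_wordProd {b a l : ℕ} (ha : a ≤ l) (hl : l < b) :
    ∃ v ∈ descSpan O t b (a + 1), t l * wordProd t (descWord a (b + 1)) =
      wordProd t (descWord a (b + 1)) * t (l + 1) + v := by
  obtain ⟨o, ho, e⟩ := H.braid l
  have h1 : wordProd t (descWord a (b + 1)) = wordProd t (descWord (l + 2) (b + 1)) *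
      (t (l + 1) * t l) * wordProd t (descWord a l) := by
    rw [descWord_append ha (show l ≤ b + 1 by omega),
      descWord_append (show l ≤ l + 2 by omega) (show l + 2 ≤ b + 1 by omega),
      descWord_append (show l ≤ l + 1 by omega) (show l + 1 ≤ l + 2 by omega)]
    simp only [wordProd_append, descWord_succ, wordProd_singleton, mul_assoc]
  have h2 : Commute (t (l + 1)) (wordProd t (descWord a l)) :=
    H.commute_wordProd fun j hj => by rw [mem_descWord] at hj; omega
  have h3 : Commute (t l) (wordProd t (descWord (l + 2) (b + 1))) :=
    H.commute_wordProd fun j hj => by rw [mem_descWord] at hj; omega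
  refine ⟨-(wordProd t (descWord (l + 2) (b + 1)) * o * wordProd t (descWord a l)),
    neg_mem (descSpan_anti (show a + 1 ≤ l + 2 by omega) (H.descSpan_mul_word
      (fun j hj => by rw [mem_descWord] at hj; omega) (H.wordProd_mul_mem (by omega) ho))), ?_⟩
  have h4 : wordProd t (descWord a (b + 1)) * t (l + 1) = wordProd t (descWord (l + 2) (b + 1)) *
      (t (l + 1) * t l * t (l + 1)) * wordProd t (descWord a l) := by
    rw [h1, mul_assoc, ← h2.eq]; simp only [mul_assoc]
  rw [h4, e, h1, ← mul_assoc (t l), ← mul_assoc (t l), h3.eq]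
  simp only [mul_assoc, mul_add, add_mul, add_neg_cancel_right]

end BraidLike

/-- The words whose permutations are the `(p, q)`-shuffles. -/
def shuffleWords : ℕ → ℕ → List (List ℕ)
  | 0, _ => [[]]
  | _ + 1, 0 => [[]]
  -- Pascal's recursion on the last entry of the shuffle. If it comes from the second block it stays
  -- in place; if it comes from the first block, the descending word carries it from position p to
  -- the end, and the remaining entries form a (p, q + 1)-shuffle.
  | p + 1, q + 1 => shuffleWords (p + 1) q ++
      (shuffleWords p (q + 1)).map (· ++ descWord p (p + q + 1))

theorem length_shuffleWords (p q : ℕ) : (shuffleWords p q).length = (p + q).choose p := by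
  induction p, q using shuffleWords.induct with
  | case1 q => simp [shuffleWords]
  | case2 p => simp [shuffleWords]
  | case3 p q h1 h2 =>
    rw [shuffleWords, List.length_append, List.length_map, h1, h2,
      show p + 1 + (q + 1) = p + 1 + q + 1 by ring, Nat.choose_succ_succ,
      show p + (q + 1) = p + 1 + q by ring, add_comm]

theorem shuffleWords_lt {p q : ℕ} {u : List ℕ} (hu : u ∈ shuffleWords p q) {l : ℕ} (hl : l ∈ u) :
    l + 1 < p + q := by
  induction p, q using shuffleWords.induct generalizing u with
  | case1 q => simp_all [shuffleWords]
  | case2 p => simp_all [shuffleWords]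
  | case3 p q h1 h2 =>
    rw [shuffleWords, List.mem_append, List.mem_map] at hu
    rcases hu with hu | ⟨u', hu', rfl⟩
    · have := h1 hu hl
      omega
    · rcases List.mem_append.1 hl with h | h
      · have := h2 hu' h
        omega
      · rw [mem_descWord] at h
        omega

variable (t) in
/-- `∑_u t_u Z`, for `u` in a set of words. -/
def wordSpan (U : List (List ℕ)) (Z : Submodule k A) : Submodule k A :=
  Submodule.span k {x | ∃ u ∈ U, ∃ z ∈ Z, x = wordProd t u * z}

/-- The multipliers that preserve `Z ⊔ Y` form a subalgebra, so generators suffice; on them the part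
in `Y` is harmless because `Y` is a module over the larger algebra. -/
theorem lowAlg_mul_le {b p : ℕ} {Y Z : Submodule k A}
    (hY : ∀ s ∈ lowAlg O t b, ∀ y ∈ Y, s * y ∈ Y)
    (hO : ∀ f ∈ O, ∀ z ∈ Z, f * z ∈ Z ⊔ Y)
    (ht : ∀ l < b, l + 1 ≠ p → ∀ z ∈ Z, t l * z ∈ Z ⊔ Y) :
    ∀ s ∈ splitAlg O t b p, ∀ z ∈ Z ⊔ Y, s * z ∈ Z ⊔ Y := by
  intro s hs
  induction hs using Algebra.adjoin_induction with
  | mem x h =>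
    intro z hz
    obtain ⟨z, hz', y, hy, rfl⟩ := Submodule.mem_sup.1 hz
    rw [mul_add]
    rcases h with h | ⟨l, hl, hp, rfl⟩
    · exact add_mem (hO x h z hz') (Submodule.mem_sup_right (hY _ (O_le_lowAlg h) y hy))
    · exact add_mem (ht l hl hp z hz') (Submodule.mem_sup_right (hY _ (t_mem_lowAlg hl) y hy))
  | algebraMap c =>
    intro y hy
    rw [← Algebra.smul_def]
    exact Submodule.smul_mem _ c hy
  | add x y _ _ hx hy => intro z hz; rw [add_mul]; exact add_mem (hx z hz) (hy z hz)
  | mul x y _ _ hx hy => intro z hz; rw [mul_assoc]; exact hx _ (hy z hz)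

/-- Write c = t_{p+q} ⋯ t_p for a split into p + 1 and q + 1 strands, and S_b for the algebra
generated by `O` and the letters below b = p + q. By `lowAlg_succ_le`, the full algebra times `Z` is
S_b Z + S_b c Z up to `Y`, and the two summands are the two branches of Pascal's recursion. Since
the relations hold only up to lower terms, cZ is stable under its split algebra only modulo S_b(Z +
Y). This is why the statement is proved for an arbitrary module `Z` and relative to an error module
`Y`. -/
theorem BraidLike.lowAlg_mul_mem_wordSpan (H : BraidLike O t) (m : ℕ) : ∀ (p q : ℕ), p + q = m →
    ∀ (Y Z : Submodule k A),
    (∀ s ∈ lowAlg O t (m - 1), ∀ y ∈ Y, s * y ∈ Y) →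
    (∀ s ∈ splitAlg O t (m - 1) p, ∀ z ∈ Z, s * z ∈ Z ⊔ Y) →
    ∀ s ∈ lowAlg O t (m - 1), ∀ z ∈ Z, s * z ∈ wordSpan t (shuffleWords p q) Z ⊔ Y := by
  induction m with
  | zero =>
    intro p q hpq Y Z hY hZ s hs z hz
    obtain ⟨rfl, rfl⟩ : p = 0 ∧ q = 0 := by omega
    refine (sup_le_sup_right ?_ Y : Z ⊔ Y ≤ _) (hZ s (lowAlg_le_splitAlg (Or.inl rfl) hs) z hz)
    exact fun z hz => Submodule.subset_span ⟨[], by simp [shuffleWords], z, hz,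
      by simp [wordProd_nil]⟩
  | succ m ih =>
    intro p q hpq Y Z hY hZ s hs z hz
    have triv : shuffleWords p q = [[]] → s ∈ splitAlg O t m p →
        s * z ∈ wordSpan t (shuffleWords p q) Z ⊔ Y := by
      intro h hs'
      rw [h]
      refine (sup_le_sup_right ?_ Y : Z ⊔ Y ≤ _) (hZ s hs' z hz)
      exact fun z hz => Submodule.subset_span ⟨[], by simp, z, hz, by simp [wordProd_nil]⟩
    rcases p with _ | p
    · exact triv (by simp [shuffleWords]) (lowAlg_le_splitAlg (Or.inl rfl) hs)
    rcases q with _ | q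
    · exact triv (by simp [shuffleWords]) (lowAlg_le_splitAlg (Or.inr (by simp; omega)) hs)
    obtain ⟨b, rfl⟩ : ∃ b, m = b + 1 := ⟨m - 1, by omega⟩
    obtain rfl : b = p + q := by omega
    simp only [Nat.add_sub_cancel] at ih hY hZ hs
    set b := p + q with hb
    set c := wordProd t (descWord p (b + 1)) with hc
    have hZb : ∀ s ∈ splitAlg O t b (p + 1), ∀ z ∈ Z, s * z ∈ Z ⊔ Y := fun s hs =>
      hZ s ((Algebra.adjoin_mono (Set.union_subset_union_right _
        fun _ ⟨l, h, h'⟩ => ⟨l, by omega, h'⟩) :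
          splitAlg O t b (p + 1) ≤ splitAlg O t (b + 1) (p + 1)) hs)
    have hYb : ∀ s ∈ lowAlg O t b, ∀ y ∈ Y, s * y ∈ Y := fun s hs =>
      hY s (lowAlg_mono (by omega) hs)
    -- the `S_b`-module generated by `Z` and `Y`
    let Y₁ : Submodule k A := Submodule.span k {x | ∃ s ∈ lowAlg O t b, ∃ z ∈ Z ⊔ Y, x = s * z}
    have hZ₁ : Z ⊔ Y ≤ Y₁ := fun z hz => Submodule.subset_span ⟨1, one_mem _, z, hz, by simp⟩
    have hY₁ : ∀ s ∈ lowAlg O t b, ∀ y ∈ Y₁, s * y ∈ Y₁ := by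
      intro s hs y hy
      induction hy using Submodule.span_induction with
      | mem x h =>
        obtain ⟨s', hs', z, hz, rfl⟩ := h
        exact Submodule.subset_span ⟨s * s', mul_mem hs hs', z, hz, by rw [mul_assoc]⟩
      | zero => simp
      | add x y _ _ hx hy => rw [mul_add]; exact add_mem hx hy
      | smul c x _ hx => rw [mul_smul_comm]; exact Submodule.smul_mem _ c hx
    have hY₁' : Y₁ ≤ wordSpan t (shuffleWords (p + 1) q) Z ⊔ Y := by
      refine Submodule.span_le.2 ?_
      rintro _ ⟨s, hs, z, hz, rfl⟩
      obtain ⟨z, hz', y, hy, rfl⟩ := Submodule.mem_sup.1 hz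
      rw [mul_add]
      exact add_mem (ih (p + 1) q (by omega) Y Z hYb hZb s hs z hz')
        (Submodule.mem_sup_right (hYb s hs y hy))
    have hsplit : ∀ s ∈ splitAlg O t (b + 1) (p + 1), ∀ z ∈ Z ⊔ Y, s * z ∈ Z ⊔ Y := by
      intro s hs z hz
      obtain ⟨z, hz', y, hy, rfl⟩ := Submodule.mem_sup.1 hz
      rw [mul_add]
      exact add_mem (hZ s hs z hz')
        (Submodule.mem_sup_right (hY s (splitAlg_le_lowAlg _ _ hs) y hy))
    -- words above the split position
    have hdesc : ∀ v ∈ descSpan O t b (p + 1), ∀ z ∈ Z, v * z ∈ Y₁ := by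
      intro v hv z hz
      induction hv using Submodule.span_induction with
      | mem x h =>
        obtain ⟨a, h1, h2, s, hs, rfl⟩ := h
        refine Submodule.subset_span ⟨s, hs, _, hZ (wordProd t (descWord a (b + 1))) ?_ z hz,
          by rw [mul_assoc]⟩
        refine wordProd_mem fun l hl => ?_
        rw [mem_descWord] at hl
        exact t_mem_splitAlg (by omega) (by omega)
      | zero => simp
      | add x y _ _ hx hy => rw [add_mul]; exact add_mem hx hy
      | smul c x _ hx => rw [smul_mul_assoc]; exact Submodule.smul_mem _ c hx
    have hcY : ∀ y ∈ Y, c * y ∈ Y := fun y hy => hY c (wordProd_mem fun l hl => by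
      rw [mem_descWord] at hl; exact t_mem_lowAlg (by omega)) y hy
    -- The new split excludes the letter p - 1. A letter below that commutes with c, and a letter l
    -- ≥ p becomes l + 1 > p on the other side of c; neither result is the letter p excluded by the
    -- old split.
    let Z₂ : Submodule k A := Z.map (LinearMap.mulLeft k c)
    have hcZ : ∀ z ∈ Z ⊔ Y, c * z ∈ Z₂ ⊔ Y₁ := by
      intro z hz
      obtain ⟨z, hz', y, hy, rfl⟩ := Submodule.mem_sup.1 hz
      rw [mul_add]
      exact add_mem (Submodule.mem_sup_left ⟨z, hz', rfl⟩)
        (Submodule.mem_sup_right (hZ₁ (Submodule.mem_sup_right (hcY y hy))))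
    have hZ₂ : ∀ s ∈ splitAlg O t b p, ∀ z ∈ Z₂ ⊔ Y₁, s * z ∈ Z₂ ⊔ Y₁ := by
      refine lowAlg_mul_le hY₁ ?_ ?_
      · rintro f hf _ ⟨z, hz, rfl⟩
        obtain ⟨g, hg, v, hv, e⟩ := H.O_mul_wordProd (show p ≤ b + 1 by omega) hf
        rw [LinearMap.mulLeft_apply, ← mul_assoc, e, add_mul, mul_assoc]
        exact add_mem (hcZ _ (hZ g (O_le_splitAlg hg) z hz))
          (Submodule.mem_sup_right (hdesc v hv z hz))
      · rintro l hl hlp _ ⟨z, hz, rfl⟩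
        rw [LinearMap.mulLeft_apply, ← mul_assoc]
        rcases Nat.lt_or_ge l p with h | h
        · rw [(H.commute_wordProd fun j hj => by rw [mem_descWord] at hj; omega :
            Commute (t l) c).eq, mul_assoc]
          exact hcZ _ (hZ (t l) (t_mem_splitAlg (by omega) (by omega)) z hz)
        · obtain ⟨v, hv, e⟩ := H.t_mul_wordProd h hl
          rw [e, add_mul, mul_assoc]
          exact add_mem (hcZ _ (hZ (t (l + 1)) (t_mem_splitAlg (by omega) (by omega)) z hz))
            (Submodule.mem_sup_right (hdesc v hv z hz))
    have hT : ∀ s ∈ lowAlg O t b, ∀ z ∈ Z₂ ⊔ Y₁,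
        s * z ∈ wordSpan t (shuffleWords p (q + 1)) Z₂ ⊔ Y₁ := by
      intro s hs z hz
      obtain ⟨z, hz', y, hy, rfl⟩ := Submodule.mem_sup.1 hz
      rw [mul_add]
      exact add_mem (ih p (q + 1) (by omega) Y₁ Z₂ hY₁
        (fun s hs z hz => hZ₂ s hs z (Submodule.mem_sup_left hz)) s hs z hz')
        (Submodule.mem_sup_right (hY₁ s hs y hy))
    have hfinal : wordSpan t (shuffleWords p (q + 1)) Z₂ ⊔ Y₁ ≤
        wordSpan t (shuffleWords (p + 1) (q + 1)) Z ⊔ Y := by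
      refine sup_le ?_ (hY₁'.trans (sup_le_sup_right ?_ _))
      · refine (Submodule.span_le.2 ?_ : _ ≤ wordSpan t _ Z).trans le_sup_left
        rintro _ ⟨u, hu, _, ⟨z, hz, rfl⟩, rfl⟩
        refine Submodule.subset_span ⟨u ++ descWord p (b + 1), ?_, z, hz, ?_⟩
        · rw [shuffleWords, List.mem_append, List.mem_map]
          exact Or.inr ⟨u, hu, rfl⟩
        · rw [wordProd_append, LinearMap.mulLeft_apply, mul_assoc]
      · refine Submodule.span_mono ?_
        rintro _ ⟨u, hu, z, hz, rfl⟩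
        refine ⟨u, ?_, z, hz, rfl⟩
        rw [shuffleWords, List.mem_append]
        exact Or.inl hu
    refine hfinal ?_
    have hs0 := H.lowAlg_succ_le b hs
    clear triv hs
    induction hs0 using Submodule.span_induction with
    | mem x h =>
      obtain ⟨a, -, h2, s', hs', rfl⟩ := h
      rw [mul_assoc]
      -- A coset word ending above p avoids the letter p and lies in the split algebra. One that
      -- ends at a ≤ p is c times a word in letters below p, which again lies in the split algebra.
      rcases Nat.lt_or_ge p a with h | h
      · refine hT s' hs' _ (Submodule.mem_sup_right (hdesc _ (wordProd_mem_descSpan h h2) z hz))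
      · rw [descWord_append h (show p ≤ b + 1 by omega), wordProd_append, mul_assoc]
        refine hT s' hs' _ (hcZ _ (hZ _ (wordProd_mem fun l hl => ?_) z hz))
        rw [mem_descWord] at hl
        exact t_mem_splitAlg (by omega) (by omega)
    | zero => simp
    | add x y _ _ hx hy => rw [add_mul]; exact add_mem hx hy
    | smul c x _ hx => rw [smul_mul_assoc]; exact Submodule.smul_mem _ c hx

/-- The algebra generated by `O` and all `t l` is spanned over the subalgebra of a two-block split
by the shuffle words. -/
theorem BraidLike.lowAlg_mem_wordSpan (H : BraidLike O t) {p q : ℕ} {s : A}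
    (hs : s ∈ lowAlg O t (p + q - 1)) : s ∈ wordSpan t (shuffleWords p q)
      (Subalgebra.toSubmodule (splitAlg O t (p + q - 1) p)) := by
  have := H.lowAlg_mul_mem_wordSpan (p + q) p q rfl ⊥
    (Subalgebra.toSubmodule (splitAlg O t (p + q - 1) p)) (by simp)
    (fun s hs z hz => Submodule.mem_sup_left
      ((splitAlg O t (p + q - 1) p).mul_mem hs hz)) s hs 1 (splitAlg O t (p + q - 1) p).one_mem
  simpa using this

/-- Words for all permutations. -/
def permWords : ℕ → List (List ℕ)
  | 0 => [[]]
  | m + 1 => (shuffleWords m 1).flatMap fun u => (permWords m).map (u ++ ·)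

theorem length_permWords (m : ℕ) : (permWords m).length = m.factorial := by
  induction m with
  | zero => simp [permWords]
  | succ m ih =>
    rw [permWords, List.length_flatMap]
    simp [ih, length_shuffleWords, Nat.factorial_succ]

/-- One strand is split off at a time: for the split (m, 1) the split algebra is the algebra
generated by `O` and the letters on the first m strands. -/
theorem BraidLike.lowAlg_mem_permSpan (H : BraidLike O t) (m : ℕ) {s : A}
    (hs : s ∈ lowAlg O t (m - 1)) :
    s ∈ wordSpan t (permWords m) (Subalgebra.toSubmodule O) := by
  induction m generalizing s with
  | zero =>
    rw [Nat.zero_sub, lowAlg_zero] at hs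
    exact Submodule.subset_span ⟨[], by simp [permWords], s, hs, by simp [wordProd_nil]⟩
  | succ m ih =>
    have h1 : ∀ s ∈ splitAlg O t m m, s ∈ lowAlg O t (m - 1) := by
      intro s hs
      rcases m with _ | m
      · exact splitAlg_le_lowAlg _ _ hs
      · rwa [splitAlg_succ_self] at hs
    have h2 := H.lowAlg_mem_wordSpan (p := m) (q := 1) hs
    refine Submodule.span_le.2 ?_ h2
    rintro _ ⟨u, hu, z, hz, rfl⟩
    have h3 := ih (h1 z hz)
    change wordProd t u * z ∈ wordSpan t _ _
    clear hz
    induction h3 using Submodule.span_induction with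
    | mem x h =>
      obtain ⟨v, hv, f, hf, rfl⟩ := h
      refine Submodule.subset_span ⟨u ++ v, ?_, f, hf, by rw [wordProd_append, mul_assoc]⟩
      rw [permWords, List.mem_flatMap]
      exact ⟨u, hu, List.mem_map.2 ⟨v, hv, rfl⟩⟩
    | zero => simp
    | add x y _ _ hx hy => rw [mul_add]; exact add_mem hx hy
    | smul c x _ hx => rw [mul_smul_comm]; exact Submodule.smul_mem _ c hx

end spanning

end

section

/-! ### Evaluation of polynomials at commuting elements -/

section commEval

variable {k A σ : Type*} [Field k] [Ring A] [Algebra k A]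

/-- Evaluation of polynomials at a family of pairwise commuting elements of an algebra. -/
def commEval (x : σ → A) (h : ∀ i j, Commute (x i) (x j)) : MvPolynomial σ k →ₐ[k] A :=
  -- `aeval` requires a commutative target, and the subalgebra generated by commuting elements is
  -- one.
  let _ : CommRing (Algebra.adjoin k (Set.range x)) :=
    { (inferInstance : Ring (Algebra.adjoin k (Set.range x))) with
      mul_comm := (Algebra.isMulCommutative_adjoin k (s := Set.range x) (by
        rintro _ ⟨i, rfl⟩ _ ⟨j, rfl⟩
        exact h i j)).is_comm.comm }
  (Algebra.adjoin k (Set.range x)).val.comp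
    (MvPolynomial.aeval fun i => ⟨x i, Algebra.subset_adjoin ⟨i, rfl⟩⟩)

@[simp]
theorem commEval_X (x : σ → A) (h : ∀ i j, Commute (x i) (x j)) (i : σ) :
    commEval (k := k) x h (MvPolynomial.X i) = x i := by
  let _ : CommRing (Algebra.adjoin k (Set.range x)) :=
    { (inferInstance : Ring (Algebra.adjoin k (Set.range x))) with
      mul_comm := (Algebra.isMulCommutative_adjoin k (s := Set.range x) (by
        rintro _ ⟨i, rfl⟩ _ ⟨j, rfl⟩
        exact h i j)).is_comm.comm }
  change (((MvPolynomial.aeval fun i => (⟨x i, Algebra.subset_adjoin ⟨i, rfl⟩⟩ :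
    Algebra.adjoin k (Set.range x))) (MvPolynomial.X i) : Algebra.adjoin k (Set.range x)) : A) = _
  rw [MvPolynomial.aeval_X]

theorem evalOrd_mem {n : ℕ} (O : Subalgebra k A) (q : MvPolynomial (Fin n) k) {a : Fin n → A}
    (ha : ∀ i, a i ∈ O) : evalOrd q a ∈ O := by
  refine sum_mem fun m _ => O.smul_mem (Subalgebra.list_prod_mem _ fun x hx => ?_) _
  obtain ⟨i, rfl⟩ := (List.mem_ofFn' _ _).1 hx
  exact pow_mem (ha i) _

end commEval

variable {I : Type w} {P : Type p} [AddCommGroup P] {k : Type u} [Field k]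
  {D : CartanDatum I P} {Q : QPoly D k} {β : I →₀ ℕ}

/-! ### Quiver Hecke algebras satisfy the braid-like relations over their polynomial part. -/

namespace Seq

/-- The action of permutations of positions. -/
def perm (ν : Seq β) (g : Equiv.Perm (Fin (ht β))) : Seq β where
  toFun := fun j => ν (g j)
  sum_eq := by
    have h := Equiv.sum_comp g fun j => (Finsupp.single (ν j) 1 : I →₀ ℕ)
    rw [ν.sum_eq] at h
    exact h

theorem perm_one (ν : Seq β) : ν.perm 1 = ν := rfl

theorem swap_eq (ν : Seq β) (l : ℕ) (hl : l + 1 < ht β) :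
    ν.swap l hl = ν.perm (Equiv.swap ⟨l, Nat.lt_of_succ_lt hl⟩ ⟨l + 1, hl⟩) := rfl

theorem perm_perm (ν : Seq β) (g h : Equiv.Perm (Fin (ht β))) :
    (ν.perm g).perm h = ν.perm (g * h) := rfl

theorem swap_swap (ν : Seq β) (l : ℕ) (hl : l + 1 < ht β) : (ν.swap l hl).swap l hl = ν := by
  rw [swap_eq, swap_eq, perm_perm, Equiv.swap_mul_self, perm_one]

theorem perm_eq_swap (ν : Seq β) (g : Equiv.Perm (Fin (ht β))) (l : ℕ) (hl : l + 1 < ht β) :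
    ν.perm (g * Equiv.swap ⟨l, Nat.lt_of_succ_lt hl⟩ ⟨l + 1, hl⟩) = (ν.perm g).swap l hl := rfl

end Seq

namespace R

variable (D Q β) in
/-- The elements `τ_l`, extended by zero. -/
def tau (l : ℕ) : R D Q β := if h : l + 1 < ht β then τ D Q l h else 0

theorem tau_eq (l : ℕ) (h : l + 1 < ht β) : tau D Q β l = τ D Q l h := dif_pos h

theorem tau_eq_zero {l : ℕ} (h : ¬ l + 1 < ht β) : tau D Q β l = 0 := dif_neg h

variable (D Q β) in
/-- The subalgebra generated by the `e(ν)` and the `x_j`. -/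
def polAlg : Subalgebra k (R D Q β) :=
  Algebra.adjoin k (Set.range (e D Q) ∪ Set.range (x D Q))

theorem e_mem_polAlg (ν : Seq β) : e D Q ν ∈ polAlg D Q β :=
  Algebra.subset_adjoin (Or.inl ⟨ν, rfl⟩)

theorem x_mem_polAlg (j : Fin (ht β)) : x D Q j ∈ polAlg D Q β :=
  Algebra.subset_adjoin (Or.inr ⟨j, rfl⟩)

theorem x_comm (i j : Fin (ht β)) : Commute (x D Q i) (x D Q j) := rel (.x_x i j)

theorem x_comm_e (j : Fin (ht β)) (ν : Seq β) : Commute (x D Q j) (e D Q ν) := rel (.x_e j ν)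

theorem eq_of_mul_e {a b : R D Q β} (h : ∀ ν, a * e D Q ν = b * e D Q ν) : a = b := by
  rw [← mul_one a, ← mul_one b, ← sum_e, Finset.mul_sum, Finset.mul_sum]
  exact Finset.sum_congr rfl fun ν _ => h ν

theorem mem_of_mul_e {O : Subalgebra k (R D Q β)} {a : R D Q β} (h : ∀ ν, a * e D Q ν ∈ O) :
    a ∈ O := by
  rw [← mul_one a, ← sum_e, Finset.mul_sum]
  exact sum_mem fun ν _ => h ν

theorem τ_mul_x_sub_mem (l : ℕ) (hl : l + 1 < ht β) (j : Fin (ht β)) :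
    τ D Q l hl * x D Q j - x D Q (Equiv.swap ⟨l, by omega⟩ ⟨l + 1, hl⟩ j) * τ D Q l hl ∈
      polAlg D Q β := by
  refine mem_of_mul_e fun ν => ?_
  rw [rel (.τ_x l hl j ν)]
  split_ifs
  exacts [neg_mem (e_mem_polAlg ν), e_mem_polAlg ν, zero_mem _, zero_mem _]

/-- In each defining relation with a τ, the terms spoiling the relation of the symmetric group lie
in the subalgebra of the e(ν) and x_j. The extension of τ by zero makes the axioms hold for every
natural number l. Membership is checked after multiplication by each e(ν), where the relations are
stated. -/
theorem braidLike : BraidLike (polAlg D Q β) (tau D Q β) where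
  t_mul := by
    intro l f hf
    by_cases hl : l + 1 < ht β
    swap
    · exact ⟨0, zero_mem _, 0, zero_mem _, by simp [tau_eq_zero hl]⟩
    rw [tau_eq l hl]
    induction hf using Algebra.adjoin_induction with
    | mem f h =>
      rcases h with ⟨ν, rfl⟩ | ⟨j, rfl⟩
      · exact ⟨_, e_mem_polAlg (ν.swap l hl), 0, zero_mem _, by rw [rel (.τ_e l hl ν), add_zero]⟩
      · exact ⟨_, x_mem_polAlg _, _, τ_mul_x_sub_mem l hl j, by rw [add_sub_cancel]⟩
    | algebraMap c =>
      exact ⟨_, algebraMap_mem _ c, 0, zero_mem _, by rw [Algebra.commutes, add_zero]⟩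
    | add f f' _ _ hf hf' =>
      obtain ⟨g, hg, h, hh, e⟩ := hf
      obtain ⟨g', hg', h', hh', e'⟩ := hf'
      exact ⟨g + g', add_mem hg hg', h + h', add_mem hh hh', by
        rw [mul_add, e, e', add_mul]; abel⟩
    | mul f f' _ hf' hf ih' =>
      obtain ⟨g, hg, h, hh, e⟩ := hf
      obtain ⟨g', hg', h', hh', e'⟩ := ih'
      refine ⟨g * g', mul_mem hg hg', g * h' + h * f',
        add_mem (mul_mem hg hh') (mul_mem hh hf'), ?_⟩
      rw [← mul_assoc, e, add_mul, mul_assoc, e', mul_add, mul_assoc, add_assoc]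
  mul_t := by
    intro l f hf
    by_cases hl : l + 1 < ht β
    swap
    · exact ⟨0, zero_mem _, 0, zero_mem _, by simp [tau_eq_zero hl]⟩
    rw [tau_eq l hl]
    induction hf using Algebra.adjoin_induction with
    | mem f h =>
      rcases h with ⟨ν, rfl⟩ | ⟨j, rfl⟩
      · refine ⟨_, e_mem_polAlg (ν.swap l hl), 0, zero_mem _, ?_⟩
        rw [rel (.τ_e l hl (ν.swap l hl)), ν.swap_swap, add_zero]
      · refine ⟨x D Q (Equiv.swap ⟨l, by omega⟩ ⟨l + 1, hl⟩ j), x_mem_polAlg _, _,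
          neg_mem (τ_mul_x_sub_mem l hl (Equiv.swap ⟨l, by omega⟩ ⟨l + 1, hl⟩ j)), ?_⟩
        rw [Equiv.swap_apply_self]
        abel
    | algebraMap c =>
      exact ⟨_, algebraMap_mem _ c, 0, zero_mem _, by rw [Algebra.commutes, add_zero]⟩
    | add f f' _ _ hf hf' =>
      obtain ⟨g, hg, h, hh, e⟩ := hf
      obtain ⟨g', hg', h', hh', e'⟩ := hf'
      exact ⟨g + g', add_mem hg hg', h + h', add_mem hh hh', by
        rw [add_mul, e, e', mul_add]; abel⟩
    | mul f f' hf0 _ hf ih' =>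
      obtain ⟨g, hg, h, hh, e⟩ := hf
      obtain ⟨g', hg', h', hh', e'⟩ := ih'
      refine ⟨g * g', mul_mem hg hg', h * g' + f * h',
        add_mem (mul_mem hh hg') (mul_mem hf0 hh'), ?_⟩
      rw [mul_assoc, e', mul_add, ← mul_assoc, e, add_mul, mul_assoc, add_assoc]
  sq := by
    intro l
    by_cases hl : l + 1 < ht β
    · rw [tau_eq l hl]
      refine mem_of_mul_e fun ν => ?_
      rw [rel (.τ_sq l hl ν)]
      refine mul_mem (evalOrd_mem _ _ fun i => ?_) (e_mem_polAlg ν)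
      fin_cases i <;> exact x_mem_polAlg _
    · rw [tau_eq_zero hl, mul_zero]
      exact zero_mem _
  comm := by
    intro l j hlj
    by_cases hj : j + 1 < ht β
    · rw [tau_eq j hj, tau_eq l (by omega)]
      exact rel (.τ_τ l j _ hj (Or.inl hlj))
    · rw [tau_eq_zero hj]
      exact Commute.zero_right _
  braid := by
    intro l
    by_cases hl : l + 2 < ht β
    · rw [tau_eq l (by omega), tau_eq (l + 1) hl]
      refine ⟨_, ?_, (add_sub_cancel _ _).symm⟩
      refine mem_of_mul_e fun ν => ?_
      rw [rel (.braid l hl ν)]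
      split_ifs
      · refine mul_mem (evalOrd_mem _ _ fun i => ?_) (e_mem_polAlg ν)
        fin_cases i <;> exact x_mem_polAlg _
      · exact zero_mem _
    · rw [tau_eq_zero (l := l + 1) (by omega)]
      exact ⟨0, zero_mem _, by simp⟩

theorem lowAlg_eq_top : lowAlg (polAlg D Q β) (tau D Q β) (ht β - 1) = ⊤ := by
  rw [eq_top_iff]
  rintro a -
  induction a using R.induction with
  | he ν => exact O_le_lowAlg (e_mem_polAlg ν)
  | hx j => exact O_le_lowAlg (x_mem_polAlg j)
  | hτ l hl => rw [← tau_eq l hl]; exact t_mem_lowAlg (by omega)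
  | halg c => exact algebraMap_mem _ c
  | hmul a b ha hb => exact mul_mem ha hb
  | hadd a b ha hb => exact add_mem ha hb

variable (D Q β) in
/-- Polynomials in the `x_j`. -/
def pol : MvPolynomial (Fin (ht β)) k →ₐ[k] R D Q β := commEval (x D Q) x_comm

theorem pol_X (j : Fin (ht β)) : pol D Q β (.X j) = x D Q j := commEval_X _ _ _

theorem pol_comm_e (f : MvPolynomial (Fin (ht β)) k) (ν : Seq β) :
    Commute (pol D Q β f) (e D Q ν) := by
  induction f using MvPolynomial.induction_on with
  | C c => rw [← MvPolynomial.algebraMap_eq, AlgHom.commutes]; exact Algebra.commutes _ _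
  | add f g hf hg => rw [map_add]; exact hf.add_left hg
  | mul_X f j hf => rw [map_mul, pol_X]; exact hf.mul_left (x_comm_e j ν)

/-- Next to e(ν) on the right, every idempotent of the polynomial part acts as 0 or 1, so only a
polynomial in the x_j is left. -/
theorem exists_pol {f : R D Q β} (hf : f ∈ polAlg D Q β) (ν : Seq β) :
    ∃ q, f * e D Q ν = pol D Q β q * e D Q ν := by
  induction hf using Algebra.adjoin_induction with
  | mem f h =>
    rcases h with ⟨ν', rfl⟩ | ⟨j, rfl⟩
    · rw [e_mul_e]
      split_ifs with h
      · exact ⟨1, by rw [h, map_one, one_mul]⟩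
      · exact ⟨0, by simp⟩
    · exact ⟨.X j, by rw [pol_X]⟩
  | algebraMap c => exact ⟨algebraMap _ _ c, by rw [AlgHom.commutes]⟩
  | add f g _ _ hf hg =>
    obtain ⟨q, hq⟩ := hf
    obtain ⟨q', hq'⟩ := hg
    exact ⟨q + q', by rw [add_mul, hq, hq', map_add, add_mul]⟩
  | mul f g _ _ hf hg =>
    obtain ⟨q, hq⟩ := hf
    obtain ⟨q', hq'⟩ := hg
    refine ⟨q * q', ?_⟩
    rw [mul_assoc, hq', (pol_comm_e q' ν).eq, ← mul_assoc, hq, mul_assoc, ← (pol_comm_e q' ν).eq,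
      ← mul_assoc, map_mul]

end R

/-! ### The generic representation -/

section generic

variable (Q) (ν₀ : Seq β)

/-- The field of rational functions in the `x_j`. -/
def RatField (k : Type u) [Field k] (n : ℕ) : Type u := FractionRing (MvPolynomial (Fin n) k)

instance (n : ℕ) : Field (RatField k n) :=
  inferInstanceAs (Field (FractionRing (MvPolynomial (Fin n) k)))

instance (n : ℕ) : Algebra (MvPolynomial (Fin n) k) (RatField k n) :=
  inferInstanceAs (Algebra (MvPolynomial (Fin n) k) (FractionRing (MvPolynomial (Fin n) k)))

instance (n : ℕ) : IsFractionRing (MvPolynomial (Fin n) k) (RatField k n) :=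
  inferInstanceAs (IsFractionRing _ (FractionRing (MvPolynomial (Fin n) k)))

instance (n : ℕ) : Algebra k (RatField k n) :=
  ((algebraMap (MvPolynomial (Fin n) k) (RatField k n)).comp MvPolynomial.C).toAlgebra

instance (n : ℕ) : IsScalarTower k (MvPolynomial (Fin n) k) (RatField k n) :=
  IsScalarTower.of_algebraMap_eq fun _ => rfl

/-- The generic representation, with basis the orderings of `n` generic coloured points. -/
abbrev GenericRep (k : Type u) [Field k] (n : ℕ) : Type u :=
  Equiv.Perm (Fin n) →₀ RatField k n

namespace GenericRep

/-- The coordinate of the `a`-th generic point. -/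
def pt (k : Type u) [Field k] {n : ℕ} (a : Fin n) : RatField k n :=
  algebraMap (MvPolynomial (Fin n) k) _ (.X a)

theorem pt_injective {n : ℕ} : Function.Injective (pt k (n := n)) :=
  (IsFractionRing.injective (MvPolynomial (Fin n) k) _).comp (MvPolynomial.X_injective)

theorem aeval_pt {n : ℕ} (q : MvPolynomial (Fin n) k) :
    MvPolynomial.aeval (pt k) q = algebraMap _ (RatField k n) q := by
  have := MvPolynomial.aeval_algebraMap_apply (A := MvPolynomial (Fin n) k)
    (RatField k n) MvPolynomial.X q
  rwa [MvPolynomial.aeval_X_left_apply] at this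

/-- The diagonal coefficient of `τ`. -/
def coeffB (a b : Fin (ht β)) : RatField k (ht β) :=
  -- Forced by the relation between τ and x: for equal colours this coefficient times x_a - x_b has
  -- to be -1.
  if ν₀ a = ν₀ b then (pt k b - pt k a)⁻¹ else 0

/-- The value of `Q` at two points. -/
def coeffQ (a b : Fin (ht β)) : RatField k (ht β) :=
  MvPolynomial.aeval ![pt k a, pt k b] (Q.poly (ν₀ a) (ν₀ b))

/-- The off-diagonal coefficient of `τ`. -/
def coeffA (a b : Fin (ht β)) : RatField k (ht β) :=
  -- The square of τ determines only the product of the coefficients for (a, b) and (b, a). The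
  -- whole product is put on one ordering of the pair, which avoids square roots.
  if a < b then coeffQ Q ν₀ a b - coeffB (k := k) ν₀ a b ^ 2 else 1

theorem coeffB_symm (a b : Fin (ht β)) : coeffB (k := k) ν₀ b a = -coeffB ν₀ a b := by
  simp only [coeffB, eq_comm (a := ν₀ b)]
  split_ifs
  · rw [← inv_neg, neg_sub]
  · simp

theorem coeffQ_symm (a b : Fin (ht β)) : coeffQ Q ν₀ b a = coeffQ Q ν₀ a b := by
  rw [coeffQ, coeffQ, Q.symm, MvPolynomial.aeval_rename]
  congr 2
  funext i
  fin_cases i <;> rfl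

theorem coeffA_mul {a b : Fin (ht β)} (h : a ≠ b) : coeffA Q ν₀ a b * coeffA Q ν₀ b a =
    coeffQ Q ν₀ a b - coeffB (k := k) ν₀ a b ^ 2 := by
  rcases h.lt_or_gt with h | h
  · rw [coeffA, if_pos h, coeffA, if_neg h.not_gt, mul_one]
  · rw [coeffA, if_neg h.not_gt, coeffA, if_pos h, one_mul, coeffQ_symm, coeffB_symm, neg_sq]

/-- This is what makes the generic representation cyclic. For equal colours Q = 0 and the value is
minus a nonzero square; for different colours the diagonal coefficient is zero and Q ≠ 0 because of
its leading coefficient. -/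
theorem coeffA_ne_zero {a b : Fin (ht β)} (h : a ≠ b) : coeffA Q ν₀ a b ≠ 0 := by
  rw [coeffA]
  split_ifs
  swap
  · exact one_ne_zero
  by_cases hc : ν₀ a = ν₀ b
  · rw [coeffQ, hc, Q.diag, map_zero, zero_sub, neg_ne_zero, coeffB, if_pos hc]
    exact pow_ne_zero _ (inv_ne_zero (sub_ne_zero.2 (pt_injective.ne h.symm)))
  · rw [coeffB, if_neg hc, coeffQ]
    have hq : Q.poly (ν₀ a) (ν₀ b) ≠ 0 := by
      intro h0
      have := Q.leading _ _ hc
      rw [h0] at this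
      simp at this
    have h1 : pt k ∘ ![a, b] = ![pt k a, pt k b] := by
      funext i
      fin_cases i <;> rfl
    have h2 : MvPolynomial.aeval ![pt k a, pt k b] (Q.poly (ν₀ a) (ν₀ b)) =
        algebraMap (MvPolynomial (Fin (ht β)) k) (RatField k (ht β))
          (MvPolynomial.rename ![a, b] (Q.poly (ν₀ a) (ν₀ b))) := by
      rw [← h1, ← MvPolynomial.aeval_rename, aeval_pt]
    rw [h2]
    simp only [ne_eq, OfNat.ofNat_ne_zero, not_false_eq_true, zero_pow, sub_zero]
    rw [map_eq_zero_iff _ (IsFractionRing.injective _ _)]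
    refine (map_ne_zero_iff _ (MvPolynomial.rename_injective _ ?_)).2 hq
    intro i j hij
    fin_cases i <;> fin_cases j <;> simp_all

/-- For three points of one colour this is the partial fraction identity behind the braid relation.
In every other colouring both sides vanish. -/
theorem coeffB_mul {a b c : Fin (ht β)} (hab : a ≠ b) (hbc : b ≠ c) (hac : a ≠ c) :
    coeffB (k := k) ν₀ a b * coeffB ν₀ b c =
      coeffB ν₀ a c * (coeffB ν₀ a b + coeffB ν₀ b c) := by
  have h1 := sub_ne_zero.2 ((pt_injective (k := k)).ne hab.symm)
  have h2 := sub_ne_zero.2 ((pt_injective (k := k)).ne hbc.symm)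
  have h3 := sub_ne_zero.2 ((pt_injective (k := k)).ne hac.symm)
  simp only [coeffB]
  split_ifs <;> simp_all
  field_simp
  ring

/-- The basis vector attached to an ordering. -/
abbrev vec (k : Type u) [Field k] {n : ℕ} (g : Equiv.Perm (Fin n)) : GenericRep k n :=
  Finsupp.single g 1

/-- An operator given by its values on basis vectors. -/
def op {n : ℕ} (f : Equiv.Perm (Fin n) → GenericRep k n) :
    Module.End (RatField k n) (GenericRep k n) :=
  Finsupp.linearCombination _ f

@[simp]
theorem op_vec {n : ℕ} (f : Equiv.Perm (Fin n) → GenericRep k n) (g : Equiv.Perm (Fin n)) :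
    op f (vec k g) = f g := by
  simp [op, vec]

/-- The operator of `e(ν)`. -/
def opE (k : Type u) [Field k] (ν : Seq β) :
    Module.End (RatField k (ht β)) (GenericRep k (ht β)) :=
  op fun g => if ν₀.perm g = ν then vec k g else 0

/-- The operator of `x_j`. -/
def opX (k : Type u) [Field k] {n : ℕ} (j : Fin n) :
    Module.End (RatField k n) (GenericRep k n) :=
  op fun g => pt k (g j) • vec k g

/-- The operator of `τ_l`. -/
def opT (l : ℕ) (hl : l + 1 < ht β) : Module.End (RatField k (ht β)) (GenericRep k (ht β)) :=
  op fun g => coeffA Q ν₀ (g ⟨l, Nat.lt_of_succ_lt hl⟩) (g ⟨l + 1, hl⟩) •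
      vec k (g * Equiv.swap ⟨l, Nat.lt_of_succ_lt hl⟩ ⟨l + 1, hl⟩) +
    coeffB (k := k) ν₀ (g ⟨l, Nat.lt_of_succ_lt hl⟩) (g ⟨l + 1, hl⟩) • vec k g

theorem end_ext {n : ℕ} {f f' : Module.End (RatField k n) (GenericRep k n)}
    (h : ∀ g, f (vec k g) = f' (vec k g)) : f = f' :=
  Finsupp.lhom_ext' fun g => LinearMap.ext_ring (h g)

theorem opE_vec (ν : Seq β) (g) :
    opE ν₀ k ν (vec k g) = if ν₀.perm g = ν then vec k g else 0 := op_vec _ _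

theorem opX_vec {n : ℕ} (j : Fin n) (g) : opX k j (vec k g) = pt k (g j) • vec k g := op_vec _ _

theorem opT_vec (l : ℕ) (hl : l + 1 < ht β) (g) : opT Q ν₀ l hl (vec k g) =
    coeffA Q ν₀ (g ⟨l, Nat.lt_of_succ_lt hl⟩) (g ⟨l + 1, hl⟩) •
      vec k (g * Equiv.swap ⟨l, Nat.lt_of_succ_lt hl⟩ ⟨l + 1, hl⟩) +
    coeffB (k := k) ν₀ (g ⟨l, Nat.lt_of_succ_lt hl⟩) (g ⟨l + 1, hl⟩) • vec k g := op_vec _ _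

theorem evalOrd_apply {n m : ℕ} (q : MvPolynomial (Fin m) k)
    {a : Fin m → Module.End (RatField k n) (GenericRep k n)} {c : Fin m → RatField k n}
    {v : GenericRep k n} (h : ∀ i, a i v = c i • v) :
    evalOrd q a v = MvPolynomial.aeval c q • v := by
  have hpow : ∀ i r, (a i ^ r) v = c i ^ r • v := by
    intro i r
    induction r with
    | zero => simp
    | succ r ih =>
      rw [pow_succ, Module.End.mul_apply, h, map_smul, ih, smul_smul, pow_succ, mul_comm]
  have hprod : ∀ (L : List (Fin m)) (e : Fin m → ℕ), (L.map fun i => a i ^ e i).prod v =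
      (L.map fun i => c i ^ e i).prod • v := by
    intro L e
    induction L with
    | nil => simp
    | cons i L ih =>
      rw [List.map_cons, List.prod_cons, Module.End.mul_apply, ih, map_smul, hpow, smul_smul,
        List.map_cons, List.prod_cons, mul_comm]
  rw [evalOrd, MvPolynomial.aeval_def, MvPolynomial.eval₂_eq', LinearMap.sum_apply,
    Finset.sum_smul]
  refine Finset.sum_congr rfl fun e _ => ?_
  have := hprod (List.finRange m) e
  rw [← List.ofFn_eq_map, ← List.ofFn_eq_map, List.prod_ofFn (f := fun i => c i ^ e i)] at this
  rw [LinearMap.smul_apply, this, mul_smul, algebraMap_smul]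

end GenericRep

end generic

end

section

variable {I : Type w} {P : Type p} [AddCommGroup P] {k : Type u} [Field k]
  {D : CartanDatum I P} {Q : QPoly D k} {β : I →₀ ℕ}

/-! ### The defining relations in the generic representation. -/

namespace GenericRep

theorem coeffB_mul_sub (ν₀ : Seq β) {a b : Fin (ht β)} (h : a ≠ b) :
    coeffB (k := k) ν₀ a b * (pt k a - pt k b) = if ν₀ a = ν₀ b then -1 else 0 := by
  rw [coeffB]
  split_ifs
  · rw [← neg_sub (pt k b) (pt k a), mul_neg,
      inv_mul_cancel₀ (sub_ne_zero.2 (pt_injective.ne h.symm))]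
  · rw [zero_mul]

/-- The diagonal coefficient for (a, c) is 1/(x_c - x_a), so it turns a difference of two values of
Q into the divided difference on the right of the braid relation. -/
theorem coeffQ_eq_divDiff (ν₀ : Seq β) {a b c : Fin (ht β)} (hac : a ≠ c) (h : ν₀ a = ν₀ c) :
    coeffB ν₀ a c * (coeffQ Q ν₀ b c - coeffQ Q ν₀ a b) =
      MvPolynomial.aeval ![pt k a, pt k b, pt k c] (divDiff (Q.poly (ν₀ a) (ν₀ b))) := by
  have h1 := congrArg (MvPolynomial.aeval ![pt k a, pt k b, pt k c])
    (divDiff_mul (Q.poly (ν₀ a) (ν₀ b)))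
  simp only [map_mul, map_sub, MvPolynomial.aeval_rename, MvPolynomial.aeval_X] at h1
  have h2 : ![pt k a, pt k b, pt k c] ∘ ![0, 1] = ![pt k a, pt k b] := by
    funext i; fin_cases i <;> rfl
  have h3 : ![pt k a, pt k b, pt k c] ∘ ![2, 1] = ![pt k c, pt k b] := by
    funext i; fin_cases i <;> rfl
  rw [h2, h3] at h1
  have h4 : coeffQ Q ν₀ b c = MvPolynomial.aeval ![pt k c, pt k b] (Q.poly (ν₀ a) (ν₀ b)) := by
    rw [coeffQ_symm, coeffQ, h]
  have h5 := sub_ne_zero.2 ((pt_injective (k := k)).ne hac)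
  rw [h4, coeffQ, ← neg_sub, mul_neg, ← h1]
  have h6 := coeffB_mul_sub (k := k) ν₀ hac
  rw [if_pos h] at h6
  simp only [Matrix.cons_val_zero, Matrix.cons_val]
  linear_combination -(MvPolynomial.aeval ![pt k a, pt k b, pt k c]
    (divDiff (Q.poly (ν₀ a) (ν₀ b)))) * h6

variable (Q)

/-- The mixed terms cancel because the diagonal coefficient is antisymmetric, and `coeffA_mul` was
arranged to complete its square to Q. -/
theorem opT_sq (ν₀ : Seq β) (l : ℕ) (hl : l + 1 < ht β) (g : Equiv.Perm (Fin (ht β))) :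
    opT Q ν₀ l hl (opT Q ν₀ l hl (vec k g)) =
      coeffQ Q ν₀ (g ⟨l, Nat.lt_of_succ_lt hl⟩) (g ⟨l + 1, hl⟩) • vec k g := by
  have hne : g ⟨l, Nat.lt_of_succ_lt hl⟩ ≠ g ⟨l + 1, hl⟩ := g.injective.ne (by simp)
  have hA := coeffA_mul Q ν₀ hne
  have hB := coeffB_symm (k := k) ν₀ (g ⟨l, Nat.lt_of_succ_lt hl⟩) (g ⟨l + 1, hl⟩)
  rw [opT_vec, map_add, map_smul, map_smul, opT_vec, opT_vec]
  simp only [Equiv.Perm.mul_apply, Equiv.swap_apply_left, Equiv.swap_apply_right, mul_assoc,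
    Equiv.swap_mul_self, mul_one, hB]
  linear_combination (norm := module) hA • vec k g

theorem opT_braid (ν₀ : Seq β) (l : ℕ) (hl : l + 2 < ht β) (g : Equiv.Perm (Fin (ht β))) :
    opT Q ν₀ (l + 1) hl (opT Q ν₀ l (by omega) (opT Q ν₀ (l + 1) hl (vec k g))) -
      opT Q ν₀ l (by omega) (opT Q ν₀ (l + 1) hl (opT Q ν₀ l (by omega) (vec k g))) =
    (coeffB ν₀ (g ⟨l, by omega⟩) (g ⟨l + 2, hl⟩) *
      (coeffQ Q ν₀ (g ⟨l + 1, by omega⟩) (g ⟨l + 2, hl⟩) -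
        coeffQ Q ν₀ (g ⟨l, by omega⟩) (g ⟨l + 1, by omega⟩))) • vec k g := by
  have h0 : l < ht β := by omega
  have h1 : l + 1 < ht β := by omega
  set s := Equiv.swap (⟨l, h0⟩ : Fin (ht β)) ⟨l + 1, h1⟩ with hs
  set r := Equiv.swap (⟨l + 1, h1⟩ : Fin (ht β)) ⟨l + 1 + 1, hl⟩ with hr
  have n1 : (⟨l, h0⟩ : Fin (ht β)) ≠ ⟨l + 1, h1⟩ := by simp
  have n2 : (⟨l, h0⟩ : Fin (ht β)) ≠ ⟨l + 1 + 1, hl⟩ := by simp; omega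
  have n3 : (⟨l + 1, h1⟩ : Fin (ht β)) ≠ ⟨l + 1 + 1, hl⟩ := by simp
  have s0 : s ⟨l, h0⟩ = ⟨l + 1, h1⟩ := Equiv.swap_apply_left _ _
  have s1 : s ⟨l + 1, h1⟩ = ⟨l, h0⟩ := Equiv.swap_apply_right _ _
  have s2 : s ⟨l + 1 + 1, hl⟩ = ⟨l + 1 + 1, hl⟩ :=
    Equiv.swap_apply_of_ne_of_ne n2.symm n3.symm
  have r0 : r ⟨l, h0⟩ = ⟨l, h0⟩ := Equiv.swap_apply_of_ne_of_ne n1 n2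
  have r1 : r ⟨l + 1, h1⟩ = ⟨l + 1 + 1, hl⟩ := Equiv.swap_apply_left _ _
  have r2 : r ⟨l + 1 + 1, hl⟩ = ⟨l + 1, h1⟩ := Equiv.swap_apply_right _ _
  have ss : s * s = 1 := Equiv.swap_mul_self _ _
  have rr : r * r = 1 := Equiv.swap_mul_self _ _
  have srs : s * (r * s) = r * (s * r) := by
    have e1 : r * s * r = Equiv.swap ⟨l + 1 + 1, hl⟩ ⟨l, h0⟩ :=
      Equiv.swap_mul_swap_mul_swap n1 n2
    have e2 := Equiv.swap_mul_swap_mul_swap n3.symm n2.symm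
    rw [Equiv.swap_comm (⟨l + 1, h1⟩ : Fin (ht β)) ⟨l, h0⟩, Equiv.swap_comm
      (⟨l + 1 + 1, hl⟩ : Fin (ht β)) ⟨l + 1, h1⟩, Equiv.swap_comm (⟨l, h0⟩ : Fin (ht β))
      ⟨l + 1 + 1, hl⟩, ← e1] at e2
    simpa only [mul_assoc] using e2
  set a := g ⟨l, h0⟩ with ha
  set b := g ⟨l + 1, h1⟩ with hb
  set c := g ⟨l + 1 + 1, hl⟩ with hc
  have hab : a ≠ b := g.injective.ne n1
  have hac : a ≠ c := g.injective.ne n2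
  have hbc : b ≠ c := g.injective.ne n3
  have A1 := coeffA_mul Q ν₀ hab
  have A2 := coeffA_mul Q ν₀ hbc
  have B1 := coeffB_mul (k := k) ν₀ hab hbc hac
  have S1 := coeffB_symm (k := k) ν₀ a b
  have S2 := coeffB_symm (k := k) ν₀ b c
  simp only [opT_vec, map_add, map_smul, Equiv.Perm.mul_apply, ← hs, ← hr, s0, s1, s2, r0, r1, r2,
    mul_assoc, ss, rr, mul_one, srs, ← ha, ← hb, ← hc, S1, S2]
  -- Coefficients are compared on the translates of g by the group generated by s and r. Those at gs
  -- and gr cancel by the partial fraction identity. At g the same identity and the two product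
  -- formulas `A1`, `A2` leave the difference of the two values of Q.
  linear_combination (norm := module) 
    (coeffB (k := k) ν₀ a c * (A2 - A1) + (coeffB (k := k) ν₀ b c - coeffB (k := k) ν₀ a b) * B1) •
      vec k g + (coeffA Q ν₀ b c * B1) • vec k (g * r) - (coeffA Q ν₀ a b * B1) • vec k (g * s)

theorem rel_eq (ν₀ : Seq β) {a b : Module.End (RatField k (ht β)) (GenericRep k (ht β))}
    (h : Rel D Q β (opE ν₀ k) (opX k) (opT Q ν₀) a b) : a = b := by
  refine end_ext fun g => ?_
  cases h with
  | e_e ν ν' =>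
    rw [Module.End.mul_apply, opE_vec]
    split_ifs with h1 h2 h2
    · rw [h2]
    · rw [opE_vec, if_neg (fun h3 => h2 (h3.symm.trans h1)), LinearMap.zero_apply]
    · rw [opE_vec, h2, if_neg h1, map_zero]
    · simp
  | e_sum =>
    rw [LinearMap.sum_apply, Finset.sum_eq_single (ν₀.perm g)]
    · rw [opE_vec, if_pos rfl, Module.End.one_apply]
    · intro ν _ h
      rw [opE_vec, if_neg h.symm]
    · simp
  | x_e j ν =>
    rw [Module.End.mul_apply, Module.End.mul_apply, opE_vec, opX_vec, map_smul, opE_vec]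
    split_ifs
    · rw [opX_vec]
    · simp
  | x_x j l =>
    rw [Module.End.mul_apply, Module.End.mul_apply, opX_vec, opX_vec, map_smul, map_smul, opX_vec,
      opX_vec, smul_comm]
  | τ_e l hl ν =>
    have hs : ν₀.perm (g * Equiv.swap ⟨l, Nat.lt_of_succ_lt hl⟩ ⟨l + 1, hl⟩) = ν.swap l hl ↔
        ν₀.perm g = ν := by
      rw [Seq.perm_eq_swap]
      exact ⟨fun h => by rw [← (ν₀.perm g).swap_swap l hl, h, Seq.swap_swap], fun h => by rw [h]⟩
    rw [Module.End.mul_apply, Module.End.mul_apply, opE_vec, opT_vec, map_add, map_smul, map_smul,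
      opE_vec, opE_vec]
    simp only [hs]
    split_ifs with h1 h2 h2
    · rw [opT_vec]
    · rw [opT_vec]
      -- The diagonal term of τ is nonzero only for equal colours, and then the swap fixes the
      -- sequence, contrary to the case at hand. The mirrored case below is excluded in the same
      -- way.
      have : ν₀ (g ⟨l, Nat.lt_of_succ_lt hl⟩) ≠ ν₀ (g ⟨l + 1, hl⟩) := by
        intro h3
        apply h2
        rw [h1]
        ext j
        simp only [Seq.swap, Equiv.swap_apply_def]
        rw [← h1]
        split_ifs with h4 h5
        · rw [h4]; exact h3
        · rw [h5]; exact h3.symm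
        · rfl
      simp [coeffB, this]
    · have : ν₀ (g ⟨l, Nat.lt_of_succ_lt hl⟩) ≠ ν₀ (g ⟨l + 1, hl⟩) := by
        intro h3
        apply h1
        rw [← ν.swap_swap l hl, ← h2]
        ext j
        simp only [Seq.swap, Equiv.swap_apply_def]
        split_ifs with h4 h5
        · rw [h4]; exact h3
        · rw [h5]; exact h3.symm
        · rfl
      simp [coeffB, this]
    · simp
  | τ_τ j l hj hl hjl =>
    have c1 : Equiv.swap (⟨l, Nat.lt_of_succ_lt hl⟩ : Fin (ht β)) ⟨l + 1, hl⟩ *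
        Equiv.swap (⟨j, Nat.lt_of_succ_lt hj⟩ : Fin (ht β)) ⟨j + 1, hj⟩ =
        Equiv.swap (⟨j, Nat.lt_of_succ_lt hj⟩ : Fin (ht β)) ⟨j + 1, hj⟩ *
        Equiv.swap (⟨l, Nat.lt_of_succ_lt hl⟩ : Fin (ht β)) ⟨l + 1, hl⟩ := by
      refine (Equiv.Perm.Disjoint.commute ?_).eq
      intro i
      by_cases hi : i.1 = l ∨ i.1 = l + 1
      · right
        apply Equiv.swap_apply_of_ne_of_ne <;> simp [Fin.ext_iff] <;> omega
      · left
        apply Equiv.swap_apply_of_ne_of_ne <;> simp [Fin.ext_iff] <;> omega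
    have e1 : ∀ i, i = j ∨ i = j + 1 → ∀ hi : i < ht β,
        Equiv.swap (⟨l, Nat.lt_of_succ_lt hl⟩ : Fin (ht β)) ⟨l + 1, hl⟩ ⟨i, hi⟩ = ⟨i, hi⟩ := by
      intro i h hi
      apply Equiv.swap_apply_of_ne_of_ne <;> simp [Fin.ext_iff] <;> omega
    have e2 : ∀ i, i = l ∨ i = l + 1 → ∀ hi : i < ht β,
        Equiv.swap (⟨j, Nat.lt_of_succ_lt hj⟩ : Fin (ht β)) ⟨j + 1, hj⟩ ⟨i, hi⟩ = ⟨i, hi⟩ := by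
      intro i h hi
      apply Equiv.swap_apply_of_ne_of_ne <;> simp [Fin.ext_iff] <;> omega
    rw [Module.End.mul_apply, Module.End.mul_apply, opT_vec, opT_vec]
    simp only [map_add, map_smul, opT_vec, Equiv.Perm.mul_apply, e1 j (Or.inl rfl),
      e1 (j + 1) (Or.inr rfl), e2 l (Or.inl rfl), e2 (l + 1) (Or.inr rfl), mul_assoc, c1]
    module
  | τ_sq l hl ν =>
    rw [Module.End.mul_apply, Module.End.mul_apply, Module.End.mul_apply, opE_vec]
    split_ifs with h1
    · rw [opT_sq, evalOrd_apply _ (c := ![pt k (g ⟨l, Nat.lt_of_succ_lt hl⟩), pt k (g ⟨l + 1, hl⟩)]),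
        ← h1]
      · rfl
      · intro i
        fin_cases i <;> exact opX_vec _ _
    · simp
  | τ_x l hl j ν =>
    have hne : g ⟨l, Nat.lt_of_succ_lt hl⟩ ≠ g ⟨l + 1, hl⟩ := g.injective.ne (by simp)
    have hB := coeffB_mul_sub (k := k) ν₀ hne
    rw [Module.End.mul_apply, opE_vec]
    by_cases h1 : ν₀.perm g = ν
    swap
    · rw [if_neg h1, map_zero]
      split_ifs <;> simp [opE_vec, h1]
    rw [if_pos h1, LinearMap.sub_apply, Module.End.mul_apply, Module.End.mul_apply, opX_vec,
      map_smul, opT_vec, map_add, map_smul, map_smul, opX_vec, opX_vec]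
    have hν : ∀ i, ν i = ν₀ (g i) := fun i => by rw [← h1]; rfl
    simp only [Equiv.Perm.mul_apply, Equiv.swap_apply_self, hν]
    have key : ∀ (A B c d : RatField k (ht β)) (v v' : GenericRep k (ht β)),
        c • (A • v' + B • v) - (A • c • v' + B • d • v) = (B * (c - d)) • v := by
      intros; module
    rw [key]
    rcases j with ⟨j, hj⟩
    by_cases hj1 : j = l
    · subst hj1
      rw [Equiv.swap_apply_left, hB]
      split_ifs <;> simp_all [opE_vec]
    by_cases hj2 : j = l + 1
    · subst hj2
      rw [Equiv.swap_apply_right, ← neg_sub, mul_neg, hB]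
      split_ifs <;> simp_all [opE_vec]
    · rw [Equiv.swap_apply_of_ne_of_ne (by simpa [Fin.ext_iff]) (by simpa [Fin.ext_iff])]
      simp [hj1, hj2]
  | braid l hl ν =>
    rw [Module.End.mul_apply, opE_vec]
    by_cases h1 : ν₀.perm g = ν
    swap
    · rw [if_neg h1, map_zero]
      split_ifs <;> simp [opE_vec, h1]
    have hac : g ⟨l, by omega⟩ ≠ g ⟨l + 2, hl⟩ := g.injective.ne (by simp)
    have hν : ∀ i, ν i = ν₀ (g i) := fun i => by rw [← h1]; rfl
    rw [if_pos h1, LinearMap.sub_apply]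
    simp only [Module.End.mul_apply]
    rw [opT_braid]
    simp only [hν]
    split_ifs with h2
    · rw [Module.End.mul_apply, opE_vec, if_pos h1, evalOrd_apply _ (c := ![pt k (g ⟨l, by omega⟩),
        pt k (g ⟨l + 1, by omega⟩), pt k (g ⟨l + 2, hl⟩)]), coeffQ_eq_divDiff ν₀ hac h2]
      intro i
      fin_cases i <;> exact opX_vec _ _
    · rw [coeffB, if_neg h2, zero_mul, zero_smul, LinearMap.zero_apply]

/-- The generic representation of `R(β)`. -/
theorem exists_rep (ν₀ : Seq β) : ∃ ρ : R D Q β →ₐ[k]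
    Module.End (RatField k (ht β)) (GenericRep k (ht β)), (∀ ν, ρ (R.e D Q ν) = opE ν₀ k ν) ∧
      (∀ j, ρ (R.x D Q j) = opX k j) ∧ ∀ l hl, ρ (R.τ D Q l hl) = opT Q ν₀ l hl :=
  R.exists_lift _ _ _ fun _ _ h => rel_eq Q ν₀ h

end GenericRep

theorem perm_induction_adjacent {n : ℕ} {C : Equiv.Perm (Fin n) → Prop} (h1 : C 1)
    (hmul : ∀ g (l : ℕ) (hl : l + 1 < n), C g →
      C (g * Equiv.swap ⟨l, Nat.lt_of_succ_lt hl⟩ ⟨l + 1, hl⟩)) (g : Equiv.Perm (Fin n)) : C g := by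
  rcases n with _ | n
  · rwa [Subsingleton.elim g 1]
  have hg : g ∈ Submonoid.closure
      (Set.range fun i : Fin n ↦ Equiv.swap i.castSucc i.succ) := by
    rw [Equiv.Perm.mclosure_swap_castSucc_succ]
    trivial
  induction hg using Submonoid.closure_induction_right with
  | one => exact h1
  | mul_right g _ s hs ih =>
    obtain ⟨i, rfl⟩ := hs
    exact hmul g i.1 (by omega) ih

/-! ### Linear independence over the polynomials. -/

namespace R

open GenericRep

/-- A family of `n!` elements which spans `R(β) e(ν)` over the polynomials is linearly independent
over the polynomials. -/
theorem eq_zero_of_sum_eq_zero {ι : Type*} [Fintype ι] (hι : Fintype.card ι = (ht β).factorial)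
    (ν : Seq β) (y : ι → R D Q β)
    (hy : ∀ r : R D Q β, r * e D Q ν ∈
      Submodule.span k {z | ∃ i f, z = y i * pol D Q β f * e D Q ν})
    (f : ι → MvPolynomial (Fin (ht β)) k) (hf : ∑ i, y i * pol D Q β (f i) * e D Q ν = 0) (i : ι) :
    f i = 0 := by
  obtain ⟨ρ, he, hx, hτ⟩ := exists_rep (D := D) Q ν
  let v : GenericRep k (ht β) := vec k 1
  have hev : ρ (e D Q ν) v = v := by rw [he, opE_vec, Seq.perm_one, if_pos rfl]
  have hpol : ∀ q, ρ (pol D Q β q) v = algebraMap _ (RatField k (ht β)) q • v := by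
    intro q
    induction q using MvPolynomial.induction_on with
    | C c =>
      rw [← MvPolynomial.algebraMap_eq, AlgHom.commutes, AlgHom.commutes,
        ← IsScalarTower.algebraMap_apply, algebraMap_smul]
      rfl
    | add f g hf hg => simp only [map_add, LinearMap.add_apply, hf, hg, add_smul]
    | mul_X f j hf =>
      rw [map_mul, map_mul, Module.End.mul_apply, pol_X, hx, opX_vec, map_smul, hf, smul_smul,
        map_mul, mul_comm]
      rfl
  have hyp : ∀ i q, ρ (y i * pol D Q β q * e D Q ν) v =
      algebraMap _ (RatField k (ht β)) q • ρ (y i) v := by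
    intro i q
    rw [map_mul, map_mul, Module.End.mul_apply, Module.End.mul_apply, hev, hpol, map_smul]
  -- After extension of scalars to rational functions, the hypothesis on `y` says that the ρ(y_i)v
  -- span everything reached from v, since v is fixed by e(ν) and polynomials act on it by scalars.
  let W := Submodule.span (RatField k (ht β)) (Set.range fun i => ρ (y i) v)
  have hW : ∀ r, ρ r v ∈ W := by
    intro r
    have h1 : ρ r v = ρ (r * e D Q ν) v := by rw [map_mul, Module.End.mul_apply, hev]
    rw [h1]
    have h2 := hy r
    generalize r * e D Q ν = z at h2
    induction h2 using Submodule.span_induction with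
    | mem z h =>
      obtain ⟨i, q, rfl⟩ := h
      rw [hyp]
      exact Submodule.smul_mem _ _ (Submodule.subset_span ⟨i, rfl⟩)
    | zero => simp
    | add a b _ _ ha hb => rw [map_add, LinearMap.add_apply]; exact add_mem ha hb
    | smul c a _ ha =>
      rw [map_smul, LinearMap.smul_apply, ← algebraMap_smul (RatField k (ht β)) c]
      exact Submodule.smul_mem _ _ ha
  let S := Submodule.span (RatField k (ht β)) (Set.range fun r => ρ r v)
  have hSW : S ≤ W := Submodule.span_le.2 (by rintro _ ⟨r, rfl⟩; exact hW r)
  have hS : ∀ r, ∀ z ∈ S, ρ r z ∈ S := by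
    intro r z hz
    induction hz using Submodule.span_induction with
    | mem z h =>
      obtain ⟨r', rfl⟩ := h
      exact Submodule.subset_span ⟨r * r', by simp only [map_mul, Module.End.mul_apply]⟩
    | zero => simp
    | add a b _ _ ha hb => rw [map_add]; exact add_mem ha hb
    | smul c a _ ha => rw [map_smul]; exact Submodule.smul_mem _ _ ha
  -- Cyclicity of v: τ_l sends the basis vector of g to a nonzero multiple of its neighbour plus a
  -- multiple of itself, and adjacent transpositions generate all permutations.
  have hg : ∀ g, vec k g ∈ S := by
    intro g
    induction g using perm_induction_adjacent with
    | h1 => exact Submodule.subset_span ⟨1, by simp [v]⟩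
    | hmul g l hl ih =>
      have h1 := hS (τ D Q l hl) _ ih
      rw [hτ, opT_vec, Submodule.add_mem_iff_left _ (Submodule.smul_mem _ _ ih)] at h1
      exact (Submodule.smul_mem_iff _ (coeffA_ne_zero Q ν (g.injective.ne (by simp)))).1 h1
  have htop : ⊤ ≤ W := by
    refine le_trans ?_ hSW
    rintro z -
    rw [← Finsupp.sum_single z]
    refine Submodule.sum_mem _ fun g _ => ?_
    rw [← mul_one (z g), ← smul_eq_mul, ← Finsupp.smul_single]
    exact Submodule.smul_mem _ _ (hg g)
  -- A spanning family of n! vectors in a space of dimension n! is a basis.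
  have hli := linearIndependent_of_top_le_span_of_card_eq_finrank htop (by
    rw [hι, Module.finrank_finsupp_self, Fintype.card_perm, Fintype.card_fin])
  rw [Fintype.linearIndependent_iff] at hli
  have h0 := hli (fun i => algebraMap _ (RatField k (ht β)) (f i)) (by
    have := congrArg (fun r => ρ r v) hf
    simp only [map_sum, LinearMap.sum_apply, hyp] at this
    simpa using this) i
  exact (map_eq_zero_iff _ (IsFractionRing.injective _ _)).1 h0

end R

end

section

variable {I : Type w} {P : Type p} [AddCommGroup P] {k : Type u} [Field k]
  {D : CartanDatum I P} {Q : QPoly D k} {β γ γ' δ : I →₀ ℕ}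

/-! ### Sequences and lists -/

/-- The weight of a list of simple roots. -/
def listWt (L : List I) : I →₀ ℕ := (L.map fun i => Finsupp.single i 1).sum

theorem listWt_append (L L' : List I) : listWt (L ++ L') = listWt L + listWt L' := by
  simp [listWt]

theorem ht_listWt (L : List I) : ht (listWt L) = L.length := by
  induction L with
  | nil => simp [listWt, ht]
  | cons i L ih =>
    have : listWt (i :: L) = Finsupp.single i 1 + listWt L := rfl
    rw [this, ht, map_add, Finsupp.degree_single, List.length_cons, add_comm, ← ih]

namespace Seq

/-- The list of entries. -/
def toList (ν : Seq β) : List I := List.ofFn ν.toFun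

theorem length_toList (ν : Seq β) : ν.toList.length = ht β := by simp [toList]

theorem listWt_toList (ν : Seq β) : listWt ν.toList = β := by
  conv_rhs => rw [← ν.sum_eq]
  rw [listWt, toList, List.map_ofFn, List.sum_ofFn]
  rfl

theorem toList_injective : Function.Injective (toList (β := β)) := fun _ _ h =>
  Seq.ext (List.ofFn_injective h)

/-- The sequence with given entries. -/
def ofList (L : List I) (h : listWt L = β) : Seq β where
  toFun := fun j => L[j.1]'(by rw [← ht_listWt, h]; exact j.2)
  sum_eq := by
    subst h
    have h1 := Equiv.sum_comp (finCongr (ht_listWt L)) fun j => (Finsupp.single L[j.1] 1 : I →₀ ℕ)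
    refine h1.trans ?_
    rw [listWt, ← List.sum_ofFn]
    congr 1
    exact List.ofFn_getElem_eq_map L fun i => (Finsupp.single i 1 : I →₀ ℕ)

theorem toList_ofList (L : List I) (h : listWt L = β) : (ofList L h).toList = L := by
  refine List.ext_getElem ?_ fun i h1 h2 => ?_
  · rw [length_toList, ← h, ht_listWt]
  · simp [toList, ofList]

theorem swap_apply (ν : Seq β) (l : ℕ) (hl : l + 1 < ht β) (q : ℕ) (hq : q < ht β) :
    (ν.swap l hl) ⟨q, hq⟩ = if q = l then ν ⟨l + 1, hl⟩ else
      if q = l + 1 then ν ⟨l, Nat.lt_of_succ_lt hl⟩ else ν ⟨q, hq⟩ := by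
  simp only [Seq.swap, Equiv.swap_apply_def, Fin.mk.injEq]
  split_ifs <;> rfl

/-- The entries of `μ` occur in `ν` from position `o` on. -/
def Match (o : ℕ) (μ : Seq δ) (ν : Seq β) : Prop :=
  ∀ (j : ℕ) (hj : j < ht δ) (hj' : o + j < ht β), ν ⟨o + j, hj'⟩ = μ ⟨j, hj⟩

theorem Match.unique {o : ℕ} (h : o + ht δ ≤ ht β) {μ μ' : Seq δ} {ν : Seq β} (h1 : Match o μ ν)
    (h2 : Match o μ' ν) : μ = μ' := by
  ext ⟨j, hj⟩
  rw [← h1 j hj (by omega), ← h2 j hj (by omega)]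

theorem Match.swap {o l : ℕ} {μ : Seq δ} {ν : Seq β} (h : Match o μ ν) (hl : l + 1 < ht δ)
    (hl' : o + l + 1 < ht β) : Match o (μ.swap l hl) (ν.swap (o + l) hl') := by
  intro j hj hj'
  rw [swap_apply, swap_apply]
  simp only [Nat.add_left_cancel_iff, add_assoc]
  split_ifs
  · exact h _ _ _
  · exact h _ _ _
  · exact h _ _ _

theorem match_swap_iff {o l : ℕ} {μ : Seq δ} {ν : Seq β} (hl : l + 1 < ht δ)
    (hl' : o + l + 1 < ht β) : Match o μ (ν.swap (o + l) hl') ↔ Match o (μ.swap l hl) ν := by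
  refine ⟨fun h => ?_, fun h => ?_⟩
  · simpa only [swap_swap] using h.swap hl hl'
  · simpa only [swap_swap] using h.swap hl hl'

theorem match_swap_far_iff {o l : ℕ} {μ : Seq δ} {ν : Seq β} (hl' : l + 1 < ht β)
    (h : l + 1 < o ∨ o + ht δ ≤ l) : Match o μ (ν.swap l hl') ↔ Match o μ ν := by
  refine forall_congr' fun j => forall_congr' fun hj => forall_congr' fun hj' => ?_
  rw [swap_apply, if_neg (by omega), if_neg (by omega)]

theorem isConcat_iff (h : ht γ + ht γ' = ht β) {ν : Seq β} {μ : Seq γ} {μ' : Seq γ'} :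
    ν.IsConcat μ μ' ↔ Match 0 μ ν ∧ Match (ht γ) μ' ν := by
  refine ⟨fun h => ⟨fun j hj hj' => ?_, fun j hj hj' => h.right j hj hj'⟩, fun ⟨h1, h2⟩ => ?_⟩
  · simpa using h.left j hj (by omega)
  · refine List.ext_getElem (by simp [h]) fun i h3 h4 => ?_
    rw [List.getElem_append]
    simp only [List.length_ofFn] at h3
    split_ifs with h5
    · simp only [List.length_ofFn] at h5
      simpa using h1 i h5 (by omega)
    · simp only [List.length_ofFn] at h5
      have := h2 (i - ht γ) (by omega) (by omega)
      simpa [show ht γ + (i - ht γ) = i by omega] using this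

theorem ht_add (h : γ + γ' = β) : ht γ + ht γ' = ht β := by
  rw [← h, ht, ht, ht, map_add]

theorem exists_isConcat (h : γ + γ' = β) (μ : Seq γ) (μ' : Seq γ') :
    ∃ ν : Seq β, ν.IsConcat μ μ' :=
  ⟨ofList (μ.toList ++ μ'.toList) (by rw [listWt_append, listWt_toList, listWt_toList, h]),
    toList_ofList _ _⟩

theorem IsConcat.unique {ν ν' : Seq β} {μ : Seq γ} {μ' : Seq γ'} (h : ν.IsConcat μ μ')
    (h' : ν'.IsConcat μ μ') : ν = ν' :=
  toList_injective (Eq.trans h h'.symm)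

theorem Match.exists_right (h : γ + γ' = β) {μ : Seq γ} {ν : Seq β} (hν : Match 0 μ ν) :
    ∃ μ' : Seq γ', ν.IsConcat μ μ' := by
  have hh := ht_add h
  have h1 : ν.toList.take (ht γ) = μ.toList := by
    refine List.ext_getElem ?_ fun i h1 h2 => ?_
    · simp [length_toList]; omega
    · rw [length_toList] at h2
      simpa [toList] using hν i h2 (by omega)
  have h2 : listWt (ν.toList.drop (ht γ)) = γ' := by
    have h3 := listWt_append (ν.toList.take (ht γ)) (ν.toList.drop (ht γ))
    rw [List.take_append_drop, listWt_toList, h1, listWt_toList] at h3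
    exact (add_left_cancel (h.trans h3)).symm
  refine ⟨ofList _ h2, ?_⟩
  change ν.toList = μ.toList ++ (ofList _ h2).toList
  rw [toList_ofList, ← h1, List.take_append_drop]

theorem Match.exists_left (h : γ + γ' = β) {μ' : Seq γ'} {ν : Seq β} (hν : Match (ht γ) μ' ν) :
    ∃ μ : Seq γ, ν.IsConcat μ μ' := by
  have hh := ht_add h
  have h1 : ν.toList.drop (ht γ) = μ'.toList := by
    refine List.ext_getElem ?_ fun i h1 h2 => ?_
    · simp [length_toList]; omega
    · rw [length_toList] at h2
      simpa [toList] using hν i h2 (by omega)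
  have h2 : listWt (ν.toList.take (ht γ)) = γ := by
    have h3 := listWt_append (ν.toList.take (ht γ)) (ν.toList.drop (ht γ))
    rw [List.take_append_drop, listWt_toList, h1, listWt_toList] at h3
    exact (add_right_cancel (h.trans h3)).symm
  refine ⟨ofList _ h2, ?_⟩
  change ν.toList = (ofList _ h2).toList ++ μ'.toList
  rw [toList_ofList, ← h1, List.take_append_drop]

end Seq

/-! ### Idempotents attached to sets of sequences -/

namespace R

variable (D Q β) in
/-- The elements `x_j`, extended by zero. -/
def xN (j : ℕ) : R D Q β := if h : j < ht β then x D Q ⟨j, h⟩ else 0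

theorem xN_eq {j : ℕ} (h : j < ht β) : xN D Q β j = x D Q ⟨j, h⟩ := dif_pos h

variable (D Q) in
/-- The idempotent `∑ e(ν)`, over the `ν` with a given property. -/
def eP (S : Seq β → Prop) : R D Q β := ∑ ν with S ν, e D Q ν

theorem eP_mul_e (S : Seq β → Prop) (ν : Seq β) :
    eP D Q S * e D Q ν = if S ν then e D Q ν else 0 := by
  rw [eP, Finset.sum_mul]
  split_ifs with h
  · rw [Finset.sum_eq_single ν]
    · simp [e_mul_e]
    · intro ν' _ h'
      rw [e_mul_e, if_neg h']
    · simp [h]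
  · refine Finset.sum_eq_zero fun ν' hν' => ?_
    rw [e_mul_e, if_neg]
    rintro rfl
    exact h (Finset.mem_filter.1 hν').2

theorem eP_mul_eP (S T : Seq β → Prop) :
    eP D Q S * eP D Q T = eP D Q fun ν => S ν ∧ T ν := by
  refine eq_of_mul_e fun ν => ?_
  rw [mul_assoc, eP_mul_e, eP_mul_e]
  by_cases hT : T ν <;> by_cases hS : S ν <;> simp [hT, hS, eP_mul_e]

theorem eP_mul_of_imp {S T : Seq β → Prop} (h : ∀ ν, S ν → T ν) :
    eP D Q S * eP D Q T = eP D Q S := by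
  rw [eP_mul_eP]
  congr 1
  ext ν
  exact and_iff_left_of_imp (h ν)

theorem mul_eP_of_imp {S T : Seq β → Prop} (h : ∀ ν, S ν → T ν) :
    eP D Q T * eP D Q S = eP D Q S := by
  rw [eP_mul_eP]
  congr 1
  ext ν
  exact and_iff_right_of_imp (h ν)

theorem eP_commute (S T : Seq β → Prop) : Commute (eP D Q S) (eP D Q T) := by
  rw [Commute, SemiconjBy, eP_mul_eP, eP_mul_eP]
  congr 1
  ext ν
  exact and_comm

theorem eP_eq (ν : Seq β) : eP D Q (fun ν' => ν' = ν) = e D Q ν := by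
  refine eq_of_mul_e fun ν' => ?_
  rw [eP_mul_e, e_mul_e]
  by_cases h : ν' = ν
  · simp [h]
  · rw [if_neg h, if_neg (Ne.symm h)]

theorem xN_commute_eP (j : ℕ) (S : Seq β → Prop) : Commute (xN D Q β j) (eP D Q S) := by
  rw [xN]
  split_ifs
  · exact Commute.sum_right _ _ _ fun ν _ => x_comm_e _ ν
  · exact Commute.zero_left _

theorem xN_comm (i j : ℕ) : Commute (xN D Q β i) (xN D Q β j) := by
  rw [xN, xN]
  split_ifs
  · exact x_comm _ _
  all_goals simp

theorem tau_mul_eP (l : ℕ) (hl : l + 1 < ht β) (S : Seq β → Prop) :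
    tau D Q β l * eP D Q S = eP D Q (fun ν => S (ν.swap l hl)) * tau D Q β l := by
  refine eq_of_mul_e fun ν => ?_
  rw [tau_eq l hl, mul_assoc, mul_assoc, eP_mul_e, rel (.τ_e l hl ν), ← mul_assoc, eP_mul_e,
    ν.swap_swap]
  split_ifs
  · exact rel (.τ_e l hl ν)
  · simp

theorem tau_commute_eP (l : ℕ) (S : Seq β → Prop)
    (h : ∀ (hl : l + 1 < ht β) ν, S (ν.swap l hl) ↔ S ν) :
    Commute (tau D Q β l) (eP D Q S) := by
  by_cases hl : l + 1 < ht β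
  · rw [Commute, SemiconjBy, tau_mul_eP l hl]
    simp only [h hl]
  · rw [tau_eq_zero hl]
    exact Commute.zero_left _

theorem tau_commute_xN {l j : ℕ} (h1 : j ≠ l) (h2 : j ≠ l + 1) :
    Commute (tau D Q β l) (xN D Q β j) := by
  by_cases hl : l + 1 < ht β
  swap
  · rw [tau_eq_zero hl]
    exact Commute.zero_left _
  by_cases hj : j < ht β
  swap
  · rw [xN, dif_neg hj]
    exact Commute.zero_right _
  rw [tau_eq l hl, xN_eq hj]
  refine eq_of_mul_e fun ν => ?_
  have := rel (.τ_x (D := D) (Q := Q) (e := e D Q) (x := x D Q) (τ := τ D Q) l hl ⟨j, hj⟩ ν)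
  rw [Equiv.swap_apply_of_ne_of_ne (by simpa [Fin.ext_iff]) (by simpa [Fin.ext_iff])] at this
  simp only [h1, h2, if_false, ite_self, sub_mul, sub_eq_zero] at this
  exact this

theorem tau_comm {l j : ℕ} (h : l + 1 < j ∨ j + 1 < l) :
    Commute (tau D Q β l) (tau D Q β j) :=
  h.elim (braidLike.comm l j) fun h => (braidLike.comm j l h).symm

end R

/-! ### Corner algebras -/

section corner

variable {A : Type*} [Ring A] [Algebra k A] {e : A} (he : IsIdempotentElem e)

/-- The corner `e A e` as an algebra. -/
instance cornerAlgebra : Algebra k he.Corner :=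
  RingHom.toAlgebra'
    { toFun := fun c => ⟨c • e, (Subsemigroup.mem_corner_iff he).2
        ⟨by rw [mul_smul_comm, he.eq], by rw [smul_mul_assoc, he.eq]⟩⟩
      map_one' := Subtype.ext (one_smul _ _)
      map_mul' := fun a b => Subtype.ext (by
        change (a * b) • e = (a • e) * (b • e)
        rw [smul_mul_smul_comm, he.eq])
      map_zero' := Subtype.ext (zero_smul _ _)
      map_add' := fun a b => Subtype.ext (add_smul _ _ _) }
    fun c x => Subtype.ext (by
      obtain ⟨h1, h2⟩ := (Subsemigroup.mem_corner_iff he).1 x.2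
      change (c • e) * x.1 = x.1 * (c • e)
      rw [smul_mul_assoc, mul_smul_comm, h1, h2])

/-- The inclusion of the corner. -/
def cornerVal : he.Corner →ₗ[k] A where
  toFun := Subtype.val
  map_add' _ _ := rfl
  map_smul' c x := by
    obtain ⟨h1, h2⟩ := (Subsemigroup.mem_corner_iff he).1 x.2
    change (c • e) * x.1 = c • x.1
    rw [smul_mul_assoc, h1]

theorem cornerVal_mul (a b : he.Corner) :
    cornerVal (k := k) he (a * b) = cornerVal (k := k) he a * cornerVal (k := k) he b := rfl

theorem cornerVal_one : cornerVal (k := k) he 1 = e := rfl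

theorem cornerVal_injective : Function.Injective (cornerVal (k := k) he) :=
  Subtype.val_injective

/-- The map `z ↦ z e` from the centralizer of `e` to the corner. -/
def toCorner : Subalgebra.centralizer k {e} →ₐ[k] he.Corner where
  toFun z := ⟨z.1 * e, (Subsemigroup.mem_corner_iff he).2 (by
    have := (Subalgebra.mem_centralizer_iff k).1 z.2 e rfl
    exact ⟨by rw [← mul_assoc, this, mul_assoc, he.eq], by rw [mul_assoc, he.eq]⟩)⟩
  map_one' := Subtype.ext (one_mul _)
  map_mul' a b := Subtype.ext (by
    have := (Subalgebra.mem_centralizer_iff k).1 b.2 e rfl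
    change a.1 * b.1 * e = (a.1 * e) * (b.1 * e)
    rw [mul_assoc, mul_assoc, ← mul_assoc e, this, mul_assoc, he.eq])
  map_zero' := Subtype.ext (zero_mul _)
  map_add' a b := Subtype.ext (add_mul _ _ _)
  commutes' c := Subtype.ext (by
    change algebraMap k A c * e = c • e
    rw [Algebra.smul_def])

theorem cornerVal_toCorner (z : Subalgebra.centralizer k {e}) :
    cornerVal (k := k) he (toCorner he z) = z.1 * e := rfl

end corner

end

section

variable {I : Type w} {P : Type p} [AddCommGroup P] {k : Type u} [Field k]
  {D : CartanDatum I P} {Q : QPoly D k} {β γ γ' δ : I →₀ ℕ}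

namespace R

/-! ### Block embeddings -/

variable (D Q β δ) in
/-- The idempotent of the sequences whose entries from position `o` on have weight `δ`. -/
def blkE (o : ℕ) : R D Q β := eP D Q fun ν => ∃ μ : Seq δ, Seq.Match o μ ν

theorem blkE_idem (o : ℕ) : IsIdempotentElem (blkE D Q β δ o) :=
  eP_mul_of_imp fun _ h => h

/-- The embedding is not unital, as its unit goes to the idempotent E of the block. The universal
property of R(δ) is therefore applied with target the corner of E, where E is the unit. The images
of the generators come from elements commuting with E, so that the relations can be checked in the
centralizer before they are cut down by E. -/
theorem exists_blk (o : ℕ) (h : o + ht δ ≤ ht β) : ∃ f : R D Q δ →ₗ[k] R D Q β,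
    (∀ a b, f (a * b) = f a * f b) ∧ f 1 = blkE D Q β δ o ∧
    (∀ μ, f (e D Q μ) = eP D Q (Seq.Match o μ)) ∧
    (∀ j : Fin (ht δ), f (x D Q j) = xN D Q β (o + j) * blkE D Q β δ o) ∧
    ∀ l hl, f (τ D Q l hl) = tau D Q β (o + l) * blkE D Q β δ o := by
  set E := blkE D Q β δ o with hE
  have he : IsIdempotentElem E := blkE_idem o
  have hcE : ∀ S, eP D Q S ∈ Subalgebra.centralizer k {E} := fun S =>
    (Subalgebra.mem_centralizer_iff k).2 fun g hg => by
      obtain rfl := Set.mem_singleton_iff.1 hg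
      exact (eP_commute _ _).eq
  have hcX : ∀ j, xN D Q β j ∈ Subalgebra.centralizer k {E} := fun j =>
    (Subalgebra.mem_centralizer_iff k).2 fun g hg => by
      obtain rfl := Set.mem_singleton_iff.1 hg
      exact (xN_commute_eP _ _).eq.symm
  have hcT : ∀ l, l + 1 < ht δ → tau D Q β (o + l) ∈ Subalgebra.centralizer k {E} := fun l hl =>
    (Subalgebra.mem_centralizer_iff k).2 fun g hg => by
      obtain rfl := Set.mem_singleton_iff.1 hg
      refine (tau_commute_eP _ _ fun hl' ν => ?_).eq.symm
      exact ⟨fun ⟨μ, hμ⟩ => ⟨_, (Seq.match_swap_iff hl hl').1 hμ⟩,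
        fun ⟨μ, hμ⟩ => ⟨_, hμ.swap hl hl'⟩⟩
  let zE : Seq δ → Subalgebra.centralizer k {E} := fun μ => ⟨_, hcE (Seq.Match o μ)⟩
  let zX : Fin (ht δ) → Subalgebra.centralizer k {E} := fun j => ⟨_, hcX (o + j)⟩
  let zT : (l : ℕ) → l + 1 < ht δ → Subalgebra.centralizer k {E} := fun l hl => ⟨_, hcT l hl⟩
  let c := toCorner (k := k) he
  -- E kills e(ν) unless the block of ν has weight δ, so an equation in the corner only needs
  -- checking on the e(ν) that match some μ. There each relation becomes the relation of R(β)
  -- shifted by o.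
  have key : ∀ z z' : Subalgebra.centralizer k {E},
      (∀ (ν : Seq β) (μ : Seq δ), Seq.Match o μ ν → z.1 * e D Q ν = z'.1 * e D Q ν) →
      c z = c z' := by
    intro z z' hz
    apply cornerVal_injective (k := k) he
    rw [cornerVal_toCorner, cornerVal_toCorner]
    refine eq_of_mul_e fun ν => ?_
    have h0 : E * e D Q ν = if ∃ μ : Seq δ, Seq.Match o μ ν then e D Q ν else 0 :=
      (eP_mul_e _ ν).trans (by congr)
    rw [mul_assoc, mul_assoc, h0]
    split_ifs with h1
    · obtain ⟨μ, hμ⟩ := h1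
      exact hz ν μ hμ
    · simp
  have zE_e : ∀ μ ν, (zE μ).1 * e D Q ν = if Seq.Match o μ ν then e D Q ν else 0 := fun μ ν =>
    eP_mul_e _ _
  have zX_e : ∀ j, (zX j).1 = x D Q ⟨o + j, by omega⟩ := fun j => xN_eq _
  have zT_e : ∀ l hl, (zT l hl).1 = τ D Q (o + l) (by omega) := fun l hl => tau_eq _ _
  have coeX : ∀ {n : ℕ} (q : MvPolynomial (Fin n) k) (a : Fin n → Subalgebra.centralizer k {E}),
      (evalOrd q a).1 = evalOrd q fun i => (a i).1 := fun q a =>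
    map_evalOrd (Subalgebra.centralizer k {E}).val q a
  have hν : ∀ {μ : Seq δ} {ν : Seq β}, Seq.Match o μ ν → ∀ (j : ℕ) (hj : j < ht δ),
      μ ⟨j, hj⟩ = ν ⟨o + j, by omega⟩ := fun h1 j hj => (h1 j hj _).symm
  have hswap : ∀ (l : ℕ) (hl : l + 1 < ht δ) (j : Fin (ht δ)) h1 h2 h3,
      (⟨o + (Equiv.swap (⟨l, Nat.lt_of_succ_lt hl⟩ : Fin (ht δ)) ⟨l + 1, hl⟩ j).1, h1⟩ :
        Fin (ht β)) = Equiv.swap ⟨o + l, h2⟩ ⟨o + l + 1, h3⟩ ⟨o + j.1, by omega⟩ := by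
    intro l hl j h1 h2 h3
    rw [Fin.ext_iff]
    simp only [Equiv.swap_apply_def, Fin.ext_iff]
    split_ifs <;> (try simp only at *) <;> omega
  have hrel : ∀ a b, Rel D Q δ (fun μ => c (zE μ)) (fun j => c (zX j))
      (fun l hl => c (zT l hl)) a b → a = b := by
    intro a b hab
    cases hab with
    | e_e μ μ' =>
      rw [← map_mul, show (if μ = μ' then c (zE μ) else 0) = c (if μ = μ' then zE μ else 0) by
        split_ifs <;> simp]
      refine key _ _ fun ν μ₀ hμ₀ => ?_
      change (zE μ).1 * (zE μ').1 * _ = _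
      rw [mul_assoc, zE_e]
      by_cases h1 : Seq.Match o μ' ν
      · rw [if_pos h1, zE_e]
        by_cases h2 : Seq.Match o μ ν
        · rw [if_pos h2, if_pos (h2.unique h h1), zE_e, if_pos h2]
        · rw [if_neg h2, if_neg (fun h3 => h2 (by rwa [h3]))]
          simp
      · rw [if_neg h1, mul_zero]
        split_ifs with h3
        · rw [zE_e, if_neg (by rwa [h3])]
        · simp
    | e_sum =>
      rw [← map_sum, ← map_one c]
      refine key _ _ fun ν μ₀ hμ₀ => ?_
      have h1 : (∑ μ, zE μ : Subalgebra.centralizer k {E}).1 = ∑ μ, (zE μ).1 :=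
        map_sum (Subalgebra.centralizer k {E}).val _ _
      rw [h1, Finset.sum_mul, Finset.sum_eq_single μ₀]
      · rw [zE_e, if_pos hμ₀]
        exact (one_mul _).symm
      · intro μ _ hμ
        rw [zE_e, if_neg fun h2 => hμ (h2.unique h hμ₀)]
      · simp
    | x_e j μ =>
      rw [← map_mul, ← map_mul]
      congr 1
      exact Subtype.ext (xN_commute_eP _ _).eq
    | x_x j l =>
      rw [← map_mul, ← map_mul]
      congr 1
      exact Subtype.ext (xN_comm _ _).eq
    | τ_e l hl μ =>
      rw [← map_mul, ← map_mul]
      congr 1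
      refine Subtype.ext ?_
      change tau D Q β (o + l) * eP D Q _ = eP D Q _ * tau D Q β (o + l)
      rw [tau_mul_eP (o + l) (by omega)]
      simp only [Seq.match_swap_iff hl]
    | τ_τ j l hj hl hjl =>
      rw [← map_mul, ← map_mul]
      congr 1
      exact Subtype.ext (tau_comm (by omega)).eq
    | τ_sq l hl μ =>
      rw [← comp_two, ← map_evalOrd, ← map_mul, ← map_mul, ← map_mul]
      refine key _ _ fun ν μ₀ hμ₀ => ?_
      rw [Subalgebra.coe_mul, Subalgebra.coe_mul, Subalgebra.coe_mul, mul_assoc, zE_e,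
        mul_assoc (Subtype.val (evalOrd _ _)), zE_e]
      split_ifs with h1
      swap
      · simp
      rw [zT_e l hl, rel (.τ_sq (o + l) (by omega) ν), coeX, hν h1, hν h1]
      congr 2
      funext i
      fin_cases i
      · exact (zX_e ⟨l, by omega⟩).symm
      · exact (zX_e ⟨l + 1, hl⟩).symm
    | τ_x l hl j μ =>
      rw [← map_mul, ← map_mul, ← map_sub, ← map_mul]
      have h0 : (if μ ⟨l, by omega⟩ = μ ⟨l + 1, hl⟩ then
          (if j.1 = l then - c (zE μ) else if j.1 = l + 1 then c (zE μ) else 0) else 0) =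
          c (if μ ⟨l, by omega⟩ = μ ⟨l + 1, hl⟩ then
          (if j.1 = l then - zE μ else if j.1 = l + 1 then zE μ else 0) else 0) := by
        split_ifs <;> simp
      rw [h0]
      refine key _ _ fun ν μ₀ hμ₀ => ?_
      have hr := rel (.τ_x (D := D) (Q := Q) (e := e D Q) (x := x D Q) (τ := τ D Q) (o + l)
        (by omega) ⟨o + j.1, by omega⟩ ν)
      rw [Subalgebra.coe_mul, Subalgebra.coe_sub, Subalgebra.coe_mul, Subalgebra.coe_mul,
        mul_assoc, zE_e]
      by_cases h1 : Seq.Match o μ ν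
      · rw [if_pos h1, zT_e l hl, zX_e, zX_e, hswap l hl j _ (by omega) (by omega), hr, hν h1, hν h1]
        simp only [Nat.add_assoc, Nat.add_left_cancel_iff]
        split_ifs
        · rw [Subalgebra.coe_neg, neg_mul, zE_e, if_pos h1]
        · rw [zE_e, if_pos h1]
        · exact (zero_mul _).symm
        · exact (zero_mul _).symm
      · rw [if_neg h1, mul_zero]
        split_ifs
        · rw [Subalgebra.coe_neg, neg_mul, zE_e, if_neg h1, neg_zero]
        · rw [zE_e, if_neg h1]
        · exact (zero_mul _).symm
        · exact (zero_mul _).symm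
    | braid l hl μ =>
      rw [← comp_three, ← map_evalOrd]
      have h0 : (if μ ⟨l, by omega⟩ = μ ⟨l + 2, hl⟩ then
          c (evalOrd (divDiff (Q.poly (μ ⟨l, by omega⟩) (μ ⟨l + 1, by omega⟩)))
            ![zX ⟨l, by omega⟩, zX ⟨l + 1, by omega⟩, zX ⟨l + 2, hl⟩]) * c (zE μ)
        else 0) = c (if μ ⟨l, by omega⟩ = μ ⟨l + 2, hl⟩ then
          (evalOrd (divDiff (Q.poly (μ ⟨l, by omega⟩) (μ ⟨l + 1, by omega⟩)))
            ![zX ⟨l, by omega⟩, zX ⟨l + 1, by omega⟩, zX ⟨l + 2, hl⟩]) * zE μ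
        else 0) := by
        split_ifs <;> simp
      rw [h0]
      simp only [← map_mul, ← map_sub]
      refine key _ _ fun ν μ₀ hμ₀ => ?_
      have hr := rel (.braid (D := D) (Q := Q) (e := e D Q) (x := x D Q) (τ := τ D Q) (o + l)
        (by omega) ν)
      simp only [Subalgebra.coe_mul, Subalgebra.coe_sub]
      rw [mul_assoc, zE_e]
      by_cases h1 : Seq.Match o μ ν
      · rw [if_pos h1, zT_e l (by omega), zT_e (l + 1) hl]
        refine hr.trans ?_
        rw [hν h1, hν h1, hν h1]
        split_ifs with h2 h3 h3
        · rw [Subalgebra.coe_mul, mul_assoc, zE_e, if_pos h1, coeX]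
          congr 2
          funext i
          fin_cases i
          · exact (zX_e ⟨l, by omega⟩).symm
          · exact (zX_e ⟨l + 1, by omega⟩).symm
          · exact (zX_e ⟨l + 2, hl⟩).symm
        · exact absurd h2 h3
        · exact absurd h3 h2
        · exact (zero_mul _).symm
      · rw [if_neg h1, mul_zero]
        split_ifs
        · rw [Subalgebra.coe_mul, mul_assoc, zE_e, if_neg h1, mul_zero]
        · exact (zero_mul _).symm
  obtain ⟨f, fe, fx, fτ⟩ := exists_lift (D := D) (Q := Q) (β := δ) _ _ _ hrel
  refine ⟨cornerVal (k := k) he ∘ₗ f.toLinearMap, fun a b => ?_, ?_, fun μ => ?_, fun j => ?_,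
    fun l hl => ?_⟩
  · simp only [LinearMap.comp_apply, AlgHom.toLinearMap_apply, map_mul, cornerVal_mul]
  · simp only [LinearMap.comp_apply, AlgHom.toLinearMap_apply, map_one, cornerVal_one]
  · simp only [LinearMap.comp_apply, AlgHom.toLinearMap_apply, fe]
    exact eP_mul_of_imp fun ν hν => ⟨μ, hν⟩
  · simp only [LinearMap.comp_apply, AlgHom.toLinearMap_apply, fx]
    rfl
  · simp only [LinearMap.comp_apply, AlgHom.toLinearMap_apply, fτ]
    rfl

end R

end

section

variable {I : Type w} {P : Type p} [AddCommGroup P] {k : Type u} [Field k]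
  {D : CartanDatum I P} {Q : QPoly D k} {β γ γ' δ δ' : I →₀ ℕ}

/-! ### Block embeddings: nesting, gradings and commutation of disjoint blocks. -/

namespace R

variable (D Q β δ) in
/-- The (nonunital) embedding of `R(δ)` in `R(β)` acting on the positions from `o` on. -/
def blk (o : ℕ) : R D Q δ →ₗ[k] R D Q β :=
  if h : o + ht δ ≤ ht β then (exists_blk o h).choose else 0

theorem blk_spec {o : ℕ} (h : o + ht δ ≤ ht β) :
    (∀ a b, blk D Q β δ o (a * b) = blk D Q β δ o a * blk D Q β δ o b) ∧
    blk D Q β δ o 1 = blkE D Q β δ o ∧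
    (∀ μ, blk D Q β δ o (e D Q μ) = eP D Q (Seq.Match o μ)) ∧
    (∀ j : Fin (ht δ), blk D Q β δ o (x D Q j) = xN D Q β (o + j) * blkE D Q β δ o) ∧
    ∀ l hl, blk D Q β δ o (τ D Q l hl) = tau D Q β (o + l) * blkE D Q β δ o := by
  rw [blk, dif_pos h]
  exact (exists_blk o h).choose_spec

section

variable {o : ℕ} (h : o + ht δ ≤ ht β)
include h

theorem blk_mul (a b : R D Q δ) :
    blk D Q β δ o (a * b) = blk D Q β δ o a * blk D Q β δ o b := (blk_spec h).1 a b

theorem blk_one : blk D Q β δ o 1 = blkE D Q β δ o := (blk_spec h).2.1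

theorem blk_e (μ : Seq δ) : blk D Q β δ o (e D Q μ) = eP D Q (Seq.Match o μ) :=
  (blk_spec h).2.2.1 μ

theorem blk_x (j : Fin (ht δ)) :
    blk D Q β δ o (x D Q j) = xN D Q β (o + j) * blkE D Q β δ o := (blk_spec h).2.2.2.1 j

theorem blk_τ (l : ℕ) (hl : l + 1 < ht δ) :
    blk D Q β δ o (τ D Q l hl) = tau D Q β (o + l) * blkE D Q β δ o := (blk_spec h).2.2.2.2 l hl

theorem blk_algebraMap (c : k) : blk D Q β δ o (algebraMap k _ c) = c • blkE D Q β δ o := by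
  rw [Algebra.algebraMap_eq_smul_one, map_smul, blk_one h]

theorem blk_eP (S : Seq δ → Prop) :
    blk D Q β δ o (eP D Q S) = eP D Q fun ν => ∃ μ, S μ ∧ Seq.Match o μ ν := by
  rw [eP, map_sum]
  simp only [blk_e h]
  refine eq_of_mul_e fun ν => ?_
  rw [Finset.sum_mul, eP_mul_e]
  simp only [eP_mul_e]
  by_cases h1 : ∃ μ, S μ ∧ Seq.Match o μ ν
  · rw [if_pos h1]
    obtain ⟨μ, hS, hμ⟩ := h1
    rw [Finset.sum_eq_single μ]
    · rw [if_pos hμ]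
    · intro μ' _ hne
      rw [if_neg fun h2 => hne (h2.unique h hμ)]
    · intro h2
      exact absurd (Finset.mem_filter.2 ⟨Finset.mem_univ _, hS⟩) h2
  · rw [if_neg h1]
    refine Finset.sum_eq_zero fun μ hμ => if_neg fun h2 => h1 ⟨μ, (Finset.mem_filter.1 hμ).2, h2⟩

theorem blk_x_mul_e (j : Fin (ht δ)) (μ : Seq δ) :
    blk D Q β δ o (x D Q j * e D Q μ) = xN D Q β (o + j) * eP D Q (Seq.Match o μ) := by
  rw [blk_mul h, blk_x h, blk_e h, mul_assoc, blkE, mul_eP_of_imp fun ν hν => ⟨μ, hν⟩]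

theorem blk_τ_mul_e (l : ℕ) (hl : l + 1 < ht δ) (μ : Seq δ) :
    blk D Q β δ o (τ D Q l hl * e D Q μ) = tau D Q β (o + l) * eP D Q (Seq.Match o μ) := by
  rw [blk_mul h, blk_τ h, blk_e h, mul_assoc, blkE, mul_eP_of_imp fun ν hν => ⟨μ, hν⟩]

theorem commute_blk {y : R D Q β} (he : ∀ μ : Seq δ, Commute (eP D Q (Seq.Match o μ)) y)
    (hx : ∀ j < ht δ, Commute (xN D Q β (o + j)) y)
    (hτ : ∀ l, l + 1 < ht δ → Commute (tau D Q β (o + l)) y) (a : R D Q δ) :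
    Commute (blk D Q β δ o a) y := by
  have hE : Commute (blkE D Q β δ o) y := by
    rw [← blk_one h, ← sum_e, map_sum]
    simp only [blk_e h]
    exact Commute.sum_left _ _ _ fun μ _ => he μ
  induction a using R.induction with
  | he ν => rw [blk_e h]; exact he ν
  | hx j => rw [blk_x h]; exact (hx j j.2).mul_left hE
  | hτ l hl => rw [blk_τ h]; exact (hτ l hl).mul_left hE
  | halg c => rw [blk_algebraMap h]; exact hE.smul_left c
  | hmul a b ha hb => rw [blk_mul h]; exact ha.mul_left hb
  | hadd a b ha hb => rw [map_add]; exact ha.add_left hb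

/-- Operations inside a smaller window permute the entries of the larger one without changing its
total weight. -/
theorem blkE_commute_blk {o' : ℕ} (h' : o ≤ o') (h'' : o' + ht δ' ≤ o + ht δ) (a : R D Q δ') :
    Commute (blk D Q β δ' o' a) (blkE D Q β δ o) := by
  refine commute_blk (by omega) (fun μ => eP_commute _ _) (fun j hj => xN_commute_eP _ _)
    (fun l hl => tau_commute_eP _ _ fun hl' ν => ?_) a
  obtain ⟨l', hl'⟩ := Nat.exists_eq_add_of_le (show o ≤ o' + l by omega)
  simp only [hl']
  exact ⟨fun ⟨μ, hμ⟩ => ⟨_, (Seq.match_swap_iff (l := l') (by omega) (by omega)).1 hμ⟩,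
    fun ⟨μ, hμ⟩ => ⟨_, hμ.swap (by omega) (by omega)⟩⟩

/-- The outer idempotent has to remain as a factor: a direct embedding of the inner block fixes only
the inner weight, while the composite also prescribes the weight of the outer window. -/
theorem blk_blk {o' : ℕ} (h' : o' + ht δ' ≤ ht δ) (a : R D Q δ') :
    blk D Q β δ o (blk D Q δ δ' o' a) = blk D Q β δ' (o + o') a * blkE D Q β δ o := by
  have h3 : o + o' + ht δ' ≤ ht β := by omega
  have key : ∀ (μ' : Seq δ') (ν : Seq β), (∃ μ : Seq δ, Seq.Match o' μ' μ ∧ Seq.Match o μ ν) ↔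
      Seq.Match (o + o') μ' ν ∧ ∃ μ : Seq δ, Seq.Match o μ ν := by
    refine fun μ' ν => ⟨fun ⟨μ, h1, h2⟩ => ⟨fun j hj hj' => ?_, μ, h2⟩,
      fun ⟨h1, μ, h2⟩ => ⟨μ, fun j hj hj' => ?_, h2⟩⟩
    · rw [← h1 j hj (by omega), ← h2 (o' + j) (by omega) (by omega)]
      simp only [Nat.add_assoc]
    · rw [← h1 j hj (by omega), ← h2 (o' + j) (by omega) (by omega)]
      simp only [Nat.add_assoc]
  have hE : blk D Q β δ o (blkE D Q δ δ' o') = blkE D Q β δ' (o + o') * blkE D Q β δ o := by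
    rw [blkE, blk_eP h, blkE, blkE, eP_mul_eP]
    congr 1
    funext ν
    refine propext ⟨fun ⟨μ, ⟨μ', h1⟩, h2⟩ => ?_, fun ⟨⟨μ', h1⟩, h2⟩ => ?_⟩
    · have := (key μ' ν).1 ⟨μ, h1, h2⟩
      exact ⟨⟨μ', this.1⟩, this.2⟩
    · obtain ⟨μ, h3, h4⟩ := (key μ' ν).2 ⟨h1, h2⟩
      exact ⟨μ, ⟨μ', h3⟩, h4⟩
  have hEE : blkE D Q β δ o * blkE D Q β δ o = blkE D Q β δ o := blkE_idem o
  have hx' : ∀ j < ht δ, blk D Q β δ o (xN D Q δ j) = xN D Q β (o + j) * blkE D Q β δ o :=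
    fun j hj => by rw [xN_eq hj, blk_x h]
  have ht' : ∀ l, l + 1 < ht δ → blk D Q β δ o (tau D Q δ l) =
      tau D Q β (o + l) * blkE D Q β δ o := fun l hl => by rw [tau_eq _ hl, blk_τ h]
  have hcomm : Commute (blkE D Q β δ' (o + o')) (blkE D Q β δ o) := eP_commute _ _
  induction a using R.induction with
  | he μ =>
    rw [blk_e h', blk_e h3, blk_eP h, blkE, eP_mul_eP]
    congr 1
    funext ν
    exact propext (key μ ν)
  | hx j =>
    rw [blk_x h', blk_mul h, hx' _ (by omega), hE, hcomm.eq, mul_assoc, ← mul_assoc (blkE D Q β δ o),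
      hEE, blk_x h3, ← hcomm.eq, Nat.add_assoc, mul_assoc]
  | hτ l hl =>
    rw [blk_τ h', blk_mul h, ht' _ (by omega), hE, hcomm.eq, mul_assoc, ← mul_assoc (blkE D Q β δ o),
      hEE, blk_τ h3, ← hcomm.eq, Nat.add_assoc, mul_assoc]
  | halg c => rw [blk_algebraMap h', map_smul, hE, blk_algebraMap h3, smul_mul_assoc]
  | hmul a b ha hb =>
    rw [blk_mul h', blk_mul h, ha, hb, blk_mul h3, mul_assoc, ← mul_assoc (blkE D Q β δ o),
      ← (blkE_commute_blk h (by omega) (by omega) b).eq, mul_assoc, hEE, mul_assoc]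
  | hadd a b ha hb => simp only [map_add, ha, hb, add_mul]

/-- The degrees of x and τ depend only on the colours at the positions involved, and a block copies
these colours. -/
theorem blk_mem_grading {c : ℤ} {a : R D Q δ} (ha : a ∈ grading D Q δ c) :
    blk D Q β δ o a ∈ grading D Q β c := by
  induction ha using Submodule.span_induction with
  | mem a ha =>
    change IsMonomial D Q a c at ha
    induction ha with
    | e μ =>
      rw [blk_e h]
      exact Submodule.sum_mem _ fun ν _ => Submodule.subset_span (.e ν)
    | x j μ =>
      rw [blk_x_mul_e h, eP, Finset.mul_sum, xN_eq (by omega)]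
      refine Submodule.sum_mem _ fun ν hν => ?_
      have hm := (Finset.mem_filter.1 hν).2
      have : degX D j μ = degX D ⟨o + j, by omega⟩ ν := by
        rw [degX, degX, ← hm j j.2]
      rw [this]
      exact Submodule.subset_span (.x _ ν)
    | τ l hl μ =>
      rw [blk_τ_mul_e h, eP, Finset.mul_sum, tau_eq _ (show o + l + 1 < ht β by omega)]
      refine Submodule.sum_mem _ fun ν hν => ?_
      have hm := (Finset.mem_filter.1 hν).2
      have : degT D l hl μ = degT D (o + l) (by omega) ν := by
        rw [degT, degT, ← hm l (by omega) (by omega), ← hm (l + 1) hl (by omega)]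
        rfl
      rw [this]
      exact Submodule.subset_span (.τ _ _ ν)
    | mul a b c d _ _ ha hb => rw [blk_mul h]; exact mul_mem_grading ha hb
  | zero => rw [map_zero]; exact Submodule.zero_mem _
  | add a b _ _ ha hb => rw [map_add]; exact Submodule.add_mem _ ha hb
  | smul t a _ ha => rw [map_smul]; exact Submodule.smul_mem _ t ha

end

/-- Commutation is reduced to generators of both blocks. Letters τ of one block are at distance at
least two from those of the other, because neither block contains the letter that crosses between
them. -/
theorem blk_commute {o o' : ℕ} (h : o + ht δ ≤ o') (h' : o' + ht δ' ≤ ht β) (a : R D Q δ)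
    (b : R D Q δ') : Commute (blk D Q β δ o a) (blk D Q β δ' o' b) := by
  have hE : ∀ l, l + 1 < o' ∨ o' + ht δ' ≤ l → ∀ μ : Seq δ',
      Commute (tau D Q β l) (eP D Q (Seq.Match o' μ)) := fun l hl μ =>
    tau_commute_eP _ _ fun hl' ν => Seq.match_swap_far_iff hl' hl
  refine (commute_blk h' (fun μ => ?_) (fun j hj => ?_) (fun l hl => ?_) b).symm
  · refine (commute_blk (by omega) (fun _ => eP_commute _ _) (fun _ _ => xN_commute_eP _ _)
      (fun l hl => hE _ (by omega) _) a).symm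
  · refine (commute_blk (by omega) (fun _ => (xN_commute_eP _ _).symm) (fun _ _ => xN_comm _ _)
      (fun l hl => tau_commute_xN (by omega) (by omega)) a).symm
  · refine (commute_blk (by omega) (fun μ => ?_) (fun j hj => ?_)
      (fun l' hl' => tau_comm (by omega)) a).symm
    · exact (tau_commute_eP _ _ fun hl' ν => Seq.match_swap_far_iff hl' (by omega)).symm
    · exact (tau_commute_xN (by omega) (by omega)).symm

theorem blkE_left (h : γ + γ' = β) : blkE D Q β γ 0 = eSplit D Q β γ γ' := by
  rw [blkE, eP, eSplit]
  refine Finset.sum_congr ?_ fun _ _ => rfl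
  ext ν
  simp only [Finset.mem_filter, Finset.mem_univ, true_and]
  refine ⟨fun ⟨μ, hμ⟩ => ⟨μ, hμ.exists_right h⟩, fun ⟨μ, μ', hμ⟩ => ⟨μ, ?_⟩⟩
  exact ((Seq.isConcat_iff (Seq.ht_add h)).1 hμ).1

theorem blkE_right (h : γ + γ' = β) : blkE D Q β γ' (ht γ) = eSplit D Q β γ γ' := by
  rw [blkE, eP, eSplit]
  refine Finset.sum_congr ?_ fun _ _ => rfl
  ext ν
  simp only [Finset.mem_filter, Finset.mem_univ, true_and]
  refine ⟨fun ⟨μ', hμ⟩ => ?_, fun ⟨μ, μ', hμ⟩ => ⟨μ', ?_⟩⟩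
  · obtain ⟨μ, h1⟩ := hμ.exists_left h
    exact ⟨μ, μ', h1⟩
  · exact ((Seq.isConcat_iff (Seq.ht_add h)).1 hμ).2

variable (D Q β γ γ') in
/-- The embedding `R(γ) ⊗ R(γ') → R(β)`, for `β = γ + γ'`. -/
def incl : R D Q γ ⊗[k] R D Q γ' →ₗ[k] R D Q β :=
  LinearMap.mul' k _ ∘ₗ TensorProduct.map (blk D Q β γ 0) (blk D Q β γ' (ht γ))

theorem incl_tmul (a : R D Q γ) (b : R D Q γ') :
    incl D Q β γ γ' (a ⊗ₜ b) = blk D Q β γ 0 a * blk D Q β γ' (ht γ) b := rfl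

theorem incl_mul (h : γ + γ' = β) (z z' : R D Q γ ⊗[k] R D Q γ') :
    incl D Q β γ γ' (z * z') = incl D Q β γ γ' z * incl D Q β γ γ' z' := by
  have hh := Seq.ht_add h
  induction z with
  | zero => simp
  | add a b ha hb => simp only [add_mul, map_add, ha, hb]
  | tmul a b =>
    induction z' with
    | zero => simp
    | add a b ha hb => simp only [mul_add, map_add, ha, hb]
    | tmul a' b' =>
      rw [Algebra.TensorProduct.tmul_mul_tmul, incl_tmul, incl_tmul, incl_tmul,
        blk_mul (by omega), blk_mul (by omega)]
      have := (blk_commute (by omega) hh.le a' b :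
        Commute (blk D Q β γ 0 a') (blk D Q β γ' (ht γ) b)).eq
      simp only [mul_assoc]
      rw [← mul_assoc (blk D Q β γ 0 a') (blk D Q β γ' (ht γ) b), this, mul_assoc]

theorem incl_one (h : γ + γ' = β) : incl D Q β γ γ' 1 = eSplit D Q β γ γ' := by
  have hh := Seq.ht_add h
  rw [Algebra.TensorProduct.one_def, incl_tmul, blk_one (by omega), blk_one (by omega),
    blkE_right h, ← blkE_left h]
  exact blkE_idem 0

theorem eSplit_mul_incl (h : γ + γ' = β) (z : R D Q γ ⊗[k] R D Q γ') :
    eSplit D Q β γ γ' * incl D Q β γ γ' z = incl D Q β γ γ' z := by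
  rw [← incl_one h, ← incl_mul h, one_mul]

theorem incl_mul_eSplit (h : γ + γ' = β) (z : R D Q γ ⊗[k] R D Q γ') :
    incl D Q β γ γ' z * eSplit D Q β γ γ' = incl D Q β γ γ' z := by
  rw [← incl_one h, ← incl_mul h, mul_one]

theorem incl_e (hh : ht γ + ht γ' = ht β) {ν : Seq β} {μ : Seq γ} {μ' : Seq γ'}
    (hν : ν.IsConcat μ μ') : eP D Q (Seq.Match 0 μ) * eP D Q (Seq.Match (ht γ) μ') = e D Q ν := by
  rw [eP_mul_eP, ← eP_eq]
  congr 1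
  funext ν'
  rw [← Seq.isConcat_iff hh]
  exact propext ⟨fun h => h.unique hν, fun h => h ▸ hν⟩

/-- This identifies the relation on generators from which the convolution product was built with an
actual multiplicative map, so that the balanced relation can be extended beyond generators. -/
theorem incl_embGen {a : R D Q γ} {b : R D Q γ'} {c : R D Q β} (h : EmbGen D Q β γ γ' a b c) :
    incl D Q β γ γ' (a ⊗ₜ b) = c := by
  cases h with
  | e h =>
    have hh := h.length.symm
    rw [incl_tmul, blk_e (by omega), blk_e (by omega), incl_e hh h]
  | x_left h j i hij =>
    have hh := h.length.symm
    rw [incl_tmul, blk_x_mul_e (by omega), blk_e (by omega), mul_assoc, incl_e hh h,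
      xN_eq (by omega)]
    congr 2
    exact Fin.ext (by simp [hij])
  | x_right h j i hij =>
    have hh := h.length.symm
    rw [incl_tmul, blk_x_mul_e (by omega), blk_e (by omega), ← mul_assoc,
      ← (xN_commute_eP _ _).eq, mul_assoc, incl_e hh h, xN_eq (by omega)]
    congr 2
    exact Fin.ext (by simp [hij])
  | τ_left h l hl hl' =>
    have hh := h.length.symm
    rw [incl_tmul, blk_τ_mul_e (by omega), blk_e (by omega), mul_assoc, incl_e hh h]
    simp only [Nat.zero_add]
    rw [tau_eq]
  | τ_right h l hl hl' =>
    have hh := h.length.symm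
    rw [incl_tmul, blk_τ_mul_e (by omega), blk_e (by omega), ← mul_assoc,
      ← (tau_commute_eP _ _ fun hl' ν => Seq.match_swap_far_iff hl' (by omega)).eq, mul_assoc,
      incl_e hh h, tau_eq]

end R

end

section

variable {I : Type w} {P : Type p} [AddCommGroup P] {k : Type u} [Field k]
  {D : CartanDatum I P} {Q : QPoly D k} {β γ γ' δ δ' : I →₀ ℕ}

theorem exists_sum_of_mem_span {ι A σ : Type*} [Fintype ι] [Ring A] [Algebra k A] (y : ι → A)
    (ρ : MvPolynomial σ k →ₐ[k] A) (e : A) {r : A}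
    (h : r ∈ Submodule.span k {z | ∃ i f, z = y i * ρ f * e}) :
    ∃ F : ι → MvPolynomial σ k, r = ∑ i, y i * ρ (F i) * e := by
  induction h using Submodule.span_induction with
  | mem r h =>
    obtain ⟨i, f, rfl⟩ := h
    refine ⟨Pi.single i f, ?_⟩
    rw [Finset.sum_eq_single i]
    · simp
    · intro j _ hj
      simp [Pi.single_eq_of_ne hj]
    · simp
  | zero => exact ⟨0, by simp⟩
  | add a b _ _ ha hb =>
    obtain ⟨F, rfl⟩ := ha
    obtain ⟨G, rfl⟩ := hb
    exact ⟨F + G, by simp [mul_add, add_mul, Finset.sum_add_distrib]⟩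
  | smul c a _ ha =>
    obtain ⟨F, rfl⟩ := ha
    exact ⟨c • F, by simp [Finset.smul_sum]⟩

namespace R

theorem exists_sum_permWords (a : R D Q β) (ν : Seq β) :
    ∃ F : Fin (permWords (ht β)).length → MvPolynomial (Fin (ht β)) k, a * e D Q ν =
      ∑ i, wordProd (tau D Q β) ((permWords (ht β)).get i) * pol D Q β (F i) * e D Q ν := by
  apply exists_sum_of_mem_span
  have := braidLike.lowAlg_mem_permSpan (ht β) (s := a) (lowAlg_eq_top (D := D) (Q := Q) ▸ Algebra.mem_top)
  rw [wordSpan] at this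
  induction this using Submodule.span_induction with
  | mem a h =>
    obtain ⟨u, hu, z, hz, rfl⟩ := h
    obtain ⟨q, hq⟩ := exists_pol hz ν
    obtain ⟨i, hi, rfl⟩ := List.mem_iff_get.1 hu
    exact Submodule.subset_span ⟨i, q, by rw [mul_assoc, hq, mul_assoc]⟩
  | zero => rw [zero_mul]; exact Submodule.zero_mem _
  | add a b _ _ ha hb => rw [add_mul]; exact Submodule.add_mem _ ha hb
  | smul c a _ ha => rw [smul_mul_assoc]; exact Submodule.smul_mem _ c ha

/-! ### `R(β) e(γ,γ')` is a free right module over `R(γ) ⊗ R(γ')` -/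

variable (D Q γ γ') in
/-- The variable `x_j` of `R(γ) ⊗ R(γ')`. -/
def xT (j : ℕ) : R D Q γ ⊗[k] R D Q γ' :=
  if j < ht γ then xN D Q γ j ⊗ₜ 1 else 1 ⊗ₜ xN D Q γ' (j - ht γ)

theorem xT_comm (i j : ℕ) : Commute (xT D Q γ γ' i) (xT D Q γ γ' j) := by
  rw [xT, xT, Commute, SemiconjBy]
  split_ifs <;> simp only [Algebra.TensorProduct.tmul_mul_tmul, one_mul, mul_one, (xN_comm i j).eq,
    (xN_comm (i - ht γ) (j - ht γ)).eq]

variable (D Q β γ γ') in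
/-- Polynomials in the variables of `R(γ) ⊗ R(γ')`. -/
def polT : MvPolynomial (Fin (ht β)) k →ₐ[k] R D Q γ ⊗[k] R D Q γ' :=
  commEval (fun j => xT D Q γ γ' j) fun _ _ => xT_comm _ _

theorem polT_X (j : Fin (ht β)) : polT D Q β γ γ' (.X j) = xT D Q γ γ' j := commEval_X _ _ _

variable (D Q γ γ') in
/-- A word in the `τ` of `R(γ)` tensored with a word in the `τ` of `R(γ')`. -/
def wordT (i : Fin (permWords (ht γ)).length × Fin (permWords (ht γ')).length) :
    R D Q γ ⊗[k] R D Q γ' :=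
  wordProd (tau D Q γ) ((permWords (ht γ)).get i.1) ⊗ₜ
    wordProd (tau D Q γ') ((permWords (ht γ')).get i.2)

section

variable (h : γ + γ' = β)
include h

theorem incl_tmul_one (a : R D Q γ) : incl D Q β γ γ' (a ⊗ₜ 1) = blk D Q β γ 0 a := by
  have hh := Seq.ht_add h
  rw [incl_tmul, blk_one (by omega), blkE_right h, ← blkE_left h, ← blk_one (by omega),
    ← blk_mul (by omega), mul_one]

theorem incl_one_tmul (b : R D Q γ') : incl D Q β γ γ' (1 ⊗ₜ b) = blk D Q β γ' (ht γ) b := by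
  have hh := Seq.ht_add h
  rw [incl_tmul, blk_one (by omega), blkE_left h, ← blkE_right h, ← blk_one (by omega),
    ← blk_mul (by omega), one_mul]

theorem incl_xT {j : ℕ} (hj : j < ht β) :
    incl D Q β γ γ' (xT D Q γ γ' j) = xN D Q β j * eSplit D Q β γ γ' := by
  have hh := Seq.ht_add h
  rw [xT]
  split_ifs with h1
  · rw [incl_tmul_one h, xN_eq h1, blk_x (by omega), blkE_left h]
    simp only [Nat.zero_add]
  · rw [incl_one_tmul h, xN_eq (show j - ht γ < ht γ' by omega), blk_x (by omega), blkE_right h]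
    simp only [show ht γ + (j - ht γ) = j by omega]

theorem incl_polT (f : MvPolynomial (Fin (ht β)) k) :
    incl D Q β γ γ' (polT D Q β γ γ' f) = pol D Q β f * eSplit D Q β γ γ' := by
  induction f using MvPolynomial.induction_on with
  | C c =>
    rw [← MvPolynomial.algebraMap_eq, AlgHom.commutes, AlgHom.commutes,
      Algebra.algebraMap_eq_smul_one, map_smul, incl_one h, Algebra.algebraMap_eq_smul_one,
      smul_mul_assoc, one_mul]
  | add f g hf hg => simp only [map_add, hf, hg, add_mul]
  | mul_X f j hf =>
    rw [map_mul, incl_mul h, hf, mul_assoc, eSplit_mul_incl h, polT_X, incl_xT h j.2, xN_eq j.2,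
      map_mul, pol_X, mul_assoc]

/-- The expansion in permutation words for each tensor factor, with the variables of the two factors
renamed into the first ht γ and the last ht γ' of the variables of R(β). -/
theorem exists_sum_wordT (z : R D Q γ ⊗[k] R D Q γ') (μ : Seq γ) (μ' : Seq γ') :
    ∃ F : Fin (permWords (ht γ)).length × Fin (permWords (ht γ')).length →
      MvPolynomial (Fin (ht β)) k, z * (e D Q μ ⊗ₜ e D Q μ') =
      ∑ i, wordT D Q γ γ' i * polT D Q β γ γ' (F i) * (e D Q μ ⊗ₜ e D Q μ') := by
  have hh := Seq.ht_add h
  have h1 : ∀ f, polT D Q β γ γ' (MvPolynomial.rename (Fin.castLE (by omega)) f) =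
      pol D Q γ f ⊗ₜ 1 := by
    intro f
    refine DFunLike.congr_fun (f := (polT D Q β γ γ').comp (MvPolynomial.rename _))
      (g := Algebra.TensorProduct.includeLeft.comp (pol D Q γ))
      (MvPolynomial.algHom_ext fun j => ?_) f
    simp [polT_X, pol_X, xT, xN_eq]
  have h2 : ∀ f, polT D Q β γ γ' (MvPolynomial.rename (fun j : Fin (ht γ') =>
      (⟨ht γ + j.1, by omega⟩ : Fin (ht β))) f) = 1 ⊗ₜ pol D Q γ' f := by
    intro f
    refine DFunLike.congr_fun (f := (polT D Q β γ γ').comp (MvPolynomial.rename _))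
      (g := Algebra.TensorProduct.includeRight.comp (pol D Q γ'))
      (MvPolynomial.algHom_ext fun j => ?_) f
    simp [polT_X, pol_X, xT, xN_eq]
  induction z with
  | zero => exact ⟨0, by simp⟩
  | add a b ha hb =>
    obtain ⟨F, hF⟩ := ha
    obtain ⟨G, hG⟩ := hb
    exact ⟨F + G, by simp [mul_add, add_mul, Finset.sum_add_distrib, hF, hG]⟩
  | tmul a b =>
    obtain ⟨F, hF⟩ := exists_sum_permWords a μ
    obtain ⟨G, hG⟩ := exists_sum_permWords b μ'
    refine ⟨fun i => MvPolynomial.rename (Fin.castLE (by omega)) (F i.1) *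
      MvPolynomial.rename (fun j : Fin (ht γ') => (⟨ht γ + j.1, by omega⟩ : Fin (ht β))) (G i.2), ?_⟩
    rw [Algebra.TensorProduct.tmul_mul_tmul, hF, hG, TensorProduct.sum_tmul, Fintype.sum_prod_type]
    refine Finset.sum_congr rfl fun i _ => ?_
    rw [TensorProduct.tmul_sum]
    refine Finset.sum_congr rfl fun j _ => ?_
    rw [map_mul, h1, h2, wordT]
    simp only [Algebra.TensorProduct.tmul_mul_tmul, one_mul, mul_one]

end

variable (D Q β γ γ') in
/-- The map `(b_u) ↦ ∑ τ_u b_u`, the sum being over the words of shuffles. -/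
def shuffleSum : (Fin (shuffleWords (ht γ) (ht γ')).length → R D Q γ ⊗[k] R D Q γ') →ₗ[k]
    R D Q β :=
  ∑ u, LinearMap.mulLeft k (wordProd (tau D Q β) ((shuffleWords (ht γ) (ht γ')).get u)) ∘ₗ
    incl D Q β γ γ' ∘ₗ LinearMap.proj u

theorem shuffleSum_apply (b : Fin (shuffleWords (ht γ) (ht γ')).length → R D Q γ ⊗[k] R D Q γ') :
    shuffleSum D Q β γ γ' b = ∑ u, wordProd (tau D Q β) ((shuffleWords (ht γ) (ht γ')).get u) *
      incl D Q β γ γ' (b u) := by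
  simp [shuffleSum]

section

variable (h : γ + γ' = β)
include h

theorem shuffleSum_mul (b : Fin (shuffleWords (ht γ) (ht γ')).length → R D Q γ ⊗[k] R D Q γ')
    (z : R D Q γ ⊗[k] R D Q γ') :
    shuffleSum D Q β γ γ' (fun u => b u * z) =
      shuffleSum D Q β γ γ' b * incl D Q β γ γ' z := by
  simp only [shuffleSum_apply, Finset.sum_mul, incl_mul h, mul_assoc]

theorem eSplit_mul_e {ν : Seq β} {μ : Seq γ} {μ' : Seq γ'} (hν : ν.IsConcat μ μ') :
    incl D Q β γ γ' (e D Q μ ⊗ₜ e D Q μ') = e D Q ν ∧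
      eSplit D Q β γ γ' * e D Q ν = e D Q ν := by
  have h1 : incl D Q β γ γ' (e D Q μ ⊗ₜ e D Q μ') = e D Q ν := incl_embGen (.e hν)
  exact ⟨h1, by rw [← h1, eSplit_mul_incl h]⟩

/-- The only letter τ_l missing from the split algebra is the one that mixes the two blocks; every
other generator, cut down by e(γ,γ'), comes from one of the tensor factors. -/
theorem mul_eSplit_of_mem_splitAlg {s : R D Q β}
    (hs : s ∈ splitAlg (polAlg D Q β) (tau D Q β) (ht β - 1) (ht γ)) :
    ∃ z, s * eSplit D Q β γ γ' = incl D Q β γ γ' z := by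
  have hh := Seq.ht_add h
  have hmul : ∀ a b, (∃ z, a * eSplit D Q β γ γ' = incl D Q β γ γ' z) →
      (∃ z, b * eSplit D Q β γ γ' = incl D Q β γ γ' z) →
      ∃ z, a * b * eSplit D Q β γ γ' = incl D Q β γ γ' z := by
    rintro a b ⟨z, hz⟩ ⟨z', hz'⟩
    exact ⟨z * z', by rw [mul_assoc, hz', ← eSplit_mul_incl h, ← mul_assoc, hz, incl_mul h]⟩
  have hadd : ∀ a b, (∃ z, a * eSplit D Q β γ γ' = incl D Q β γ γ' z) →
      (∃ z, b * eSplit D Q β γ γ' = incl D Q β γ γ' z) →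
      ∃ z, (a + b) * eSplit D Q β γ γ' = incl D Q β γ γ' z := by
    rintro a b ⟨z, hz⟩ ⟨z', hz'⟩
    exact ⟨z + z', by rw [add_mul, hz, hz', map_add]⟩
  have halg : ∀ c : k, ∃ z, algebraMap k _ c * eSplit D Q β γ γ' = incl D Q β γ γ' z := fun c =>
    ⟨c • 1, by rw [Algebra.algebraMap_eq_smul_one, smul_mul_assoc, one_mul, map_smul, incl_one h]⟩
  have hpol : ∀ f ∈ polAlg D Q β, ∃ z, f * eSplit D Q β γ γ' = incl D Q β γ γ' z := by
    intro f hf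
    induction hf using Algebra.adjoin_induction with
    | mem f hf =>
      rcases hf with ⟨ν, rfl⟩ | ⟨j, rfl⟩
      · by_cases hν : ∃ (μ : Seq γ) (μ' : Seq γ'), ν.IsConcat μ μ'
        · obtain ⟨μ, μ', hν⟩ := hν
          refine ⟨e D Q μ ⊗ₜ e D Q μ', ?_⟩
          obtain ⟨h1, h2⟩ := eSplit_mul_e (D := D) (Q := Q) h hν
          rw [← incl_mul_eSplit h, h1]
        · refine ⟨0, ?_⟩
          rw [map_zero, eSplit, Finset.mul_sum]
          refine Finset.sum_eq_zero fun ν' hν' => ?_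
          rw [e_mul_e, if_neg]
          rintro rfl
          exact hν (Finset.mem_filter.1 hν').2
      · exact ⟨xT D Q γ γ' j, by rw [incl_xT h j.2, xN_eq j.2]⟩
    | algebraMap c => exact halg c
    | add a b _ _ ha hb => exact hadd a b ha hb
    | mul a b _ _ ha hb => exact hmul a b ha hb
  induction hs using Algebra.adjoin_induction with
  | mem s hs =>
    rcases hs with hs | ⟨l, hl, hlp, rfl⟩
    · exact hpol s hs
    · by_cases h1 : l + 1 < ht γ
      · refine ⟨τ D Q l h1 ⊗ₜ 1, ?_⟩
        rw [incl_tmul_one h, blk_τ (by omega), blkE_left h]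
        simp only [Nat.zero_add]
      · refine ⟨1 ⊗ₜ τ D Q (l - ht γ) (by omega), ?_⟩
        rw [incl_one_tmul h, blk_τ (by omega), blkE_right h]
        simp only [show ht γ + (l - ht γ) = l by omega]
  | algebraMap c => exact halg c
  | add a b _ _ ha hb => exact hadd a b ha hb
  | mul a b _ _ ha hb => exact hmul a b ha hb

theorem exists_shuffleSum_eq (r : R D Q β) :
    ∃ b, shuffleSum D Q β γ γ' b = r * eSplit D Q β γ γ' := by
  have hh := Seq.ht_add h
  have hr : r ∈ lowAlg (polAlg D Q β) (tau D Q β) (ht γ + ht γ' - 1) := by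
    rw [hh, lowAlg_eq_top]
    exact Algebra.mem_top
  have := braidLike.lowAlg_mem_wordSpan hr
  clear hr
  rw [hh] at this
  induction this using Submodule.span_induction with
  | mem r hr =>
    obtain ⟨u, hu, s, hs, rfl⟩ := hr
    obtain ⟨z, hz⟩ := mul_eSplit_of_mem_splitAlg h hs
    obtain ⟨i, rfl⟩ := List.mem_iff_get.1 hu
    refine ⟨Pi.single i z, ?_⟩
    rw [shuffleSum_apply, Finset.sum_eq_single i, Pi.single_eq_same, mul_assoc, hz]
    · intro j _ hj
      rw [Pi.single_eq_of_ne hj, map_zero, mul_zero]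
    · simp
  | zero => exact ⟨0, by simp⟩
  | add a b _ _ ha hb =>
    obtain ⟨c, hc⟩ := ha
    obtain ⟨d, hd⟩ := hb
    exact ⟨c + d, by rw [map_add, hc, hd, add_mul]⟩
  | smul c a _ ha =>
    obtain ⟨d, hd⟩ := ha
    exact ⟨c • d, by rw [map_smul, hd, smul_mul_assoc]⟩

/-- Expanding the coefficients b_u in words of both tensor factors produces products of a shuffle
word with two permutation words, with polynomial coefficients. By `exists_shuffleSum_eq` these
products span R(β)e(ν) over the polynomials, and there are n! of them, so they are independent and
all polynomials vanish. This kills b_u(e(μ) ⊗ e(μ')) for all μ and μ', and these idempotents add up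
to 1. -/
theorem shuffleSum_injective : Function.Injective (shuffleSum D Q β γ γ') := by
  have hh := Seq.ht_add h
  let ι := Fin (shuffleWords (ht γ) (ht γ')).length ×
    Fin (permWords (ht γ)).length × Fin (permWords (ht γ')).length
  let y : ι → R D Q β := fun i =>
    wordProd (tau D Q β) ((shuffleWords (ht γ) (ht γ')).get i.1) *
      incl D Q β γ γ' (wordT D Q γ γ' i.2)
  have key : ∀ b (μ : Seq γ) (μ' : Seq γ') (ν : Seq β), ν.IsConcat μ μ' →
      ∃ F : ι → MvPolynomial (Fin (ht β)) k,
      (∀ u, b u * (e D Q μ ⊗ₜ e D Q μ') = ∑ i, wordT D Q γ γ' i *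
        polT D Q β γ γ' (F (u, i)) * (e D Q μ ⊗ₜ e D Q μ')) ∧
      shuffleSum D Q β γ γ' b * e D Q ν = ∑ i, y i * pol D Q β (F i) * e D Q ν := by
    intro b μ μ' ν hν
    choose F hF using fun u => exists_sum_wordT h (b u) μ μ'
    refine ⟨fun i => F i.1 i.2, hF, ?_⟩
    obtain ⟨h1, h2⟩ := eSplit_mul_e (D := D) (Q := Q) h hν
    rw [← h1, ← shuffleSum_mul h, shuffleSum_apply, Fintype.sum_prod_type]
    refine Finset.sum_congr rfl fun u _ => ?_
    rw [hF u, map_sum, Finset.mul_sum]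
    refine Finset.sum_congr rfl fun i _ => ?_
    rw [incl_mul h, incl_mul h, incl_polT h]
    simp only [y, mul_assoc]
    rw [eSplit_mul_incl h]
  -- The binomial coefficient counts the shuffles: with p = ht γ and q = ht γ', this is C(p + q, p)
  -- · p! · q! = (p + q)!.
  have hcard : Fintype.card ι = (ht β).factorial := by
    simp only [ι, Fintype.card_prod, Fintype.card_fin, length_shuffleWords, length_permWords]
    rw [← hh, ← Nat.add_choose_mul_factorial_mul_factorial, mul_assoc,
      Nat.choose_symm_add]
  rw [injective_iff_map_eq_zero]
  intro b hb
  funext u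
  have hz : ∀ (μ : Seq γ) (μ' : Seq γ'), b u * (e D Q μ ⊗ₜ e D Q μ') = 0 := by
    intro μ μ'
    obtain ⟨ν, hν⟩ := Seq.exists_isConcat h μ μ'
    obtain ⟨F, h1, h2⟩ := key b μ μ' ν hν
    rw [hb, zero_mul] at h2
    have h3 := eq_zero_of_sum_eq_zero hcard ν y (fun r => ?_) F h2.symm
    · rw [h1]
      exact Finset.sum_eq_zero fun i _ => by rw [h3 (u, i), map_zero, mul_zero, zero_mul]
    · obtain ⟨c, hc⟩ := exists_shuffleSum_eq h r
      obtain ⟨G, -, hG⟩ := key c μ μ' ν hν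
      rw [hc, mul_assoc, (eSplit_mul_e h hν).2] at hG
      rw [hG]
      exact Submodule.sum_mem _ fun i _ => Submodule.subset_span ⟨i, _, rfl⟩
  have h1 : (1 : R D Q γ ⊗[k] R D Q γ') = ∑ μ, ∑ μ', e D Q μ ⊗ₜ e D Q μ' := by
    rw [Algebra.TensorProduct.one_def, ← sum_e, ← sum_e, TensorProduct.sum_tmul]
    exact Finset.sum_congr rfl fun _ _ => TensorProduct.tmul_sum _ _ _
  rw [← mul_one (b u), h1, Finset.mul_sum]
  refine Finset.sum_eq_zero fun μ _ => ?_
  rw [Finset.mul_sum]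
  exact Finset.sum_eq_zero fun μ' _ => hz μ μ'

end

end R

end

section

variable {I : Type w} {P : Type p} [AddCommGroup P] {k : Type u} [Field k]
  {D : CartanDatum I P} {Q : QPoly D k} {β γ γ' δ δ' : I →₀ ℕ}

/-! ### The balanced relation -/

/-- The action of `R(γ) ⊗ R(γ')` on `M ⊗ N`. -/
def actT (M : GMod D Q γ) (N : GMod D Q γ') :
    R D Q γ ⊗[k] R D Q γ' →ₗ[k] Module.End k (M ⊗[k] N) :=
  TensorProduct.lift ((TensorProduct.mapBilinear (RingHom.id k) M N M N).compl₁₂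
    (Algebra.lsmul k k M).toLinearMap (Algebra.lsmul k k N).toLinearMap)

theorem actT_tmul (M : GMod D Q γ) (N : GMod D Q γ') (a : R D Q γ) (b : R D Q γ') (m : M) (n : N) :
    actT M N (a ⊗ₜ b) (m ⊗ₜ n) = (a • m) ⊗ₜ (b • n) := by
  simp [actT]

theorem actT_mul (M : GMod D Q γ) (N : GMod D Q γ') (z z' : R D Q γ ⊗[k] R D Q γ')
    (t : M ⊗[k] N) : actT M N (z * z') t = actT M N z (actT M N z' t) := by
  induction z with
  | zero => simp
  | add a b ha hb => simp only [add_mul, map_add, LinearMap.add_apply, ha, hb]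
  | tmul a b =>
  induction z' with
  | zero => simp
  | add a b ha hb => simp only [mul_add, map_add, LinearMap.add_apply, ha, hb]
  | tmul a' b' =>
  induction t with
  | zero => simp
  | add a b ha hb => simp only [map_add, ha, hb]
  | tmul m n => simp only [Algebra.TensorProduct.tmul_mul_tmul, actT_tmul, mul_smul]

theorem actT_one (M : GMod D Q γ) (N : GMod D Q γ') (t : M ⊗[k] N) : actT M N 1 t = t := by
  induction t with
  | zero => simp
  | add a b ha hb => simp only [map_add, ha, hb]
  | tmul m n => simp only [Algebra.TensorProduct.one_def, actT_tmul, one_smul]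

variable (β) in
/-- The class of `r ⊗ t` in `M ∘ N`. -/
def convMkT (M : GMod D Q γ) (N : GMod D Q γ') :
    R D Q β →ₗ[k] M ⊗[k] N →ₗ[k] ConvCarrier β M N :=
  (TensorProduct.mk k (R D Q β) (M ⊗[k] N)).compr₂
    ((Submodule.span (R D Q β) (convRel β M N)).mkQ.restrictScalars k)

theorem convMkT_tmul (M : GMod D Q γ) (N : GMod D Q γ') (r : R D Q β) (m : M) (n : N) :
    convMkT β M N r (m ⊗ₜ n) = convMk β M N r m n := rfl

theorem convMkT_induction {M : GMod D Q γ} {N : GMod D Q γ'} {C : ConvCarrier β M N → Prop}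
    (hmk : ∀ r t, C (convMkT β M N r t)) (hadd : ∀ a b, C a → C b → C (a + b))
    (z : ConvCarrier β M N) : C z := by
  obtain ⟨t, rfl⟩ := Submodule.Quotient.mk_surjective _ z
  induction t with
  | zero => simpa using hmk 0 0
  | add a b ha hb => exact hadd _ _ ha hb
  | tmul r t => exact hmk r t

/-- The relations defining the convolution product are imposed only for generators multiplied by
idempotents. The elements z that can be moved across the tensor sign are closed under sums, scalars
and products, which gives all of R(γ) ⊗ R(γ'). -/
theorem convMkT_incl (h : γ + γ' = β) (M : GMod D Q γ) (N : GMod D Q γ')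
    (z : R D Q γ ⊗[k] R D Q γ') (r : R D Q β) (t : M ⊗[k] N) :
    convMkT β M N (r * R.incl D Q β γ γ' z) t = convMkT β M N r (actT M N z t) := by
  let C : R D Q γ ⊗[k] R D Q γ' → Prop := fun z => ∀ (r : R D Q β) (t : M ⊗[k] N),
    convMkT β M N (r * R.incl D Q β γ γ' z) t = convMkT β M N r (actT M N z t)
  have hgen : ∀ {a b c}, EmbGen D Q β γ γ' a b c → C (a ⊗ₜ b) := by
    intro a b c hc r t
    rw [R.incl_embGen hc]
    induction t with
    | zero => simp
    | add t t' ht ht' => simp only [map_add, ht, ht']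
    | tmul m n =>
      rw [actT_tmul, convMkT_tmul, convMkT_tmul, convMk_rel M N hc]
  have hadd : ∀ z z', C z → C z' → C (z + z') := by
    intro z z' hz hz' r t
    simp only [map_add, mul_add, LinearMap.add_apply, hz r t, hz' r t]
  have h0 : C 0 := by intro r t; simp
  have hsmul : ∀ (c : k) z, C z → C (c • z) := by
    intro c z hz r t
    simp only [map_smul, mul_smul_comm, LinearMap.smul_apply, hz r t]
  have hmul : ∀ z z', C z → C z' → C (z * z') := by
    intro z z' hz hz' r t
    rw [R.incl_mul h, ← mul_assoc, hz', hz, actT_mul]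
  have hsum : ∀ f : Seq γ → Seq γ' → R D Q γ ⊗[k] R D Q γ', (∀ μ μ', C (f μ μ')) →
      C (∑ μ, ∑ μ', f μ μ') := fun f hf => Finset.sum_induction _ C hadd h0 fun μ _ =>
    Finset.sum_induction _ C hadd h0 fun μ' _ => hf μ μ'
  have hexp : ∀ (a : R D Q γ) (b : R D Q γ'), a ⊗ₜ b =
      ∑ μ, ∑ μ', (a * R.e D Q μ) ⊗ₜ[k] (b * R.e D Q μ') := by
    intro a b
    conv_lhs => rw [← mul_one a, ← mul_one b, ← R.sum_e, ← R.sum_e, Finset.mul_sum, Finset.mul_sum,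
      TensorProduct.sum_tmul]
    exact Finset.sum_congr rfl fun _ _ => TensorProduct.tmul_sum _ _ _
  have hh := Seq.ht_add h
  -- The unit is not among the generators; it is the sum of the e(μ) ⊗ e(μ'), which are. The factors
  -- x and τ are treated below by the same expansion.
  have hone : C (1 ⊗ₜ 1) := by
    rw [hexp]
    refine hsum _ fun μ μ' => ?_
    obtain ⟨ν, hν⟩ := Seq.exists_isConcat h μ μ'
    rw [one_mul, one_mul]
    exact hgen (.e hν)
  have hleft : ∀ a, C (a ⊗ₜ 1) := by
    intro a
    induction a using R.induction with
    | he μ =>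
      have : R.e D Q μ ⊗ₜ[k] (1 : R D Q γ') = ∑ μ', R.e D Q μ ⊗ₜ[k] R.e D Q μ' := by
        rw [← R.sum_e, TensorProduct.tmul_sum]
      rw [this]
      refine Finset.sum_induction _ C hadd h0 fun μ' _ => ?_
      obtain ⟨ν, hν⟩ := Seq.exists_isConcat h μ μ'
      exact hgen (.e hν)
    | hx j =>
      rw [hexp]
      refine hsum _ fun μ μ' => ?_
      obtain ⟨ν, hν⟩ := Seq.exists_isConcat h μ μ'
      rw [one_mul]
      exact hgen (.x_left hν j ⟨j.1, by omega⟩ rfl)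
    | hτ l hl =>
      rw [hexp]
      refine hsum _ fun μ μ' => ?_
      obtain ⟨ν, hν⟩ := Seq.exists_isConcat h μ μ'
      rw [one_mul]
      exact hgen (.τ_left hν l hl (by omega))
    | halg c =>
      rw [Algebra.algebraMap_eq_smul_one, ← TensorProduct.smul_tmul']
      exact hsmul c _ hone
    | hmul a b ha hb =>
      have := hmul _ _ ha hb
      rwa [Algebra.TensorProduct.tmul_mul_tmul, one_mul] at this
    | hadd a b ha hb => rw [TensorProduct.add_tmul]; exact hadd _ _ ha hb
  have hright : ∀ b, C (1 ⊗ₜ b) := by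
    intro b
    induction b using R.induction with
    | he μ' =>
      have : (1 : R D Q γ) ⊗ₜ[k] R.e D Q μ' = ∑ μ, R.e D Q μ ⊗ₜ[k] R.e D Q μ' := by
        rw [← R.sum_e, TensorProduct.sum_tmul]
      rw [this]
      refine Finset.sum_induction _ C hadd h0 fun μ _ => ?_
      obtain ⟨ν, hν⟩ := Seq.exists_isConcat h μ μ'
      exact hgen (.e hν)
    | hx j =>
      rw [hexp]
      refine hsum _ fun μ μ' => ?_
      obtain ⟨ν, hν⟩ := Seq.exists_isConcat h μ μ'
      rw [one_mul]
      exact hgen (.x_right hν j ⟨ht γ + j.1, by omega⟩ rfl)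
    | hτ l hl =>
      rw [hexp]
      refine hsum _ fun μ μ' => ?_
      obtain ⟨ν, hν⟩ := Seq.exists_isConcat h μ μ'
      rw [one_mul]
      exact hgen (.τ_right hν l hl (by omega))
    | halg c =>
      rw [Algebra.algebraMap_eq_smul_one, TensorProduct.tmul_smul]
      exact hsmul c _ hone
    | hmul a b ha hb =>
      have := hmul _ _ ha hb
      rwa [Algebra.TensorProduct.tmul_mul_tmul, one_mul] at this
    | hadd a b ha hb => rw [TensorProduct.tmul_add]; exact hadd _ _ ha hb
  have : C z := by
    induction z with
    | zero => exact h0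
    | add a b ha hb => exact hadd _ _ ha hb
    | tmul a b =>
      have := hmul _ _ (hleft a) (hright b)
      rwa [Algebra.TensorProduct.tmul_mul_tmul, one_mul, mul_one] at this
  exact this r t

theorem convMk_blk (h : γ + γ' = β) (M : GMod D Q γ) (N : GMod D Q γ') (a : R D Q γ)
    (b : R D Q γ') (r : R D Q β) (m : M) (n : N) :
    convMk β M N (r * (R.blk D Q β γ 0 a * R.blk D Q β γ' (ht γ) b)) m n =
      convMk β M N r (a • m) (b • n) := by
  rw [← R.incl_tmul, ← convMkT_tmul, convMkT_incl h, actT_tmul, convMkT_tmul]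

theorem convMkT_eSplit (h : γ + γ' = β) (M : GMod D Q γ) (N : GMod D Q γ') (r : R D Q β)
    (t : M ⊗[k] N) : convMkT β M N (r * R.eSplit D Q β γ γ') t = convMkT β M N r t := by
  rw [← R.incl_one h, convMkT_incl h, actT_one]

/-! ### Functoriality -/

section lift

variable {M : GMod D Q γ} {N : GMod D Q γ'} {X : Type*} [AddCommGroup X] [Module k X]

/-- Linear maps on `M ∘ N`. -/
def convLift (J : R D Q β →ₗ[k] M ⊗[k] N →ₗ[k] X)
    (hJ : ∀ a b c, EmbGen D Q β γ γ' a b c → ∀ r m n,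
      J (r * c) (m ⊗ₜ n) = J r ((a • m) ⊗ₜ (b • n))) : ConvCarrier β M N →ₗ[k] X :=
  ((Submodule.span (R D Q β) (convRel β M N)).restrictScalars k).liftQ (TensorProduct.lift J) (by
    intro w hw
    -- The relations generate an R(β)-submodule while the lifted map is only k-linear, so the
    -- vanishing is proved for all multiples of w at once.
    have : ∀ r : R D Q β, TensorProduct.lift J (r • w) = 0 := by
      replace hw : w ∈ Submodule.span (R D Q β) (convRel β M N) := hw
      induction hw using Submodule.span_induction with
      | mem w h =>
        obtain ⟨a, b, c, m, n, h, rfl⟩ := h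
        intro r
        rw [smul_sub, map_sub, TensorProduct.smul_tmul', TensorProduct.smul_tmul', smul_eq_mul,
          smul_eq_mul, mul_one, TensorProduct.lift.tmul, TensorProduct.lift.tmul, hJ a b c h,
          sub_self]
      | zero => simp
      | add v w _ _ hv hw => intro r; rw [smul_add, map_add, hv, hw, add_zero]
      | smul a w _ hw => intro r; rw [smul_smul]; exact hw _
    simpa using this 1)

end lift

variable (β) in
/-- The map `f ∘ g : M ∘ N → M' ∘ N'`. -/
def convMap {M M' : GMod D Q γ} {N N' : GMod D Q γ'} (f : M →ₗ[R D Q γ] M')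
    (g : N →ₗ[R D Q γ'] N') : ConvCarrier β M N →ₗ[R D Q β] ConvCarrier β M' N' where
  toFun := convLift ((convMkT β M' N').compl₂
      (TensorProduct.map (f.restrictScalars k) (g.restrictScalars k))) (by
    intro a b c h r m n
    simp only [LinearMap.compl₂_apply, TensorProduct.map_tmul, LinearMap.coe_restrictScalars,
      map_smul, convMkT_tmul]
    exact convMk_rel _ _ h _ _ _)
  map_add' := map_add _
  map_smul' := by
    intro r z
    induction z using convMkT_induction with
    | hmk s t => rfl
    | hadd a b ha hb => simp only [smul_add, map_add, ha, hb]

/-! ### The underlying vector space of `M ∘ N` -/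

variable (D Q β γ γ') in
/-- The coordinates of `r e(γ,γ')` in the basis given by shuffles. -/
def shuffleCoord (h : γ + γ' = β) : R D Q β →ₗ[k]
    (Fin (shuffleWords (ht γ) (ht γ')).length → R D Q γ ⊗[k] R D Q γ') :=
  (LinearEquiv.ofInjective _ (R.shuffleSum_injective h)).symm.toLinearMap ∘ₗ
    (LinearMap.mulRight k (R.eSplit D Q β γ γ')).codRestrict _ fun r =>
      R.exists_shuffleSum_eq h r

theorem shuffleSum_shuffleCoord (h : γ + γ' = β) (r : R D Q β) :
    R.shuffleSum D Q β γ γ' (shuffleCoord D Q β γ γ' h r) = r * R.eSplit D Q β γ γ' := by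
  have := congrArg Subtype.val ((LinearEquiv.ofInjective _ (R.shuffleSum_injective
    (D := D) (Q := Q) h)).apply_symm_apply ((LinearMap.mulRight k (R.eSplit D Q β γ γ')).codRestrict _
      (fun r => R.exists_shuffleSum_eq h r) r))
  exact this

theorem shuffleCoord_eq (h : γ + γ' = β) {r : R D Q β}
    {b : Fin (shuffleWords (ht γ) (ht γ')).length → R D Q γ ⊗[k] R D Q γ'}
    (hb : R.shuffleSum D Q β γ γ' b = r * R.eSplit D Q β γ γ') :
    shuffleCoord D Q β γ γ' h r = b :=
  R.shuffleSum_injective h ((shuffleSum_shuffleCoord h r).trans hb.symm)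

section theta

variable (β) in
/-- The map `(t_u) ↦ ∑ τ_u ⊗ t_u` from a power of `M ⊗ N` to `M ∘ N`. -/
def shuffleMap (M : GMod D Q γ) (N : GMod D Q γ') :
    (Fin (shuffleWords (ht γ) (ht γ')).length → M ⊗[k] N) →ₗ[k] ConvCarrier β M N :=
  ∑ u, convMkT β M N (wordProd (R.tau D Q β) ((shuffleWords (ht γ) (ht γ')).get u)) ∘ₗ
    LinearMap.proj u

theorem shuffleMap_apply (M : GMod D Q γ) (N : GMod D Q γ')
    (t : Fin (shuffleWords (ht γ) (ht γ')).length → M ⊗[k] N) :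
    shuffleMap β M N t =
      ∑ u, convMkT β M N (wordProd (R.tau D Q β) ((shuffleWords (ht γ) (ht γ')).get u)) (t u) := by
  simp [shuffleMap]

theorem shuffleMap_natural {M M' : GMod D Q γ} {N N' : GMod D Q γ'} (f : M →ₗ[R D Q γ] M')
    (g : N →ₗ[R D Q γ'] N') (t : Fin (shuffleWords (ht γ) (ht γ')).length → M ⊗[k] N) :
    convMap β f g (shuffleMap β M N t) = shuffleMap β M' N' fun u =>
      TensorProduct.map (f.restrictScalars k) (g.restrictScalars k) (t u) := by
  rw [shuffleMap_apply, shuffleMap_apply, map_sum]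
  rfl

/-- The inverse of `shuffleMap`. -/
def shuffleInv (h : γ + γ' = β) (M : GMod D Q γ) (N : GMod D Q γ') :
    ConvCarrier β M N →ₗ[k] (Fin (shuffleWords (ht γ) (ht γ')).length → M ⊗[k] N) :=
  convLift (LinearMap.mk₂ k
    (fun r t u => actT M N (shuffleCoord D Q β γ γ' h r u) t)
    (by intros; funext u; simp) (by intros; funext u; simp) (by intros; funext u; simp)
    (by intros; funext u; simp)) (by
    intro a b c hc r m n
    funext u
    simp only [LinearMap.mk₂_apply]
    rw [← actT_tmul, ← actT_mul]
    congr 2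
    -- The coordinates are linear for the right action: those of r c are those of r multiplied by a
    -- ⊗ b, because e(γ,γ') is a unit on both sides for the image c of a ⊗ b.
    refine congrFun (shuffleCoord_eq h
      (b := fun u => shuffleCoord D Q β γ γ' h r u * a ⊗ₜ[k] b) ?_) u
    rw [R.shuffleSum_mul h, shuffleSum_shuffleCoord, R.incl_embGen hc, mul_assoc, mul_assoc,
      ← R.incl_embGen hc, R.eSplit_mul_incl h, R.incl_mul_eSplit h])

theorem shuffleInv_convMkT (h : γ + γ' = β) (M : GMod D Q γ) (N : GMod D Q γ') (r : R D Q β)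
    (t : M ⊗[k] N) (u) : shuffleInv h M N (convMkT β M N r t) u =
      actT M N (shuffleCoord D Q β γ γ' h r u) t := rfl

theorem shuffleMap_shuffleInv (h : γ + γ' = β) (M : GMod D Q γ) (N : GMod D Q γ')
    (z : ConvCarrier β M N) : shuffleMap β M N (shuffleInv h M N z) = z := by
  induction z using convMkT_induction with
  | hmk r t =>
    rw [shuffleMap_apply]
    simp only [shuffleInv_convMkT, ← convMkT_incl h]
    rw [← LinearMap.sum_apply, ← map_sum, ← R.shuffleSum_apply, shuffleSum_shuffleCoord,
      convMkT_eSplit h]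
  | hadd a b ha hb => rw [map_add, map_add, ha, hb]

theorem shuffleCoord_wordProd (h : γ + γ' = β) (u) : shuffleCoord D Q β γ γ' h
    (wordProd (R.tau D Q β) ((shuffleWords (ht γ) (ht γ')).get u)) = Pi.single u 1 := by
  refine shuffleCoord_eq h ?_
  rw [R.shuffleSum_apply, Finset.sum_eq_single u]
  · rw [Pi.single_eq_same, R.incl_one h]
  · intro v _ hv
    rw [Pi.single_eq_of_ne hv, map_zero, mul_zero]
  · simp

theorem shuffleInv_shuffleMap (h : γ + γ' = β) (M : GMod D Q γ) (N : GMod D Q γ') (t) :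
    shuffleInv h M N (shuffleMap β M N t) = t := by
  funext v
  rw [shuffleMap_apply, map_sum, Finset.sum_apply]
  simp only [shuffleInv_convMkT, shuffleCoord_wordProd]
  rw [Finset.sum_eq_single v]
  · rw [Pi.single_eq_same, actT_one]
  · intro u _ hu
    rw [Pi.single_eq_of_ne (Ne.symm hu), map_zero, LinearMap.zero_apply]
  · simp

/-- The vector space `M ∘ N` is a power of `M ⊗ N`. -/
def shuffleEquiv (h : γ + γ' = β) (M : GMod D Q γ) (N : GMod D Q γ') :
    (Fin (shuffleWords (ht γ) (ht γ')).length → M ⊗[k] N) ≃ₗ[k] ConvCarrier β M N :=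
  { shuffleMap β M N with
    invFun := shuffleInv h M N
    left_inv := shuffleInv_shuffleMap h M N
    right_inv := shuffleMap_shuffleInv h M N }

theorem shuffleMap_bijective (h : γ + γ' = β) (M : GMod D Q γ) (N : GMod D Q γ') :
    Function.Bijective (shuffleMap β M N) := (shuffleEquiv h M N).bijective

end theta

theorem finiteDimensional_conv (h : γ + γ' = β) (M : GMod D Q γ) (N : GMod D Q γ')
    [FiniteDimensional k M] [FiniteDimensional k N] :
    FiniteDimensional k (ConvCarrier β M N) :=
  (shuffleEquiv h M N).finiteDimensional

/-- Under the natural isomorphism with a power of M ⊗ N, the map acts componentwise as f ⊗ g, which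
is injective because everything is flat over a field. -/
theorem convMap_injective (h : γ + γ' = β) {M M' : GMod D Q γ} {N N' : GMod D Q γ'}
    {f : M →ₗ[R D Q γ] M'} {g : N →ₗ[R D Q γ'] N'} (hf : Function.Injective f)
    (hg : Function.Injective g) : Function.Injective (convMap β f g) := by
  have h1 : Function.Injective
      (TensorProduct.map (f.restrictScalars k) (g.restrictScalars k)) :=
    TensorProduct.map_injective_of_flat_flat _ _ hf hg
  intro z z' hz
  obtain ⟨t, rfl⟩ := (shuffleMap_bijective h M N).2 z
  obtain ⟨t', rfl⟩ := (shuffleMap_bijective h M N).2 z'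
  rw [shuffleMap_natural, shuffleMap_natural] at hz
  have h2 := (shuffleMap_bijective h M' N').1 hz
  congr 1
  funext u
  exact h1 (congrFun h2 u)

theorem convMap_surjective {M M' : GMod D Q γ} {N N' : GMod D Q γ'}
    {f : M →ₗ[R D Q γ] M'} {g : N →ₗ[R D Q γ'] N'} (hf : Function.Surjective f)
    (hg : Function.Surjective g) : Function.Surjective (convMap β f g) := by
  have h1 : Function.Surjective
      (TensorProduct.map (f.restrictScalars k) (g.restrictScalars k)) :=
    TensorProduct.map_surjective hf hg
  intro z
  induction z using convMkT_induction with
  | hmk r t =>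
    obtain ⟨t, rfl⟩ := h1 t
    exact ⟨convMkT β M N r t, rfl⟩
  | hadd a b ha hb =>
    obtain ⟨a, rfl⟩ := ha
    obtain ⟨b, rfl⟩ := hb
    exact ⟨a + b, map_add _ _ _⟩

/-- Exactness is transported through the natural isomorphism with powers of the tensor product,
where it can be checked in each component. -/
theorem exact_of_shuffle (h : γ + γ' = β) {M M' M'' : GMod D Q γ} {N N' N'' : GMod D Q γ'}
    {f : M' →ₗ[R D Q γ] M} {f' : M →ₗ[R D Q γ] M''} {g : N' →ₗ[R D Q γ'] N}
    {g' : N →ₗ[R D Q γ'] N''}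
    (he : Function.Exact (TensorProduct.map (f.restrictScalars k) (g.restrictScalars k))
      (TensorProduct.map (f'.restrictScalars k) (g'.restrictScalars k))) :
    Function.Exact (convMap β f g) (convMap β f' g') := by
  intro z
  obtain ⟨t, rfl⟩ := (shuffleMap_bijective h M N).2 z
  rw [shuffleMap_natural]
  constructor
  · intro hz
    have h2 := (shuffleMap_bijective h M'' N'').1 (hz.trans (map_zero _).symm)
    choose s hs using fun u => (he (t u)).1 (congrFun h2 u)
    refine ⟨shuffleMap β M' N' s, ?_⟩
    rw [shuffleMap_natural]
    congr 1
    funext u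
    exact hs u
  · rintro ⟨z', hz'⟩
    obtain ⟨s, rfl⟩ := (shuffleMap_bijective h M' N').2 z'
    rw [shuffleMap_natural] at hz'
    have h2 := (shuffleMap_bijective h M N).1 hz'
    have h3 : (fun u => TensorProduct.map (f'.restrictScalars k) (g'.restrictScalars k) (t u)) = 0 := by
      funext u
      exact (he (t u)).2 ⟨s u, congrFun h2 u⟩
    rw [h3, map_zero]

theorem convMap_exact_left (h : γ + γ' = β) {M M' M'' : GMod D Q γ} (N : GMod D Q γ')
    {f : M' →ₗ[R D Q γ] M} {f' : M →ₗ[R D Q γ] M''} (he : Function.Exact f f')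
    (hs : Function.Surjective f') :
    Function.Exact (convMap β f (LinearMap.id : N →ₗ[R D Q γ'] N)) (convMap β f' LinearMap.id) :=
  exact_of_shuffle h (rTensor_exact (M := M') (N := M) (P := M'') (f := f.restrictScalars k)
    (g := f'.restrictScalars k) N he hs)

theorem convMap_exact_right (h : γ + γ' = β) (M : GMod D Q γ) {N N' N'' : GMod D Q γ'}
    {g : N' →ₗ[R D Q γ'] N} {g' : N →ₗ[R D Q γ'] N''} (he : Function.Exact g g')
    (hs : Function.Surjective g') :
    Function.Exact (convMap β (LinearMap.id : M →ₗ[R D Q γ] M) g) (convMap β LinearMap.id g') :=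
  exact_of_shuffle h (lTensor_exact (M := N') (N := N) (P := N'') (f := g.restrictScalars k)
    (g := g'.restrictScalars k) M he hs)

end

section

variable {I : Type w} {P : Type p} [AddCommGroup P] {k : Type u} [Field k]
  {D : CartanDatum I P} {Q : QPoly D k} {β γ γ' δ δ' : I →₀ ℕ}

/-! ### Prefix sums of shuffles -/

/-- The action of a word in the simple transpositions on functions on `ℕ`. -/
def actWord {X : Type*} (u : List ℕ) (f : ℕ → X) : ℕ → X :=
  u.foldr (fun l g j => g (Equiv.swap l (l + 1) j)) f

theorem actWord_cons {X : Type*} (l : ℕ) (u : List ℕ) (f : ℕ → X) (j : ℕ) :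
    actWord (l :: u) f j = actWord u f (Equiv.swap l (l + 1) j) := rfl

theorem actWord_append {X : Type*} (u v : List ℕ) (f : ℕ → X) :
    actWord (u ++ v) f = actWord u (actWord v f) := by
  simp [actWord]

theorem sum_range_actWord {X : Type*} [AddCommMonoid X] {n : ℕ} {u : List ℕ}
    (hu : ∀ l ∈ u, l + 1 < n) (f : ℕ → X) :
    ∑ j ∈ Finset.range n, actWord u f j = ∑ j ∈ Finset.range n, f j := by
  induction u with
  | nil => rfl
  | cons l u ih =>
    rw [← ih fun j hj => hu j (List.mem_cons_of_mem _ hj)]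
    have hl := hu l List.mem_cons_self
    simp only [actWord_cons]
    refine Finset.sum_equiv (Equiv.swap l (l + 1)) (fun j => ?_) fun _ _ => rfl
    simp only [Finset.mem_range, Equiv.swap_apply_def]
    split_ifs <;> omega

/-- The descending word acts as a cyclic shift: the entry at a jumps to b and the entries in between
move down by one. -/
theorem actWord_descWord {X : Type*} {a b : ℕ} (h : a ≤ b) (f : ℕ → X) (j : ℕ) :
    actWord (descWord a b) f j =
      if j < a then f j else if j < b then f (j + 1) else if j = b then f a else f j := by
  induction b, h using Nat.le_induction generalizing j with
  | base =>
    rw [descWord_self]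
    change f j = _
    split_ifs with h1 h2
    · rfl
    · rw [h2]
    · rfl
  | succ b hab ih =>
    rw [descWord_append hab (Nat.le_succ b), descWord_succ, List.singleton_append, actWord_cons, ih,
      Equiv.swap_apply_def]
    split_ifs <;> first | rfl | omega | (congr 1; omega)

/-- A shuffle keeps the order within each block, so its first a entries consist of an initial piece
of each block. The proof follows the recursion of `shuffleWords`. In the second branch, a proper
prefix does not see the entry moved to the end. -/
theorem exists_prefix_shuffle {X : Type*} [AddCommMonoid X] {p q : ℕ} {u : List ℕ}
    (hu : u ∈ shuffleWords p q) (f : ℕ → X) {a : ℕ} (ha : a ≤ p + q) :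
    ∃ a₁ ≤ p, ∃ a₂ ≤ q, ∑ j ∈ Finset.range a, actWord u f j =
      ∑ j ∈ Finset.range a₁, f j + ∑ j ∈ Finset.range a₂, f (p + j) := by
  -- Both branches of the recursion remove the last position, so the prefix of full length is
  -- handled separately: the total sum is invariant under permutations.
  have htot : a = p + q → ∃ a₁ ≤ p, ∃ a₂ ≤ q, ∑ j ∈ Finset.range a, actWord u f j =
      ∑ j ∈ Finset.range a₁, f j + ∑ j ∈ Finset.range a₂, f (p + j) := by
    rintro rfl
    refine ⟨p, le_rfl, q, le_rfl, ?_⟩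
    rw [sum_range_actWord fun l hl => shuffleWords_lt hu hl, Finset.sum_range_add]
  induction p, q using shuffleWords.induct generalizing u f a with
  | case1 q =>
    simp only [shuffleWords, List.mem_singleton] at hu
    subst hu
    exact ⟨0, le_rfl, a, by omega, by simp [actWord]⟩
  | case2 p =>
    simp only [shuffleWords, List.mem_singleton] at hu
    subst hu
    exact ⟨a, by omega, 0, le_rfl, by simp [actWord]⟩
  | case3 p q h1 h2 =>
    rcases ha.eq_or_lt with ha | ha
    · exact htot ha
    rw [shuffleWords, List.mem_append, List.mem_map] at hu
    rcases hu with hu | ⟨v, hv, rfl⟩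
    · obtain ⟨a₁, h3, a₂, h4, h5⟩ := h1 hu f (a := a) (by omega) (by
        rintro rfl
        refine ⟨p + 1, le_rfl, q, le_rfl, ?_⟩
        rw [sum_range_actWord fun l hl => shuffleWords_lt hu hl, Finset.sum_range_add])
      exact ⟨a₁, h3, a₂, by omega, h5⟩
    · set g := actWord (descWord p (p + q + 1)) f with hg
      obtain ⟨a₁, h3, a₂, h4, h5⟩ := h2 hv g (a := a) (by omega) (by
        rintro rfl
        refine ⟨p, le_rfl, q + 1, le_rfl, ?_⟩
        rw [sum_range_actWord fun l hl => shuffleWords_lt hv hl, Finset.sum_range_add])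
      refine ⟨a₁, by omega, a₂, h4, ?_⟩
      rw [actWord_append, ← hg, h5]
      congr 1
      · refine Finset.sum_congr rfl fun j hj => ?_
        rw [Finset.mem_range] at hj
        rw [hg, actWord_descWord (by omega), if_pos (by omega)]
      · refine Finset.sum_congr rfl fun j hj => ?_
        rw [Finset.mem_range] at hj
        rw [hg, actWord_descWord (by omega), if_neg (by omega), if_pos (by omega)]
        congr 1
        omega

/-! ### Supports -/

namespace Seq

/-- The weight of the entry at position `j`, and `0` out of range. -/
def wtFn (ν : Seq β) (j : ℕ) : I →₀ ℕ := if h : j < ht β then Finsupp.single (ν ⟨j, h⟩) 1 else 0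

/-- The weight of the prefix of length `a`. -/
def pre (ν : Seq β) (a : ℕ) : I →₀ ℕ := ∑ j ∈ Finset.range a, ν.wtFn j

theorem pre_eq_listWt (ν : Seq β) {a : ℕ} (ha : a ≤ ht β) :
    ν.pre a = listWt (ν.toList.take a) := by
  induction a with
  | zero => simp [pre, listWt]
  | succ a ih =>
    rw [pre, Finset.sum_range_succ, ← pre, ih (by omega), List.take_succ_eq_append_getElem
      (by rw [length_toList]; omega), listWt_append, wtFn, dif_pos (by omega)]
    simp [listWt, toList]

theorem pre_ht (ν : Seq β) : ν.pre (ht β) = β := by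
  rw [pre_eq_listWt ν le_rfl, List.take_of_length_le (length_toList ν).le, listWt_toList]

/-- The length bound is needed because `Match` asks nothing of positions beyond the end of ν. -/
theorem exists_match_iff (ν : Seq β) :
    (∃ μ : Seq γ, Match 0 μ ν) ∧ ht γ ≤ ht β ↔ ∃ a ≤ ht β, ν.pre a = γ := by
  constructor
  · rintro ⟨⟨μ, hμ⟩, h⟩
    refine ⟨ht γ, h, ?_⟩
    have h0 : ν.toList.take (ht γ) = μ.toList := ?_
    · rw [pre_eq_listWt ν h, h0, listWt_toList]
    refine List.ext_getElem ?_ fun i h1 h2 => ?_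
    · simp [length_toList]; omega
    · rw [length_toList] at h2
      simpa [toList] using hμ i h2 (by omega)
  · rintro ⟨a, ha, h⟩
    rw [pre_eq_listWt ν ha] at h
    have h3 : ht γ = a := by
      rw [← h, ht_listWt, List.length_take, length_toList]
      omega
    have h4 := toList_ofList _ h
    generalize ofList _ h = μ at h4
    refine ⟨⟨μ, fun j hj hj' => ?_⟩, by omega⟩
    have h5 : μ.toList[j]? = (ν.toList.take a)[j]? := by rw [h4]
    rw [List.getElem?_eq_getElem (by rw [length_toList]; omega),
      List.getElem?_eq_getElem (by rw [List.length_take, length_toList]; omega)] at h5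
    have h6 := Option.some.inj h5
    simp only [toList, List.getElem_ofFn, List.getElem_take] at h6
    rw [h6]
    simp only [Nat.zero_add]

end Seq

/-- The sequences `ν` with `e(ν) M ≠ 0`. -/
def GMod.supp (M : GMod D Q β) : Set (Seq β) := {ν | ∃ m : M, R.e D Q ν • m ≠ 0}

theorem GMod.exists_eP_smul_ne_zero (M : GMod D Q β) (S : Seq β → Prop) :
    (∃ m : M, R.eP D Q S • m ≠ 0) ↔ ∃ ν ∈ M.supp, S ν := by
  constructor
  · rintro ⟨m, hm⟩
    rw [R.eP, Finset.sum_smul] at hm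
    obtain ⟨ν, hν, h⟩ := Finset.exists_ne_zero_of_sum_ne_zero hm
    exact ⟨ν, ⟨m, h⟩, (Finset.mem_filter.1 hν).2⟩
  · rintro ⟨ν, ⟨m, hm⟩, hS⟩
    refine ⟨R.e D Q ν • m, ?_⟩
    rwa [smul_smul, R.eP_mul_e, if_pos hS]

/-- The idempotent e(γ, β - γ) is the sum of the e(ν) whose prefix of length ht γ has weight γ.
Hence W(M) depends only on the support of M, and is read off from prefixes. -/
theorem GMod.mem_gW {M : GMod D Q β} :
    γ ∈ M.gW ↔ ∃ ν ∈ M.supp, ∃ a ≤ ht β, ν.pre a = γ := by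
  have key : ∀ ν : Seq β, γ ≤ β ∧ (∃ μ : Seq γ, Seq.Match 0 μ ν) ↔ ∃ a ≤ ht β, ν.pre a = γ := by
    intro ν
    rw [← Seq.exists_match_iff]
    refine ⟨fun ⟨h1, h2⟩ => ⟨h2, Finsupp.degree_mono h1⟩, fun ⟨h1, h2⟩ => ⟨?_, h1⟩⟩
    obtain ⟨a, ha, rfl⟩ := (Seq.exists_match_iff ν).1 ⟨h1, h2⟩
    conv_rhs => rw [← ν.pre_ht]
    exact Finset.sum_le_sum_of_subset (Finset.range_subset_range.2 ha)
  rw [gW, Set.mem_ofPred_eq]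
  constructor
  · rintro ⟨h, hm⟩
    rw [← R.blkE_left (add_tsub_cancel_of_le h), R.blkE, GMod.exists_eP_smul_ne_zero] at hm
    obtain ⟨ν, hν, hS⟩ := hm
    exact ⟨ν, hν, (key ν).1 ⟨h, hS⟩⟩
  · rintro ⟨ν, hν, h⟩
    obtain ⟨h1, h2⟩ := (key ν).2 h
    refine ⟨h1, ?_⟩
    rw [← R.blkE_left (add_tsub_cancel_of_le h1), R.blkE, GMod.exists_eP_smul_ne_zero]
    exact ⟨ν, hν, h2⟩

/-- Taking complements γ ↦ β - γ exchanges W and W*, so suffix weights are what is left after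
removing prefix weights. -/
theorem GMod.mem_gWstar {M : GMod D Q β} :
    γ ∈ M.gWstar ↔ ∃ ν ∈ M.supp, ∃ a ≤ ht β, ν.pre a + γ = β := by
  have key : γ ∈ M.gWstar ↔ γ ≤ β ∧ β - γ ∈ M.gW := by
    rw [gWstar, gW, Set.mem_ofPred_eq, Set.mem_ofPred_eq]
    refine and_congr_right fun h => ?_
    rw [tsub_tsub_cancel_of_le h]
    exact (and_iff_right tsub_le_self).symm
  rw [key]
  constructor
  · rintro ⟨h, h'⟩
    obtain ⟨ν, hν, a, ha, h2⟩ := GMod.mem_gW.1 h'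
    exact ⟨ν, hν, a, ha, by rw [h2, tsub_add_cancel_of_le h]⟩
  · rintro ⟨ν, hν, a, ha, h2⟩
    refine ⟨h2 ▸ le_add_self, GMod.mem_gW.2 ⟨ν, hν, a, ha, ?_⟩⟩
    exact eq_tsub_of_add_eq h2

theorem R.wordProd_mul_e {u : List ℕ} (hu : ∀ l ∈ u, l + 1 < ht β) (ν : Seq β) :
    ∃ ν' : Seq β, wordProd (R.tau D Q β) u * R.e D Q ν = R.e D Q ν' * wordProd (R.tau D Q β) u ∧
      ν'.wtFn = actWord u ν.wtFn := by
  induction u with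
  | nil => exact ⟨ν, by simp [wordProd], rfl⟩
  | cons l u ih =>
    obtain ⟨ν', h1, h2⟩ := ih fun j hj => hu j (List.mem_cons_of_mem _ hj)
    have hl := hu l List.mem_cons_self
    refine ⟨ν'.swap l hl, ?_, ?_⟩
    · have h3 : wordProd (R.tau D Q β) (l :: u) = R.tau D Q β l * wordProd (R.tau D Q β) u := rfl
      rw [h3, mul_assoc, h1, R.tau_eq l hl, ← mul_assoc, R.rel (.τ_e l hl ν'), mul_assoc]
    · funext j
      rw [actWord_cons, ← h2, Seq.wtFn, Seq.wtFn]
      by_cases hj : j < ht β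
      · rw [dif_pos hj, Seq.swap_apply, Equiv.swap_apply_def]
        split_ifs <;> first | rfl | omega
      · rw [dif_neg hj, Equiv.swap_apply_of_ne_of_ne (by omega) (by omega), dif_neg hj]

theorem Seq.IsConcat.wtFn_left {ν : Seq β} {μ : Seq γ} {μ' : Seq γ'} (h : ν.IsConcat μ μ') {j : ℕ}
    (hj : j < ht γ) : ν.wtFn j = μ.wtFn j := by
  have := h.length
  rw [Seq.wtFn, Seq.wtFn, dif_pos hj, dif_pos (by omega), h.left]

theorem Seq.IsConcat.wtFn_right {ν : Seq β} {μ : Seq γ} {μ' : Seq γ'} (h : ν.IsConcat μ μ') {j : ℕ}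
    (hj : j < ht γ') : ν.wtFn (ht γ + j) = μ'.wtFn j := by
  have := h.length
  rw [Seq.wtFn, Seq.wtFn, dif_pos hj, dif_pos (by omega), h.right]

theorem R.sum_smul_e {M : Type*} [AddCommGroup M] [Module (R D Q β) M] (m : M) :
    ∑ ν : Seq β, R.e D Q ν • m = m := by
  rw [← Finset.sum_smul, R.sum_e, one_smul]

/-- By `shuffleMap_bijective`, e(ν) is nonzero on some τ_u ⊗ t with u a shuffle word, hence on some
τ_u ⊗ e(μ)m ⊗ e(μ')n. Moving e(μ ∗ μ') to the left of τ_u permutes the sequence by u, and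
orthogonality of the idempotents forces ν to be that shuffle of μ and μ'. One pair (μ, μ') serves
all prefixes of ν. -/
theorem supp_conv (h : γ + γ' = β) {M : GMod D Q γ} {N : GMod D Q γ'} {ν : Seq β}
    (hν : ν ∈ (GMod.conv β M N).supp) : ∃ μ ∈ M.supp, ∃ μ' ∈ N.supp, ∀ a ≤ ht β,
      ∃ a₁ ≤ ht γ, ∃ a₂ ≤ ht γ', ν.pre a = μ.pre a₁ + μ'.pre a₂ := by
  have hh := Seq.ht_add h
  obtain ⟨z, hz⟩ := hν
  change ConvCarrier β M N at z
  obtain ⟨t, rfl⟩ := (shuffleMap_bijective h M N).2 z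
  have hz' : R.e D Q ν • shuffleMap β M N t ≠ 0 := hz
  rw [shuffleMap_apply, Finset.smul_sum] at hz'
  obtain ⟨i, -, hi⟩ := Finset.exists_ne_zero_of_sum_ne_zero hz'
  have hu := List.get_mem (shuffleWords (ht γ) (ht γ')) i
  generalize (shuffleWords (ht γ) (ht γ')).get i = u at hi hu
  generalize t i = s at hi
  have key : ∃ (m : M) (n : N), R.e D Q ν • convMk β M N (wordProd (R.tau D Q β) u) m n ≠ 0 := by
    by_contra! hc
    apply hi
    induction s with
    | zero => rw [map_zero, smul_zero]
    | add a b ha hb =>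
      rw [map_add, smul_add]
      by_cases ha0 : R.e D Q ν • convMkT β M N (wordProd (R.tau D Q β) u) a = 0
      · by_cases hb0 : R.e D Q ν • convMkT β M N (wordProd (R.tau D Q β) u) b = 0
        · rw [ha0, hb0, add_zero]
        · exact absurd (hb hb0) hb0
      · exact absurd (ha ha0) ha0
    | tmul m n => exact hc m n
  obtain ⟨m, n, hmn⟩ := key
  have h1 : convMk β M N (wordProd (R.tau D Q β) u) m n =
      ∑ μ : Seq γ, ∑ μ' : Seq γ', convMk β M N (wordProd (R.tau D Q β) u) (R.e D Q μ • m) (R.e D Q μ' • n) := by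
    simp only [← convMkT_tmul, ← map_sum, ← TensorProduct.tmul_sum, ← TensorProduct.sum_tmul,
      R.sum_smul_e]
  rw [h1, Finset.smul_sum] at hmn
  obtain ⟨μ, -, hmn⟩ := Finset.exists_ne_zero_of_sum_ne_zero hmn
  rw [Finset.smul_sum] at hmn
  obtain ⟨μ', -, hmn⟩ := Finset.exists_ne_zero_of_sum_ne_zero hmn
  obtain ⟨ν₀, hν₀⟩ := Seq.exists_isConcat h μ μ'
  obtain ⟨ν₁, h2, h3⟩ := R.wordProd_mul_e (D := D) (Q := Q) (u := u) (fun l hl => by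
    have := shuffleWords_lt hu hl
    omega) ν₀
  have h4 : R.e D Q ν * R.e D Q ν₁ ≠ 0 := by
    intro h4
    apply hmn
    rw [← convMk_rel M N (.e hν₀), smul_convMk, h2, ← mul_assoc, h4, zero_mul, ← convMkT_tmul,
      map_zero, LinearMap.zero_apply]
  have h5 : ν = ν₁ := by
    by_contra h5
    rw [R.e_mul_e, if_neg h5] at h4
    exact h4 rfl
  subst h5
  refine ⟨μ, ⟨m, fun h6 => hmn ?_⟩, μ', ⟨n, fun h6 => hmn ?_⟩, fun a ha => ?_⟩
  · rw [h6, ← convMkT_tmul, TensorProduct.zero_tmul, map_zero, smul_zero]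
  · rw [h6, ← convMkT_tmul, TensorProduct.tmul_zero, map_zero, smul_zero]
  · obtain ⟨a₁, h7, a₂, h8, h9⟩ := exists_prefix_shuffle hu ν₀.wtFn (a := a) (by omega)
    refine ⟨a₁, h7, a₂, h8, ?_⟩
    rw [Seq.pre, h3, h9, Seq.pre, Seq.pre]
    congr 1
    · refine Finset.sum_congr rfl fun j hj => hν₀.wtFn_left ?_
      rw [Finset.mem_range] at hj
      omega
    · refine Finset.sum_congr rfl fun j hj => hν₀.wtFn_right ?_
      rw [Finset.mem_range] at hj
      omega

theorem gW_conv (h : γ + γ' = β) {M : GMod D Q γ} {N : GMod D Q γ'}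
    (hδ : δ ∈ (GMod.conv β M N).gW) : ∃ δ₁ ∈ M.gW, ∃ δ₂ ∈ N.gW, δ = δ₁ + δ₂ := by
  obtain ⟨ν, hν, a, ha, rfl⟩ := GMod.mem_gW.1 hδ
  obtain ⟨μ, hμ, μ', hμ', H⟩ := supp_conv h hν
  obtain ⟨a₁, h1, a₂, h2, e⟩ := H a ha
  exact ⟨_, GMod.mem_gW.2 ⟨μ, hμ, a₁, h1, rfl⟩, _, GMod.mem_gW.2 ⟨μ', hμ', a₂, h2, rfl⟩, e⟩

theorem Seq.exists_pre_add (ν : Seq β) {a : ℕ} (ha : a ≤ ht β) : ∃ δ, ν.pre a + δ = β := by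
  have h : ν.pre a ≤ β := by
    conv_rhs => rw [← ν.pre_ht]
    exact Finset.sum_le_sum_of_subset (Finset.range_subset_range.2 ha)
  exact ⟨β - ν.pre a, add_tsub_cancel_of_le h⟩

theorem gWstar_conv (h : γ + γ' = β) {M : GMod D Q γ} {N : GMod D Q γ'}
    (hδ : δ ∈ (GMod.conv β M N).gWstar) : ∃ δ₁ ∈ M.gWstar, ∃ δ₂ ∈ N.gWstar, δ = δ₁ + δ₂ := by
  obtain ⟨ν, hν, a, ha, e⟩ := GMod.mem_gWstar.1 hδ
  obtain ⟨μ, hμ, μ', hμ', H⟩ := supp_conv h hν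
  obtain ⟨a₁, h1, a₂, h2, e'⟩ := H a ha
  obtain ⟨δ₁, h3⟩ := μ.exists_pre_add h1
  obtain ⟨δ₂, h4⟩ := μ'.exists_pre_add h2
  refine ⟨δ₁, GMod.mem_gWstar.2 ⟨μ, hμ, a₁, h1, h3⟩, δ₂,
    GMod.mem_gWstar.2 ⟨μ', hμ', a₂, h2, h4⟩, ?_⟩
  rw [e', ← h] at e
  refine add_left_cancel (a := μ.pre a₁ + μ'.pre a₂) (e.trans ?_)
  rw [add_add_add_comm, h3, h4]

end

section

variable {I : Type w} {P : Type p} [AddCommGroup P] {k : Type u} [Field k]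
  {D : CartanDatum I P} {Q : QPoly D k} {β γ γ' δ δ' : I →₀ ℕ}

/-! ### Direct sums of graded modules -/

namespace GMod

section directSum

variable {ι : Type w} (F G H : ι → GMod D Q β)

/-- The inclusion of a summand. -/
def incl (i : ι) : F i →ₗ[R D Q β] directSum F := DirectSum.lof (R D Q β) ι (fun i => F i) i

variable {F G H}

theorem incl_injective (i : ι) : Function.Injective (incl F i) := DirectSum.of_injective i

theorem directSum_induction {C : directSum F → Prop} (h0 : C 0) (hι : ∀ i m, C (incl F i m))
    (hadd : ∀ a b, C a → C b → C (a + b)) (z : directSum F) : C z :=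
  DirectSum.induction_on (motive := C) z h0 hι hadd

theorem incl_mem_part {i : ι} {d : ℤ} {m : F i} (hm : m ∈ (F i).part d) :
    incl F i m ∈ (directSum F).part d := by
  intro j
  change DirectSum.of (fun i => F i) i m j ∈ _
  by_cases hij : i = j
  · subst hij
    rw [DirectSum.of_eq_same]
    exact hm
  · rw [DirectSum.of_eq_of_ne _ _ _ (Ne.symm hij)]
    exact Submodule.zero_mem _

theorem part_directSum_le {d : ℤ} {Y : Submodule k (directSum F)}
    (hY : ∀ i, ∀ m ∈ (F i).part d, incl F i m ∈ Y) : (directSum F).part d ≤ Y := by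
  let Y' : Submodule k (⨁ i, F i) := Y
  have key : ∀ z : ⨁ i, F i, (∀ i, z i ∈ (F i).part d) → z ∈ Y' := by
    intro z hz
    rw [← DirectSum.sum_support_of z]
    exact Submodule.sum_mem _ fun i _ => hY i _ (hz i)
  exact fun z hz => key z hz

/-- The map on a direct sum given by linear maps on the summands. -/
def desc {X : Type*} [AddCommGroup X] [Module (R D Q β) X] (f : ∀ i, F i →ₗ[R D Q β] X) :
    directSum F →ₗ[R D Q β] X := DirectSum.toModule (R D Q β) ι X f

theorem desc_incl {X : Type*} [AddCommGroup X] [Module (R D Q β) X] (f : ∀ i, F i →ₗ[R D Q β] X)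
    (i : ι) (m : F i) : desc f (incl F i m) = f i m := DirectSum.toModule_lof _ _ _

/-- The map on a direct sum given by `k`-linear maps on the summands. -/
def descK {X : Type*} [AddCommGroup X] [Module k X] (f : ∀ i, F i →ₗ[k] X) :
    directSum F →ₗ[k] X := DirectSum.toModule k ι X f

theorem descK_incl {X : Type*} [AddCommGroup X] [Module k X] (f : ∀ i, F i →ₗ[k] X)
    (i : ι) (m : F i) : descK f (incl F i m) = f i m := by
  exact DirectSum.toModule_lof (M := fun i => F i) (φ := f) k i m

/-- The direct sum of a family of morphisms. -/
def mapHom (f : ∀ i, Hom (F i) (G i)) : Hom (directSum F) (directSum G) where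
  toLin := DirectSum.lmap fun i => (f i).toLin
  map_part := fun d _ hm i => (f i).map_part d _ (hm i)

theorem mapHom_injective {f : ∀ i, Hom (F i) (G i)} (h : ∀ i, Function.Injective (f i).toLin) :
    Function.Injective (mapHom f).toLin := (DirectSum.lmap_injective _).2 h

theorem mapHom_surjective {f : ∀ i, Hom (F i) (G i)} (h : ∀ i, Function.Surjective (f i).toLin) :
    Function.Surjective (mapHom f).toLin := (DirectSum.lmap_surjective _).2 h

theorem mapHom_exact {f : ∀ i, Hom (F i) (G i)} {g : ∀ i, Hom (G i) (H i)}
    (h : ∀ i, Function.Exact (f i).toLin (g i).toLin) :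
    Function.Exact (mapHom f).toLin (mapHom g).toLin := by
  rw [LinearMap.exact_iff]
  change LinearMap.ker (DirectSum.lmap fun i => (g i).toLin) =
    LinearMap.range (DirectSum.lmap fun i => (f i).toLin)
  rw [DirectSum.ker_lmap, DirectSum.range_lmap]
  simp only [fun i => (LinearMap.exact_iff.1 (h i))]

theorem finiteDimensional_directSum [Finite ι] (h : ∀ i, FiniteDimensional k (F i)) :
    FiniteDimensional k (directSum F) := by
  have := Fintype.ofFinite ι
  exact inferInstanceAs (Module.Finite k (⨁ i, F i))

theorem supp_directSum {ν : Seq β} (hν : ν ∈ (directSum F).supp) : ∃ i, ν ∈ (F i).supp := by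
  obtain ⟨z, hz⟩ := hν
  by_contra! h
  apply hz
  refine DFinsupp.ext fun i => ?_
  by_contra h'
  exact h i ⟨DFinsupp.toFun z i, h'⟩

theorem nontrivial_directSum (h : Nontrivial (directSum F)) : ∃ i, Nontrivial (F i) := by
  by_contra! h'
  obtain ⟨a, b, hab⟩ := h
  exact hab (DFinsupp.ext fun i => (h' i).elim _ _)

theorem incl_bijective {i : ι} (h : ∀ j ≠ i, Subsingleton (F j)) :
    Function.Bijective (incl F i) := by
  refine ⟨incl_injective i, fun z => ?_⟩
  induction z using directSum_induction with
  | h0 => exact ⟨0, map_zero _⟩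
  | hι j m =>
    by_cases hj : j = i
    · subst hj
      exact ⟨m, rfl⟩
    · have := h j hj
      exact ⟨0, by rw [Subsingleton.elim m 0, map_zero, map_zero]⟩
  | hadd a b ha hb =>
    obtain ⟨a, rfl⟩ := ha
    obtain ⟨b, rfl⟩ := hb
    exact ⟨a + b, map_add _ _ _⟩

end directSum

/-! ### Convolution of morphisms -/

variable (β) in
/-- The class of `r ⊗ m ⊗ n` in `M ∘ N`. -/
def pure (M : GMod D Q γ) (N : GMod D Q γ') (r : R D Q β) (m : M) (n : N) : conv β M N :=
  convMk β M N r m n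

section mk

variable {M : GMod D Q γ} {N : GMod D Q γ'}

theorem smul_pure (a r : R D Q β) (m : M) (n : N) : a • pure β M N r m n = pure β M N (a * r) m n := rfl

theorem pure_add_mid (r : R D Q β) (m m' : M) (n : N) :
    pure β M N r (m + m') n = pure β M N r m n + pure β M N r m' n := by
  refine Eq.trans ?_ (map_add (convMkT β M N r) (m ⊗ₜ n) (m' ⊗ₜ n))
  rw [← TensorProduct.add_tmul]
  rfl

theorem pure_add_right (r : R D Q β) (m : M) (n n' : N) :
    pure β M N r m (n + n') = pure β M N r m n + pure β M N r m n' := by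
  refine Eq.trans ?_ (map_add (convMkT β M N r) (m ⊗ₜ n) (m ⊗ₜ n'))
  rw [← TensorProduct.tmul_add]
  rfl

theorem pure_smul_mid (c : k) (r : R D Q β) (m : M) (n : N) :
    pure β M N r (c • m) n = c • pure β M N r m n :=
  map_smul (convMkT β M N r) c (m ⊗ₜ n)

theorem pure_smul_right (c : k) (r : R D Q β) (m : M) (n : N) :
    pure β M N r m (c • n) = c • pure β M N r m n := by
  refine Eq.trans ?_ (map_smul (convMkT β M N r) c (m ⊗ₜ n))
  rw [← TensorProduct.tmul_smul]
  rfl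

theorem conv_induction {C : conv β M N → Prop} (h0 : C 0) (hpure : ∀ r m n, C (pure β M N r m n))
    (hadd : ∀ a b, C a → C b → C (a + b)) (z : conv β M N) : C z := by
  refine convMkT_induction (C := C) (fun r t => ?_) hadd z
  induction t with
  | zero => rw [map_zero]; exact h0
  | add a b ha hb => rw [map_add]; exact hadd _ _ ha hb
  | tmul m n => exact hpure r m n

theorem pure_blk (h : γ + γ' = β) (a : R D Q γ) (b : R D Q γ') (r : R D Q β) (m : M) (n : N) :
    pure β M N (r * (R.blk D Q β γ 0 a * R.blk D Q β γ' (ht γ) b)) m n =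
      pure β M N r (a • m) (b • n) := convMk_blk h M N a b r m n

theorem pure_mem_part {c₀ c₁ c₂ d : ℤ} {r : R D Q β} {m : M}
    {n : N} (hr : r ∈ R.grading D Q β c₀) (hm : m ∈ M.part c₁) (hn : n ∈ N.part c₂)
    (hd : c₀ + c₁ + c₂ = d) : pure β M N r m n ∈ (conv β M N).part d := by
  have h : convMk β M N r m n ∈ convPart β M N d :=
    Submodule.subset_span ⟨c₀, c₁, c₂, r, m, n, hr, hm, hn, hd, rfl⟩
  exact h

theorem part_conv_le {d : ℤ} {Y : Submodule k (conv β M N)}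
    (hY : ∀ (c₀ c₁ c₂ : ℤ) r m n, r ∈ R.grading D Q β c₀ → m ∈ M.part c₁ → n ∈ N.part c₂ →
      c₀ + c₁ + c₂ = d → pure β M N r m n ∈ Y) : (conv β M N).part d ≤ Y := by
  let Y' : Submodule k (ConvCarrier β M N) := Y
  have h : convPart β M N d ≤ Y' := by
    refine Submodule.span_le.2 ?_
    rintro _ ⟨c₀, c₁, c₂, r, m, n, hr, hm, hn, hd, rfl⟩
    exact hY c₀ c₁ c₂ r m n hr hm hn hd
  exact h

end mk

variable (β) in
/-- The convolution of two morphisms. -/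
def convHom {M M' : GMod D Q γ} {N N' : GMod D Q γ'} (f : Hom M M') (g : Hom N N') :
    Hom (conv β M N) (conv β M' N') where
  toLin := convMap β f.toLin g.toLin
  map_part := fun d z hz => by
    let φ : conv β M N →ₗ[R D Q β] conv β M' N' := convMap β f.toLin g.toLin
    exact part_conv_le (Y := ((conv β M' N').part d).comap (φ.restrictScalars k))
      (fun c₀ c₁ c₂ r m n hr hm hn hd =>
        pure_mem_part hr (f.map_part _ _ hm) (g.map_part _ _ hn) hd) hz

theorem subsingleton_conv {M : GMod D Q γ} {N : GMod D Q γ'}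
    (h : Subsingleton M ∨ Subsingleton N) : Subsingleton (conv β M N) := by
  refine subsingleton_of_forall_eq 0 fun z => ?_
  induction z using conv_induction with
  | h0 => rfl
  | hpure r m n =>
    rcases h with h | h
    · rw [Subsingleton.elim m ((0 : k) • m), pure_smul_mid, zero_smul]
    · rw [Subsingleton.elim n ((0 : k) • n), pure_smul_right, zero_smul]
  | hadd a b ha hb => rw [ha, hb, add_zero]

end GMod

/-! ### Convolution with the trivial module -/

theorem nil_mem_shuffleWords (p q : ℕ) : [] ∈ shuffleWords p q := by
  induction p, q using shuffleWords.induct with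
  | case1 q => simp [shuffleWords]
  | case2 p => simp [shuffleWords]
  | case3 p q h1 h2 =>
    rw [shuffleWords, List.mem_append]
    exact Or.inl h1

/-- The empty word is a shuffle word, so t ↦ 1 ⊗ t is the inclusion of one coordinate of the power
of M ⊗ N. -/
theorem convMkT_one_injective (h : γ + γ' = β) (M : GMod D Q γ) (N : GMod D Q γ') :
    Function.Injective (convMkT β M N 1) := by
  obtain ⟨i, hi⟩ := List.mem_iff_get.1 (nil_mem_shuffleWords (ht γ) (ht γ'))
  have key : ∀ t, convMkT β M N 1 t = shuffleMap β M N (Pi.single i t) := by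
    intro t
    rw [shuffleMap_apply, Finset.sum_eq_single i]
    · rw [hi, wordProd_nil, Pi.single_eq_same]
    · intro j _ hj
      rw [Pi.single_eq_of_ne hj, map_zero]
    · simp
  intro t t' htt
  rw [key, key] at htt
  exact Pi.single_injective i ((shuffleMap_bijective h M N).1 htt)

theorem ht_zero : ht (0 : I →₀ ℕ) = 0 := by simp

namespace R

theorem blkE_self : blkE D Q β β 0 = 1 := by
  refine eq_of_mul_e fun ν => ?_
  rw [blkE, eP_mul_e, if_pos ⟨ν, fun j _ _ => by simp only [Nat.zero_add]⟩, one_mul]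

theorem blk_self (a : R D Q β) : blk D Q β β 0 a = a := by
  have h : 0 + ht β ≤ ht β := by omega
  induction a using R.induction with
  | he μ =>
    rw [blk_e h, ← eP_eq]
    congr 1
    funext ν
    refine propext ⟨fun hν => ?_, ?_⟩
    · ext j
      have := hν j.1 j.2 (by omega)
      simpa only [Nat.zero_add] using this
    · rintro rfl j hj hj'
      simp only [Nat.zero_add]
  | hx j => rw [blk_x h, blkE_self, mul_one, xN_eq (by omega)]; simp only [Nat.zero_add]
  | hτ l hl => rw [blk_τ h, blkE_self, mul_one, Nat.zero_add, tau_eq]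
  | halg c => rw [blk_algebraMap h, blkE_self, Algebra.algebraMap_eq_smul_one]
  | hmul a b ha hb => rw [blk_mul h, ha, hb]
  | hadd a b ha hb => rw [map_add, ha, hb]

/-- For weight zero there are no generators x or τ, and the only sequence is the empty one, whose
idempotent is the unit. -/
theorem exists_smul_one (a : R D Q (0 : I →₀ ℕ)) : ∃ c : k, a = c • 1 := by
  have h0 : ht (0 : I →₀ ℕ) = 0 := ht_zero
  have hs : ∀ ν ν' : Seq (0 : I →₀ ℕ), ν = ν' := by
    intro ν ν'
    ext j
    exact absurd j.2 (by omega)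
  induction a using R.induction with
  | he ν =>
    refine ⟨1, ?_⟩
    rw [one_smul, ← sum_e, Finset.sum_eq_single ν (fun ν' _ h => absurd (hs ν' ν) h) (by simp)]
  | hx j => exact absurd j.2 (by omega)
  | hτ l hl => exact absurd hl (by omega)
  | halg c => exact ⟨c, Algebra.algebraMap_eq_smul_one c⟩
  | hmul a b ha hb =>
    obtain ⟨c, rfl⟩ := ha
    obtain ⟨d, rfl⟩ := hb
    exact ⟨c * d, by rw [smul_mul_smul_comm, one_mul]⟩
  | hadd a b ha hb =>
    obtain ⟨c, rfl⟩ := ha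
    obtain ⟨d, rfl⟩ := hb
    exact ⟨c + d, by rw [add_smul]⟩

theorem one_ne_zero_zero : (1 : R D Q (0 : I →₀ ℕ)) ≠ 0 := by
  intro h
  have hs : Subsingleton (R D Q (0 : I →₀ ℕ)) := subsingleton_of_zero_eq_one h.symm
  have h0 : ht (0 : I →₀ ℕ) = 0 := ht_zero
  have ν : Seq (0 : I →₀ ℕ) := ⟨fun j => absurd j.2 (by omega), Finset.sum_eq_zero fun j _ =>
    absurd j.2 (by omega)⟩
  -- If R(0) were zero, the single element 1 would be a family of 0! = 1 elements that spans, with a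
  -- vanishing combination of coefficient 1; the independence theorem excludes this.
  have := eq_zero_of_sum_eq_zero (D := D) (Q := Q) (ι := Unit) (by rw [h0]; rfl) ν (fun _ => 1)
    (fun r => by rw [Subsingleton.elim (r * _) 0]; exact Submodule.zero_mem _) (fun _ => 1)
    (Subsingleton.elim _ _) ()
  exact one_ne_zero this

end R

/-- A graded `R(0)`-module which is free of rank one over `k`, with generator `u` in degree `n`. -/
structure IsGen (U : GMod D Q 0) (n : ℤ) (u : U) : Prop where
  mem : u ∈ U.part n
  ne_zero : u ≠ 0
  exists_smul : ∀ v : U, ∃ c : k, v = c • u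

theorem tmul_ne_zero_of_ne_zero {V W : Type*} [AddCommGroup V] [Module k V] [AddCommGroup W]
    [Module k W] {v : V} {w : W} (hv : v ≠ 0) (hw : w ≠ 0) : v ⊗ₜ[k] w ≠ 0 := by
  obtain ⟨f, hf⟩ := Module.Projective.exists_dual_ne_zero k hv
  intro h
  have := congrArg (TensorProduct.lid k W ∘ f.rTensor W) h
  simp at this
  exact this.elim hf hw

section unit

variable {U : GMod D Q 0} {n : ℤ} {u : U}

/-- The isomorphism of `q^n M` with `U ∘ M`. -/
def unitLeft (hu : IsGen U n u) (M : GMod D Q β) : GMod.Hom (M.shift n) (GMod.conv β U M) where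
  toLin :=
    { toFun := fun m : M => GMod.pure β U M 1 u m
      map_add' := fun a b => GMod.pure_add_right _ _ _ _
      map_smul' := by
        intro b m
        change M at m
        have h := GMod.pure_blk (M := U) (N := M) (zero_add β) 1 b 1 u m
        rw [← R.incl_tmul, R.incl_one_tmul (zero_add β), ht_zero, R.blk_self, one_mul,
          one_smul, ← mul_one b, ← GMod.smul_pure, mul_one] at h
        exact h.symm }
  map_part := fun d m hm => GMod.pure_mem_part R.one_mem_grading hu.mem hm (by ring)

/-- The isomorphism of `q^n M` with `M ∘ U`. -/
def unitRight (hu : IsGen U n u) (M : GMod D Q β) : GMod.Hom (M.shift n) (GMod.conv β M U) where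
  toLin :=
    { toFun := fun m : M => GMod.pure β M U 1 m u
      map_add' := fun a b => GMod.pure_add_mid _ _ _ _
      map_smul' := by
        intro b m
        change M at m
        have h := GMod.pure_blk (M := M) (N := U) (add_zero β) b 1 1 m u
        rw [← R.incl_tmul, R.incl_tmul_one (add_zero β), R.blk_self, one_mul, one_smul,
          ← mul_one b, ← GMod.smul_pure, mul_one] at h
        exact h.symm }
  map_part := fun d m hm => GMod.pure_mem_part R.one_mem_grading hm hu.mem (by ring)

/-- Injectivity is `convMkT_one_injective`. For surjectivity, every v in U is a scalar multiple of
the generator u, and the element of R(β) is moved onto m. -/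
theorem unitLeft_bijective (hu : IsGen U n u) (M : GMod D Q β) :
    Function.Bijective (unitLeft hu M).toLin := by
  constructor
  · rw [injective_iff_map_eq_zero]
    intro m hm
    change M at m
    have h1 : convMkT β U M 1 (u ⊗ₜ m) = 0 := hm
    have h2 := convMkT_one_injective (zero_add β) U M (h1.trans (map_zero _).symm)
    by_contra hm0
    exact tmul_ne_zero_of_ne_zero hu.ne_zero hm0 h2
  · intro z
    induction z using GMod.conv_induction with
    | h0 => exact ⟨0, map_zero _⟩
    | hpure r v m =>
      obtain ⟨c, rfl⟩ := hu.exists_smul v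
      let m' : M.shift n := m
      refine ⟨r • (c • m'), ?_⟩
      rw [map_smul, LinearMap.map_smul_of_tower]
      change r • c • GMod.pure β U M 1 u m = _
      rw [GMod.pure_smul_mid, smul_algebra_smul_comm, GMod.smul_pure, mul_one]
    | hadd a b ha hb =>
      obtain ⟨a, rfl⟩ := ha
      obtain ⟨b, rfl⟩ := hb
      exact ⟨a + b, map_add _ _ _⟩

theorem unitRight_bijective (hu : IsGen U n u) (M : GMod D Q β) :
    Function.Bijective (unitRight hu M).toLin := by
  constructor
  · rw [injective_iff_map_eq_zero]
    intro m hm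
    change M at m
    have h1 : convMkT β M U 1 (m ⊗ₜ u) = 0 := hm
    have h2 := convMkT_one_injective (add_zero β) M U (h1.trans (map_zero _).symm)
    by_contra hm0
    exact tmul_ne_zero_of_ne_zero hm0 hu.ne_zero h2
  · intro z
    induction z using GMod.conv_induction with
    | h0 => exact ⟨0, map_zero _⟩
    | hpure r m v =>
      obtain ⟨c, rfl⟩ := hu.exists_smul v
      let m' : M.shift n := m
      refine ⟨r • (c • m'), ?_⟩
      rw [map_smul, LinearMap.map_smul_of_tower]
      change r • c • GMod.pure β M U 1 m u = _
      rw [GMod.pure_smul_right, smul_algebra_smul_comm, GMod.smul_pure, mul_one]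
    | hadd a b ha hb =>
      obtain ⟨a, rfl⟩ := ha
      obtain ⟨b, rfl⟩ := hb
      exact ⟨a + b, map_add _ _ _⟩

end unit

end

section

variable {I : Type w} {P : Type p} [AddCommGroup P] {k : Type u} [Field k]
  {D : CartanDatum I P} {Q : QPoly D k} {β γ γ' δ δ' : I →₀ ℕ}

namespace GMod

/-! ### Universal property of the convolution product -/

section desc

variable {X : Type*} [AddCommGroup X] [Module k X] [Module (R D Q β) X]
  [IsScalarTower k (R D Q β) X]

variable (k D Q β X) in
/-- The action of `R(β)` on a module, as a linear map. -/
def smulL : R D Q β →ₗ[k] X →ₗ[k] X := (Algebra.lsmul k k X).toLinearMap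

theorem smulL_apply (r : R D Q β) (x : X) : smulL k D Q β X r x = r • x := rfl

theorem exists_convDesc {M : GMod D Q γ} {N : GMod D Q γ'}
    (ψ : M →ₗ[k] N →ₗ[k] X) (h1 : ∀ a m n, ψ (a • m) n = R.blk D Q β γ 0 a • ψ m n)
    (h2 : ∀ b m n, ψ m (b • n) = R.blk D Q β γ' (ht γ) b • ψ m n) :
    ∃ F : conv β M N →ₗ[R D Q β] X, ∀ r m n, F (pure β M N r m n) = r • ψ m n := by
  let J : R D Q β →ₗ[k] M ⊗[k] N →ₗ[k] X :=
    (smulL k D Q β X).compl₂ (TensorProduct.lift ψ)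
  have hJ : ∀ a b c, EmbGen D Q β γ γ' a b c → ∀ r m n,
      J (r * c) (m ⊗ₜ n) = J r ((a • m) ⊗ₜ (b • n)) := by
    intro a b c hc r m n
    rw [← R.incl_embGen hc, R.incl_tmul]
    simp only [J, LinearMap.compl₂_apply, TensorProduct.lift.tmul, smulL_apply, h1, h2, mul_smul]
  let F : conv β M N →ₗ[k] X := convLift J hJ
  have hF : ∀ r m n, F (pure β M N r m n) = r • ψ m n := fun r m n => rfl
  refine ⟨{ F with map_smul' := fun a z => ?_ }, hF⟩
  change F (a • z) = a • F z
  induction z using conv_induction with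
  | h0 => rw [smul_zero, map_zero, smul_zero]
  | hpure r m n => rw [smul_pure, hF, hF, mul_smul]
  | hadd x y hx hy => rw [smul_add, map_add, map_add, hx, hy, smul_add]

end desc

theorem pure_smul_left (h : γ + γ' = β) {M : GMod D Q γ} {N : GMod D Q γ'} (a : R D Q γ) (m : M)
    (n : N) : pure β M N 1 (a • m) n = R.blk D Q β γ 0 a • pure β M N 1 m n := by
  have h1 := pure_blk (M := M) (N := N) h a 1 1 m n
  rw [one_smul, ← R.incl_tmul, R.incl_tmul_one h, one_mul] at h1
  rw [← h1, smul_pure, mul_one]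

theorem pure_smul_right' (h : γ + γ' = β) {M : GMod D Q γ} {N : GMod D Q γ'} (b : R D Q γ') (m : M)
    (n : N) : pure β M N 1 m (b • n) = R.blk D Q β γ' (ht γ) b • pure β M N 1 m n := by
  have h1 := pure_blk (M := M) (N := N) h 1 b 1 m n
  rw [one_smul, ← R.incl_tmul, R.incl_one_tmul h, one_mul] at h1
  rw [← h1, smul_pure, mul_one]

variable (β) in
/-- The bilinear map `(m, n) ↦ 1 ⊗ m ⊗ n`. -/
def pureL (M : GMod D Q γ) (N : GMod D Q γ') : M →ₗ[k] N →ₗ[k] conv β M N :=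
  LinearMap.mk₂ k (pure β M N 1) (fun _ _ _ => pure_add_mid _ _ _ _)
    (fun _ _ _ => pure_smul_mid _ _ _ _) (fun _ _ _ => pure_add_right _ _ _ _)
    (fun _ _ _ => pure_smul_right _ _ _ _)

/-! ### Threefold convolution products -/

section three

variable {γ₁ γ₂ γ₃ : I →₀ ℕ} {L : GMod D Q γ₁} {M : GMod D Q γ₂} {N : GMod D Q γ₃}

/-- A trilinear map to an `R(β)`-module which is balanced over `R(γ₁) ⊗ R(γ₂) ⊗ R(γ₃)`. -/
structure Balanced {X : Type*} [AddCommGroup X] [Module k X] [Module (R D Q β) X]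
    (T : L →ₗ[k] M →ₗ[k] N →ₗ[k] X) : Prop where
  left : ∀ a l m n, T (a • l) m n = R.blk D Q β γ₁ 0 a • T l m n
  mid : ∀ b l m n, T l (b • m) n = R.blk D Q β γ₂ (ht γ₁) b • T l m n
  right : ∀ c l m n, T l m (c • n) = R.blk D Q β γ₃ (ht γ₁ + ht γ₂) c • T l m n

variable {X : Type*} [AddCommGroup X] [Module k X] [Module (R D Q β) X]
  [IsScalarTower k (R D Q β) X]

omit [IsScalarTower k (R D Q β) X] in
-- Balancedness in the third variable for the scalar 1 says that the values are fixed by the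
-- idempotent of the last block, which is also the idempotent of the complementary first block.
theorem Balanced.blkE_left_smul {T : L →ₗ[k] M →ₗ[k] N →ₗ[k] X} (hT : Balanced (β := β) T)
    (h' : γ₁ + γ₂ = γ) (h : γ + γ₃ = β) (l : L) (m : M) (n : N) :
    R.blkE D Q β γ 0 • T l m n = T l m n := by
  have hh := Seq.ht_add h
  have hh' := Seq.ht_add h'
  have := hT.right 1 l m n
  rw [one_smul, R.blk_one (by omega), hh', R.blkE_right h, ← R.blkE_left h] at this
  exact this.symm

omit [IsScalarTower k (R D Q β) X] in
theorem Balanced.blkE_right_smul {T : L →ₗ[k] M →ₗ[k] N →ₗ[k] X} (hT : Balanced (β := β) T)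
    (h' : γ₂ + γ₃ = γ) (h : γ₁ + γ = β) (l : L) (m : M) (n : N) :
    R.blkE D Q β γ (ht γ₁) • T l m n = T l m n := by
  have hh := Seq.ht_add h
  have hh' := Seq.ht_add h'
  have := hT.left 1 l m n
  rw [one_smul, R.blk_one (by omega), R.blkE_left h, ← R.blkE_right h] at this
  exact this.symm

/-- A balanced trilinear map factors through the convolution of its first two variables; what
remains is bilinear and balanced for the coarser split (γ, γ₃), as the universal property of the
outer product demands. -/
theorem Balanced.exists_left {T : L →ₗ[k] M →ₗ[k] N →ₗ[k] X} (hT : Balanced (β := β) T)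
    (h' : γ₁ + γ₂ = γ) (h : γ + γ₃ = β) :
    ∃ ψ : conv γ L M →ₗ[k] N →ₗ[k] X,
      (∀ s l m n, ψ (pure γ L M s l m) n = R.blk D Q β γ 0 s • T l m n) ∧
      (∀ a z n, ψ (a • z) n = R.blk D Q β γ 0 a • ψ z n) ∧
      ∀ b z n, ψ z (b • n) = R.blk D Q β γ₃ (ht γ) b • ψ z n := by
  have hh := Seq.ht_add h
  have hh' := Seq.ht_add h'
  have hE := hT.blkE_left_smul h' h
  let J : R D Q γ →ₗ[k] L ⊗[k] M →ₗ[k] (N →ₗ[k] X) :=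
    LinearMap.mk₂ k (fun s t => smulL k D Q β X (R.blk D Q β γ 0 s) ∘ₗ TensorProduct.lift T t)
      (fun _ _ _ => by simp only [map_add, LinearMap.add_comp])
      (fun _ _ _ => by simp only [map_smul, LinearMap.smul_comp])
      (fun _ _ _ => by simp only [map_add, LinearMap.comp_add])
      (fun _ _ _ => by simp only [map_smul, LinearMap.comp_smul])
  have hJ' : ∀ s l m n, J s (l ⊗ₜ m) n = R.blk D Q β γ 0 s • T l m n := fun _ _ _ _ => rfl
  have hJ : ∀ a b c, EmbGen D Q γ γ₁ γ₂ a b c → ∀ r m n,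
      J (r * c) (m ⊗ₜ n) = J r ((a • m) ⊗ₜ (b • n)) := by
    intro a b c hc s l m
    ext n
    -- Nesting the blocks γ₁ and γ₂ inside γ leaves the idempotent of γ as an extra factor, and `hE`
    -- absorbs it.
    rw [hJ', hJ', ← R.incl_embGen hc, R.incl_tmul, R.blk_mul (by omega), R.blk_mul (by omega),
      R.blk_blk (by omega) (by omega), R.blk_blk (by omega) (by omega), hT.left, hT.mid]
    simp only [mul_smul, hE, Nat.zero_add]
    rw [← hT.mid, hE]
  let ψ : conv γ L M →ₗ[k] N →ₗ[k] X := convLift J hJ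
  have hψ : ∀ s l m n, ψ (pure γ L M s l m) n = R.blk D Q β γ 0 s • T l m n :=
    fun _ _ _ _ => rfl
  refine ⟨ψ, hψ, fun a z n => ?_, fun b z n => ?_⟩
  · induction z using conv_induction with
    | h0 => rw [smul_zero, map_zero, LinearMap.zero_apply, smul_zero]
    | hpure s l m => rw [smul_pure, hψ, hψ, R.blk_mul (by omega), mul_smul]
    | hadd x y hx hy => rw [smul_add, map_add, map_add, LinearMap.add_apply, LinearMap.add_apply, hx,
        hy, smul_add]
  · induction z using conv_induction with
    | h0 => rw [map_zero, LinearMap.zero_apply, LinearMap.zero_apply, smul_zero]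
    | hpure s l m =>
      rw [hψ, hψ, hT.right, hh', ← mul_smul, ← mul_smul,
        (R.blk_commute (by omega) (by omega) s b).eq]
    | hadd x y hx hy => rw [map_add, LinearMap.add_apply, LinearMap.add_apply, hx, hy, smul_add]

theorem Balanced.exists_right {T : L →ₗ[k] M →ₗ[k] N →ₗ[k] X} (hT : Balanced (β := β) T)
    (h' : γ₂ + γ₃ = γ) (h : γ₁ + γ = β) :
    ∃ ψ : conv γ M N →ₗ[k] L →ₗ[k] X,
      (∀ s l m n, ψ (pure γ M N s m n) l = R.blk D Q β γ (ht γ₁) s • T l m n) ∧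
      (∀ a z l, ψ (a • z) l = R.blk D Q β γ (ht γ₁) a • ψ z l) ∧
      ∀ b z l, ψ z (b • l) = R.blk D Q β γ₁ 0 b • ψ z l := by
  have hh := Seq.ht_add h
  have hh' := Seq.ht_add h'
  have hE := hT.blkE_right_smul h' h
  let T' : M →ₗ[k] N →ₗ[k] L →ₗ[k] X :=
    LinearMap.mk₂ k (fun m n => (LinearMap.applyₗ n) ∘ₗ (LinearMap.applyₗ m) ∘ₗ T)
      (fun _ _ _ => by ext; simp) (fun _ _ _ => by ext; simp) (fun _ _ _ => by ext; simp)
      (fun _ _ _ => by ext; simp)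
  let J : R D Q γ →ₗ[k] M ⊗[k] N →ₗ[k] (L →ₗ[k] X) :=
    LinearMap.mk₂ k (fun s t => smulL k D Q β X (R.blk D Q β γ (ht γ₁) s) ∘ₗ
        TensorProduct.lift T' t)
      (fun _ _ _ => by simp only [map_add, LinearMap.add_comp])
      (fun _ _ _ => by simp only [map_smul, LinearMap.smul_comp])
      (fun _ _ _ => by simp only [map_add, LinearMap.comp_add])
      (fun _ _ _ => by simp only [map_smul, LinearMap.comp_smul])
  have hJ' : ∀ s l m n, J s (m ⊗ₜ n) l = R.blk D Q β γ (ht γ₁) s • T l m n := fun _ _ _ _ => rfl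
  have hJ : ∀ a b c, EmbGen D Q γ γ₂ γ₃ a b c → ∀ r m n,
      J (r * c) (m ⊗ₜ n) = J r ((a • m) ⊗ₜ (b • n)) := by
    intro a b c hc s m n
    ext l
    rw [hJ', hJ', ← R.incl_embGen hc, R.incl_tmul, R.blk_mul (by omega), R.blk_mul (by omega),
      R.blk_blk (by omega) (by omega), R.blk_blk (by omega) (by omega), hT.mid, hT.right]
    simp only [mul_smul, hE, Nat.add_zero]
    rw [← hT.right, hE]
  let ψ : conv γ M N →ₗ[k] L →ₗ[k] X := convLift J hJ
  have hψ : ∀ s l m n, ψ (pure γ M N s m n) l = R.blk D Q β γ (ht γ₁) s • T l m n :=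
    fun _ _ _ _ => rfl
  refine ⟨ψ, hψ, fun a z n => ?_, fun b z n => ?_⟩
  · induction z using conv_induction with
    | h0 => rw [smul_zero, map_zero, LinearMap.zero_apply, smul_zero]
    | hpure s l m => rw [smul_pure, hψ, hψ, R.blk_mul (by omega), mul_smul]
    | hadd x y hx hy => rw [smul_add, map_add, map_add, LinearMap.add_apply, LinearMap.add_apply, hx,
        hy, smul_add]
  · induction z using conv_induction with
    | h0 => rw [map_zero, LinearMap.zero_apply, LinearMap.zero_apply, smul_zero]
    | hpure s l m =>
      rw [hψ, hψ, hT.left, ← mul_smul, ← mul_smul,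
        (R.blk_commute (by omega) (by omega) b s).eq]
    | hadd x y hx hy => rw [map_add, LinearMap.add_apply, LinearMap.add_apply, hx, hy, smul_add]

end three

section families

variable {ι : Type w} {A B : ι → I →₀ ℕ} {α : I →₀ ℕ}
  {X : Type*} [AddCommGroup X] [Module k X] [Module (R D Q β) X] [IsScalarTower k (R D Q β) X]

theorem exists_leftNest {L : ∀ i, GMod D Q (A i)} {M : ∀ i, GMod D Q (B i)} {N : GMod D Q γ}
    (hAB : ∀ i, A i + B i = α) (h : α + γ = β) (T : ∀ i, L i →ₗ[k] M i →ₗ[k] N →ₗ[k] X)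
    (hT : ∀ i, Balanced (β := β) (T i)) :
    ∃ F : conv β (directSum fun i => conv α (L i) (M i)) N →ₗ[R D Q β] X, ∀ r i s l m n,
      F (pure β _ N r (incl (fun i => conv α (L i) (M i)) i (pure α (L i) (M i) s l m)) n) =
        r • R.blk D Q β α 0 s • T i l m n := by
  choose ψ h1 h2 h3 using fun i => (hT i).exists_left (hAB i) h
  obtain ⟨F, hF⟩ := exists_convDesc (β := β) (γ := α) (γ' := γ) (descK ψ)
    (fun a z n => by
      induction z using directSum_induction with
      | h0 => rw [smul_zero, map_zero, LinearMap.zero_apply, smul_zero]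
      | hι i z => rw [← map_smul, descK_incl, descK_incl, h2]
      | hadd x y hx hy => rw [smul_add, map_add, map_add, LinearMap.add_apply,
          LinearMap.add_apply, hx, hy, smul_add])
    (fun b z n => by
      induction z using directSum_induction with
      | h0 => rw [map_zero, LinearMap.zero_apply, LinearMap.zero_apply, smul_zero]
      | hι i z => rw [descK_incl, h3]
      | hadd x y hx hy => rw [map_add, LinearMap.add_apply, LinearMap.add_apply, hx, hy, smul_add])
  exact ⟨F, fun r i s l m n => by rw [hF, descK_incl, h1]⟩

theorem exists_rightNest {L : GMod D Q γ} {M : ∀ i, GMod D Q (A i)} {N : ∀ i, GMod D Q (B i)}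
    (hAB : ∀ i, A i + B i = α) (h : γ + α = β) (T : ∀ i, L →ₗ[k] M i →ₗ[k] N i →ₗ[k] X)
    (hT : ∀ i, Balanced (β := β) (T i)) :
    ∃ F : conv β L (directSum fun i => conv α (M i) (N i)) →ₗ[R D Q β] X, ∀ r i s l m n,
      F (pure β L _ r l (incl (fun i => conv α (M i) (N i)) i (pure α (M i) (N i) s m n))) =
        r • R.blk D Q β α (ht γ) s • T i l m n := by
  choose ψ h1 h2 h3 using fun i => (hT i).exists_right (hAB i) h
  obtain ⟨F, hF⟩ := exists_convDesc (β := β) (γ := γ) (γ' := α) (descK ψ).flip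
    (fun a l z => by
      simp only [LinearMap.flip_apply]
      induction z using directSum_induction with
      | h0 => rw [map_zero, LinearMap.zero_apply, LinearMap.zero_apply, smul_zero]
      | hι i z => rw [descK_incl, h3]
      | hadd x y hx hy => rw [map_add, LinearMap.add_apply, LinearMap.add_apply, hx, hy, smul_add])
    (fun b l z => by
      simp only [LinearMap.flip_apply]
      induction z using directSum_induction with
      | h0 => rw [smul_zero, map_zero, LinearMap.zero_apply, smul_zero]
      | hι i z => rw [← map_smul, descK_incl, descK_incl, h2]
      | hadd x y hx hy => rw [smul_add, map_add, map_add, LinearMap.add_apply,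
          LinearMap.add_apply, hx, hy, smul_add])
  exact ⟨F, fun r i s l m n => by rw [hF, LinearMap.flip_apply, descK_incl, h1]⟩

end families

end GMod

/-! ### Associativity of the convolution product -/

namespace RMod

open GMod

variable {L M N : RMod D Q}

/-- The indices of the summands of a convolution product. -/
abbrev Split (β : I →₀ ℕ) : Type w := {p : (I →₀ ℕ) × (I →₀ ℕ) // p.1 + p.2 = β}

variable (L M) in
/-- The inclusion of `M_γ ∘ N_γ'` in `(M ∘ N)_β`. -/
def inj (p : Split β) : GMod.conv β (L.obj p.1.1) (M.obj p.1.2) →ₗ[R D Q β] (L.conv M).obj β :=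
  GMod.incl (fun p : Split β => GMod.conv β (L.obj p.1.1) (M.obj p.1.2)) p

variable (L M N) in
/-- The trilinear map to `L ∘ (M ∘ N)`. -/
def triRight {γ₁ γ₂ γ₃ : I →₀ ℕ} (h : γ₁ + (γ₂ + γ₃) = β) :
    L.obj γ₁ →ₗ[k] M.obj γ₂ →ₗ[k] N.obj γ₃ →ₗ[k] (L.conv (M.conv N)).obj β :=
  LinearMap.mk₂ k (fun l m =>
    (inj L (M.conv N) ⟨(γ₁, γ₂ + γ₃), h⟩).restrictScalars k ∘ₗ
      pureL β (L.obj γ₁) ((M.conv N).obj (γ₂ + γ₃)) l ∘ₗ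
      (inj M N ⟨(γ₂, γ₃), rfl⟩).restrictScalars k ∘ₗ
      pureL (γ₂ + γ₃) (M.obj γ₂) (N.obj γ₃) m)
    (fun _ _ _ => by simp only [map_add, LinearMap.add_comp, LinearMap.comp_add])
    (fun _ _ _ => by simp only [map_smul, LinearMap.smul_comp, LinearMap.comp_smul])
    (fun _ _ _ => by simp only [map_add, LinearMap.comp_add])
    (fun _ _ _ => by simp only [map_smul, LinearMap.comp_smul])

theorem triRight_apply {γ₁ γ₂ γ₃ : I →₀ ℕ} (h : γ₁ + (γ₂ + γ₃) = β) (l : L.obj γ₁) (m : M.obj γ₂)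
    (n : N.obj γ₃) : triRight L M N h l m n = inj L (M.conv N) ⟨(γ₁, γ₂ + γ₃), h⟩
      (pure β (L.obj γ₁) ((M.conv N).obj (γ₂ + γ₃)) 1 l
        (inj M N ⟨(γ₂, γ₃), rfl⟩ (pure (γ₂ + γ₃) (M.obj γ₂) (N.obj γ₃) 1 m n))) := rfl

variable (L M N) in
/-- The trilinear map to `(L ∘ M) ∘ N`. -/
def triLeft {γ₁ γ₂ γ₃ : I →₀ ℕ} (h : γ₁ + γ₂ + γ₃ = β) :
    L.obj γ₁ →ₗ[k] M.obj γ₂ →ₗ[k] N.obj γ₃ →ₗ[k] ((L.conv M).conv N).obj β :=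
  LinearMap.mk₂ k (fun l m =>
    (inj (L.conv M) N ⟨(γ₁ + γ₂, γ₃), h⟩).restrictScalars k ∘ₗ
      pureL β ((L.conv M).obj (γ₁ + γ₂)) (N.obj γ₃) (inj L M ⟨(γ₁, γ₂), rfl⟩
        (pureL (γ₁ + γ₂) (L.obj γ₁) (M.obj γ₂) l m)))
    (fun _ _ _ => by simp only [map_add, LinearMap.add_apply, LinearMap.comp_add])
    (fun _ _ _ => by
      simp only [map_smul, LinearMap.smul_apply, LinearMap.map_smul_of_tower, LinearMap.comp_smul])
    (fun _ _ _ => by simp only [map_add, LinearMap.comp_add])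
    (fun _ _ _ => by
      simp only [map_smul, LinearMap.map_smul_of_tower, LinearMap.comp_smul])

theorem triLeft_apply {γ₁ γ₂ γ₃ : I →₀ ℕ} (h : γ₁ + γ₂ + γ₃ = β) (l : L.obj γ₁) (m : M.obj γ₂)
    (n : N.obj γ₃) : triLeft L M N h l m n = inj (L.conv M) N ⟨(γ₁ + γ₂, γ₃), h⟩
      (pure β ((L.conv M).obj (γ₁ + γ₂)) (N.obj γ₃) 1
        (inj L M ⟨(γ₁, γ₂), rfl⟩ (pure (γ₁ + γ₂) (L.obj γ₁) (M.obj γ₂) 1 l m)) n) := rfl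

theorem triRight_balanced {γ₁ γ₂ γ₃ : I →₀ ℕ} (h : γ₁ + (γ₂ + γ₃) = β) :
    Balanced (β := β) (triRight L M N h) := by
  have hh := Seq.ht_add h
  have hh' := Seq.ht_add (rfl : γ₂ + γ₃ = γ₂ + γ₃)
  have hE : ∀ l (z : (M.conv N).obj (γ₂ + γ₃)),
      R.blkE D Q β (γ₂ + γ₃) (ht γ₁) • pure β (L.obj γ₁) ((M.conv N).obj (γ₂ + γ₃)) 1 l z =
        pure β (L.obj γ₁) ((M.conv N).obj (γ₂ + γ₃)) 1 l z := by
    intro l z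
    rw [← R.blk_one (by omega), ← pure_smul_right' h, one_smul]
  refine ⟨fun a l m n => ?_, fun b l m n => ?_, fun c l m n => ?_⟩
  · simp only [triRight_apply]
    rw [pure_smul_left h, map_smul]
  · simp only [triRight_apply]
    rw [pure_smul_left rfl, map_smul, pure_smul_right' h, R.blk_blk (by omega) (by omega), mul_smul,
      hE, map_smul, Nat.add_zero]
  · simp only [triRight_apply]
    rw [pure_smul_right' rfl, map_smul, pure_smul_right' h, R.blk_blk (by omega) (by omega), mul_smul,
      hE, map_smul]

theorem triLeft_balanced {γ₁ γ₂ γ₃ : I →₀ ℕ} (h : γ₁ + γ₂ + γ₃ = β) :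
    Balanced (β := β) (triLeft L M N h) := by
  have hh := Seq.ht_add h
  have hh' := Seq.ht_add (rfl : γ₁ + γ₂ = γ₁ + γ₂)
  have hE : ∀ (z : (L.conv M).obj (γ₁ + γ₂)) n,
      R.blkE D Q β (γ₁ + γ₂) 0 • pure β ((L.conv M).obj (γ₁ + γ₂)) (N.obj γ₃) 1 z n =
        pure β ((L.conv M).obj (γ₁ + γ₂)) (N.obj γ₃) 1 z n := by
    intro z n
    rw [← R.blk_one (by omega), ← pure_smul_left h, one_smul]
  refine ⟨fun a l m n => ?_, fun b l m n => ?_, fun c l m n => ?_⟩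
  · simp only [triLeft_apply]
    rw [pure_smul_left rfl, map_smul, pure_smul_left h, R.blk_blk (by omega) (by omega), mul_smul,
      hE, map_smul, Nat.add_zero]
  · simp only [triLeft_apply]
    rw [pure_smul_right' rfl, map_smul, pure_smul_left h, R.blk_blk (by omega) (by omega), mul_smul,
      hE, map_smul, Nat.zero_add]
  · simp only [triLeft_apply]
    rw [pure_smul_right' h, map_smul, hh']

end RMod

end

section

variable {I : Type w} {P : Type p} [AddCommGroup P] {k : Type u} [Field k]
  {D : CartanDatum I P} {Q : QPoly D k} {β γ γ' δ δ' : I →₀ ℕ}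

/-! ### The associativity isomorphism. -/

namespace RMod

open GMod CategoryTheory

variable {L M N : RMod D Q} {γ₁ γ₂ γ₃ : I →₀ ℕ}

theorem inj_mem_part {p : Split β} {d : ℤ} {z : GMod.conv β (L.obj p.1.1) (M.obj p.1.2)}
    (hz : z ∈ (GMod.conv β (L.obj p.1.1) (M.obj p.1.2)).part d) :
    inj L M p z ∈ ((L.conv M).obj β).part d :=
  incl_mem_part (F := fun p : Split β => GMod.conv β (L.obj p.1.1) (M.obj p.1.2)) hz

theorem conv_obj_induction {C : (L.conv M).obj β → Prop} (h0 : C 0)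
    (hpure : ∀ (p : Split β) r l m, C (inj L M p (pure β _ _ r l m)))
    (hadd : ∀ a b, C a → C b → C (a + b)) (z : (L.conv M).obj β) : C z := by
  refine directSum_induction (C := C) h0 (fun p z => ?_) hadd z
  change C (inj L M p z)
  induction z using conv_induction with
  | h0 => rw [map_zero]; exact h0
  | hpure r l m => exact hpure p r l m
  | hadd a b ha hb => rw [map_add]; exact hadd _ _ ha hb

theorem part_conv_obj_le {d : ℤ} {Y : Submodule k ((L.conv M).obj β)}
    (hY : ∀ (p : Split β) (c₀ c₁ c₂ : ℤ) r l m, r ∈ R.grading D Q β c₀ →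
      l ∈ (L.obj p.1.1).part c₁ → m ∈ (M.obj p.1.2).part c₂ → c₀ + c₁ + c₂ = d →
      inj L M p (pure β _ _ r l m) ∈ Y) : ((L.conv M).obj β).part d ≤ Y :=
  part_directSum_le (F := fun p : Split β => GMod.conv β (L.obj p.1.1) (M.obj p.1.2))
    fun p _ hm => part_conv_le (Y := Y.comap ((inj L M p).restrictScalars k))
      (fun c₀ c₁ c₂ r l m hr hl hm hd => hY p c₀ c₁ c₂ r l m hr hl hm hd) hm

theorem triRight_mem_part (h : γ₁ + (γ₂ + γ₃) = β) {c₁ c₂ c₃ : ℤ} {l : L.obj γ₁} {m : M.obj γ₂}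
    {n : N.obj γ₃} (hl : l ∈ (L.obj γ₁).part c₁) (hm : m ∈ (M.obj γ₂).part c₂)
    (hn : n ∈ (N.obj γ₃).part c₃) :
    triRight L M N h l m n ∈ ((L.conv (M.conv N)).obj β).part (c₁ + c₂ + c₃) :=
  inj_mem_part (pure_mem_part R.one_mem_grading hl
    (inj_mem_part (pure_mem_part R.one_mem_grading hm hn rfl)) (by ring))

/-- A generator of the nested product is an R(β)-multiple of a value of `triLeft`. Linear maps out
of the threefold product are thus determined on these values, and its graded parts are spanned by
multiples of homogeneous ones. -/
theorem inj_pure_left (h' : γ₁ + γ₂ = γ) (h : γ + γ₃ = β) (r : R D Q β) (s : R D Q γ)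
    (l : L.obj γ₁) (m : M.obj γ₂) (n : N.obj γ₃) :
    inj (L.conv M) N ⟨(γ, γ₃), h⟩ (pure β ((L.conv M).obj γ) (N.obj γ₃) r
        (inj L M ⟨(γ₁, γ₂), h'⟩ (pure γ (L.obj γ₁) (M.obj γ₂) s l m)) n) =
      (r * R.blk D Q β γ 0 s) • triLeft L M N (show γ₁ + γ₂ + γ₃ = β by rw [h', h]) l m n := by
  subst h'
  rw [triLeft_apply, mul_smul, ← map_smul (inj (L.conv M) N _) (R.blk D Q β (γ₁ + γ₂) 0 s),
    ← pure_smul_left h, ← map_smul (inj L M _), ← map_smul, smul_pure, smul_pure, mul_one, mul_one]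

theorem inj_pure_right (h' : γ₂ + γ₃ = γ) (h : γ₁ + γ = β) (r : R D Q β) (s : R D Q γ)
    (l : L.obj γ₁) (m : M.obj γ₂) (n : N.obj γ₃) :
    inj L (M.conv N) ⟨(γ₁, γ), h⟩ (pure β (L.obj γ₁) ((M.conv N).obj γ) r l
        (inj M N ⟨(γ₂, γ₃), h'⟩ (pure γ (M.obj γ₂) (N.obj γ₃) s m n))) =
      (r * R.blk D Q β γ (ht γ₁) s) •
        triRight L M N (show γ₁ + (γ₂ + γ₃) = β by rw [h', h]) l m n := by
  subst h'
  rw [triRight_apply, mul_smul, ← map_smul (inj L (M.conv N) _) (R.blk D Q β (γ₂ + γ₃) _ s),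
    ← pure_smul_right' h, ← map_smul (inj M N _), ← map_smul, smul_pure, smul_pure, mul_one,
    mul_one]

theorem triLeft_induction {C : ((L.conv M).conv N).obj β → Prop} (h0 : C 0)
    (htri : ∀ γ₁ γ₂ γ₃ (h : γ₁ + γ₂ + γ₃ = β) (a : R D Q β) l m n, C (a • triLeft L M N h l m n))
    (hadd : ∀ a b, C a → C b → C (a + b)) (z : ((L.conv M).conv N).obj β) : C z := by
  induction z using conv_obj_induction with
  | h0 => exact h0
  | hpure p r z n =>
    induction z using conv_obj_induction with
    | h0 => rw [← zero_smul k 0, pure_smul_mid, zero_smul, map_zero]; exact h0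
    | hpure p' s l m =>
      obtain ⟨⟨γ, γ₃⟩, h⟩ := p
      obtain ⟨⟨γ₁, γ₂⟩, h'⟩ := p'
      rw [inj_pure_left]
      exact htri _ _ _ _ _ _ _ _
    | hadd a b ha hb => rw [pure_add_mid, map_add]; exact hadd _ _ ha hb
  | hadd a b ha hb => exact hadd _ _ ha hb

theorem triRight_induction {C : (L.conv (M.conv N)).obj β → Prop} (h0 : C 0)
    (htri : ∀ γ₁ γ₂ γ₃ (h : γ₁ + (γ₂ + γ₃) = β) (a : R D Q β) l m n, C (a • triRight L M N h l m n))
    (hadd : ∀ a b, C a → C b → C (a + b)) (z : (L.conv (M.conv N)).obj β) : C z := by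
  induction z using conv_obj_induction with
  | h0 => exact h0
  | hpure p r l z =>
    induction z using conv_obj_induction with
    | h0 => rw [← zero_smul k 0, pure_smul_right, zero_smul, map_zero]; exact h0
    | hpure p' s m n =>
      obtain ⟨⟨γ₁, γ⟩, h⟩ := p
      obtain ⟨⟨γ₂, γ₃⟩, h'⟩ := p'
      rw [inj_pure_right]
      exact htri _ _ _ _ _ _ _ _
    | hadd a b ha hb => rw [pure_add_right, map_add]; exact hadd _ _ ha hb
  | hadd a b ha hb => exact hadd _ _ ha hb

theorem part_triLeft_le {d : ℤ} {Y : Submodule k (((L.conv M).conv N).obj β)}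
    (hY : ∀ γ₁ γ₂ γ₃ (h : γ₁ + γ₂ + γ₃ = β) (c₀ c₁ c₂ c₃ : ℤ) a l m n, a ∈ R.grading D Q β c₀ →
      l ∈ (L.obj γ₁).part c₁ → m ∈ (M.obj γ₂).part c₂ → n ∈ (N.obj γ₃).part c₃ →
      c₀ + (c₁ + c₂ + c₃) = d → a • triLeft L M N h l m n ∈ Y) :
    (((L.conv M).conv N).obj β).part d ≤ Y := by
  refine part_conv_obj_le fun p c₀ c c₃ r z n hr hz hn hd => ?_
  let ψ : (L.conv M).obj p.1.1 →ₗ[k] ((L.conv M).conv N).obj β :=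
    { toFun := fun z => inj (L.conv M) N p (pure β ((L.conv M).obj p.1.1) (N.obj p.1.2) r z n)
      map_add' := fun _ _ => by rw [pure_add_mid, map_add]
      map_smul' := fun _ _ => by
        rw [pure_smul_mid, LinearMap.map_smul_of_tower, RingHom.id_apply] }
  refine part_conv_obj_le (Y := Y.comap ψ) (fun p' b₀ c₁ c₂ s l m hs hl hm hd' => ?_) hz
  obtain ⟨⟨γ, γ₃⟩, h⟩ := p
  obtain ⟨⟨γ₁, γ₂⟩, h'⟩ := p'
  change inj (L.conv M) N ⟨(γ, γ₃), h⟩ _ ∈ Y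
  rw [inj_pure_left]
  have : ht γ + ht γ₃ = ht β := Seq.ht_add h
  exact hY _ _ _ _ (c₀ + b₀) c₁ c₂ c₃ _ _ _ _
    (R.mul_mem_grading hr (R.blk_mem_grading (show 0 + ht γ ≤ ht β by omega) hs)) hl hm hn (by omega)

variable (L M N) in
-- The universal property of the left-nested product, applied summand by summand to the balanced
-- maps `triRight`.
theorem exists_assoc (β : I →₀ ℕ) :
    ∃ F : ((L.conv M).conv N).obj β →ₗ[R D Q β] (L.conv (M.conv N)).obj β,
      ∀ γ₁ γ₂ γ₃ (h : γ₁ + γ₂ + γ₃ = β) l m n,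
        F (triLeft L M N h l m n) =
          triRight L M N (show γ₁ + (γ₂ + γ₃) = β by rw [← add_assoc, h]) l m n := by
  have hs : ∀ (p : Split β) (p' : Split p.1.1), p'.1.1 + (p'.1.2 + p.1.2) = β :=
    fun p p' => by rw [← add_assoc, p'.2, p.2]
  choose F hF using fun p : Split β => exists_leftNest (fun p' : Split p.1.1 => p'.2) p.2
    (fun p' => triRight L M N (hs p p')) fun p' => triRight_balanced (hs p p')
  refine ⟨GMod.desc (F := fun p : Split β => GMod.conv β ((L.conv M).obj p.1.1) (N.obj p.1.2)) F,
    fun γ₁ γ₂ γ₃ h l m n => ?_⟩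
  have h1 := hF ⟨(γ₁ + γ₂, γ₃), h⟩ 1 ⟨(γ₁, γ₂), rfl⟩ 1 l m n
  have := Seq.ht_add h
  rw [one_smul, R.blk_one (by simp only; omega), (triRight_balanced _).blkE_left_smul rfl h] at h1
  rw [← h1, triLeft_apply]
  exact GMod.desc_incl F _ _

variable (L M N) in
theorem exists_assocInv (β : I →₀ ℕ) :
    ∃ F : (L.conv (M.conv N)).obj β →ₗ[R D Q β] ((L.conv M).conv N).obj β,
      ∀ γ₁ γ₂ γ₃ (h : γ₁ + (γ₂ + γ₃) = β) l m n,
        F (triRight L M N h l m n) =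
          triLeft L M N (show γ₁ + γ₂ + γ₃ = β by rw [add_assoc, h]) l m n := by
  have hs : ∀ (p : Split β) (p' : Split p.1.2), p.1.1 + p'.1.1 + p'.1.2 = β :=
    fun p p' => by rw [add_assoc, p'.2, p.2]
  choose F hF using fun p : Split β => exists_rightNest (fun p' : Split p.1.2 => p'.2) p.2
    (fun p' => triLeft L M N (hs p p')) fun p' => triLeft_balanced (hs p p')
  refine ⟨GMod.desc (F := fun p : Split β => GMod.conv β (L.obj p.1.1) ((M.conv N).obj p.1.2)) F,
    fun γ₁ γ₂ γ₃ h l m n => ?_⟩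
  have h1 := hF ⟨(γ₁, γ₂ + γ₃), h⟩ 1 ⟨(γ₂, γ₃), rfl⟩ 1 l m n
  have := Seq.ht_add h
  rw [one_smul, R.blk_one (by simp only; omega), (triLeft_balanced _).blkE_right_smul rfl h] at h1
  rw [← h1, triRight_apply]
  exact GMod.desc_incl F _ _

variable (L M N) in
/-- Convolution products are associative. -/
theorem exists_assoc_hom : ∃ f : (L.conv M).conv N ⟶ L.conv (M.conv N),
    ∀ β, Function.Bijective (lin f β) := by
  choose F hF using exists_assoc L M N
  choose G hG using exists_assocInv L M N
  refine ⟨⟨fun β => ⟨F β, fun d z hz => ?_⟩⟩, fun β => ?_⟩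
  · refine part_triLeft_le (Y := (((L.conv (M.conv N)).obj β).part d).comap
      ((F β).restrictScalars k)) (fun γ₁ γ₂ γ₃ h c₀ c₁ c₂ c₃ a l m n ha hl hm hn hd => ?_) hz
    change F β (a • triLeft L M N h l m n) ∈ ((L.conv (M.conv N)).obj β).part d
    rw [map_smul, hF, ← hd]
    exact ((L.conv (M.conv N)).obj β).smul_mem ha (triRight_mem_part _ hl hm hn)
  -- The two maps exchange the trilinear generators, so both composites are the identity on a
  -- generating set.
  · refine Function.bijective_iff_has_inverse.2 ⟨G β, fun z => ?_, fun z => ?_⟩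
    · change G β (F β z) = z
      induction z using triLeft_induction with
      | h0 => rw [map_zero, map_zero]
      | htri γ₁ γ₂ γ₃ h a l m n => rw [map_smul, hF, map_smul, hG]
      | hadd a b ha hb => rw [map_add, map_add, ha, hb]
    · change F β (G β z) = z
      induction z using triRight_induction with
      | h0 => rw [map_zero, map_zero]
      | htri γ₁ γ₂ γ₃ h a l m n => rw [map_smul, hG, map_smul, hF]
      | hadd a b ha hb => rw [map_add, map_add, ha, hb]

end RMod

end

section

variable {I : Type w} {P : Type p} [AddCommGroup P] {k : Type u} [Field k]
  {D : CartanDatum I P} {Q : QPoly D k} {β γ γ' δ δ' : I →₀ ℕ}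

/-! ### Supports and finiteness in exact sequences. -/

namespace GMod

variable {M M' M'' : GMod D Q β}

theorem supp_subset_of_injective (f : M →ₗ[R D Q β] M') (hf : Function.Injective f) :
    M.supp ⊆ M'.supp := by
  rintro ν ⟨m, hm⟩
  refine ⟨f m, fun h => hm (hf ?_)⟩
  rw [map_smul, h, map_zero]

theorem supp_subset_of_surjective (f : M →ₗ[R D Q β] M') (hf : Function.Surjective f) :
    M'.supp ⊆ M.supp := by
  rintro ν ⟨m, hm⟩
  obtain ⟨m, rfl⟩ := hf m
  refine ⟨m, fun h => hm ?_⟩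
  rw [← map_smul, h, map_zero]

/-- If e(ν) kills the image of m in the quotient, then e(ν)m comes from some m' in the submodule.
Since e(ν) is idempotent, e(ν)m is the image of e(ν)m', which is therefore nonzero. -/
theorem supp_subset_of_exact (f : M' →ₗ[R D Q β] M) (g : M →ₗ[R D Q β] M'')
    (hfg : Function.Exact f g) : M.supp ⊆ M'.supp ∪ M''.supp := by
  rintro ν ⟨m, hm⟩
  by_cases h : R.e D Q ν • g m = 0
  · rw [← map_smul] at h
    obtain ⟨m', hm'⟩ := (hfg _).1 h
    refine Or.inl ⟨m', fun h' => hm ?_⟩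
    have hee : R.e D Q ν * R.e D Q ν = R.e D Q ν := by
      rw [R.rel (.e_e ν ν), if_pos rfl]
    rw [← hee, mul_smul, ← hm', ← map_smul, h', map_zero]
  · exact Or.inr ⟨g m, h⟩

theorem gW_subset_of_supp (h : M.supp ⊆ M'.supp) : M.gW ⊆ M'.gW := fun _ hγ =>
  let ⟨ν, hν, ha⟩ := mem_gW.1 hγ
  mem_gW.2 ⟨ν, h hν, ha⟩

theorem gWstar_subset_of_supp (h : M.supp ⊆ M'.supp) : M.gWstar ⊆ M'.gWstar := fun _ hγ =>
  let ⟨ν, hν, ha⟩ := mem_gWstar.1 hγ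
  mem_gWstar.2 ⟨ν, h hν, ha⟩

theorem gW_subset_of_supp_union (h : M.supp ⊆ M'.supp ∪ M''.supp) : M.gW ⊆ M'.gW ∪ M''.gW := by
  intro γ hγ
  obtain ⟨ν, hν, ha⟩ := mem_gW.1 hγ
  exact (h hν).imp (fun h => mem_gW.2 ⟨ν, h, ha⟩) fun h => mem_gW.2 ⟨ν, h, ha⟩

theorem gWstar_subset_of_supp_union (h : M.supp ⊆ M'.supp ∪ M''.supp) :
    M.gWstar ⊆ M'.gWstar ∪ M''.gWstar := by
  intro γ hγ
  obtain ⟨ν, hν, ha⟩ := mem_gWstar.1 hγ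
  exact (h hν).imp (fun h => mem_gWstar.2 ⟨ν, h, ha⟩) fun h => mem_gWstar.2 ⟨ν, h, ha⟩

theorem finiteDimensional_of_exact (f : M' →ₗ[R D Q β] M) (g : M →ₗ[R D Q β] M'')
    (hfg : Function.Exact f g) [FiniteDimensional k M'] [FiniteDimensional k M''] :
    FiniteDimensional k M := by
  let f' := f.restrictScalars k
  let g' := g.restrictScalars k
  have hk : LinearMap.ker g' = LinearMap.range f' := LinearMap.exact_iff.1 hfg
  have h1 : (LinearMap.ker g').FG := by
    rw [hk]
    exact Module.Finite.iff_fg.1 inferInstance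
  have h2 : ((⊤ : Submodule k M).map g').FG := Module.Finite.iff_fg.1 inferInstance
  exact ⟨Submodule.fg_of_fg_map_of_fg_inf_ker g' h2 (by rwa [top_inf_eq])⟩

theorem nontrivial_of_exact (f : M' →ₗ[R D Q β] M) (g : M →ₗ[R D Q β] M'')
    (hfg : Function.Exact f g) (h : Nontrivial M) : Nontrivial M' ∨ Nontrivial M'' := by
  by_contra! hc
  obtain ⟨h1, h2⟩ := hc
  obtain ⟨m, hm⟩ := exists_ne (0 : M)
  obtain ⟨m', rfl⟩ := (hfg m).1 (Subsingleton.elim _ _)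
  rw [Subsingleton.elim m' 0, map_zero] at hm
  exact hm rfl

end GMod

namespace RMod

open GMod CategoryTheory

/-! ### The zero module and the unit -/

variable (D Q) in
/-- The zero `R`-module. -/
def zero : RMod D Q := ⟨fun β => GMod.zero D Q β⟩

instance (β : I →₀ ℕ) : Subsingleton (GMod.zero D Q β) := inferInstanceAs (Subsingleton PUnit)

instance (β : I →₀ ℕ) : Subsingleton ((zero D Q).obj β) := inferInstanceAs (Subsingleton PUnit)

theorem unit_obj_zero : (unit D Q).obj 0 = GMod.regular D Q 0 := by
  change (if (0 : I →₀ ℕ) = 0 then GMod.regular D Q 0 else GMod.zero D Q 0) = _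
  exact if_pos rfl

theorem unit_obj_of_ne (h : β ≠ 0) : (unit D Q).obj β = GMod.zero D Q β := by
  unfold unit
  exact if_neg h

theorem subsingleton_unit (h : β ≠ 0) : Subsingleton ((unit D Q).obj β) := by
  rw [unit_obj_of_ne h]
  infer_instance

variable (D Q) in
theorem exists_isGen (n : ℤ) : ∃ u, IsGen (((unit D Q).shift n).obj 0) n u := by
  -- The component of the trivial module at 0 is the regular module only by a propositional
  -- equality, so the claim is stated for any module equal to it.
  have key : ∀ U : GMod D Q 0, U = GMod.regular D Q 0 → ∃ u, IsGen (U.shift n) n u := by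
    rintro _ rfl
    refine ⟨(1 : R D Q 0), ?_, R.one_ne_zero_zero, R.exists_smul_one⟩
    change (1 : R D Q 0) ∈ R.grading D Q 0 (n - n)
    rw [sub_self]
    exact R.one_mem_grading
  exact key _ unit_obj_zero

theorem finiteDimensional_unit (β : I →₀ ℕ) : FiniteDimensional k ((unit D Q).obj β) := by
  by_cases h : β = 0
  · subst h
    obtain ⟨u, hu⟩ := exists_isGen D Q 0
    exact Module.Finite.of_surjective
      (LinearMap.toSpanSingleton k (((unit D Q).shift 0).obj 0) u) fun v =>
        (hu.exists_smul v).imp fun c hc => hc.symm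
  · have := subsingleton_unit (D := D) (Q := Q) h
    infer_instance

/-- An isomorphism `q^n M ≅ q^n 1 ∘ M`. -/
theorem exists_unit_conv (n : ℤ) (M : RMod D Q) :
    ∃ f : M.shift n ⟶ ((unit D Q).shift n).conv M, ∀ β, Function.Bijective (lin f β) := by
  obtain ⟨u, hu⟩ := exists_isGen D Q n
  refine ⟨⟨fun β => ⟨inj ((unit D Q).shift n) M ⟨(0, β), zero_add β⟩ ∘ₗ
    (unitLeft hu (M.obj β)).toLin, fun d m hm => inj_mem_part
      (L := (unit D Q).shift n) (p := ⟨(0, β), zero_add β⟩)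
      ((unitLeft hu (M.obj β)).map_part d m hm)⟩⟩, fun β => ?_⟩
  refine Function.Bijective.comp (g := inj ((unit D Q).shift n) M ⟨(0, β), zero_add β⟩)
    (incl_bijective ?_) (unitLeft_bijective hu (M.obj β))
  rintro ⟨⟨γ, γ'⟩, h⟩ hne
  refine subsingleton_conv (Or.inl (subsingleton_unit (D := D) (Q := Q) ?_))
  rintro rfl
  obtain rfl : γ' = β := by simpa using h
  exact hne rfl

/-- An isomorphism `q^n M ≅ M ∘ q^n 1`. -/
theorem exists_conv_unit (n : ℤ) (M : RMod D Q) :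
    ∃ f : M.shift n ⟶ M.conv ((unit D Q).shift n), ∀ β, Function.Bijective (lin f β) := by
  obtain ⟨u, hu⟩ := exists_isGen D Q n
  refine ⟨⟨fun β => ⟨inj M ((unit D Q).shift n) ⟨(β, 0), add_zero β⟩ ∘ₗ
    (unitRight hu (M.obj β)).toLin, fun d m hm => inj_mem_part
      (M := (unit D Q).shift n) (p := ⟨(β, 0), add_zero β⟩)
      ((unitRight hu (M.obj β)).map_part d m hm)⟩⟩, fun β => ?_⟩
  refine Function.Bijective.comp (g := inj M ((unit D Q).shift n) ⟨(β, 0), add_zero β⟩)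
    (incl_bijective ?_) (unitRight_bijective hu (M.obj β))
  rintro ⟨⟨γ, γ'⟩, h⟩ hne
  refine subsingleton_conv (Or.inr (subsingleton_unit (D := D) (Q := Q) ?_))
  rintro rfl
  obtain rfl : γ = β := by simpa using h
  exact hne rfl

/-- An isomorphism `q^m (q^n M) ≅ q^(m+n) M`. -/
theorem exists_shift_shift (m n : ℤ) (M : RMod D Q) :
    ∃ f : (M.shift n).shift m ⟶ M.shift (m + n), ∀ β, Function.Bijective (lin f β) := by
  refine ⟨⟨fun β => ⟨(LinearMap.id : M.obj β →ₗ[R D Q β] M.obj β), fun d z hz => ?_⟩⟩,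
    fun β => Function.bijective_id⟩
  change z ∈ (M.obj β).part (d - (m + n))
  rw [← sub_sub]
  exact hz

/-- An isomorphism `q^0 M ≅ M`. -/
theorem exists_shift_zero (M : RMod D Q) :
    ∃ f : M.shift 0 ⟶ M, ∀ β, Function.Bijective (lin f β) := by
  refine ⟨⟨fun β => ⟨(LinearMap.id : M.obj β →ₗ[R D Q β] M.obj β), fun d z hz => ?_⟩⟩,
    fun β => Function.bijective_id⟩
  change z ∈ (M.obj β).part d
  rw [← sub_zero d]
  exact hz

/-! ### Exactness of the convolution product -/

/-- Exactness in each variable is what lets the convolution product descend to the Grothendieck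
group. -/
theorem exists_conv_left {M' M M'' : RMod D Q} {f : M' ⟶ M} {g : M ⟶ M''}
    (h : IsShortExact f g) (N : RMod D Q) :
    ∃ (f' : M'.conv N ⟶ M.conv N) (g' : M.conv N ⟶ M''.conv N), IsShortExact f' g' := by
  refine ⟨⟨fun β => mapHom fun p => convHom β (Hom.app f p.1.1) ⟨LinearMap.id, fun _ _ h => h⟩⟩,
    ⟨fun β => mapHom fun p => convHom β (Hom.app g p.1.1) ⟨LinearMap.id, fun _ _ h => h⟩⟩,
    fun β => ⟨?_, ?_, ?_⟩⟩
  · exact mapHom_injective fun p => convMap_injective p.2 (h p.1.1).1 Function.injective_id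
  · exact mapHom_exact fun p => convMap_exact_left p.2 _ (h p.1.1).2.1 (h p.1.1).2.2
  · exact mapHom_surjective fun p => convMap_surjective (h p.1.1).2.2 Function.surjective_id

theorem exists_conv_right {N' N N'' : RMod D Q} {f : N' ⟶ N} {g : N ⟶ N''}
    (h : IsShortExact f g) (M : RMod D Q) :
    ∃ (f' : M.conv N' ⟶ M.conv N) (g' : M.conv N ⟶ M.conv N''), IsShortExact f' g' := by
  refine ⟨⟨fun β => mapHom fun p => convHom β ⟨LinearMap.id, fun _ _ h => h⟩ (Hom.app f p.1.2)⟩,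
    ⟨fun β => mapHom fun p => convHom β ⟨LinearMap.id, fun _ _ h => h⟩ (Hom.app g p.1.2)⟩,
    fun β => ⟨?_, ?_, ?_⟩⟩
  · exact mapHom_injective fun p => convMap_injective p.2 Function.injective_id (h p.1.2).1
  · exact mapHom_exact fun p => convMap_exact_right p.2 _ (h p.1.2).2.1 (h p.1.2).2.2
  · exact mapHom_surjective fun p => convMap_surjective Function.surjective_id (h p.1.2).2.2

/-! ### Finiteness -/

instance (β : I →₀ ℕ) : Finite (Split β) :=
  Set.Finite.to_subtype (s := {p : (I →₀ ℕ) × (I →₀ ℕ) | p.1 + p.2 = β})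
    ((Finset.HasAntidiagonal.antidiagonal β).finite_toSet.subset fun p hp => by simpa using hp)

theorem gmod_conv {M N : RMod D Q} (hM : gmod D Q M) (hN : gmod D Q N) :
    gmod D Q (M.conv N) := by
  refine ⟨fun β => finiteDimensional_directSum fun p => ?_,
    (Set.Finite.image2 (· + ·) hM.2 hN.2).subset fun β hβ => ?_⟩
  · have := hM.1 p.1.1
    have := hN.1 p.1.2
    exact finiteDimensional_conv p.2 _ _
  · obtain ⟨p, hp⟩ := nontrivial_directSum hβ
    refine ⟨p.1.1, ?_, p.1.2, ?_, p.2⟩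
    · by_contra h
      have := subsingleton_conv (β := β) (N := N.obj p.1.2)
        (Or.inl (not_nontrivial_iff_subsingleton.1 h))
      exact not_nontrivial _ hp
    · by_contra h
      have := subsingleton_conv (β := β) (M := M.obj p.1.1)
        (Or.inr (not_nontrivial_iff_subsingleton.1 h))
      exact not_nontrivial _ hp

/-- Both finiteness conditions pass from M to a submodule and from there to its quotient. -/
theorem gmod_subquotient {M N : RMod D Q} (hM : gmod D Q M) (h : N.IsSubquotient M) :
    gmod D Q N := by
  obtain ⟨L, f, g, hfg⟩ := h
  refine ⟨fun β => ?_, hM.2.subset fun β hβ => ?_⟩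
  · have := hM.1 β
    have : FiniteDimensional k (L.obj β) :=
      Module.Finite.of_injective ((lin f β).restrictScalars k) (hfg β).1
    exact Module.Finite.of_surjective ((lin g β).restrictScalars k) (hfg β).2
  · have : Nontrivial (N.obj β) := hβ
    have := (hfg β).2.nontrivial
    exact (hfg β).1.nontrivial

theorem gmod_extension {M' M M'' : RMod D Q} {f : M' ⟶ M} {g : M ⟶ M''}
    (h : IsShortExact f g) (h' : gmod D Q M') (h'' : gmod D Q M'') : gmod D Q M := by
  refine ⟨fun β => ?_, (h'.2.union h''.2).subset fun β hβ =>
    nontrivial_of_exact _ _ (h β).2.1 hβ⟩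
  have := h'.1 β
  have := h''.1 β
  exact finiteDimensional_of_exact _ _ (h β).2.1

theorem gmod_unit : gmod D Q (unit D Q) := by
  refine ⟨finiteDimensional_unit, (Set.finite_singleton 0).subset fun β hβ => ?_⟩
  by_contra h
  have := subsingleton_unit (D := D) (Q := Q) h
  exact not_nontrivial _ hβ

theorem gmod_zero : gmod D Q (zero D Q) :=
  ⟨fun _ => inferInstance, Set.finite_empty.subset fun _ hβ => not_nontrivial _ hβ⟩

end RMod

/-! ### Subcategories defined by conditions on `W(M)` and `W^*(M)` -/

section cat

open CategoryTheory RMod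

variable (D Q) in
/-- The full subcategory of `R-gmod` of the `M` with `W(M) ⊆ K` and `W^*(M) ⊆ K'`. -/
def catOf (K K' : AddSubmonoid (I →₀ ℕ)) : ObjectProperty (RMod D Q) := fun M =>
  RMod.gmod D Q M ∧ (∀ γ ∈ M.gW, γ ∈ K) ∧ ∀ γ ∈ M.gWstar, γ ∈ K'

variable {K K' : AddSubmonoid (I →₀ ℕ)}

theorem gW_conv_obj {M N : RMod D Q} (hγ : γ ∈ (M.conv N).gW) :
    ∃ δ ∈ M.gW, ∃ δ' ∈ N.gW, γ = δ + δ' := by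
  obtain ⟨β, hβ⟩ := Set.mem_iUnion.1 hγ
  obtain ⟨ν, hν, ha⟩ := GMod.mem_gW.1 hβ
  obtain ⟨p, hp⟩ := GMod.supp_directSum hν
  obtain ⟨δ, hδ, δ', hδ', h⟩ := gW_conv p.2 (GMod.mem_gW.2 ⟨ν, hp, ha⟩)
  exact ⟨δ, Set.mem_iUnion.2 ⟨_, hδ⟩, δ', Set.mem_iUnion.2 ⟨_, hδ'⟩, h⟩

theorem gWstar_conv_obj {M N : RMod D Q} (hγ : γ ∈ (M.conv N).gWstar) :
    ∃ δ ∈ M.gWstar, ∃ δ' ∈ N.gWstar, γ = δ + δ' := by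
  obtain ⟨β, hβ⟩ := Set.mem_iUnion.1 hγ
  obtain ⟨ν, hν, ha⟩ := GMod.mem_gWstar.1 hβ
  obtain ⟨p, hp⟩ := GMod.supp_directSum hν
  obtain ⟨δ, hδ, δ', hδ', h⟩ := gWstar_conv p.2 (GMod.mem_gWstar.2 ⟨ν, hp, ha⟩)
  exact ⟨δ, Set.mem_iUnion.2 ⟨_, hδ⟩, δ', Set.mem_iUnion.2 ⟨_, hδ'⟩, h⟩

variable (D Q K K') in
-- All conditions are read off from supports. Subquotients and extensions need only inclusions of
-- supports, while the convolution product is the one place where the additivity of K and K' is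
-- used.
theorem isStable_catOf : IsStable (catOf D Q K K') where
  subquotient := by
    rintro M N ⟨h1, h2, h3⟩ h
    refine ⟨gmod_subquotient h1 h, fun γ hγ => h2 γ ?_, fun γ hγ => h3 γ ?_⟩
    all_goals
      obtain ⟨L, f, g, hfg⟩ := h
      obtain ⟨β, hβ⟩ := Set.mem_iUnion.1 hγ
      have hs := (GMod.supp_subset_of_surjective _ (hfg β).2).trans
        (GMod.supp_subset_of_injective _ (hfg β).1)
    · exact Set.mem_iUnion.2 ⟨β, GMod.gW_subset_of_supp hs hβ⟩
    · exact Set.mem_iUnion.2 ⟨β, GMod.gWstar_subset_of_supp hs hβ⟩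
  extension := by
    rintro M' M M'' f g h ⟨h1, h2, h3⟩ ⟨h1', h2', h3'⟩
    refine ⟨gmod_extension h h1 h1', fun γ hγ => ?_, fun γ hγ => ?_⟩
    all_goals
      obtain ⟨β, hβ⟩ := Set.mem_iUnion.1 hγ
      have hs := GMod.supp_subset_of_exact _ _ (h β).2.1
    · exact (GMod.gW_subset_of_supp_union hs hβ).elim (fun h => h2 _ (Set.mem_iUnion.2 ⟨β, h⟩))
        fun h => h2' _ (Set.mem_iUnion.2 ⟨β, h⟩)
    · exact (GMod.gWstar_subset_of_supp_union hs hβ).elim (fun h => h3 _ (Set.mem_iUnion.2 ⟨β, h⟩))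
        fun h => h3' _ (Set.mem_iUnion.2 ⟨β, h⟩)
  conv := by
    rintro M N ⟨h1, h2, h3⟩ ⟨h1', h2', h3'⟩
    refine ⟨gmod_conv h1 h1', fun γ hγ => ?_, fun γ hγ => ?_⟩
    · obtain ⟨δ, hδ, δ', hδ', rfl⟩ := gW_conv_obj hγ
      exact K.add_mem (h2 _ hδ) (h2' _ hδ')
    · obtain ⟨δ, hδ, δ', hδ', rfl⟩ := gWstar_conv_obj hγ
      exact K'.add_mem (h3 _ hδ) (h3' _ hδ')
  -- A shift relabels the degrees only; the underlying module, and with it every condition, is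
  -- unchanged by definition.
  shift := fun _ _ h => h

theorem catOf_unit : catOf D Q K K' (unit D Q) := by
  refine ⟨gmod_unit, fun γ hγ => ?_, fun γ hγ => ?_⟩
  all_goals
    obtain ⟨β, hle, m, hm⟩ := Set.mem_iUnion.1 hγ
    obtain rfl : β = 0 := by
      by_contra h
      have := subsingleton_unit (D := D) (Q := Q) h
      exact hm (Subsingleton.elim _ _)
    obtain rfl : γ = 0 := le_antisymm hle zero_le
    exact zero_mem _

theorem catOf_zero : catOf D Q K K' (RMod.zero D Q) := by
  refine ⟨gmod_zero, fun γ hγ => ?_, fun γ hγ => ?_⟩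
  all_goals
    obtain ⟨β, hle, m, hm⟩ := Set.mem_iUnion.1 hγ
    exact absurd (Subsingleton.elim _ _) hm

end cat

end

section

variable {I : Type w} {P : Type p} [AddCommGroup P] {k : Type u} [Field k]
  {D : CartanDatum I P} {Q : QPoly D k} {β γ γ' δ δ' : I →₀ ℕ}

open CategoryTheory

/-! ### Grothendieck rings -/

namespace K0

variable {C : ObjectProperty (RMod D Q)} {G : Type*} [AddCommGroup G]

theorem cls_of_shortExact {M' M M'' : RMod D Q} {f : M' ⟶ M} {g : M ⟶ M''}
    (h : RMod.IsShortExact f g) (hM' : C M') (hM : C M) (hM'' : C M'') :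
    cls M hM = cls M' hM' + cls M'' hM'' := by
  have : (QuotientAddGroup.mk (FreeAbelianGroup.of ⟨M, hM⟩ - FreeAbelianGroup.of ⟨M', hM'⟩ -
      FreeAbelianGroup.of ⟨M'', hM''⟩) : K0 C) = 0 :=
    (QuotientAddGroup.eq_zero_iff _).2 (AddSubgroup.subset_closure
      ⟨⟨M', hM'⟩, ⟨M, hM⟩, ⟨M'', hM''⟩, f, g, h, rfl⟩)
  rw [QuotientAddGroup.mk_sub, QuotientAddGroup.mk_sub, sub_sub, sub_eq_zero] at this
  exact this

/-- The homomorphism from `K₀(C)` given by an additive function on objects. -/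
def lift (F : (M : RMod D Q) → C M → G)
    (hF : ∀ (M' M M'' : RMod D Q) (f : M' ⟶ M) (g : M ⟶ M'') (hM' : C M') (hM : C M)
      (hM'' : C M''), RMod.IsShortExact f g → F M hM = F M' hM' + F M'' hM'') : K0 C →+ G :=
  QuotientAddGroup.lift _ (FreeAbelianGroup.lift fun M => F M.1 M.2) <| by
    refine (AddSubgroup.closure_le _).2 ?_
    rintro _ ⟨M', M, M'', f, g, h, rfl⟩
    simp [hF _ _ _ f g M'.2 M.2 M''.2 h]

theorem lift_cls (F : (M : RMod D Q) → C M → G) (hF) (M : RMod D Q) (hM : C M) :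
    lift F hF (cls M hM) = F M hM := by
  refine (QuotientAddGroup.lift_mk' _ _ _).trans ?_
  rw [FreeAbelianGroup.lift_apply_of]

theorem hom_ext {f g : K0 C →+ G} (h : ∀ M hM, f (cls M hM) = g (cls M hM)) : f = g :=
  QuotientAddGroup.addMonoidHom_ext _ (FreeAbelianGroup.lift_ext _ _ fun M => h M.1 M.2)

end K0

/-- `C` is stable, and contains the zero module and the trivial module. -/
structure IsUnitalStable (C : ObjectProperty (RMod D Q)) : Prop extends IsStable C where
  zero : C (RMod.zero D Q)
  unit : C (RMod.unit D Q)

section ring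

variable {C : ObjectProperty (RMod D Q)}

/-- The Grothendieck group of `C`, as a ring. -/
def K0Ring (_ : IsUnitalStable C) : Type (max u w + 1) := K0 C

namespace K0Ring

variable {hC : IsUnitalStable C}

instance : AddCommGroup (K0Ring hC) := inferInstanceAs (AddCommGroup (K0 C))

variable (hC) in
/-- The class of `M`. -/
def cls (M : RMod D Q) (hM : C M) : K0Ring hC := K0.cls M hM

theorem cls_of_shortExact {M' M M'' : RMod D Q} {f : M' ⟶ M} {g : M ⟶ M''}
    (h : RMod.IsShortExact f g) (hM' : C M') (hM : C M) (hM'' : C M'') :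
    cls hC M hM = cls hC M' hM' + cls hC M'' hM'' := K0.cls_of_shortExact h hM' hM hM''

theorem hom_ext {G : Type*} [AddCommGroup G] {f g : K0Ring hC →+ G}
    (h : ∀ M hM, f (cls hC M hM) = g (cls hC M hM)) : f = g := K0.hom_ext (C := C) h

/-- An isomorphism is a short exact sequence with zero kernel, so the two classes differ by the
class of the zero module. That class vanishes, by the same remark applied to the identity of the
zero module. -/
theorem cls_eq_of_bijective {M N : RMod D Q} (hM : C M) (hN : C N) (f : M ⟶ N)
    (hf : ∀ β, Function.Bijective (RMod.lin f β)) : cls hC M hM = cls hC N hN := by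
  have key : ∀ (M N : RMod D Q) (hM : C M) (hN : C N) (f : M ⟶ N),
      (∀ β, Function.Bijective (RMod.lin f β)) →
        cls hC M hM = cls hC (RMod.zero D Q) hC.zero + cls hC N hN := by
    intro M N hM hN f hf
    let i : RMod.zero D Q ⟶ M := ⟨fun β => ⟨0, fun _ _ _ => Submodule.zero_mem _⟩⟩
    refine cls_of_shortExact (f := i) (g := f) (fun β => ⟨fun _ _ _ => Subsingleton.elim _ _,
      fun m => ⟨fun h => ⟨0, ?_⟩, ?_⟩, (hf β).2⟩) _ _ _
    · rw [map_zero]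
      exact (hf β).1 (by rw [map_zero, h])
    · rintro ⟨z, rfl⟩
      rw [Subsingleton.elim z 0, map_zero, map_zero]
  have h0 := key _ _ hC.zero hC.zero (𝟙 _) fun β => Function.bijective_id
  rw [left_eq_add] at h0
  rw [key M N hM hN f hf, h0, zero_add]

variable (hC) in
/-- The biadditive map induced by the convolution product. -/
def convHom : K0 C →+ K0 C →+ K0Ring hC :=
  K0.lift
    (fun M hM => K0.lift
      (fun N hN => cls hC (M.conv N) (hC.conv M N hM hN))
      (fun _ _ _ _ _ _ _ _ h => by
        obtain ⟨_, _, h⟩ := RMod.exists_conv_right h M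
        exact cls_of_shortExact h _ _ _))
    (fun _ _ _ _ _ _ _ _ h => K0.hom_ext fun N hN => by
      obtain ⟨_, _, h⟩ := RMod.exists_conv_left h N
      rw [AddMonoidHom.add_apply, K0.lift_cls, K0.lift_cls, K0.lift_cls]
      exact cls_of_shortExact h _ _ _)

theorem convHom_cls (M N : RMod D Q) (hM : C M) (hN : C N) :
    convHom hC (K0.cls M hM) (K0.cls N hN) = cls hC (M.conv N) (hC.conv M N hM hN) := by
  rw [convHom, K0.lift_cls, K0.lift_cls]

variable (hC) in
/-- The multiplication induced by the convolution product. -/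
def mulHom : K0Ring hC →+ K0Ring hC →+ K0Ring hC := convHom hC

theorem mulHom_cls (M N : RMod D Q) (hM : C M) (hN : C N) :
    mulHom hC (cls hC M hM) (cls hC N hN) = cls hC (M.conv N) (hC.conv M N hM hN) :=
  convHom_cls M N hM hN

instance : Mul (K0Ring hC) := ⟨fun a b => mulHom hC a b⟩

instance : One (K0Ring hC) := ⟨cls hC (RMod.unit D Q) hC.unit⟩

theorem mul_def (a b : K0Ring hC) : a * b = mulHom hC a b := rfl

theorem cls_mul_cls (M N : RMod D Q) (hM : C M) (hN : C N) :
    cls hC M hM * cls hC N hN = cls hC (M.conv N) (hC.conv M N hM hN) := mulHom_cls M N hM hN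

/-- Together with `mul_shift_unit` this makes the classes of the shifted trivial modules central,
with left and right multiplication both equal to the shift; the case n = 0 gives the unit laws. -/
theorem shift_unit_mul (n : ℤ) (M : RMod D Q) (hM : C M) :
    cls hC ((RMod.unit D Q).shift n) (hC.shift n _ hC.unit) * cls hC M hM =
      cls hC (M.shift n) (hC.shift n M hM) := by
  obtain ⟨f, hf⟩ := RMod.exists_unit_conv n M
  rw [cls_mul_cls]
  exact (cls_eq_of_bijective _ _ f hf).symm

theorem mul_shift_unit (n : ℤ) (M : RMod D Q) (hM : C M) :
    cls hC M hM * cls hC ((RMod.unit D Q).shift n) (hC.shift n _ hC.unit) =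
      cls hC (M.shift n) (hC.shift n M hM) := by
  obtain ⟨f, hf⟩ := RMod.exists_conv_unit n M
  rw [cls_mul_cls]
  exact (cls_eq_of_bijective _ _ f hf).symm

theorem cls_shift_zero (M : RMod D Q) (hM : C M) :
    cls hC (M.shift 0) (hC.shift 0 M hM) = cls hC M hM := by
  obtain ⟨f, hf⟩ := RMod.exists_shift_zero M
  exact cls_eq_of_bijective _ _ f hf

theorem hom_mul_comm_of_cls {f g : K0Ring hC →+ K0Ring hC}
    (h : ∀ M hM, f (cls hC M hM) = g (cls hC M hM)) (a : K0Ring hC) : f a = g a :=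
  DFunLike.congr_fun (hom_ext h) a

instance : Ring (K0Ring hC) :=
  { (inferInstance : AddCommGroup (K0Ring hC)) with
    mul := (· * ·)
    one := 1
    left_distrib := fun a b c => map_add (mulHom hC a) b c
    right_distrib := fun a b c => by
      rw [mul_def, map_add, AddMonoidHom.add_apply]
      rfl
    zero_mul := fun a => by rw [mul_def, map_zero, AddMonoidHom.zero_apply]
    mul_zero := fun a => map_zero (mulHom hC a)
    one_mul := fun a => by
      refine hom_mul_comm_of_cls (f := mulHom hC 1) (g := AddMonoidHom.id _) (fun M hM => ?_) a
      have h1 := shift_unit_mul (hC := hC) 0 M hM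
      rw [cls_shift_zero _ hC.unit, cls_shift_zero] at h1
      exact h1
    mul_one := fun a => by
      refine hom_mul_comm_of_cls (f := (mulHom hC).flip 1) (g := AddMonoidHom.id _)
        (fun M hM => ?_) a
      have h1 := mul_shift_unit (hC := hC) 0 M hM
      rw [cls_shift_zero _ hC.unit, cls_shift_zero] at h1
      exact h1
    -- Both sides are additive in each variable, so the three variables are replaced by classes of
    -- modules in turn before the isomorphism of threefold products is used.
    mul_assoc := fun a b c => by
      refine hom_mul_comm_of_cls (f := (mulHom hC).flip c |>.comp ((mulHom hC).flip b))
        (g := (mulHom hC).flip (b * c)) (fun L hL => ?_) a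
      refine hom_mul_comm_of_cls
        (f := (mulHom hC).flip c |>.comp (mulHom hC (cls hC L hL)))
        (g := (mulHom hC (cls hC L hL)).comp ((mulHom hC).flip c)) (fun M hM => ?_) b
      refine hom_mul_comm_of_cls
        (f := mulHom hC (cls hC L hL * cls hC M hM))
        (g := (mulHom hC (cls hC L hL)).comp (mulHom hC (cls hC M hM))) (fun N hN => ?_) c
      obtain ⟨f, hf⟩ := RMod.exists_assoc_hom L M N
      rw [AddMonoidHom.comp_apply, cls_mul_cls, mulHom_cls, mulHom_cls, mulHom_cls]
      exact cls_eq_of_bijective _ _ f hf }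

theorem commute_shift_unit (n : ℤ) (a : K0Ring hC) :
    cls hC ((RMod.unit D Q).shift n) (hC.shift n _ hC.unit) * a =
      a * cls hC ((RMod.unit D Q).shift n) (hC.shift n _ hC.unit) :=
  hom_mul_comm_of_cls (f := mulHom hC (cls hC ((RMod.unit D Q).shift n) (hC.shift n _ hC.unit)))
    (g := (mulHom hC).flip (cls hC ((RMod.unit D Q).shift n) (hC.shift n _ hC.unit)))
    (fun M hM => (shift_unit_mul n M hM).trans (mul_shift_unit n M hM).symm) a

variable (hC) in
/-- The homomorphism `n ↦ [q^n 1]`. -/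
def shiftHom : Multiplicative ℤ →* K0Ring hC where
  toFun n := cls hC ((RMod.unit D Q).shift n.toAdd) (hC.shift _ _ hC.unit)
  map_one' := cls_shift_zero _ hC.unit
  map_mul' := fun m n => by
    rw [shift_unit_mul _ _ (hC.shift _ _ hC.unit)]
    obtain ⟨f, hf⟩ := RMod.exists_shift_shift m.toAdd n.toAdd (RMod.unit D Q)
    exact (cls_eq_of_bijective _ _ f hf).symm

variable (hC) in
/-- The structure homomorphism `ℤ[q, q⁻¹] → K₀(C)`. -/
def laurentHom : LaurentPolynomial ℤ →+* K0Ring hC :=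
  (AddMonoidAlgebra.lift ℤ (K0Ring hC) ℤ (shiftHom hC)).toRingHom

theorem laurentHom_T (n : ℤ) : laurentHom hC (LaurentPolynomial.T n) =
    cls hC ((RMod.unit D Q).shift n) (hC.shift n _ hC.unit) := by
  refine (AddMonoidAlgebra.lift_single _ _ _).trans ?_
  rw [one_smul]
  rfl

theorem laurentHom_mul_comm (c : LaurentPolynomial ℤ) (a : K0Ring hC) :
    laurentHom hC c * a = a * laurentHom hC c := by
  induction c using LaurentPolynomial.induction_on' with
  | add p q hp hq => rw [map_add, add_mul, mul_add, hp, hq]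
  | C_mul_T n z =>
    have : (LaurentPolynomial.C z : LaurentPolynomial ℤ) = (z : LaurentPolynomial ℤ) := by simp
    rw [this, map_mul, map_intCast, laurentHom_T, mul_assoc, commute_shift_unit, ← mul_assoc,
      (Int.cast_commute z a).eq, mul_assoc]

/-- The variable q acts as multiplication by the class of the shifted trivial module; its centrality
is what allows an algebra structure over a noncommutative ring. -/
instance : Algebra (LaurentPolynomial ℤ) (K0Ring hC) :=
  (laurentHom hC).toAlgebra' laurentHom_mul_comm

theorem T_smul_cls (n : ℤ) (M : RMod D Q) (hM : C M) :
    (LaurentPolynomial.T n : LaurentPolynomial ℤ) • cls hC M hM =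
      cls hC (M.shift n) (hC.shift n M hM) := by
  rw [Algebra.smul_def, ← shift_unit_mul, ← laurentHom_T]
  rfl

end K0Ring

/-- The ring lives on the Grothendieck group itself, so the group isomorphism can be taken to be the
identity. -/
theorem IsUnitalStable.k0IsAlgebra (hC : IsUnitalStable C) : K0IsAlgebra C :=
  ⟨K0Ring hC, inferInstance, inferInstance, AddEquiv.refl (K0 C),
    fun M N hM hN => ⟨hC.conv M N hM hN, K0Ring.cls_mul_cls M N hM hN⟩, ⟨hC.unit, rfl⟩,
    fun n M hM => ⟨hC.shift n M hM, K0Ring.T_smul_cls n M hM⟩⟩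

end ring

theorem isUnitalStable_catOf (K K' : AddSubmonoid (I →₀ ℕ)) :
    IsUnitalStable (catOf D Q K K') where
  toIsStable := isStable_catOf D Q K K'
  zero := catOf_zero
  unit := catOf_unit

/-! ### The categories attached to pairs of Weyl group elements -/

theorem zero_mem_Sp (S : Set P) : 0 ∈ Sp S := ⟨0, by simp, by simp, by simp⟩

theorem add_mem_Sp {S : Set P} {x y : ℝ ⊗[ℤ] P} (hx : x ∈ Sp S) (hy : y ∈ Sp S) : x + y ∈ Sp S := by
  obtain ⟨c, hc, hcS, rfl⟩ := hx
  obtain ⟨d, hd, hdS, rfl⟩ := hy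
  refine ⟨c + d, fun z => add_nonneg (hc z) (hd z), fun z hz => ?_, ?_⟩
  · by_cases h : c z = 0
    · exact hdS z fun h' => hz (by rw [Finsupp.add_apply, h, h', add_zero])
    · exact hcS z h
  · exact (Finsupp.sum_add_index' (h := fun (y : P) (r : ℝ) => r ⊗ₜ[ℤ] y)
      (fun _ => TensorProduct.zero_tmul _ _)
      fun _ _ _ => TensorProduct.add_tmul _ _ _).symm

variable (D) in
/-- The elements of `Q₊` in the cone spanned by `S`. -/
def coneSubmonoid (S : Set P) : AddSubmonoid (I →₀ ℕ) where
  carrier := {γ | (1 : ℝ) ⊗ₜ[ℤ] D.wt γ ∈ Sp S}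
  zero_mem' := by
    have : D.wt 0 = 0 := Finsupp.sum_zero_index
    simp only [Set.mem_ofPred_eq, this, TensorProduct.tmul_zero]
    exact zero_mem_Sp S
  add_mem' := by
    intro γ γ' h h'
    have : D.wt (γ + γ') = D.wt γ + D.wt γ' :=
      Finsupp.sum_add_index' (fun _ => zero_smul _ _) fun _ _ _ => add_smul _ _ _
    simp only [Set.mem_ofPred_eq, this, TensorProduct.tmul_add]
    exact add_mem_Sp h h'

variable (D Q)

/-- The missing condition on W* is expressed by the submonoid ⊤, and the cone contributes nothing
but its additive closure. -/
theorem isUnitalStable_catC (w : D.weylGroup) : IsUnitalStable (catC D Q w) := by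
  have : catC D Q w = catOf D Q (coneSubmonoid D (D.posRoots ∩ w.1 '' D.negRoots)) ⊤ :=
    funext fun M => propext ⟨fun h => ⟨h.1, h.2, fun _ _ => trivial⟩, fun h => ⟨h.1, h.2.1⟩⟩
  rw [this]
  exact isUnitalStable_catOf _ _

theorem isUnitalStable_catCstar (v : D.weylGroup) : IsUnitalStable (catCstar D Q v) := by
  have : catCstar D Q v = catOf D Q ⊤ (coneSubmonoid D (D.posRoots ∩ v.1 '' D.posRoots)) :=
    funext fun M => propext ⟨fun h => ⟨h.1, fun _ _ => trivial, h.2⟩, fun h => ⟨h.1, h.2.2⟩⟩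
  rw [this]
  exact isUnitalStable_catOf _ _

theorem isUnitalStable_catCC (w v : D.weylGroup) : IsUnitalStable (catCC D Q w v) := by
  have : catCC D Q w v = catOf D Q (coneSubmonoid D (D.posRoots ∩ w.1 '' D.negRoots))
      (coneSubmonoid D (D.posRoots ∩ v.1 '' D.posRoots)) :=
    funext fun M => propext ⟨fun h => ⟨h.1.1, h.1.2, h.2.2⟩, fun h => ⟨⟨h.1, h.2.1⟩, h.1, h.2.2⟩⟩
  rw [this]
  exact isUnitalStable_catOf _ _

end

end QHecke

end

theorem proposition2p5 {I P k : Type*} [AddCommGroup P] [Field k]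
    (D : QHecke.CartanDatum I P) (Q : QHecke.QPoly D k) (w v : D.weylGroup) :
    (QHecke.IsStable (QHecke.catC D Q w) ∧ QHecke.IsStable (QHecke.catCstar D Q v) ∧
      QHecke.IsStable (QHecke.catCC D Q w v)) ∧
    (QHecke.K0IsAlgebra (QHecke.catC D Q w) ∧ QHecke.K0IsAlgebra (QHecke.catCstar D Q v) ∧
      QHecke.K0IsAlgebra (QHecke.catCC D Q w v)) := by
  have h1 := QHecke.isUnitalStable_catC D Q w
  have h2 := QHecke.isUnitalStable_catCstar D Q v
  have h3 := QHecke.isUnitalStable_catCC D Q w v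
  exact ⟨⟨h1.toIsStable, h2.toIsStable, h3.toIsStable⟩,
    h1.k0IsAlgebra, h2.k0IsAlgebra, h3.k0IsAlgebra⟩
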